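/- Let $M,N\ge 0$ be integers with $M+N\ge 2$ and $M\ne N$. Let $I$ be the index set of $\mathbb C^{M|N}$ with parity $|i|\in\{0,1\}$ ($M$ even and $N$ odd indices), $V=\mathbb C^{M|N}$, and let $\mathcal G=(g_{ij})$ be a nondegenerate complex block diagonal matrix whose even $M\times M$ block is symmetric and whose odd $N\times N$ block is skew-symmetric (so $N$ is even). Put $P=\sum_{i,j}(-1)^{|j|}E_{ij}\otimes E_{ji}$, $R(u)=1-u^{-1}P$, $J=\sum_i(-1)^{|i|}E_{ii}$, and $(X^t)_{ij}=(-1)^{|i||j|+|j|}X_{ji}$, with $t_1,t_2$ the corresponding partial transpositions. Matrices are multiplied in the tensor product superalgebras $\operatorname{End}V^{\otimes m}\otimes\mathcal A$. The super Yangian $Y(\mathfrak{gl}_{M|N})$ is the superalgebra generated by $t_{ij}^{(r)}$ ($r\ge1$, parity $|i|+|j|$) with $R(u-v)T_1(u)T_2(v)=T_2(v)T_1(u)R(u-v)$, where $t_{ij}(u)=\delta_{ij}+\sum_{r\ge1}t_{ij}^{(r)}u^{-r}$. The twisted super Yangian $Y^{tw}=Y^{tw}(\mathfrak{osp}_{M|N})$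 is the superalgebra generated by $s_{ij}^{(r)}$ ($r\ge 1$, parity $|i|+|j|$) with $$R(u-v)S_1(u)R^{t_1}(-u-v)S_2(v)=S_2(v)R^{t_2}(-u-v)S_1(u)R(u-v),\qquad JS^t(-u)=S(u)+\frac{S(u)-S(-u)}{2u},$$ where $s_{ij}(u)=g_{ij}+\sum_{r\ge1}s_{ij}^{(r)}u^{-r}$. Let $\mathcal ZY^{tw}$ be the center of the superalgebra $Y^{tw}$ (spanned by the homogeneous elements that supercommute with $Y^{tw}$), and let $SY^{tw}$ be the subalgebra of elements fixed by all automorphisms of $Y^{tw}$ of the form $S(u)\mapsto f(u)S(u)$ with $f(u)\in 1+u^{-1}\mathbb C[[u^{-1}]]$. Then: 1. For $f(u)\in1+u^{-1}\mathbb C[[u^{-1}]]$, there is an automorphism $S(u)\mapsto f(u)S(u)$ of $Y^{tw}$ if and only if $f(-u)=f(u)$. 2. All elements of $\mathcal ZY^{tw}$ are even, $SY^{tw}$ is a sub-superalgebra, and multiplication $z\otimes y\mapsto zy$ is an isomorphism of (super)algebras $$\mathcal ZY^{tw}(\mathfrak{osp}_{M|N})\otimes SY^{tw}(\mathfrak{osp}_{M|N})\;\cong\;Y^{tw}(\mathfrak{osp}_{M|N}).$$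 3. The assignment $S(u)\mapsto T(u)\,\mathcal G\,T^t(-u)$ defines an injective homomorphism $Y^{tw}\to Y(\mathfrak{gl}_{M|N})$. With $\widetilde T(u)=T(u)^{-1}=(\tilde t_{ij}(u))$ there is a series $z(u)$ over $Y(\mathfrak{gl}_{M|N})$ such that $\sum_k\tilde t_{kj}(u)\,t_{ik}(u+M-N)=\delta_{ij}z(u)$ for all $i,j$. The series $\mathfrak z(u)=z(u)\,z(-u-M+N)^{-1}=\sum_{r\ge0}\mathfrak z^{(r)}u^{-r}$ has its coefficients in (the image of) $Y^{tw}$, these coefficients lie in $\mathcal ZY^{tw}$, and the composite $SY^{tw}\hookrightarrow Y^{tw}\to Y^{tw}/\bigl(\mathfrak z^{(r)}: r\ge3\bigr)$ is an isomorphism of $SY^{tw}$ onto the quotient of $Y^{tw}$ by the two-sided ideal generated by $\mathfrak z^{(3)},\mathfrak z^{(4)},\dots$ -/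

import Mathlib

open scoped TensorProduct

noncomputable section

namespace SuperYangian

/-! ### Matrices over a superalgebra -/

/-- The index set of `ℂ^{M|N}`: the left summand carries the even indices, the right summand the
odd ones. -/
abbrev Idx (M N : ℕ) : Type := Fin M ⊕ Fin N

/-- The parity `|i|` of an index. -/
def par {M N : ℕ} : Idx M N → ℕ := Sum.elim (fun _ => 0) (fun _ => 1)

/-- `X : Mat1 M N A` stands for the element `∑ E_{ij} ⊗ X i j` of `End V ⊗ A`, where `X i j` has
parity `|i| + |j|`. -/
abbrev Mat1 (M N : ℕ) (A : Type*) : Type _ := Idx M N → Idx M N → A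

/-- `X : Mat2 M N A` stands for the element `∑ E_{ij} ⊗ E_{kl} ⊗ X i j k l` of
`End V ⊗ End V ⊗ A`, where `X i j k l` has parity `|i| + |j| + |k| + |l|`. -/
abbrev Mat2 (M N : ℕ) (A : Type*) : Type _ := Idx M N → Idx M N → Idx M N → Idx M N → A

section Matrices

variable {M N : ℕ} {A : Type*} [Ring A]

/-- The identity of `End V ⊗ A`. -/
def one1 : Mat1 M N A := fun i j => if i = j then 1 else 0

/-- The product of the superalgebra `End V ⊗ A` (moving `X i k` past `E_{kj}` gives the sign). -/
def mul1 (X Y : Mat1 M N A) : Mat1 M N A := fun i j =>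
  ∑ k, (-1) ^ ((par i + par k) * (par k + par j)) * (X i k * Y k j)

/-- The graded transposition `X^t`, with `(X^t) i j = (-1)^{|i||j| + |j|} X j i`. -/
def transp (X : Mat1 M N A) : Mat1 M N A := fun i j =>
  (-1) ^ (par i * par j + par j) * X j i

/-- The product of the superalgebra `End V ⊗ End V ⊗ A`:
`(E_{ij} ⊗ E_{kl} ⊗ x) (E_{ja} ⊗ E_{lb} ⊗ y)` is `E_{ia} ⊗ E_{kb} ⊗ x y` with the sign that comes
from moving `E_{ja}` past `E_{kl}` and both `E_{ja}` and `E_{lb}` past `x`. -/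
def mul2 (X Y : Mat2 M N A) : Mat2 M N A := fun i a k b =>
  ∑ j, ∑ l,
    (-1) ^ ((par k + par l) * (par j + par a) +
        (par i + par j + par k + par l) * (par j + par a + par l + par b)) *
      (X i j k l * Y j a l b)

/-- The identity of `End V ⊗ End V ⊗ A`. -/
def one2 : Mat2 M N A := fun i j k l => if i = j ∧ k = l then 1 else 0

/-- The super-permutation operator `P = ∑ (-1)^{|j|} E_{ij} ⊗ E_{ji}`. -/
def permP : Mat2 M N A := fun i j k l => if i = l ∧ j = k then (-1) ^ par j else 0

/-- The partial transposition `t_1`. -/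
def transp1 (X : Mat2 M N A) : Mat2 M N A := fun i j k l =>
  (-1) ^ (par i * par j + par j) * X j i k l

/-- The partial transposition `t_2`. -/
def transp2 (X : Mat2 M N A) : Mat2 M N A := fun i j k l =>
  (-1) ^ (par k * par l + par l) * X i j l k

/-- `X_1 = ∑ E_{ij} ⊗ 1 ⊗ X i j`. -/
def leg1 (X : Mat1 M N A) : Mat2 M N A := fun i j k l => if k = l then X i j else 0

/-- `X_2 = ∑ 1 ⊗ E_{kl} ⊗ X k l`. -/
def leg2 (X : Mat1 M N A) : Mat2 M N A := fun i j k l => if i = j then X k l else 0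

end Matrices

/-! ### Formal series in `u⁻¹` and `v⁻¹`

A series in `u⁻¹` over `A` is a `PowerSeries A`, with `X` standing for `u⁻¹`. A series in `u⁻¹`
and `v⁻¹` is a `PowerSeries (PowerSeries A)`: the outer variable is `u⁻¹`, the inner one `v⁻¹`. -/

section Series

variable {A : Type*} [Ring A]

/-- `f(u)` as a series in `u⁻¹` and `v⁻¹`. -/
def inU (f : PowerSeries A) : PowerSeries (PowerSeries A) :=
  PowerSeries.map (PowerSeries.C (R := A)) f

/-- `f(v)` as a series in `u⁻¹` and `v⁻¹`. -/
def inV (f : PowerSeries A) : PowerSeries (PowerSeries A) := PowerSeries.C f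

/-- The substitution `u⁻¹ ↦ w` in a series in `u⁻¹`, for a scalar series `w` without constant
term. -/
def substInv [Algebra ℂ A] (w : PowerSeries ℂ) (f : PowerSeries A) : PowerSeries A :=
  PowerSeries.mk fun n =>
    ∑ r ∈ Finset.range (n + 1), PowerSeries.coeff n (w ^ r) • PowerSeries.coeff r f

/-- `f(u) ↦ f(-u)`. -/
def negArg [Algebra ℂ A] (f : PowerSeries A) : PowerSeries A := substInv (-PowerSeries.X) f

/-- `(u + c)⁻¹ = u⁻¹ (1 + c u⁻¹)⁻¹` as a series in `u⁻¹`. -/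
def shiftedInv (c : ℂ) : PowerSeries ℂ :=
  PowerSeries.X * (1 + PowerSeries.C c * PowerSeries.X)⁻¹

/-- `f(u) ↦ f(u + c)`. -/
def shiftArg [Algebra ℂ A] (c : ℂ) (f : PowerSeries A) : PowerSeries A :=
  substInv (shiftedInv c) f

/-- `f(u) ↦ f(-u - c)`. -/
def negShiftArg [Algebra ℂ A] (c : ℂ) (f : PowerSeries A) : PowerSeries A :=
  substInv (-shiftedInv c) f

/-- `u⁻¹ v⁻¹ (u - v) R(u - v)`, where `R(w) = 1 - w⁻¹ P`. -/
def rMinus {M N : ℕ} : Mat2 M N (PowerSeries (PowerSeries A)) := fun i j k l =>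
  (inV PowerSeries.X - inU PowerSeries.X) * one2 i j k l
    - inU PowerSeries.X * inV PowerSeries.X * permP i j k l

/-- `u⁻¹ v⁻¹ (-u - v) R(-u - v)`, where `R(w) = 1 - w⁻¹ P`. -/
def rPlus {M N : ℕ} : Mat2 M N (PowerSeries (PowerSeries A)) := fun i j k l =>
  -(inV PowerSeries.X + inU PowerSeries.X) * one2 i j k l
    - inU PowerSeries.X * inV PowerSeries.X * permP i j k l

end Series

/-! ### The super Yangian and the twisted super Yangian -/

section Yangians

variable {M N : ℕ}

/-- Labels of generators: `(i, j, r)` labels the generator with upper index `r + 1`. -/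
abbrev Gen (M N : ℕ) : Type := Idx M N × Idx M N × ℕ

/-- The series `g_{ij} + ∑_{r ≥ 1} x_{ij}^{(r)} u^{-r}` over the free algebra. -/
def freeSeries (G : Matrix (Idx M N) (Idx M N) ℂ) :
    Mat1 M N (PowerSeries (FreeAlgebra ℂ (Gen M N))) :=
  fun i j => PowerSeries.mk fun n =>
    match n with
    | 0 => algebraMap ℂ _ (G i j)
    | r + 1 => FreeAlgebra.ι ℂ (i, j, r)

/-- Left side of the `RTT` relation: `R_{12}(u-v) T_1(u) T_2(v)`, times `u⁻¹ v⁻¹ (u - v)`. -/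
def rttLeft {A : Type*} [Ring A] (T : Mat1 M N (PowerSeries A)) :
    Mat2 M N (PowerSeries (PowerSeries A)) :=
  mul2 (mul2 rMinus (leg1 fun i j => inU (T i j))) (leg2 fun i j => inV (T i j))

/-- Right side of the `RTT` relation: `T_2(v) T_1(u) R_{12}(u-v)`, times `u⁻¹ v⁻¹ (u - v)`. -/
def rttRight {A : Type*} [Ring A] (T : Mat1 M N (PowerSeries A)) :
    Mat2 M N (PowerSeries (PowerSeries A)) :=
  mul2 (mul2 (leg2 fun i j => inV (T i j)) (leg1 fun i j => inU (T i j))) rMinus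

/-- Left side of the quaternary relation: `R_{12}(u-v) S_1(u) R_{12}^{t_1}(-u-v) S_2(v)`, times
`u⁻² v⁻² (u - v) (-u - v)`. -/
def quatLeft {A : Type*} [Ring A] (S : Mat1 M N (PowerSeries A)) :
    Mat2 M N (PowerSeries (PowerSeries A)) :=
  mul2 (mul2 (mul2 rMinus (leg1 fun i j => inU (S i j))) (transp1 rPlus))
    (leg2 fun i j => inV (S i j))

/-- Right side of the quaternary relation: `S_2(v) R_{12}^{t_2}(-u-v) S_1(u) R_{12}(u-v)`, times
`u⁻² v⁻² (u - v) (-u - v)`. -/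
def quatRight {A : Type*} [Ring A] (S : Mat1 M N (PowerSeries A)) :
    Mat2 M N (PowerSeries (PowerSeries A)) :=
  mul2 (mul2 (mul2 (leg2 fun i j => inV (S i j)) (transp2 rPlus))
    (leg1 fun i j => inU (S i j))) rMinus

/-- Left side of the symmetry relation: `J S^t(-u)` with `J = ∑ (-1)^{|i|} E_{ii}`. -/
def symmLeft {A : Type*} [Ring A] [Algebra ℂ A] (S : Mat1 M N (PowerSeries A)) :
    Mat1 M N (PowerSeries A) := fun i j =>
  (-1) ^ par i * transp (fun a b => negArg (S a b)) i j

/-- Right side of the symmetry relation: `S(u) + (S(u) - S(-u)) / (2u)`. -/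
def symmRight {A : Type*} [Ring A] [Algebra ℂ A] (S : Mat1 M N (PowerSeries A)) :
    Mat1 M N (PowerSeries A) := fun i j =>
  S i j + (1 / 2 : ℂ) • (PowerSeries.X * (S i j - negArg (S i j)))

/-- The defining relations of `Y(gl_{M|N})`, coefficient by coefficient. -/
inductive GlRel (M N : ℕ) : FreeAlgebra ℂ (Gen M N) → FreeAlgebra ℂ (Gen M N) → Prop
  | rtt (i j k l : Idx M N) (m n : ℕ) :
      GlRel M N
        (PowerSeries.coeff n (PowerSeries.coeff m (rttLeft (freeSeries 1) i j k l)))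
        (PowerSeries.coeff n (PowerSeries.coeff m (rttRight (freeSeries 1) i j k l)))

/-- The super Yangian `Y(gl_{M|N})`. -/
abbrev YGl (M N : ℕ) : Type := RingQuot (GlRel M N)

/-- The generator matrix `T(u)`. -/
def tSeries (M N : ℕ) : Mat1 M N (PowerSeries (YGl M N)) := fun i j =>
  PowerSeries.map (RingQuot.mkAlgHom ℂ (GlRel M N)).toRingHom (freeSeries 1 i j)

/-- The defining relations of the twisted super Yangian attached to `G`, coefficient by
coefficient. -/
inductive TwRel (G : Matrix (Idx M N) (Idx M N) ℂ) :
    FreeAlgebra ℂ (Gen M N) → FreeAlgebra ℂ (Gen M N) → Prop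
  | quat (i j k l : Idx M N) (m n : ℕ) :
      TwRel G
        (PowerSeries.coeff n (PowerSeries.coeff m (quatLeft (freeSeries G) i j k l)))
        (PowerSeries.coeff n (PowerSeries.coeff m (quatRight (freeSeries G) i j k l)))
  | symm (i j : Idx M N) (n : ℕ) :
      TwRel G
        (PowerSeries.coeff n (symmLeft (freeSeries G) i j))
        (PowerSeries.coeff n (symmRight (freeSeries G) i j))

/-- A nondegenerate supersymmetric block matrix: block diagonal, with a symmetric even block and a
skew-symmetric odd block. -/
structure IsSupersymmetric (G : Matrix (Idx M N) (Idx M N) ℂ) : Prop where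
  upperRight : G.toBlocks₁₂ = 0
  lowerLeft : G.toBlocks₂₁ = 0
  symm : G.toBlocks₁₁.transpose = G.toBlocks₁₁
  skew : G.toBlocks₂₂.transpose = -G.toBlocks₂₂
  nondegenerate : IsUnit G.det

/-- The twisted super Yangian `Y^{tw}(osp_{M|N})` attached to `G`. -/
abbrev YTw (G : Matrix (Idx M N) (Idx M N) ℂ) : Type := RingQuot (TwRel G)

/-- The generator matrix `S(u)`. -/
def sSeries (G : Matrix (Idx M N) (Idx M N) ℂ) : Mat1 M N (PowerSeries (YTw G)) := fun i j =>
  PowerSeries.map (RingQuot.mkAlgHom ℂ (TwRel G)).toRingHom (freeSeries G i j)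

end Yangians

/-! ### Parity and the center of the superalgebra -/

section Center

variable {M N : ℕ} (G : Matrix (Idx M N) (Idx M N) ℂ)

/-- The generator `s_{ij}^{(r+1)}` labelled by `(i, j, r)`. -/
def sGen (x : Gen M N) : YTw G := RingQuot.mkAlgHom ℂ (TwRel G) (FreeAlgebra.ι ℂ x)

/-- The homogeneous component of parity `p` of `Y^{tw}(osp_{M|N})`: the span of the words in the
generators whose total parity is `p`, where `s_{ij}^{(r)}` has parity `|i| + |j|`. -/
def parityPart (p : ZMod 2) : Submodule ℂ (YTw G) :=
  Submodule.span ℂ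
    {x | ∃ l : List (Gen M N),
      ((l.map fun g => ((par g.1 + par g.2.1 : ℕ) : ZMod 2)).sum = p) ∧
        (l.map (sGen G)).prod = x}

/-- The homogeneous elements of parity `p` that supercommute with every homogeneous element. -/
def centralPart (p : ZMod 2) : Submodule ℂ (YTw G) where
  carrier := {x | x ∈ parityPart G p ∧
    ∀ q : ZMod 2, ∀ y ∈ parityPart G q, x * y = (-1) ^ (p.val * q.val) * (y * x)}
  zero_mem' := ⟨Submodule.zero_mem _, fun q y _ => by simp⟩
  add_mem' := fun {a b} ha hb => ⟨Submodule.add_mem _ ha.1 hb.1, fun q y hy => by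
    rw [add_mul, ha.2 q y hy, hb.2 q y hy, mul_add, mul_add]⟩
  smul_mem' := fun c a ha => ⟨Submodule.smul_mem _ c ha.1, fun q y hy => by
    rw [smul_mul_assoc, ha.2 q y hy, mul_smul_comm, mul_smul_comm]⟩

theorem one_mem_parityPart : (1 : YTw G) ∈ parityPart G 0 :=
  Submodule.subset_span ⟨[], by simp, by simp⟩

theorem mul_mem_parityPart {p q : ZMod 2} {x y : YTw G} (hx : x ∈ parityPart G p)
    (hy : y ∈ parityPart G q) : x * y ∈ parityPart G (p + q) := by
  have h : parityPart G p * parityPart G q ≤ parityPart G (p + q) := by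
    unfold parityPart
    rw [Submodule.span_mul_span]
    refine Submodule.span_mono ?_
    rintro _ ⟨_, ⟨l, hl, rfl⟩, _, ⟨l', hl', rfl⟩, rfl⟩
    exact ⟨l ++ l', by rw [List.map_append, List.sum_append, hl, hl'], by simp⟩
  exact h (Submodule.mul_mem_mul hx hy)

theorem mul_mem_centralPart {p q : ZMod 2} {x y : YTw G} (hx : x ∈ centralPart G p)
    (hy : y ∈ centralPart G q) : x * y ∈ centralPart G (p + q) := by
  refine ⟨mul_mem_parityPart G hx.1 hy.1, fun r w hw => ?_⟩
  have hc : ∀ (e : ℕ) (a : YTw G), a * (-1) ^ e = (-1) ^ e * a := fun e a =>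
    ((Commute.neg_one_left a).pow_left e).symm.eq
  rw [mul_assoc, hy.2 r w hw, ← mul_assoc, hc, mul_assoc, ← mul_assoc x, hx.2 r w hw]
  have hs : ((-1 : YTw G)) ^ (q.val * r.val) * (-1) ^ (p.val * r.val) =
      (-1) ^ ((p + q).val * r.val) := by
    have key : ∀ p q r : ZMod 2,
        (q.val * r.val + p.val * r.val) % 2 = ((p + q).val * r.val) % 2 := by decide
    rw [← pow_add, neg_one_pow_eq_pow_mod_two, key p q r, ← neg_one_pow_eq_pow_mod_two]
  rw [← hs]
  simp only [mul_assoc]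

/-- The center `𝒵Y^{tw}(osp_{M|N})` of the superalgebra: all sums of homogeneous elements that
supercommute with the whole algebra. -/
def center : Subalgebra ℂ (YTw G) :=
  (centralPart G 0 ⊔ centralPart G 1).toSubalgebra
    (Submodule.mem_sup_left ⟨one_mem_parityPart G, fun q y _ => by simp⟩)
    (by
      intro x y hx hy
      obtain ⟨a, ha, b, hb, rfl⟩ := Submodule.mem_sup.1 hx
      obtain ⟨c, hc, d, hd, rfl⟩ := Submodule.mem_sup.1 hy
      have h11 : (1 : ZMod 2) + 1 = 0 := by decide
      have e : (a + b) * (c + d) = (a * c + b * d) + (a * d + b * c) := by noncomm_ring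
      rw [e]
      refine Submodule.add_mem_sup (Submodule.add_mem _ ?_ ?_) (Submodule.add_mem _ ?_ ?_)
      · simpa using mul_mem_centralPart G ha hc
      · simpa [h11] using mul_mem_centralPart G hb hd
      · simpa using mul_mem_centralPart G ha hd
      · simpa using mul_mem_centralPart G hb hc)

/-- `φ` is the map `S(u) ↦ f(u) S(u)`. -/
def IsScaling (f : PowerSeries ℂ) (φ : YTw G ≃ₐ[ℂ] YTw G) : Prop :=
  ∀ i j, PowerSeries.map (φ : YTw G →+* YTw G) (sSeries G i j) =
    PowerSeries.map (algebraMap ℂ (YTw G)) f * sSeries G i j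

/-- The special twisted super Yangian `SY^{tw}(osp_{M|N})`: the elements fixed by every
automorphism of the form `S(u) ↦ f(u) S(u)` with `f ∈ 1 + u⁻¹ ℂ[[u⁻¹]]`. -/
def special : Subalgebra ℂ (YTw G) where
  carrier := {y | ∀ (f : PowerSeries ℂ) (φ : YTw G ≃ₐ[ℂ] YTw G),
    PowerSeries.constantCoeff f = 1 → IsScaling G f φ → φ y = y}
  mul_mem' := fun ha hb f φ hf hφ => by rw [map_mul, ha f φ hf hφ, hb f φ hf hφ]
  add_mem' := fun ha hb f φ hf hφ => by rw [map_add, ha f φ hf hφ, hb f φ hf hφ]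
  algebraMap_mem' := fun c _ φ _ _ => φ.commutes c

end Center

/-! ### The central series -/

section CentralSeries

variable {M N : ℕ}

/-- `z(u)` is the series over `Y(gl_{M|N})` with
`∑_k t̃_{kj}(u) t_{ik}(u + M - N) = δ_{ij} z(u)`, where `T̃(u) = T(u)⁻¹` in
`End V ⊗ Y(gl_{M|N})[[u⁻¹]]`. -/
def IsCentralSeries (z : PowerSeries (YGl M N)) : Prop :=
  ∃ T' : Mat1 M N (PowerSeries (YGl M N)),
    mul1 (tSeries M N) T' = one1 ∧ mul1 T' (tSeries M N) = one1 ∧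
      ∀ i j, ∑ k, T' k j * shiftArg ((M : ℂ) - N) (tSeries M N i k) = if i = j then z else 0

/-- `emb` is the map `S(u) ↦ T(u) G T^t(-u)`. -/
def IsTwistedMap (G : Matrix (Idx M N) (Idx M N) ℂ) (emb : YTw G →ₐ[ℂ] YGl M N) : Prop :=
  ∀ i j, PowerSeries.map (emb : YTw G →+* YGl M N) (sSeries G i j) =
    mul1
      (mul1 (tSeries M N) fun a b => PowerSeries.C (algebraMap ℂ (YGl M N) (G a b)))
      (transp fun a b => negArg (tSeries M N a b)) i j

/-- The two-sided ideal generated by the coefficients `ζ^{(r)}`, `r ≥ 3`, of a series `ζ(u)`. -/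
def coeffIdeal {A : Type*} [Ring A] (ζ : PowerSeries A) : TwoSidedIdeal A :=
  TwoSidedIdeal.span {a | ∃ r : ℕ, 3 ≤ r ∧ a = PowerSeries.coeff r ζ}

end CentralSeries

end SuperYangian

end

open scoped TensorProduct

noncomputable section

namespace SuperYangian

open PowerSeries (coeff constantCoeff coeff_map coeff_mk coeff_mul
  coeff_one coeff_C_mul coeff_zero_eq_constantCoeff_apply)

set_option linter.unusedSectionVars false
set_option linter.unusedSimpArgs false

/-! ### Ordinary matrices in place of matrices over a superalgebra -/

section Signs

variable {M N : ℕ}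

/-! Multiplying the entries of a supermatrix by suitable signs (`std`) identifies End V ⊗ A with an
ordinary matrix ring, and all relations are handled there. The basic construction is dressing: if T
solves the `RTT` relation, S solves the relations of the twisted super Yangian, and their entries
supercommute, then T(u) S(u) Tᵗ(-u) is again a twisted solution (`IsTwSeries.conj`). With the
constant solution S = G this gives the map into Y(gl). With T(u) = 1 + e/(u - a), the evaluation
representation of Y(gl) at a formal point a on the dual of V, it gives a coaction `slotTw` of Y^{tw}
with values in matrices over Y^{tw}, polynomial in a.

Give s_{ij}^{(r)} the weight 2r - 1. The relations make the associated graded algebra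
supercommutative, and the difference `slotDiff` between the coaction and the inclusion lowers the
weight, a itself counting with weight 2. Contracting the leading term of `slotDiff` with dual
generators produces an operator `euler` that is a derivation fixing every generator, up to lower
weight; hence it multiplies a word by its length. Lengths of nonempty words are nonzero, so
`slotDiff` detects the filtration (`mem_filt_of_slotDiff`), and by induction on the weight a
homomorphism compatible with coactions is injective (`injective_of_slotTw`). In particular Y^{tw}
embeds in Y(gl), and no basis of either algebra enters.

Put h = (M - N)/2. The central series is characterised inside Y^{tw}: ζ(u) is the unique series for
which ζ(u) S(-u - h)⁻¹ J obeys the symmetry relation (`IsZeta`). For constant S = G it is 1, and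
dressing by T multiplies it by z(u - h)/z(-u - h) (`IsZeta.conj`). So the image in Y(gl) has such a
series, it descends along the embedding (`IsZeta.of_map`), and 𝔷(u) = ζ(u + h). Uniqueness
determines how ζ behaves under homomorphisms: scaling S by an even f multiplies it by f(u + h)/f(u -
h), and the coaction multiplies it by an explicit rational function of u and a (`slot_zeta`).

The latter formula shows that for odd n the coefficient ζ^{(n+2)} equals n + 1 times a trace of
generators, up to lower weight. If y is central up to unusually low weight, its `slotDiff` is a
scalar matrix up to lower weight, with entries that are again nearly central of smaller weight;
reconstructing y through `euler` shows by induction that the center is generated by the coefficients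
of ζ (`mem_of_supercentral`, `center_eq_adjoin`).

Since M ≠ N, the difference equation d(u + h) = ζ(u) d(u - h) has a unique solution with constant
term 1. It is even, because ζ(u) ζ(-u) = 1, its coefficients are central, and scaling S by f scales
d by f. Therefore π : S ↦ d⁻¹ S is a projection with π(d) = 1, and SY^{tw} is its fixed algebra
(`CentralRoot.mem_special_iff`). The identity S = d · π(S) gives surjectivity of multiplication ZY ⊗
SY → Y^{tw}; injectivity follows from the homomorphism S ↦ d ⊗ π(S) into Y^{tw} ⊗ Y^{tw}. Setting 𝔷
= 1 amounts to setting d = 1, after which π becomes the identity; this is the statement on the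
quotient. -/

theorem par_cases (i : Idx M N) : par i = 0 ∨ par i = 1 := by
  cases i <;> simp [par]

variable {A : Type*} [Ring A]

/-- The sign change that turns the product of `End V ⊗ A` into the product of matrices. -/
def std (X : Mat1 M N A) : Matrix (Idx M N) (Idx M N) A :=
  Matrix.of fun i j => (-1) ^ (par i * par j + par j) * X i j

/-- The inverse of `std`. -/
def unstd (X : Matrix (Idx M N) (Idx M N) A) : Mat1 M N A :=
  fun i j => (-1) ^ (par i * par j + par j) * X i j

/-- The sign change that turns the product of `End V ⊗ End V ⊗ A` into the product of matrices. -/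
def std2 (X : Mat2 M N A) : Matrix (Idx M N × Idx M N) (Idx M N × Idx M N) A :=
  Matrix.of fun a b => (-1) ^ ((par a.1 + par a.2) * (par b.1 + par b.2) + (par b.1 + par b.2) +
    (par a.1 + par b.1) * par a.2) * X a.1 b.1 a.2 b.2

theorem neg_one_pow_mul_self (n : ℕ) (x : A) : (-1) ^ n * ((-1) ^ n * x) = x := by
  rw [← mul_assoc, ← pow_add, ← two_mul, pow_mul]; simp

theorem std_unstd (X : Matrix (Idx M N) (Idx M N) A) : std (unstd X) = X := by
  ext i j; simp [std, unstd, neg_one_pow_mul_self]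

theorem unstd_std (X : Mat1 M N A) : unstd (std X) = X := by
  funext i j; simp [std, unstd, neg_one_pow_mul_self]

theorem std2_injective : Function.Injective (std2 : Mat2 M N A → _) := by
  intro X Y h
  funext i j k l
  have := congrFun (congrFun h (i, k)) (j, l)
  simp only [std2, Matrix.of_apply] at this
  rw [← neg_one_pow_mul_self _ (X i j k l), this, neg_one_pow_mul_self]

/-- Modulo 2 the exponents agree: (|i|+|k|)(|k|+|j|) + |i||j| + |j| = (|i||k| + |k|) + (|k||j| +
|j|). -/
theorem std_mul1 (X Y : Mat1 M N A) : std (mul1 X Y) = std X * std Y := by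
  ext i j
  simp only [std, mul1, Matrix.of_apply, Matrix.mul_apply, Finset.mul_sum]
  refine Finset.sum_congr rfl fun k _ => ?_
  rcases par_cases i with hi | hi <;> rcases par_cases j with hj | hj <;>
    rcases par_cases k with hk | hk <;> simp [hi, hj, hk, pow_succ]

theorem std_one1 : std (one1 : Mat1 M N A) = 1 := by
  ext i j
  rcases eq_or_ne i j with rfl | h
  · rcases par_cases i with hi | hi <;> simp [std, one1, hi]
  · simp [std, one1, h]

theorem std2_mul2 (X Y : Mat2 M N A) : std2 (mul2 X Y) = std2 X * std2 Y := by
  ext ⟨i, k⟩ ⟨a, b⟩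
  simp only [std2, mul2, Matrix.of_apply, Matrix.mul_apply, Finset.mul_sum,
    Fintype.sum_prod_type]
  refine Finset.sum_congr rfl fun j _ => Finset.sum_congr rfl fun l _ => ?_
  rcases par_cases i with hi | hi <;> rcases par_cases j with hj | hj <;>
    rcases par_cases k with hk | hk <;> rcases par_cases l with hl | hl <;>
    rcases par_cases a with ha | ha <;> rcases par_cases b with hb | hb <;>
    simp [hi, hj, hk, hl, ha, hb, pow_succ]

/-- The super transposition in terms of ordinary matrices. -/
def str (X : Matrix (Idx M N) (Idx M N) A) : Matrix (Idx M N) (Idx M N) A :=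
  Matrix.of fun i j => (-1) ^ (par i * par j + par i) * X j i

/-- `X ⊗ 1` as a matrix. -/
def leg1M (X : Matrix (Idx M N) (Idx M N) A) :
    Matrix (Idx M N × Idx M N) (Idx M N × Idx M N) A :=
  Matrix.of fun a b => if a.2 = b.2 then X a.1 b.1 else 0

/-- `1 ⊗ X` as a matrix. -/
def leg2M (X : Matrix (Idx M N) (Idx M N) A) :
    Matrix (Idx M N × Idx M N) (Idx M N × Idx M N) A :=
  Matrix.of fun a b => if a.1 = b.1 then (-1) ^ (par a.1 * (par a.2 + par b.2)) * X a.2 b.2 else 0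

variable (M N A) in
/-- The super flip as a matrix. -/
def flipM : Matrix (Idx M N × Idx M N) (Idx M N × Idx M N) A :=
  Matrix.of fun a b => if a.1 = b.2 ∧ a.2 = b.1 then (-1) ^ (par a.1 * par a.2) else 0

variable (M N A) in
/-- The first partial transpose of the super flip. -/
def contr1M : Matrix (Idx M N × Idx M N) (Idx M N × Idx M N) A :=
  Matrix.of fun a b => if a.1 = a.2 ∧ b.1 = b.2 then (-1) ^ par b.1 else 0

variable (M N A) in
/-- The second partial transpose of the super flip. -/
def contr2M : Matrix (Idx M N × Idx M N) (Idx M N × Idx M N) A :=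
  Matrix.of fun a b => if a.1 = a.2 ∧ b.1 = b.2 then (-1) ^ par a.1 else 0

theorem std_transp (X : Mat1 M N A) : std (transp X) = str (std X) := by
  ext i j
  rcases par_cases i with hi | hi <;> rcases par_cases j with hj | hj <;>
    simp [std, str, transp, hi, hj]

theorem std2_leg1 (X : Mat1 M N A) : std2 (leg1 X) = leg1M (std X) := by
  ext ⟨i, k⟩ ⟨j, l⟩
  by_cases h : k = l
  · subst h
    rcases par_cases i with hi | hi <;> rcases par_cases j with hj | hj <;>
      rcases par_cases k with hk | hk <;> simp [std, std2, leg1, leg1M, hi, hj, hk, pow_succ]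
  · simp [std2, leg1, leg1M, h]

theorem std2_leg2 (X : Mat1 M N A) : std2 (leg2 X) = leg2M (std X) := by
  ext ⟨i, k⟩ ⟨j, l⟩
  by_cases h : i = j
  · subst h
    rcases par_cases i with hi | hi <;> rcases par_cases l with hj | hj <;>
      rcases par_cases k with hk | hk <;> simp [std, std2, leg2, leg2M, hi, hj, hk, pow_succ]
  · simp [std2, leg2, leg2M, h]

theorem std2_one2 : std2 (one2 : Mat2 M N A) = 1 := by
  ext ⟨i, k⟩ ⟨j, l⟩
  by_cases h : i = j ∧ k = l
  · obtain ⟨rfl, rfl⟩ := h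
    rcases par_cases i with hi | hi <;>
      rcases par_cases k with hk | hk <;> simp [std2, one2, hi, hk, pow_succ]
  · rw [Matrix.one_apply_ne (by simpa using h)]
    simp [std2, one2, h]

theorem std2_permP : std2 (permP : Mat2 M N A) = flipM M N A := by
  ext ⟨i, k⟩ ⟨j, l⟩
  by_cases h : i = l ∧ k = j
  · obtain ⟨rfl, rfl⟩ := h
    rcases par_cases i with hi | hi <;>
      rcases par_cases k with hk | hk <;> simp [std2, permP, flipM, hi, hk, pow_succ]
  · have h' : ¬ (i = l ∧ j = k) := fun h' => h ⟨h'.1, h'.2.symm⟩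
    simp [std2, permP, flipM, h, h']

theorem std2_transp1_permP : std2 (transp1 (permP : Mat2 M N A)) = contr1M M N A := by
  ext ⟨i, k⟩ ⟨j, l⟩
  by_cases h : i = k ∧ j = l
  · obtain ⟨rfl, rfl⟩ := h
    rcases par_cases i with hi | hi <;>
      rcases par_cases j with hk | hk <;> simp [std2, permP, transp1, contr1M, hi, hk, pow_succ]
  · have h' : ¬ (j = l ∧ i = k) := fun h' => h ⟨h'.2, h'.1⟩
    simp [std2, permP, transp1, contr1M, h, h']

theorem std2_transp2_permP : std2 (transp2 (permP : Mat2 M N A)) = contr2M M N A := by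
  ext ⟨i, k⟩ ⟨j, l⟩
  by_cases h : i = k ∧ j = l
  · obtain ⟨rfl, rfl⟩ := h
    rcases par_cases i with hi | hi <;>
      rcases par_cases j with hk | hk <;> simp [std2, permP, transp2, contr2M, hi, hk, pow_succ]
  · have h' : ¬ (i = k ∧ j = l) := fun h' => h ⟨h'.1, h'.2⟩
    simp [std2, permP, transp2, contr2M, h']

theorem std2_transp1_one2 : std2 (transp1 (one2 : Mat2 M N A)) = 1 := by
  rw [← std2_one2]
  congr 1
  funext i j k l
  rcases eq_or_ne i j with rfl | h
  · rcases par_cases i with hi | hi <;> simp [transp1, one2, hi]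
  · simp [transp1, one2, h, h.symm]

theorem std2_transp2_one2 : std2 (transp2 (one2 : Mat2 M N A)) = 1 := by
  rw [← std2_one2]
  congr 1
  funext i j k l
  rcases eq_or_ne k l with rfl | h
  · rcases par_cases k with hi | hi <;> simp [transp2, one2, hi]
  · simp [transp2, one2, h, h.symm]

theorem leg1M_mul (X Y : Matrix (Idx M N) (Idx M N) A) : leg1M (X * Y) = leg1M X * leg1M Y := by
  ext ⟨i, k⟩ ⟨j, l⟩
  rcases eq_or_ne k l with rfl | h
  · simp [leg1M, Matrix.mul_apply, Fintype.sum_prod_type]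
  · simp [leg1M, Matrix.mul_apply, Fintype.sum_prod_type, h]

theorem leg2M_mul (X Y : Matrix (Idx M N) (Idx M N) A) : leg2M (X * Y) = leg2M X * leg2M Y := by
  ext ⟨i, k⟩ ⟨j, l⟩
  rw [Matrix.mul_apply, Fintype.sum_prod_type, Finset.sum_eq_single i]
  · rcases eq_or_ne i j with rfl | h
    · simp only [leg2M, Matrix.of_apply, Matrix.mul_apply, if_true, Finset.mul_sum]
      refine Finset.sum_congr rfl fun m _ => ?_
      rcases par_cases i with hi | hi <;> rcases par_cases l with hj | hj <;>
        rcases par_cases m with hm | hm <;>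
        rcases par_cases k with hk | hk <;> simp [hi, hj, hk, hm]
    · simp [leg2M, h]
  · intro b _ hb
    exact Finset.sum_eq_zero fun a _ => by simp [leg2M, hb.symm]
  · simp

theorem leg1M_one : leg1M (1 : Matrix (Idx M N) (Idx M N) A) = 1 := by
  ext ⟨i, k⟩ ⟨j, l⟩
  by_cases h : i = j <;> by_cases h' : k = l <;> simp [leg1M, Matrix.one_apply, h, h']

theorem leg2M_one : leg2M (1 : Matrix (Idx M N) (Idx M N) A) = 1 := by
  ext ⟨i, k⟩ ⟨j, l⟩
  by_cases h : i = j
  · by_cases h' : k = l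
    · subst h h'
      rcases par_cases i with hi | hi <;> rcases par_cases k with hk | hk <;>
        simp [leg2M, hi, hk]
    · simp [leg2M, Matrix.one_apply, h, h']
  · simp [leg2M, Matrix.one_apply, h]

theorem leg1M_mul_leg2M (X Y : Matrix (Idx M N) (Idx M N) A) (i k j l : Idx M N) :
    (leg1M X * leg2M Y) (i, k) (j, l) = (-1) ^ (par j * (par k + par l)) * (X i j * Y k l) := by
  rw [Matrix.mul_apply, Fintype.sum_prod_type, Finset.sum_eq_single j, Finset.sum_eq_single k]
  · rcases neg_one_pow_eq_or A (par j * (par k + par l)) with h | h <;> simp [leg1M, leg2M, h]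
  · intro b _ hb; simp [leg1M, leg2M, hb.symm]
  · simp
  · intro b _ hb
    exact Finset.sum_eq_zero fun a _ => by simp [leg1M, leg2M, hb]
  · simp

theorem leg2M_mul_leg1M (X Y : Matrix (Idx M N) (Idx M N) A) (i k j l : Idx M N) :
    (leg2M Y * leg1M X) (i, k) (j, l) = (-1) ^ (par i * (par k + par l)) * (Y k l * X i j) := by
  rw [Matrix.mul_apply, Fintype.sum_prod_type, Finset.sum_eq_single i, Finset.sum_eq_single l]
  · simp [leg1M, leg2M, mul_assoc]
  · intro b _ hb; simp [leg1M, leg2M, hb]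
  · simp
  · intro b _ hb
    exact Finset.sum_eq_zero fun a _ => by simp [leg1M, leg2M, hb.symm]
  · simp

theorem flipM_mul (Z : Matrix (Idx M N × Idx M N) (Idx M N × Idx M N) A) (i k : Idx M N)
    (b : Idx M N × Idx M N) : (flipM M N A * Z) (i, k) b = (-1) ^ (par i * par k) * Z (k, i) b := by
  rw [Matrix.mul_apply, Finset.sum_eq_single (k, i)]
  · simp [flipM]
  · rintro ⟨a, c⟩ _ h
    have : ¬ (i = c ∧ k = a) := fun h' => h (by rw [h'.1, h'.2])
    simp [flipM, this]
  · simp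

theorem mul_flipM (Z : Matrix (Idx M N × Idx M N) (Idx M N × Idx M N) A) (j l : Idx M N)
    (b : Idx M N × Idx M N) : (Z * flipM M N A) b (j, l) = (-1) ^ (par j * par l) * Z b (l, j) := by
  rw [Matrix.mul_apply, Finset.sum_eq_single (l, j)]
  · rcases neg_one_pow_eq_or A (par l * par j) with h | h <;> simp [flipM, h, mul_comm (par j)]
  · rintro ⟨a, c⟩ _ h
    have : ¬ (a = l ∧ c = j) := fun h' => h (by rw [h'.1, h'.2])
    simp [flipM, this]
  · simp

/-- The transposed flip has rank one, so each entry of the triple product is a single product of an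
entry of X and an entry of Y. -/
theorem leg1M_mul_contr1M_mul_leg2M (X Y : Matrix (Idx M N) (Idx M N) A) (i k j l : Idx M N) :
    (leg1M X * contr1M M N A * leg2M Y) (i, k) (j, l) =
      (-1) ^ (par j * par l) * (X i k * Y j l) := by
  rw [mul_assoc, Matrix.mul_apply, Fintype.sum_prod_type, Finset.sum_eq_single k,
    Finset.sum_eq_single k, Matrix.mul_apply, Fintype.sum_prod_type, Finset.sum_eq_single j,
    Finset.sum_eq_single j]
  · rcases par_cases j with hi | hi <;> rcases par_cases l with hj | hj <;>
      simp [leg1M, leg2M, contr1M, hi, hj]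
  · intro b _ hb; simp [contr1M, hb.symm]
  · simp
  · intro b _ hb
    exact Finset.sum_eq_zero fun a _ => by simp [leg2M, hb]
  · simp
  · intro b _ hb; simp [leg1M, hb.symm]
  · simp
  · intro b _ hb
    refine Finset.sum_eq_zero fun a _ => ?_
    rcases eq_or_ne k a with rfl | h
    · rw [Matrix.mul_apply, Finset.sum_eq_zero, mul_zero]
      intro x _; simp [contr1M, hb]
    · simp [leg1M, h]
  · simp

theorem leg2M_mul_contr1M_mul_leg1M (X Y : Matrix (Idx M N) (Idx M N) A) (i k j l : Idx M N) :
    (leg2M Y * contr1M M N A * leg1M X) (i, k) (j, l) =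
      (-1) ^ (par i * (par k + par i) + par l) * (Y k i * X l j) := by
  rw [mul_assoc, Matrix.mul_apply, Fintype.sum_prod_type, Finset.sum_eq_single i,
    Finset.sum_eq_single i, Matrix.mul_apply, Fintype.sum_prod_type, Finset.sum_eq_single l,
    Finset.sum_eq_single l]
  · rcases par_cases i with hi | hi <;> rcases par_cases l with hj | hj <;>
      rcases par_cases k with hk | hk <;> simp [leg1M, leg2M, contr1M, hi, hj, hk, pow_succ]
  · intro b _ hb; simp [contr1M, hb.symm]
  · simp
  · intro b _ hb
    refine Finset.sum_eq_zero fun a _ => ?_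
    rcases eq_or_ne a l with rfl | h
    · simp [contr1M, hb]
    · simp [leg1M, h]
  · simp
  · intro b _ hb
    rw [Matrix.mul_apply, Finset.sum_eq_zero, mul_zero]
    intro x _; simp [contr1M, hb.symm]
  · simp
  · intro b _ hb
    exact Finset.sum_eq_zero fun a _ => by simp [leg2M, hb.symm]
  · simp

theorem leg1M_mul_contr2M_mul_leg2M (X Y : Matrix (Idx M N) (Idx M N) A) (i k j l : Idx M N) :
    (leg1M X * contr2M M N A * leg2M Y) (i, k) (j, l) =
      (-1) ^ (par k + par j + par j * par l) * (X i k * Y j l) := by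
  rw [mul_assoc, Matrix.mul_apply, Fintype.sum_prod_type, Finset.sum_eq_single k,
    Finset.sum_eq_single k, Matrix.mul_apply, Fintype.sum_prod_type, Finset.sum_eq_single j,
    Finset.sum_eq_single j]
  · rcases par_cases j with hi | hi <;> rcases par_cases l with hj | hj <;>
      rcases par_cases k with hk | hk <;> simp [leg1M, leg2M, contr2M, hi, hj, hk, pow_succ]
  · intro b _ hb; simp [contr2M, hb.symm]
  · simp
  · intro b _ hb
    exact Finset.sum_eq_zero fun a _ => by simp [leg2M, hb]
  · simp
  · intro b _ hb; simp [leg1M, hb.symm]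
  · simp
  · intro b _ hb
    refine Finset.sum_eq_zero fun a _ => ?_
    rcases eq_or_ne k a with rfl | h
    · rw [Matrix.mul_apply, Finset.sum_eq_zero, mul_zero]
      intro x _; simp [contr2M, hb]
    · simp [leg1M, h]
  · simp

theorem leg2M_mul_contr2M_mul_leg1M (X Y : Matrix (Idx M N) (Idx M N) A) (i k j l : Idx M N) :
    (leg2M Y * contr2M M N A * leg1M X) (i, k) (j, l) =
      (-1) ^ (par i * par k) * (Y k i * X l j) := by
  rw [mul_assoc, Matrix.mul_apply, Fintype.sum_prod_type, Finset.sum_eq_single i,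
    Finset.sum_eq_single i, Matrix.mul_apply, Fintype.sum_prod_type, Finset.sum_eq_single l,
    Finset.sum_eq_single l]
  · rcases par_cases i with hi | hi <;>
      rcases par_cases k with hk | hk <;> simp [leg1M, leg2M, contr2M, hi, hk, pow_succ]
  · intro b _ hb; simp [contr2M, hb.symm]
  · simp
  · intro b _ hb
    refine Finset.sum_eq_zero fun a _ => ?_
    rcases eq_or_ne a l with rfl | h
    · simp [contr2M, hb]
    · simp [leg1M, h]
  · simp
  · intro b _ hb
    rw [Matrix.mul_apply, Finset.sum_eq_zero, mul_zero]
    intro x _; simp [contr2M, hb.symm]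
  · simp
  · intro b _ hb
    exact Finset.sum_eq_zero fun a _ => by simp [leg2M, hb.symm]
  · simp

end Signs

/-! ### The `RTT` relation and the quaternary relation for matrices -/

section Relations

variable {M N : ℕ} {K A : Type*} [CommRing K] [Ring A] [Algebra K A]

/-- The `RTT` relation between `T(u)` and `T(v)`, where `α = u⁻¹` and `β = v⁻¹`. -/
def IsRTT (α β : K) (T T' : Matrix (Idx M N) (Idx M N) A) : Prop := ∀ i j k l,
  (β - α) • ((-1) ^ (par j * (par k + par l)) * (T i j * T' k l) -
      (-1) ^ (par i * (par k + par l)) * (T' k l * T i j)) =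
    (α * β) • ((-1) ^ (par i * par k + par j * (par i + par l)) * (T k j * T' i l) -
      (-1) ^ (par j * par l + par i * (par k + par j)) * (T' k j * T i l))

variable (M N A) in
/-- The matrix `a + b P`. -/
def rMat (a b : K) : Matrix (Idx M N × Idx M N) (Idx M N × Idx M N) A := a • 1 - b • flipM M N A

variable (M N A) in
/-- The matrix `a + b P^{t_1}`. -/
def rMat1 (a b : K) : Matrix (Idx M N × Idx M N) (Idx M N × Idx M N) A := a • 1 - b • contr1M M N A

variable (M N A) in
/-- The matrix `a + b P^{t_2}`. -/
def rMat2 (a b : K) : Matrix (Idx M N × Idx M N) (Idx M N × Idx M N) A := a • 1 - b • contr2M M N A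

theorem rMat_mul_apply (a b : K) (Z : Matrix (Idx M N × Idx M N) (Idx M N × Idx M N) A)
    (i k : Idx M N) (c : Idx M N × Idx M N) : (rMat M N A a b * Z) (i, k) c =
      a • Z (i, k) c - b • ((-1) ^ (par i * par k) * Z (k, i) c) := by
  simp only [rMat, sub_mul, smul_mul_assoc, one_mul, Matrix.sub_apply, Matrix.smul_apply, flipM_mul]

theorem mul_rMat_apply (a b : K) (Z : Matrix (Idx M N × Idx M N) (Idx M N × Idx M N) A)
    (j l : Idx M N) (c : Idx M N × Idx M N) : (Z * rMat M N A a b) c (j, l) =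
      a • Z c (j, l) - b • ((-1) ^ (par j * par l) * Z c (l, j)) := by
  simp only [rMat, mul_sub, mul_smul_comm, mul_one, Matrix.sub_apply, Matrix.smul_apply, mul_flipM]

/-- The componentwise form makes partial transposition a mere relabelling of indices; the matrix
form serves for multiplying and inverting. -/
theorem isRTT_iff {α β : K} {T T' : Matrix (Idx M N) (Idx M N) A} : IsRTT α β T T' ↔
    rMat M N A (β - α) (α * β) * leg1M T * leg2M T' =
      leg2M T' * leg1M T * rMat M N A (β - α) (α * β) := by
  have key : ∀ i k j l, (rMat M N A (β - α) (α * β) * leg1M T * leg2M T') (i, k) (j, l) -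
      (leg2M T' * leg1M T * rMat M N A (β - α) (α * β)) (i, k) (j, l) =
      (β - α) • ((-1) ^ (par j * (par k + par l)) * (T i j * T' k l) -
        (-1) ^ (par i * (par k + par l)) * (T' k l * T i j)) -
      (α * β) • ((-1) ^ (par i * par k + par j * (par i + par l)) * (T k j * T' i l) -
        (-1) ^ (par j * par l + par i * (par k + par j)) * (T' k j * T i l)) := by
    intro i k j l
    rw [mul_assoc, rMat_mul_apply, mul_rMat_apply]
    simp only [leg1M_mul_leg2M, leg2M_mul_leg1M, ← mul_assoc ((-1 : A) ^ _) ((-1) ^ _), ← pow_add]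
    module
  constructor
  · intro h
    ext ⟨i, k⟩ ⟨j, l⟩
    rw [← sub_eq_zero, key, h, sub_self]
  · intro h i j k l
    rw [← sub_eq_zero, ← key, h, sub_self]

/-- Transposing the first leg exchanges the indices i and j, so this is the `RTT` relation at (j, i,
k, l), up to a common sign depending on the parities. -/
theorem IsRTT.leg1_str {α β : K} {T T' : Matrix (Idx M N) (Idx M N) A} (h : IsRTT α β T T') :
    leg1M (str T) * rMat1 M N A (β - α) (α * β) * leg2M T' =
      leg2M T' * rMat1 M N A (β - α) (α * β) * leg1M (str T) := by
  ext ⟨i, k⟩ ⟨j, l⟩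
  have := h j i k l
  simp only [rMat1, sub_mul, mul_sub, smul_mul_assoc, mul_smul_comm, mul_one,
      Matrix.sub_apply, Matrix.smul_apply, leg1M_mul_contr1M_mul_leg2M,
      leg2M_mul_contr1M_mul_leg1M, leg1M_mul_leg2M, leg2M_mul_leg1M, str, Matrix.of_apply] at this ⊢
  rcases par_cases i with hi | hi <;> rcases par_cases j with hj | hj <;>
      rcases par_cases k with hk | hk <;> rcases par_cases l with hl | hl <;>
    simp only [hi, hj, hk, hl, add_zero, zero_add, mul_zero, mul_one, pow_zero, one_mul,
      Nat.reduceAdd, Nat.reduceMul, neg_mul, mul_neg, pow_succ, neg_neg] at this ⊢ <;>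
    first
      | linear_combination (norm := module) this
      | linear_combination (norm := module) (-1 : K) • this

theorem IsRTT.leg2_str {α β : K} {T T' : Matrix (Idx M N) (Idx M N) A} (h : IsRTT β α T' T) :
    leg2M (str T') * rMat2 M N A (α - β) (α * β) * leg1M T =
      leg1M T * rMat2 M N A (α - β) (α * β) * leg2M (str T') := by
  ext ⟨i, k⟩ ⟨j, l⟩
  have := h l k i j
  simp only [rMat2, sub_mul, mul_sub, smul_mul_assoc, mul_smul_comm, mul_one,
      Matrix.sub_apply, Matrix.smul_apply, leg1M_mul_contr2M_mul_leg2M,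
      leg2M_mul_contr2M_mul_leg1M, leg1M_mul_leg2M, leg2M_mul_leg1M, str, Matrix.of_apply] at this ⊢
  rcases par_cases i with hi | hi <;> rcases par_cases j with hj | hj <;>
      rcases par_cases k with hk | hk <;> rcases par_cases l with hl | hl <;>
    simp only [hi, hj, hk, hl, add_zero, zero_add, mul_zero, mul_one, pow_zero, one_mul,
      Nat.reduceAdd, Nat.reduceMul, neg_mul, mul_neg, pow_succ, neg_neg] at this ⊢ <;>
    first
      | linear_combination (norm := module) this
      | linear_combination (norm := module) (-1 : K) • this

/-- Transposing both legs reverses products, so the relation needed is the one with the two spectral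
parameters exchanged. -/
theorem IsRTT.leg12_str {α β : K} {T T' : Matrix (Idx M N) (Idx M N) A} (h : IsRTT β α T' T) :
    rMat M N A (α - β) (α * β) * leg1M (str T) * leg2M (str T') =
      leg2M (str T') * leg1M (str T) * rMat M N A (α - β) (α * β) := by
  ext ⟨i, k⟩ ⟨j, l⟩
  have := h l k j i
  rw [mul_assoc, rMat_mul_apply, mul_rMat_apply]
  simp only [mul_sub, leg1M_mul_leg2M, leg2M_mul_leg1M, str, Matrix.of_apply] at this ⊢
  rcases par_cases i with hi | hi <;> rcases par_cases j with hj | hj <;>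
      rcases par_cases k with hk | hk <;> rcases par_cases l with hl | hl <;>
    simp only [hi, hj, hk, hl, add_zero, zero_add, mul_zero, mul_one, pow_zero, one_mul,
      Nat.reduceAdd, Nat.reduceMul, neg_mul, mul_neg, pow_succ, neg_neg] at this ⊢ <;>
    first
      | linear_combination (norm := module) this
      | linear_combination (norm := module) (-1 : K) • this

/-- The entries of `X` supercommute with the entries of `Y`. -/
def SComm (X Y : Matrix (Idx M N) (Idx M N) A) : Prop := ∀ i j k l,
  X i j * Y k l = (-1) ^ ((par i + par j) * (par k + par l)) * (Y k l * X i j)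

theorem SComm.symm {X Y : Matrix (Idx M N) (Idx M N) A} (h : SComm X Y) : SComm Y X := by
  intro i j k l
  rw [h k l i j, mul_comm (par k + par l), neg_one_pow_mul_self]

theorem SComm.str_left {X Y : Matrix (Idx M N) (Idx M N) A} (h : SComm X Y) : SComm (str X) Y := by
  intro i j k l
  simp only [str, Matrix.of_apply, mul_assoc]
  rw [h j i k l, add_comm (par j)]
  rcases neg_one_pow_eq_or A (par i * par j + par i) with h | h <;> simp [h]

theorem SComm.str_right {X Y : Matrix (Idx M N) (Idx M N) A} (h : SComm X Y) : SComm X (str Y) :=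
  h.symm.str_left.symm

/-- The signs built into `leg2M` turn supercommutation of entries into honest commutation of the two
legs. This is what makes sign-free manipulations such as `quat_aux` possible. -/
theorem SComm.legs {X Y : Matrix (Idx M N) (Idx M N) A} (h : SComm X Y) :
    leg1M X * leg2M Y = leg2M Y * leg1M X := by
  ext ⟨i, k⟩ ⟨j, l⟩
  rw [leg1M_mul_leg2M, leg2M_mul_leg1M, h i j k l, ← mul_assoc, ← pow_add]
  congr 1
  rcases par_cases i with hi | hi <;> rcases par_cases j with hj | hj <;>
      rcases par_cases k with hk | hk <;> rcases par_cases l with hl | hl <;>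
      simp [hi, hj, hk, hl, pow_succ]

theorem SComm.mul_right {X Y Z : Matrix (Idx M N) (Idx M N) A} (h : SComm X Y) (h' : SComm X Z) :
    SComm X (Y * Z) := by
  intro i j k l
  simp only [Matrix.mul_apply, Finset.mul_sum, Finset.sum_mul]
  refine Finset.sum_congr rfl fun m _ => ?_
  rw [← mul_assoc, h i j k m, mul_assoc, mul_assoc, h' i j m l]
  rcases par_cases i with hi | hi <;> rcases par_cases j with hj | hj <;>
      rcases par_cases k with hk | hk <;> rcases par_cases l with hl | hl <;>
      rcases par_cases m with hm | hm <;>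
      simp [hi, hj, hk, hl, hm, mul_assoc, pow_succ]

theorem SComm.mul_left {X Y Z : Matrix (Idx M N) (Idx M N) A} (h : SComm X Z) (h' : SComm Y Z) :
    SComm (X * Y) Z := (h.symm.mul_right h'.symm).symm

/-- The super transposition reverses a product only when the entries of the factors supercommute,
because the order of multiplication in A has to be reversed too. -/
theorem SComm.str_mul {X Y : Matrix (Idx M N) (Idx M N) A} (h : SComm X Y) :
    str (X * Y) = str Y * str X := by
  ext i j
  simp only [str, Matrix.of_apply, Matrix.mul_apply, Finset.mul_sum]
  refine Finset.sum_congr rfl fun m _ => ?_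
  rw [h j m m i]
  rcases par_cases i with hi | hi <;> rcases par_cases j with hj | hj <;>
      rcases par_cases m with hm | hm <;>
      simp [hi, hj, hm, pow_succ]

/-- The quaternary relation between `S(u)` and `S(v)`, where `α = u⁻¹` and `β = v⁻¹`. -/
def IsQuat (α β : K) (S S' : Matrix (Idx M N) (Idx M N) A) : Prop :=
  rMat M N A (β - α) (α * β) * leg1M S * rMat1 M N A (-(α + β)) (α * β) * leg2M S' =
    leg2M S' * rMat2 M N A (-(α + β)) (α * β) * leg1M S * rMat M N A (β - α) (α * β)

theorem IsRTT.mul {α β : K} {T T' Y Y' : Matrix (Idx M N) (Idx M N) A} (h : IsRTT α β T T')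
    (h' : IsRTT α β Y Y') (h₁ : SComm T Y') (h₂ : SComm Y T') : IsRTT α β (T * Y) (T' * Y') := by
  rw [isRTT_iff] at h h' ⊢
  rw [leg1M_mul, leg2M_mul]
  calc rMat M N A (β - α) (α * β) * (leg1M T * leg1M Y) * (leg2M T' * leg2M Y')
      = (rMat M N A (β - α) (α * β) * leg1M T) * (leg1M Y * leg2M T') * leg2M Y' := by
        simp only [mul_assoc]
    _ = (rMat M N A (β - α) (α * β) * leg1M T * leg2M T') * leg1M Y * leg2M Y' := by
        rw [h₂.legs]; simp only [mul_assoc]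
    _ = leg2M T' * leg1M T * (rMat M N A (β - α) (α * β) * leg1M Y * leg2M Y') := by
        rw [h]; simp only [mul_assoc]
    _ = leg2M T' * (leg1M T * leg2M Y') * leg1M Y * rMat M N A (β - α) (α * β) := by
        rw [h']; simp only [mul_assoc]
    _ = _ := by rw [h₁.legs]; simp only [mul_assoc]

/-- Dressing of a reflection equation. Here t, s, m stand for T(u), S(u), Tᵗ(-u), with 1 and 2
indicating the leg and the parameter; each hypothesis moves one factor past another. -/
theorem quat_aux {B : Type*} [Ring B] {r r1 r2 t1 s1 m1 t2 s2 m2 : B}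
    (h1 : r * t1 * t2 = t2 * t1 * r) (h2 : m1 * r1 * t2 = t2 * r1 * m1)
    (h3 : m2 * r2 * t1 = t1 * r2 * m2) (h4 : r * m1 * m2 = m2 * m1 * r)
    (c1 : s1 * t2 = t2 * s1) (c2 : m1 * s2 = s2 * m1) (c3 : t1 * s2 = s2 * t1)
    (c4 : s1 * m2 = m2 * s1) (hs : r * s1 * r1 * s2 = s2 * r2 * s1 * r) :
    r * (t1 * s1 * m1) * r1 * (t2 * s2 * m2) = (t2 * s2 * m2) * r2 * (t1 * s1 * m1) * r := by
  calc r * (t1 * s1 * m1) * r1 * (t2 * s2 * m2)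
      = r * t1 * s1 * (m1 * r1 * t2) * s2 * m2 := by simp only [mul_assoc]
    _ = r * t1 * (s1 * t2) * r1 * (m1 * s2) * m2 := by rw [h2]; simp only [mul_assoc]
    _ = (r * t1 * t2) * s1 * r1 * s2 * m1 * m2 := by rw [c1, c2]; simp only [mul_assoc]
    _ = t2 * t1 * (r * s1 * r1 * s2) * m1 * m2 := by rw [h1]; simp only [mul_assoc]
    _ = t2 * (t1 * s2) * r2 * s1 * (r * m1 * m2) := by rw [hs]; simp only [mul_assoc]
    _ = t2 * s2 * t1 * r2 * (s1 * m2) * m1 * r := by rw [c3, h4]; simp only [mul_assoc]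
    _ = t2 * s2 * (t1 * r2 * m2) * s1 * m1 * r := by rw [c4]; simp only [mul_assoc]
    _ = _ := by rw [← h3]; simp only [mul_assoc]

theorem rMat1_neg (a b : K) : rMat1 M N A (-a) (-b) = -rMat1 M N A a b := by
  simp only [rMat1]; module

theorem rMat2_neg (a b : K) : rMat2 M N A (-a) (-b) = -rMat2 M N A a b := by
  simp only [rMat2]; module

/-- If `T` satisfies the `RTT` relation and `S` the quaternary relation, then `T(u) S(u) T^t(-u)`
satisfies the quaternary relation. Here `Y = T(-u)` and `Y' = T(-v)`. -/
theorem IsQuat.conj {α β : K} {T T' Y Y' S S' : Matrix (Idx M N) (Idx M N) A}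
    (hS : IsQuat α β S S') (h1 : IsRTT α β T T') (h2 : IsRTT (-α) β Y T')
    (h3 : IsRTT (-β) α Y' T) (h4 : IsRTT (-β) (-α) Y' Y)
    (c1 : SComm S T') (c2 : SComm Y S') (c3 : SComm T S') (c4 : SComm S Y') :
    IsQuat α β (T * S * str Y) (T' * S' * str Y') := by
  have h2' := h2.leg1_str
  have h3' := h3.leg2_str
  have h4' := h4.leg12_str
  rw [isRTT_iff] at h1
  rw [show β - -α = -(-(α + β)) by ring, show -α * β = -(α * β) by ring, rMat1_neg] at h2'
  rw [show α - -β = -(-(α + β)) by ring, show α * -β = -(α * β) by ring, rMat2_neg] at h3'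
  rw [show -α - -β = β - α by ring, show -α * -β = α * β by ring] at h4'
  simp only [mul_neg, neg_mul, neg_inj] at h2' h3'
  unfold IsQuat at hS ⊢
  simp only [leg1M_mul, leg2M_mul]
  exact quat_aux h1 h2' h3' h4' c1.legs c2.str_left.legs c3.legs c4.str_right.legs hS

/-- The symmetry relation, where `α = u⁻¹`, `S = S(u)` and `S' = S(-u)`. -/
def IsSymm (α : K) (S S' : Matrix (Idx M N) (Idx M N) A) : Prop := ∀ i j,
  (2 : K) • ((-1) ^ (par i * par j) * S' j i) = (2 : K) • S i j + α • (S i j - S' i j)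

/-- Transposing T(u) S(u) Tᵗ(-u) puts an entry of T(-u) before an entry of T(u). The `RTT` relation
at v = -u restores the order, and its correction term accounts for the term (S(u) - S(-u))/(2u). -/
theorem IsSymm.conj {α : K} {T S T' S' : Matrix (Idx M N) (Idx M N) A}
    (hα : ∀ x : A, α • x = 0 → x = 0)
    (hS : IsSymm α S S') (hT : IsRTT (-α) α T' T) (c : SComm S' T) (c1 : SComm S T') :
    IsSymm α (T * S * str T') (T' * S' * str T) := by
  -- The middle factor is moved to the end, so that the entries of the two outer factors become
  -- neighbours.
  have e : ∀ X Y Z : Matrix (Idx M N) (Idx M N) A, SComm Y Z → ∀ i j, (X * Y * str Z) i j =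
      ∑ a, ∑ b, (-1) ^ (par b * par j + par b + (par a + par b) * (par j + par b)) *
        (X i a * Z j b * Y a b) := by
    intro X Y Z h i j
    rw [Matrix.mul_apply, Finset.sum_comm]
    refine Finset.sum_congr rfl fun b _ => ?_
    rw [Matrix.mul_apply, Finset.sum_mul]
    refine Finset.sum_congr rfl fun a _ => ?_
    rw [str, Matrix.of_apply, mul_assoc (X i a), ← mul_assoc (Y a b)]
    rcases neg_one_pow_eq_or A (par b * par j + par b) with h' | h' <;>
      rcases neg_one_pow_eq_or A ((par a + par b) * (par j + par b)) with h'' | h'' <;>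
      simp [pow_add, h', h'', h a b j b, mul_assoc]
  -- At v = -u the two coefficients of the relation are 2α and -α²; one factor α is cancelled.
  have rtt : ∀ i j k l, (2 : K) • ((-1) ^ (par j * (par k + par l)) * (T' i j * T k l) -
      (-1) ^ (par i * (par k + par l)) * (T k l * T' i j)) =
      (-α) • ((-1) ^ (par i * par k + par j * (par i + par l)) * (T' k j * T i l) -
      (-1) ^ (par j * par l + par i * (par k + par j)) * (T k j * T' i l)) := by
    intro i j k l
    rw [← sub_eq_zero]
    apply hα
    have := hT i j k l
    linear_combination (norm := module) this
  intro i j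
  rw [e _ _ _ c, e _ _ _ c1, e _ _ _ c]
  have key : ∀ a b, (2 : K) • ((-1) ^ (par i * par j) *
      ((-1) ^ (par b * par i + par b + (par a + par b) * (par i + par b)) *
        (T' j a * T i b * S' a b))) =
      ((-1) ^ (par a * par j + par a + (par b + par a) * (par j + par a)) *
        ((2 + α) • (T i b * T' j a * S b a) - α • (T i b * T' j a * S' b a))) +
      (-1) ^ (par b * par j + par b + (par a + par b) * (par j + par b)) *
        (α • (T i a * T' j b * S' a b) - α • (T' i a * T j b * S' a b)) := by
    intro a b
    have h1 := congrArg (· * S' a b) (rtt j a i b)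
    have h2 := congrArg (T i b * T' j a * ·) (hS b a)
    simp only [smul_mul_assoc, mul_smul_comm, sub_mul, mul_sub, mul_add] at h1 h2 ⊢
    rcases par_cases i with hi | hi <;> rcases par_cases j with hj | hj <;>
      rcases par_cases a with hk | hk <;> rcases par_cases b with hl | hl <;>
    simp only [hi, hj, hk, hl, add_zero, zero_add, mul_zero, mul_one, pow_zero, one_mul,
      Nat.reduceAdd, Nat.reduceMul, neg_mul, mul_neg, pow_succ, neg_neg] at h1 h2 ⊢ <;>
    first
      | linear_combination (norm := module) h1 + h2
      | linear_combination (norm := module) (-1 : K) • h1 + h2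
      | linear_combination (norm := module) h1 - h2
      | linear_combination (norm := module) (-1 : K) • h1 - h2
  rw [Finset.mul_sum, Finset.smul_sum]
  simp only [Finset.mul_sum, Finset.smul_sum, key, Finset.sum_add_distrib]
  -- The summation indices a and b are exchanged on one side, after which the summands match
  -- termwise.
  rw [Finset.sum_comm, ← Finset.sum_sub_distrib, Finset.smul_sum]
  simp only [← Finset.sum_sub_distrib, Finset.smul_sum, ← Finset.sum_add_distrib]
  refine Finset.sum_congr rfl fun a _ => Finset.sum_congr rfl fun b _ => ?_
  rcases neg_one_pow_eq_or A (par b * par j + par b + (par a + par b) * (par j + par b)) with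
    h | h <;> rw [h] <;> simp only [one_mul, neg_mul] <;> module

end Relations

/-! ### Series over noncommutative algebras -/

section Series

/-- Series over a commutative ring `K` act on series over a `K`-algebra. -/
instance (priority := 50) algebraSeries {K A : Type*} [CommRing K] [Ring A] [Algebra K A] :
    Algebra (PowerSeries K) (PowerSeries A) :=
  (PowerSeries.map (algebraMap K A)).toAlgebra' fun f x => by
    ext n
    simp only [coeff_mul, coeff_map]
    rw [← Finset.Nat.sum_antidiagonal_swap]
    exact Finset.sum_congr rfl fun p _ => Algebra.commutes _ _

theorem series_smul_def {K A : Type*} [CommRing K] [Ring A] [Algebra K A] (f : PowerSeries K)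
    (x : PowerSeries A) : f • x = PowerSeries.map (algebraMap K A) f * x := rfl

theorem series_algebraMap {K A : Type*} [CommRing K] [Ring A] [Algebra K A] (f : PowerSeries K) :
    algebraMap (PowerSeries K) (PowerSeries A) f = PowerSeries.map (algebraMap K A) f := rfl

variable {A : Type*} [Ring A] [Algebra ℂ A]

theorem coeff_pow_eq_zero {w : PowerSeries ℂ} (hw : constantCoeff w = 0) {n r : ℕ}
    (h : n < r) : coeff n (w ^ r) = 0 :=
  PowerSeries.coeff_of_lt_order n (lt_of_lt_of_le (by exact_mod_cast h)
    (PowerSeries.le_order_pow_of_constantCoeff_eq_zero r hw))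

/-- The cut-off in the definition may be enlarged freely, since w has no constant term; a common
cut-off is needed to compare several sums. -/
theorem coeff_substInv {w : PowerSeries ℂ} (hw : constantCoeff w = 0)
    (f : PowerSeries A) {n K : ℕ} (h : n < K) : coeff n (substInv w f) =
      ∑ r ∈ Finset.range K, coeff n (w ^ r) • coeff r f := by
  rw [substInv, coeff_mk]
  refine Finset.sum_subset (Finset.range_mono h) fun r _ hr => ?_
  rw [coeff_pow_eq_zero hw (by simpa using hr), zero_smul]

/-- The substitution `u⁻¹ ↦ w` as a homomorphism. -/
def substHom (w : PowerSeries ℂ) (hw : constantCoeff w = 0) :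
    PowerSeries A →ₐ[ℂ] PowerSeries A :=
  AlgHom.ofLinearMap
    { toFun := substInv w
      map_add' := fun f g => by
        ext n
        simp [substInv, smul_add, Finset.sum_add_distrib]
      map_smul' := fun c f => by
        ext n
        simp only [substInv, coeff_mk, PowerSeries.coeff_smul, RingHom.id_apply,
          Finset.smul_sum]
        exact Finset.sum_congr rfl fun r _ => smul_comm _ _ _ }
    (by
      ext n
      simp only [LinearMap.coe_mk, AddHom.coe_mk, substInv, coeff_mk]
      rw [Finset.sum_eq_single 0]
      · simp only [pow_zero, coeff_one]
        split_ifs <;> simp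
      · intro r _ hr
        simp [coeff_one, hr]
      · simp)
    (by
      intro f g
      ext n
      simp only [LinearMap.coe_mk, AddHom.coe_mk]
      have h1 : ∀ p ∈ Finset.HasAntidiagonal.antidiagonal n,
          coeff p.1 (substInv w f) * coeff p.2 (substInv w g) =
          ∑ a ∈ Finset.range (n + 1), ∑ b ∈ Finset.range (n + 1),
            (coeff p.1 (w ^ a) * coeff p.2 (w ^ b)) •
              (coeff a f * coeff b g) := by
        intro p hp
        rw [Finset.HasAntidiagonal.mem_antidiagonal] at hp
        rw [coeff_substInv hw f (K := n + 1) (by omega), coeff_substInv hw g (K := n + 1) (by omega),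
          Finset.sum_mul_sum]
        exact Finset.sum_congr rfl fun a _ => Finset.sum_congr rfl fun b _ => by
          rw [smul_mul_smul_comm]
      -- The bound 2n + 1 admits every sum a + b of exponents a, b ≤ n.
      rw [coeff_mul, Finset.sum_congr rfl h1, Finset.sum_comm,
        coeff_substInv hw _ (K := 2 * n + 1) (by omega)]
      have h2 : ∀ a b, ∑ p ∈ Finset.HasAntidiagonal.antidiagonal n, (coeff p.1 (w ^ a) *
          coeff p.2 (w ^ b)) • (coeff a f * coeff b g) =
          coeff n (w ^ (a + b)) • (coeff a f * coeff b g) := by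
        intro a b
        rw [← Finset.sum_smul, pow_add, coeff_mul]
      simp only [fun a => Finset.sum_comm (s := Finset.HasAntidiagonal.antidiagonal n)
        (t := Finset.range (n + 1)) (f := fun p b => (coeff p.1 (w ^ a) *
          coeff p.2 (w ^ b)) • (coeff a f * coeff b g)), h2,
        coeff_mul, Finset.smul_sum]
      rw [← Finset.sum_product', Finset.sum_sigma']
      -- Only nonzero terms have to be matched: a pair with a > n or b > n has a + b > n, and then
      -- the coefficient of wᵃ⁺ᵇ at n vanishes.
      refine Finset.sum_bij_ne_zero (fun x _ _ => x.2) ?_ ?_ ?_ ?_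
      · rintro ⟨r, a, b⟩ h1 h2
        simp only [Finset.mem_sigma, Finset.mem_range, Finset.HasAntidiagonal.mem_antidiagonal,
          Finset.mem_product] at h1 ⊢
        by_contra h3
        refine h2 ?_
        dsimp only
        rw [coeff_pow_eq_zero hw (by omega), zero_smul]
      · rintro ⟨r, a, b⟩ h1 _ ⟨r', a', b'⟩ h1' _ h
        simp only [Finset.mem_sigma, Finset.HasAntidiagonal.mem_antidiagonal] at h1 h1' h
        obtain ⟨rfl, rfl⟩ := Prod.mk.inj h
        obtain rfl : r = r' := by omega
        rfl
      · rintro ⟨a, b⟩ h1 h2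
        simp only [Finset.mem_product, Finset.mem_range] at h1
        exact ⟨⟨a + b, a, b⟩, by simp; omega, h2, rfl⟩
      · rintro ⟨r, a, b⟩ h1 _
        simp only [Finset.mem_sigma, Finset.mem_range, Finset.HasAntidiagonal.mem_antidiagonal] at h1
        rw [h1.2])

theorem substHom_apply (w : PowerSeries ℂ) (hw : constantCoeff w = 0)
    (f : PowerSeries A) : substHom w hw f = substInv w f := rfl

theorem substInv_X {w : PowerSeries ℂ} (hw : constantCoeff w = 0) :
    substInv w (PowerSeries.X : PowerSeries A) = PowerSeries.map (algebraMap ℂ A) w := by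
  ext n
  rw [coeff_substInv hw _ (K := n + 2) (by omega), Finset.sum_eq_single 1]
  · simp [Algebra.algebraMap_eq_smul_one]
  · intro b _ hb; simp [PowerSeries.coeff_X, hb]
  · simp

theorem substInv_C {w : PowerSeries ℂ} (hw : constantCoeff w = 0) (a : A) :
    substInv w (PowerSeries.C a) = PowerSeries.C a := by
  ext n
  rw [coeff_substInv hw _ (K := n + 1) (by omega), Finset.sum_eq_single 0]
  · simp [PowerSeries.coeff_C, coeff_one]
  · intro b _ hb; simp [PowerSeries.coeff_C, hb]
  · simp

theorem map_substInv {B : Type*} [Ring B] [Algebra ℂ B] (φ : A →ₐ[ℂ] B) (w : PowerSeries ℂ)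
    (f : PowerSeries A) : PowerSeries.map (φ : A →+* B) (substInv w f) =
      substInv w (PowerSeries.map (φ : A →+* B) f) := by
  ext n
  simp [substInv]

theorem constantCoeff_substInv (w : PowerSeries ℂ) (f : PowerSeries A) :
    constantCoeff (substInv w f) = constantCoeff f := by
  rw [← coeff_zero_eq_constantCoeff_apply, ← coeff_zero_eq_constantCoeff_apply]
  simp only [substInv, coeff_mk]
  simp

theorem substInv_substInv {w v : PowerSeries ℂ} (hw : constantCoeff w = 0)
    (hv : constantCoeff v = 0) (f : PowerSeries A) :
    substInv w (substInv v f) = substInv (substInv w v) f := by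
  ext n
  have hwv : constantCoeff (substInv w v) = 0 := by rw [constantCoeff_substInv, hv]
  rw [coeff_substInv hw _ (K := n + 1) (by omega), coeff_substInv hwv _ (K := n + 1) (by omega)]
  have h1 : ∀ r ∈ Finset.range (n + 1), coeff n (w ^ r) •
      coeff r (substInv v f) = ∑ s ∈ Finset.range (n + 1),
        (coeff n (w ^ r) • coeff r (v ^ s)) • coeff s f := by
    intro r hr
    rw [coeff_substInv hv f (K := n + 1) (by simpa using hr), Finset.smul_sum]
    exact Finset.sum_congr rfl fun s _ => by rw [smul_assoc]
  rw [Finset.sum_congr rfl h1, Finset.sum_comm]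
  refine Finset.sum_congr rfl fun s _ => ?_
  rw [← Finset.sum_smul, ← coeff_substInv hw _ (by omega), ← substHom_apply w hw, map_pow]
  rfl

theorem substInv_self (f : PowerSeries A) : substInv PowerSeries.X f = f := by
  ext n
  rw [coeff_substInv (by simp) _ (K := n + 1) (by omega), Finset.sum_eq_single n]
  · simp
  · intro r _ hr; simp [PowerSeries.coeff_X_pow, hr.symm]
  · simp

/-! ### Series in two variables -/

/-- `inU` as a homomorphism. -/
def inUHom : PowerSeries A →+* PowerSeries (PowerSeries A) := PowerSeries.map PowerSeries.C

/-- `inV` as a homomorphism. -/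
def inVHom : PowerSeries A →+* PowerSeries (PowerSeries A) := PowerSeries.C

theorem inUHom_apply (f : PowerSeries A) : inUHom f = inU f := rfl
theorem inVHom_apply (f : PowerSeries A) : inVHom f = inV f := rfl

theorem inU_smul (w : PowerSeries ℂ) (F : PowerSeries (PowerSeries A)) :
    inU w • F = inU (PowerSeries.map (algebraMap ℂ A) w) * F := by
  rw [series_smul_def]
  congr 1
  ext m n
  by_cases h : n = 0 <;> simp [inU, series_algebraMap, PowerSeries.coeff_C, h]

theorem inV_smul (w : PowerSeries ℂ) (F : PowerSeries (PowerSeries A)) :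
    inV w • F = inV (PowerSeries.map (algebraMap ℂ A) w) * F := by
  rw [series_smul_def, inV, inV, PowerSeries.map_C]
  rfl

/-- The substitution `v⁻¹ ↦ u⁻¹`. -/
def diagHom : PowerSeries (PowerSeries A) →+* PowerSeries A where
  toFun F := PowerSeries.mk fun n => ∑ p ∈ Finset.HasAntidiagonal.antidiagonal n,
    coeff p.2 (coeff p.1 F)
  map_zero' := by ext n; simp
  map_add' F G := by ext n; simp [Finset.sum_add_distrib]
  map_one' := by
    ext n
    rw [coeff_mk, coeff_one, Finset.sum_eq_single (0, n)]
    · simp [coeff_one]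
    · rintro ⟨a, b⟩ h1 h2
      have : a ≠ 0 := by rintro rfl; simp at h1; exact h2 (by rw [h1])
      simp [coeff_one, this]
    · simp
  map_mul' F G := by
    ext n
    simp only [coeff_mk, coeff_mul, map_sum, Finset.sum_mul_sum]
    simp only [Finset.sum_sigma']
    refine Finset.sum_nbij' (fun x => ⟨(x.2.1.1 + x.2.2.1, x.2.1.2 + x.2.2.2),
        ⟨(x.2.1.1, x.2.2.1), (x.2.1.2, x.2.2.2)⟩⟩)
      (fun x => ⟨(x.2.1.1 + x.2.2.1, x.2.1.2 + x.2.2.2),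
        ⟨(x.2.1.1, x.2.2.1), (x.2.1.2, x.2.2.2)⟩⟩) ?_ ?_ ?_ ?_ ?_
    · rintro ⟨⟨a, b⟩, ⟨⟨c, d⟩, ⟨e, f⟩⟩⟩ h
      simp only [Finset.mem_sigma, Finset.HasAntidiagonal.mem_antidiagonal] at h ⊢
      exact ⟨by omega, trivial, trivial⟩
    · rintro ⟨⟨a, b⟩, ⟨⟨c, d⟩, ⟨e, f⟩⟩⟩ h
      simp only [Finset.mem_sigma, Finset.HasAntidiagonal.mem_antidiagonal] at h ⊢
      exact ⟨by omega, trivial, trivial⟩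
    · rintro ⟨⟨a, b⟩, ⟨⟨c, d⟩, ⟨e, f⟩⟩⟩ h
      simp only [Finset.mem_sigma, Finset.HasAntidiagonal.mem_antidiagonal] at h
      obtain ⟨h1, h2, h3⟩ := h
      subst h2 h3; rfl
    · rintro ⟨⟨a, b⟩, ⟨⟨c, d⟩, ⟨e, f⟩⟩⟩ h
      simp only [Finset.mem_sigma, Finset.HasAntidiagonal.mem_antidiagonal] at h
      obtain ⟨h1, h2, h3⟩ := h
      subst h2 h3; rfl
    · rintro ⟨⟨a, b⟩, ⟨⟨c, d⟩, ⟨e, f⟩⟩⟩ h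
      rfl

theorem diagHom_inU (f : PowerSeries A) : diagHom (inU f) = f := by
  ext n
  simp only [diagHom, RingHom.coe_mk, MonoidHom.coe_mk, OneHom.coe_mk, coeff_mk, inU,
    coeff_map]
  rw [Finset.sum_eq_single (n, 0)]
  · simp
  · rintro ⟨a, b⟩ h1 h2
    have : b ≠ 0 := by rintro rfl; simp at h1; exact h2 (by rw [h1])
    simp [PowerSeries.coeff_C, this]
  · simp

theorem diagHom_inV (f : PowerSeries A) : diagHom (inV f) = f := by
  ext n
  simp only [diagHom, RingHom.coe_mk, MonoidHom.coe_mk, OneHom.coe_mk, coeff_mk, inV]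
  rw [Finset.sum_eq_single (0, n)]
  · simp
  · rintro ⟨a, b⟩ h1 h2
    have : a ≠ 0 := by rintro rfl; simp at h1; exact h2 (by rw [h1])
    simp [PowerSeries.coeff_C, this]
  · simp

/-- The exchange of `u⁻¹` and `v⁻¹`. -/
def swapHom : PowerSeries (PowerSeries A) →+* PowerSeries (PowerSeries A) where
  toFun F := PowerSeries.mk fun m => PowerSeries.mk fun n =>
    coeff m (coeff n F)
  map_zero' := by ext m n; simp
  map_add' F G := by ext m n; simp
  map_one' := by
    ext m n
    simp only [coeff_mk, coeff_one]
    split_ifs <;> simp_all [coeff_one]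
  map_mul' F G := by
    ext m n
    simp only [coeff_mk, coeff_mul, map_sum]
    rw [Finset.sum_comm]

theorem swapHom_inU (f : PowerSeries A) : swapHom (inU f) = inV f := by
  ext m n
  simp only [swapHom, RingHom.coe_mk, MonoidHom.coe_mk, OneHom.coe_mk, coeff_mk, inU,
    inV, coeff_map, PowerSeries.coeff_C]
  split_ifs <;> simp

theorem swapHom_inV (f : PowerSeries A) : swapHom (inV f) = inU f := by
  ext m n
  simp only [swapHom, RingHom.coe_mk, MonoidHom.coe_mk, OneHom.coe_mk, coeff_mk, inU,
    inV, coeff_map, PowerSeries.coeff_C]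
  split_ifs <;> simp

/-- The substitution `u⁻¹ ↦ w`, `v⁻¹ ↦ x`. -/
def subst2 (w x : PowerSeries ℂ) (hw : constantCoeff w = 0)
    (hx : constantCoeff x = 0) :
    PowerSeries (PowerSeries A) →+* PowerSeries (PowerSeries A) :=
  (PowerSeries.map ((substHom x hx : PowerSeries A →ₐ[ℂ] PowerSeries A) :
    PowerSeries A →+* PowerSeries A)).comp
    ((substHom w hw : PowerSeries (PowerSeries A) →ₐ[ℂ] PowerSeries (PowerSeries A)) :
      PowerSeries (PowerSeries A) →+* PowerSeries (PowerSeries A))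

theorem subst2_inU (w x : PowerSeries ℂ) (hw : constantCoeff w = 0)
    (hx : constantCoeff x = 0) (f : PowerSeries A) :
    subst2 w x hw hx (inU f) = inU (substInv w f) := by
  have : substInv w (inU f) = inU (substInv w f) := by
    ext m n
    simp only [substInv, inU, coeff_mk, coeff_map, map_sum,
      PowerSeries.coeff_smul, PowerSeries.coeff_C]
    split_ifs <;> simp
  simp only [subst2, RingHom.comp_apply, RingHom.coe_coe, substHom_apply, this]
  ext m n
  simp [inU, coeff_map, substHom_apply, substInv_C hx]

theorem subst2_inV (w x : PowerSeries ℂ) (hw : constantCoeff w = 0)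
    (hx : constantCoeff x = 0) (f : PowerSeries A) :
    subst2 w x hw hx (inV f) = inV (substInv x f) := by
  simp [subst2, inV, substHom_apply, substInv_C hw]

end Series

/-! ### Specialisations of the `RTT` relation to arbitrary spectral parameters -/

section Families

variable {M N : ℕ} {A : Type*} [Ring A] [Algebra ℂ A]

/-- The ring of scalars may change along with A, since only the actions of α and β occur. This
allows passing from two-variable series to one-variable series. -/
theorem IsRTT.map {K K' A B : Type*} [CommRing K] [CommRing K'] [Ring A] [Ring B] [Algebra K A]
    [Algebra K' B] (f : A →+* B) {α β : K} {α' β' : K'} (hα : ∀ x, f (α • x) = α' • f x)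
    (hβ : ∀ x, f (β • x) = β' • f x) {T T' : Matrix (Idx M N) (Idx M N) A} (h : IsRTT α β T T') :
    IsRTT α' β' (T.map f) (T'.map f) := by
  intro i j k l
  have := congrArg f (h i j k l)
  simp only [Matrix.map_apply]
  simpa only [sub_smul, mul_smul, map_sub, hα, hβ, map_mul, map_pow, map_neg, map_one] using this

/-- The series `T(u)` satisfies the `RTT` relation. -/
def IsRTTSeries (T : Matrix (Idx M N) (Idx M N) (PowerSeries A)) : Prop :=
  IsRTT (inU PowerSeries.X : PowerSeries (PowerSeries ℂ)) (inV PowerSeries.X)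
    (T.map inU) (T.map inV)

variable {T : Matrix (Idx M N) (Idx M N) (PowerSeries A)}

theorem IsRTTSeries.subst₂ (h : IsRTTSeries T) {w x : PowerSeries ℂ}
    (hw : constantCoeff w = 0) (hx : constantCoeff x = 0) :
    IsRTT (inU w : PowerSeries (PowerSeries ℂ)) (inV x)
      ((T.map (substInv w)).map inU) ((T.map (substInv x)).map inV) := by
  have := IsRTT.map (subst2 w x hw hx) (α' := inU w) (β' := inV x) ?_ ?_ h
  · convert this using 1 <;> ext i j : 2 <;> simp [subst2_inU, subst2_inV]
  · intro F
    rw [inU_smul, map_mul, subst2_inU, inU_smul, PowerSeries.map_X, substInv_X hw]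
  · intro F
    rw [inV_smul, map_mul, subst2_inV, inV_smul, PowerSeries.map_X, substInv_X hx]

theorem IsRTTSeries.swap₂ (h : IsRTTSeries T) {w x : PowerSeries ℂ}
    (hw : constantCoeff w = 0) (hx : constantCoeff x = 0) :
    IsRTT (inV w : PowerSeries (PowerSeries ℂ)) (inU x)
      ((T.map (substInv w)).map inV) ((T.map (substInv x)).map inU) := by
  have := IsRTT.map swapHom (α' := inV w) (β' := inU x) ?_ ?_ (h.subst₂ hw hx)
  · convert this using 1 <;> ext i j : 2 <;> simp [swapHom_inU, swapHom_inV]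
  · intro F
    rw [inU_smul, map_mul, swapHom_inU, inV_smul]
  · intro F
    rw [inV_smul, map_mul, swapHom_inV, inU_smul]

theorem IsRTTSeries.subst₁ (h : IsRTTSeries T) {w x : PowerSeries ℂ}
    (hw : constantCoeff w = 0) (hx : constantCoeff x = 0) :
    IsRTT w x (T.map (substInv w)) (T.map (substInv x)) := by
  have := IsRTT.map diagHom (α' := w) (β' := x) ?_ ?_ (h.subst₂ hw hx)
  · convert this using 1 <;> ext i j : 2 <;> simp [diagHom_inU, diagHom_inV]
  · intro F
    rw [inU_smul, map_mul, diagHom_inU, series_smul_def]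
  · intro F
    rw [inV_smul, map_mul, diagHom_inV, series_smul_def]

end Families

/-! ### Universal properties -/

section Components

variable {M N : ℕ} {K A : Type*} [CommRing K] [Ring A] [Algebra K A]

/-- Entries of `S_1(u) R^{t_1}(-u-v) S_2(v)`. -/
def quatL (α β : K) (S S' : Matrix (Idx M N) (Idx M N) A) (i k j l : Idx M N) : A :=
  (-(α + β)) • ((-1) ^ (par j * (par k + par l)) * (S i j * S' k l)) -
    (α * β) • ((-1) ^ (par j * par l) * (S i k * S' j l))

/-- Entries of `S_2(v) R^{t_2}(-u-v) S_1(u)`. -/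
def quatR (α β : K) (S S' : Matrix (Idx M N) (Idx M N) A) (i k j l : Idx M N) : A :=
  (-(α + β)) • ((-1) ^ (par i * (par k + par l)) * (S' k l * S i j)) -
    (α * β) • ((-1) ^ (par i * par k) * (S' k i * S l j))

theorem leg1M_mul_rMat1_mul_leg2M (α β : K) (S S' : Matrix (Idx M N) (Idx M N) A)
    (i k j l : Idx M N) : (leg1M S * rMat1 M N A (-(α + β)) (α * β) * leg2M S') (i, k) (j, l) =
      quatL α β S S' i k j l := by
  simp only [rMat1, mul_sub, sub_mul, mul_smul_comm, smul_mul_assoc, mul_one, Matrix.sub_apply,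
    Matrix.smul_apply, leg1M_mul_contr1M_mul_leg2M, leg1M_mul_leg2M, quatL]

theorem leg2M_mul_rMat2_mul_leg1M (α β : K) (S S' : Matrix (Idx M N) (Idx M N) A)
    (i k j l : Idx M N) : (leg2M S' * rMat2 M N A (-(α + β)) (α * β) * leg1M S) (i, k) (j, l) =
      quatR α β S S' i k j l := by
  simp only [rMat2, mul_sub, sub_mul, mul_smul_comm, smul_mul_assoc, mul_one, Matrix.sub_apply,
    Matrix.smul_apply, leg2M_mul_contr2M_mul_leg1M, leg2M_mul_leg1M, quatR]

theorem isQuat_iff {α β : K} {S S' : Matrix (Idx M N) (Idx M N) A} : IsQuat α β S S' ↔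
    ∀ i k j l, (β - α) • quatL α β S S' i k j l -
        (α * β) • ((-1) ^ (par i * par k) * quatL α β S S' k i j l) =
      (β - α) • quatR α β S S' i k j l -
        (α * β) • ((-1) ^ (par j * par l) * quatR α β S S' i k l j) := by
  have h : ∀ i k j l, (rMat M N A (β - α) (α * β) * leg1M S * rMat1 M N A (-(α + β)) (α * β) *
      leg2M S') (i, k) (j, l) = (β - α) • quatL α β S S' i k j l -
        (α * β) • ((-1) ^ (par i * par k) * quatL α β S S' k i j l) := by
    intro i k j l
    rw [mul_assoc, mul_assoc, rMat_mul_apply, ← mul_assoc, leg1M_mul_rMat1_mul_leg2M,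
      leg1M_mul_rMat1_mul_leg2M]
  have h' : ∀ i k j l, (leg2M S' * rMat2 M N A (-(α + β)) (α * β) * leg1M S *
      rMat M N A (β - α) (α * β)) (i, k) (j, l) = (β - α) • quatR α β S S' i k j l -
        (α * β) • ((-1) ^ (par j * par l) * quatR α β S S' i k l j) := by
    intro i k j l
    rw [mul_rMat_apply, leg2M_mul_rMat2_mul_leg1M, leg2M_mul_rMat2_mul_leg1M]
  constructor
  · intro hq i k j l
    rw [← h, ← h', hq]
  · intro hq
    unfold IsQuat
    ext ⟨i, k⟩ ⟨j, l⟩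
    rw [h, h', hq]

end Components

/-! ### The defining relations in terms of ordinary matrices -/

section Series

variable {M N : ℕ} {A B : Type*} [Ring A] [Algebra ℂ A] [Ring B] [Algebra ℂ B]

theorem std_map (φ : A →+* B) (X : Mat1 M N A) : std (fun i j => φ (X i j)) = (std X).map φ := by
  ext i j; simp [std]

theorem unstd_map (φ : A →+* B) (X : Matrix (Idx M N) (Idx M N) A) :
    unstd (X.map φ) = fun i j => φ (unstd X i j) := by
  funext i j; simp [unstd]

theorem inUHom_coe (X : Mat1 M N (PowerSeries A)) :
    std (fun i j => inU (X i j)) = (std X).map inU := by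
  ext i j : 2
  simp only [std, Matrix.map_apply, Matrix.of_apply, ← inUHom_apply, map_mul, map_pow, map_neg, map_one]

theorem inVHom_coe (X : Mat1 M N (PowerSeries A)) :
    std (fun i j => inV (X i j)) = (std X).map inV := by
  ext i j : 2
  simp only [std, Matrix.map_apply, Matrix.of_apply, ← inVHom_apply, map_mul, map_pow, map_neg, map_one]

theorem std2_rMinus : std2 (rMinus : Mat2 M N (PowerSeries (PowerSeries A))) =
    rMat M N _ (inV PowerSeries.X - inU PowerSeries.X : PowerSeries (PowerSeries ℂ))
      (inU PowerSeries.X * inV PowerSeries.X) := by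
  have h1 := std2_one2 (M := M) (N := N) (A := PowerSeries (PowerSeries A))
  have h2 := std2_permP (M := M) (N := N) (A := PowerSeries (PowerSeries A))
  ext a b
  have h1' := congrFun (congrFun h1 a) b
  have h2' := congrFun (congrFun h2 a) b
  rw [rMat, Matrix.sub_apply, Matrix.smul_apply, Matrix.smul_apply, ← h1', ← h2', sub_smul, mul_smul]
  simp only [inU_smul, inV_smul, PowerSeries.map_X, std2, Matrix.of_apply, rMinus]
  generalize (par a.1 + par a.2) * (par b.1 + par b.2) + (par b.1 + par b.2) +
    (par a.1 + par b.1) * par a.2 = e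
  rcases neg_one_pow_eq_or (PowerSeries (PowerSeries A)) e with h | h <;> rw [h] <;> noncomm_ring

theorem std2_transp1_rPlus : std2 (transp1 (rPlus : Mat2 M N (PowerSeries (PowerSeries A)))) =
    rMat1 M N _ (-(inU PowerSeries.X + inV PowerSeries.X) : PowerSeries (PowerSeries ℂ))
      (inU PowerSeries.X * inV PowerSeries.X) := by
  have h1 := std2_transp1_one2 (M := M) (N := N) (A := PowerSeries (PowerSeries A))
  have h2 := std2_transp1_permP (M := M) (N := N) (A := PowerSeries (PowerSeries A))
  ext a b
  have h1' := congrFun (congrFun h1 a) b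
  have h2' := congrFun (congrFun h2 a) b
  rw [rMat1, Matrix.sub_apply, Matrix.smul_apply, Matrix.smul_apply, ← h1', ← h2', neg_smul,
    add_smul, mul_smul]
  simp only [inU_smul, inV_smul, PowerSeries.map_X, std2, Matrix.of_apply, rPlus, transp1]
  generalize (par a.1 + par a.2) * (par b.1 + par b.2) + (par b.1 + par b.2) +
    (par a.1 + par b.1) * par a.2 = e
  generalize par a.1 * par b.1 + par b.1 = e'
  generalize inU (PowerSeries.X : PowerSeries A) = x
  generalize inV (PowerSeries.X : PowerSeries A) = y
  generalize (one2 : Mat2 M N (PowerSeries (PowerSeries A))) _ _ _ _ = o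
  generalize (permP : Mat2 M N (PowerSeries (PowerSeries A))) _ _ _ _ = p
  rcases neg_one_pow_eq_or (PowerSeries (PowerSeries A)) e with h | h <;>
    rcases neg_one_pow_eq_or (PowerSeries (PowerSeries A)) e' with h' | h' <;>
    rw [h, h'] <;> simp only [one_mul, neg_mul, mul_neg, neg_neg, mul_sub, add_mul,
      mul_assoc] <;> abel_nf

theorem std2_transp2_rPlus : std2 (transp2 (rPlus : Mat2 M N (PowerSeries (PowerSeries A)))) =
    rMat2 M N _ (-(inU PowerSeries.X + inV PowerSeries.X) : PowerSeries (PowerSeries ℂ))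
      (inU PowerSeries.X * inV PowerSeries.X) := by
  have h1 := std2_transp2_one2 (M := M) (N := N) (A := PowerSeries (PowerSeries A))
  have h2 := std2_transp2_permP (M := M) (N := N) (A := PowerSeries (PowerSeries A))
  ext a b
  have h1' := congrFun (congrFun h1 a) b
  have h2' := congrFun (congrFun h2 a) b
  rw [rMat2, Matrix.sub_apply, Matrix.smul_apply, Matrix.smul_apply, ← h1', ← h2', neg_smul,
    add_smul, mul_smul]
  simp only [inU_smul, inV_smul, PowerSeries.map_X, std2, Matrix.of_apply, rPlus, transp2]
  generalize (par a.1 + par a.2) * (par b.1 + par b.2) + (par b.1 + par b.2) +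
    (par a.1 + par b.1) * par a.2 = e
  generalize par a.2 * par b.2 + par b.2 = e'
  generalize inU (PowerSeries.X : PowerSeries A) = x
  generalize inV (PowerSeries.X : PowerSeries A) = y
  generalize (one2 : Mat2 M N (PowerSeries (PowerSeries A))) _ _ _ _ = o
  generalize (permP : Mat2 M N (PowerSeries (PowerSeries A))) _ _ _ _ = p
  rcases neg_one_pow_eq_or (PowerSeries (PowerSeries A)) e with h | h <;>
    rcases neg_one_pow_eq_or (PowerSeries (PowerSeries A)) e' with h' | h' <;>
    rw [h, h'] <;> simp only [one_mul, neg_mul, mul_neg, neg_neg, mul_sub, add_mul,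
      mul_assoc] <;> abel_nf

theorem rtt_iff (X : Mat1 M N (PowerSeries A)) :
    rttLeft X = rttRight X ↔ IsRTTSeries (std X) := by
  rw [← std2_injective.eq_iff, IsRTTSeries, isRTT_iff, rttLeft, rttRight]
  simp only [std2_mul2, std2_leg1, std2_leg2, std2_rMinus, inUHom_coe, inVHom_coe]

/-- The quaternary and symmetry relations for a series `S(u)`. -/
structure IsTwSeries (S : Matrix (Idx M N) (Idx M N) (PowerSeries A)) : Prop where
  quat : IsQuat (inU PowerSeries.X : PowerSeries (PowerSeries ℂ)) (inV PowerSeries.X)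
    (S.map inU) (S.map inV)
  symm : IsSymm (PowerSeries.X : PowerSeries ℂ) S (S.map negArg)

theorem quat_iff (X : Mat1 M N (PowerSeries A)) : quatLeft X = quatRight X ↔
    IsQuat (inU PowerSeries.X : PowerSeries (PowerSeries ℂ)) (inV PowerSeries.X)
      ((std X).map inU) ((std X).map inV) := by
  rw [← std2_injective.eq_iff, IsQuat, quatLeft, quatRight]
  simp only [std2_mul2, std2_leg1, std2_leg2, std2_rMinus, std2_transp1_rPlus, std2_transp2_rPlus,
    inUHom_coe, inVHom_coe]

/-- `f(u) ↦ f(-u)` as a homomorphism. -/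
def negHom : PowerSeries A →ₐ[ℂ] PowerSeries A := substHom (-PowerSeries.X) (by simp)

theorem negHom_apply (f : PowerSeries A) : negHom f = negArg f := rfl

theorem negArg_neg_one_pow_mul (n : ℕ) (f : PowerSeries A) :
    negArg ((-1) ^ n * f) = (-1) ^ n * negArg f := by
  rw [← negHom_apply, map_mul, map_pow, map_neg, map_one, negHom_apply]

theorem series_X_smul (f : PowerSeries A) :
    (PowerSeries.X : PowerSeries ℂ) • f = PowerSeries.X * f := by
  rw [series_smul_def, PowerSeries.map_X]

theorem series_ofNat_smul (f : PowerSeries A) : (2 : PowerSeries ℂ) • f = f + f := by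
  rw [two_smul]

theorem symm_iff (X : Mat1 M N (PowerSeries A)) : symmLeft X = symmRight X ↔
    IsSymm (PowerSeries.X : PowerSeries ℂ) (std X) ((std X).map negArg) := by
  have key : ∀ i j, (-1) ^ (par i * par j + par j) * (symmLeft X i j) =
      (-1) ^ (par i * par j) * ((std X).map negArg) j i := by
    intro i j
    simp only [symmLeft, transp, std, Matrix.map_apply, Matrix.of_apply, negArg_neg_one_pow_mul,
      ← mul_assoc, ← pow_add]
    congr 1
    rcases par_cases i with hi | hi <;> rcases par_cases j with hj | hj <;> simp [hi, hj, pow_succ]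
  have key' : ∀ i j, (2 : PowerSeries ℂ) • ((-1) ^ (par i * par j + par j) * (symmRight X i j)) =
      (2 : PowerSeries ℂ) • std X i j +
        (PowerSeries.X : PowerSeries ℂ) • (std X i j - ((std X).map negArg) i j) := by
    intro i j
    simp only [symmRight, std, Matrix.map_apply, Matrix.of_apply, negArg_neg_one_pow_mul,
      series_X_smul, series_ofNat_smul]
    have h2 : ∀ y : PowerSeries A, (1 / 2 : ℂ) • y + (1 / 2 : ℂ) • y = y := by
      intro y; rw [← add_smul]; norm_num
    rcases neg_one_pow_eq_or (PowerSeries A) (par i * par j + par j) with h | h <;> rw [h]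
    · nth_rewrite 3 [← h2 (PowerSeries.X * _)]
      simp only [one_mul]; abel
    · simp only [neg_mul, one_mul]
      rw [show -X i j - -negArg (X i j) = -(X i j - negArg (X i j)) by abel, mul_neg]
      nth_rewrite 3 [← h2 (PowerSeries.X * _)]
      abel
  have two : ∀ x y : PowerSeries A, (2 : PowerSeries ℂ) • x = (2 : PowerSeries ℂ) • y → x = y := by
    intro x y h
    have h3 : ∀ z : PowerSeries A, (1 / 2 : ℂ) • ((2 : PowerSeries ℂ) • z) = z := by
      intro z; rw [series_ofNat_smul, ← two_smul ℂ, smul_smul]; norm_num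
    rw [← h3 x, h, h3]
  constructor
  · intro h i j
    rw [← key', ← key, h]
  · intro h
    funext i j
    have := h i j
    rw [← key', ← key] at this
    rw [← neg_one_pow_mul_self (par i * par j + par j) (symmLeft X i j), two _ _ this,
      neg_one_pow_mul_self]

theorem isTwSeries_iff (X : Mat1 M N (PowerSeries A)) : IsTwSeries (std X) ↔
    quatLeft X = quatRight X ∧ symmLeft X = symmRight X := by
  rw [quat_iff, symm_iff]
  exact ⟨fun h => ⟨h.1, h.2⟩, fun h => ⟨h.1, h.2⟩⟩

end Series

/-! ### Compatibility of the relations with homomorphisms of the coefficients -/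

section Naturality

variable {M N : ℕ} {A B : Type*} [Ring A] [Algebra ℂ A] [Ring B] [Algebra ℂ B]

theorem map_map_inU (φ : A →+* B) (f : PowerSeries A) :
    PowerSeries.map (PowerSeries.map φ) (inU f) = inU (PowerSeries.map φ f) := by
  ext m n
  simp only [inU, coeff_map, PowerSeries.coeff_C]
  split_ifs <;> simp

theorem map_map_inV (φ : A →+* B) (f : PowerSeries A) :
    PowerSeries.map (PowerSeries.map φ) (inV f) = inV (PowerSeries.map φ f) := by
  simp [inV]

theorem map_mul2 (φ : A →+* B) (X Y : Mat2 M N A) :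
    (fun i j k l => φ (mul2 X Y i j k l)) =
      mul2 (fun i j k l => φ (X i j k l)) (fun i j k l => φ (Y i j k l)) := by
  funext i j k l
  simp [mul2]

theorem map_rMinus (φ : A →+* B) : (fun i j k l => PowerSeries.map (PowerSeries.map φ)
    ((rMinus : Mat2 M N (PowerSeries (PowerSeries A))) i j k l)) = rMinus := by
  funext i j k l
  simp only [rMinus, one2, permP, map_sub, map_mul, map_map_inU, map_map_inV, PowerSeries.map_X]
  split_ifs <;> simp

theorem map_rPlus (φ : A →+* B) : (fun i j k l => PowerSeries.map (PowerSeries.map φ)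
    ((rPlus : Mat2 M N (PowerSeries (PowerSeries A))) i j k l)) = rPlus := by
  funext i j k l
  simp only [rPlus, one2, permP, map_sub, map_mul, map_add, map_neg, map_map_inU, map_map_inV,
    PowerSeries.map_X]
  split_ifs <;> simp

theorem map_leg1 (φ : A →+* B) (X : Mat1 M N A) :
    (fun i j k l => φ (leg1 X i j k l)) = leg1 (fun i j => φ (X i j)) := by
  funext i j k l
  simp only [leg1]; split_ifs <;> simp

theorem map_leg2 (φ : A →+* B) (X : Mat1 M N A) :
    (fun i j k l => φ (leg2 X i j k l)) = leg2 (fun i j => φ (X i j)) := by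
  funext i j k l
  simp only [leg2]; split_ifs <;> simp

theorem map_transp1 (φ : A →+* B) (X : Mat2 M N A) :
    (fun i j k l => φ (transp1 X i j k l)) = transp1 (fun i j k l => φ (X i j k l)) := by
  funext i j k l
  simp [transp1]

theorem map_transp2 (φ : A →+* B) (X : Mat2 M N A) :
    (fun i j k l => φ (transp2 X i j k l)) = transp2 (fun i j k l => φ (X i j k l)) := by
  funext i j k l
  simp [transp2]

theorem map_rttLeft (φ : A →+* B) (X : Mat1 M N (PowerSeries A)) :
    (fun i j k l => PowerSeries.map (PowerSeries.map φ) (rttLeft X i j k l)) =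
      rttLeft fun i j => PowerSeries.map φ (X i j) := by
  simp only [rttLeft, map_mul2, map_leg1, map_leg2, map_rMinus, map_map_inU, map_map_inV]

theorem map_rttRight (φ : A →+* B) (X : Mat1 M N (PowerSeries A)) :
    (fun i j k l => PowerSeries.map (PowerSeries.map φ) (rttRight X i j k l)) =
      rttRight fun i j => PowerSeries.map φ (X i j) := by
  simp only [rttRight, map_mul2, map_leg1, map_leg2, map_rMinus, map_map_inU, map_map_inV]

theorem map_quatLeft (φ : A →+* B) (X : Mat1 M N (PowerSeries A)) :
    (fun i j k l => PowerSeries.map (PowerSeries.map φ) (quatLeft X i j k l)) =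
      quatLeft fun i j => PowerSeries.map φ (X i j) := by
  simp only [quatLeft, map_mul2, map_leg1, map_leg2, map_rMinus, map_transp1, map_rPlus,
    map_map_inU, map_map_inV]

theorem map_quatRight (φ : A →+* B) (X : Mat1 M N (PowerSeries A)) :
    (fun i j k l => PowerSeries.map (PowerSeries.map φ) (quatRight X i j k l)) =
      quatRight fun i j => PowerSeries.map φ (X i j) := by
  simp only [quatRight, map_mul2, map_leg1, map_leg2, map_rMinus, map_transp2, map_rPlus,
    map_map_inU, map_map_inV]

theorem map_negArg (φ : A →ₐ[ℂ] B) (f : PowerSeries A) :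
    PowerSeries.map (φ : A →+* B) (negArg f) = negArg (PowerSeries.map (φ : A →+* B) f) :=
  map_substInv _ _ _

theorem map_symmLeft (φ : A →ₐ[ℂ] B) (X : Mat1 M N (PowerSeries A)) :
    (fun i j => PowerSeries.map (φ : A →+* B) (symmLeft X i j)) =
      symmLeft fun i j => PowerSeries.map (φ : A →+* B) (X i j) := by
  funext i j
  simp only [symmLeft, transp, map_mul, map_pow, map_neg, map_one, map_negArg]

theorem series_map_smul (φ : A →ₐ[ℂ] B) (c : ℂ) (f : PowerSeries A) :
    PowerSeries.map (φ : A →+* B) (c • f) = c • PowerSeries.map (φ : A →+* B) f := by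
  ext n; simp

theorem map_symmRight (φ : A →ₐ[ℂ] B) (X : Mat1 M N (PowerSeries A)) :
    (fun i j => PowerSeries.map (φ : A →+* B) (symmRight X i j)) =
      symmRight fun i j => PowerSeries.map (φ : A →+* B) (X i j) := by
  funext i j
  simp only [symmRight, map_add, series_map_smul, map_mul, map_sub, PowerSeries.map_X, map_negArg]

theorem IsRTTSeries.map (φ : A →ₐ[ℂ] B) {T : Matrix (Idx M N) (Idx M N) (PowerSeries A)}
    (h : IsRTTSeries T) : IsRTTSeries (T.map (PowerSeries.map (φ : A →+* B))) := by
  rw [← std_unstd T, ← rtt_iff] at h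
  rw [← std_unstd T, ← std_map, ← rtt_iff, ← map_rttLeft, h, map_rttRight]

theorem IsTwSeries.map (φ : A →ₐ[ℂ] B) {S : Matrix (Idx M N) (Idx M N) (PowerSeries A)}
    (h : IsTwSeries S) : IsTwSeries (S.map (PowerSeries.map (φ : A →+* B))) := by
  rw [← std_unstd S, isTwSeries_iff] at h
  rw [← std_unstd S, ← std_map, isTwSeries_iff, ← map_quatLeft, h.1, map_quatRight,
    ← map_symmLeft, h.2, map_symmRight]
  exact ⟨rfl, rfl⟩

end Naturality

/-! ### Homomorphisms out of Y^{tw} and Y(gl) -/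

section Lift

variable {M N : ℕ} {A : Type*} [Ring A] [Algebra ℂ A] {G : Matrix (Idx M N) (Idx M N) ℂ}

/-- The homomorphism from the free algebra that sends the generator series to `X`. -/
def freeLift (X : Mat1 M N (PowerSeries A)) : FreeAlgebra ℂ (Gen M N) →ₐ[ℂ] A :=
  FreeAlgebra.lift ℂ fun g => coeff (g.2.2 + 1) (X g.1 g.2.1)

theorem map_freeLift {X : Mat1 M N (PowerSeries A)}
    (h : ∀ i j, constantCoeff (X i j) = algebraMap ℂ A (G i j)) (i j : Idx M N) :
    PowerSeries.map (freeLift X : FreeAlgebra ℂ (Gen M N) →+* A) (freeSeries G i j) = X i j := by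
  ext n
  rw [coeff_map, freeSeries, coeff_mk]
  cases n with
  | zero => simp [h]
  | succ n => simp [freeLift]

/-- The series `S(u)` in the form in which the product of `End V ⊗ A` is the product of matrices. -/
def sStd (G : Matrix (Idx M N) (Idx M N) ℂ) : Matrix (Idx M N) (Idx M N) (PowerSeries (YTw G)) :=
  std (sSeries G)

variable (M N) in
/-- The series `T(u)` in the form in which the product of `End V ⊗ A` is the product of
matrices. -/
def tStd : Matrix (Idx M N) (Idx M N) (PowerSeries (YGl M N)) := std (tSeries M N)

theorem isRTTSeries_tStd : IsRTTSeries (tStd M N) := by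
  rw [tStd, ← rtt_iff]
  have h1 := map_rttLeft (RingQuot.mkAlgHom ℂ (GlRel M N)).toRingHom (freeSeries (1 : Matrix _ _ ℂ))
  have h2 := map_rttRight (RingQuot.mkAlgHom ℂ (GlRel M N)).toRingHom
    (freeSeries (1 : Matrix _ _ ℂ))
  rw [show tSeries M N = fun i j => PowerSeries.map (RingQuot.mkAlgHom ℂ (GlRel M N)).toRingHom
    (freeSeries 1 i j) from rfl, ← h1, ← h2]
  funext i j k l
  ext m n
  simp only [coeff_map]
  exact RingQuot.mkAlgHom_rel ℂ (GlRel.rtt i j k l m n)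

theorem isTwSeries_sStd : IsTwSeries (sStd G) := by
  rw [sStd, isTwSeries_iff]
  have h1 := map_quatLeft (RingQuot.mkAlgHom ℂ (TwRel G)).toRingHom (freeSeries G)
  have h2 := map_quatRight (RingQuot.mkAlgHom ℂ (TwRel G)).toRingHom (freeSeries G)
  have h3 := map_symmLeft (RingQuot.mkAlgHom ℂ (TwRel G)) (freeSeries G)
  have h4 := map_symmRight (RingQuot.mkAlgHom ℂ (TwRel G)) (freeSeries G)
  constructor
  · rw [show sSeries G = fun i j => PowerSeries.map (RingQuot.mkAlgHom ℂ (TwRel G)).toRingHom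
      (freeSeries G i j) from rfl, ← h1, ← h2]
    funext i j k l
    ext m n
    simp only [coeff_map]
    exact RingQuot.mkAlgHom_rel ℂ (TwRel.quat i j k l m n)
  · refine (h3.symm.trans ?_).trans h4
    funext i j
    ext n
    simp only [coeff_map]
    exact RingQuot.mkAlgHom_rel ℂ (TwRel.symm i j n)

theorem constantCoeff_tSeries (i j : Idx M N) :
    constantCoeff (tSeries M N i j) = algebraMap ℂ _ ((1 : Matrix _ _ ℂ) i j) := by
  rw [← coeff_zero_eq_constantCoeff_apply, tSeries, coeff_map, freeSeries,
    coeff_mk]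
  exact AlgHom.commutes _ _

theorem constantCoeff_sSeries (i j : Idx M N) :
    constantCoeff (sSeries G i j) = algebraMap ℂ _ (G i j) := by
  rw [← coeff_zero_eq_constantCoeff_apply, sSeries, coeff_map, freeSeries,
    coeff_mk]
  exact AlgHom.commutes _ _

theorem ytw_hom_ext {φ ψ : YTw G →ₐ[ℂ] A} (h : ∀ i j,
    PowerSeries.map (φ : YTw G →+* A) (sStd G i j) =
      PowerSeries.map (ψ : YTw G →+* A) (sStd G i j)) : φ = ψ := by
  refine RingQuot.ringQuot_ext' _ _ _ (FreeAlgebra.hom_ext (funext fun g => ?_))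
  obtain ⟨i, j, r⟩ := g
  have h' : PowerSeries.map (φ : YTw G →+* A) (sSeries G i j) =
      PowerSeries.map (ψ : YTw G →+* A) (sSeries G i j) := by
    rw [← unstd_std (sSeries G)]
    simp only [unstd, map_mul, map_pow, map_neg, map_one]
    congr 1
    exact h i j
  have := congrArg (coeff (r + 1)) h'
  rw [coeff_map, coeff_map, sSeries, coeff_map, freeSeries,
    coeff_mk] at this
  exact this

theorem exists_ytw_hom (S : Matrix (Idx M N) (Idx M N) (PowerSeries A)) (h : IsTwSeries S)
    (h0 : ∀ i j, constantCoeff (unstd S i j) = algebraMap ℂ A (G i j)) :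
    ∃ φ : YTw G →ₐ[ℂ] A, (sStd G).map (PowerSeries.map (φ : YTw G →+* A)) = S := by
  have hf := map_freeLift h0
  rw [← std_unstd S, isTwSeries_iff] at h
  refine ⟨RingQuot.liftAlgHom ℂ ⟨freeLift (unstd S), ?_⟩, ?_⟩
  · rintro x y (⟨i, j, k, l, m, n⟩ | ⟨i, j, n⟩)
    · have h1 := map_quatLeft (freeLift (unstd S) : FreeAlgebra ℂ (Gen M N) →+* A) (freeSeries G)
      have h2 := map_quatRight (freeLift (unstd S) : FreeAlgebra ℂ (Gen M N) →+* A) (freeSeries G)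
      simp only [hf] at h1 h2
      have := (h1.trans h.1).trans h2.symm
      have := congrFun (congrFun (congrFun (congrFun this i) j) k) l
      simpa using congrArg (coeff n) (congrArg (coeff m) this)
    · have h1 := map_symmLeft (freeLift (unstd S)) (freeSeries G)
      have h2 := map_symmRight (freeLift (unstd S)) (freeSeries G)
      simp only [hf] at h1 h2
      have := (h1.trans h.2).trans h2.symm
      have := congrFun (congrFun this i) j
      simpa using congrArg (coeff n) this
  · rw [sStd, ← std_map]
    refine Eq.trans ?_ (std_unstd S)
    congr 1
    funext i j
    rw [← hf]
    ext n
    simp only [sSeries, coeff_map]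
    exact RingQuot.liftAlgHom_mkAlgHom_apply _ _ _ _

theorem exists_ygl_hom (T : Matrix (Idx M N) (Idx M N) (PowerSeries A)) (h : IsRTTSeries T)
    (h0 : ∀ i j, constantCoeff (unstd T i j) =
      algebraMap ℂ A ((1 : Matrix _ _ ℂ) i j)) :
    ∃ φ : YGl M N →ₐ[ℂ] A, (tStd M N).map (PowerSeries.map (φ : YGl M N →+* A)) = T := by
  have hf := map_freeLift h0
  rw [← std_unstd T, ← rtt_iff] at h
  refine ⟨RingQuot.liftAlgHom ℂ ⟨freeLift (unstd T), ?_⟩, ?_⟩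
  · rintro x y ⟨i, j, k, l, m, n⟩
    have h1 := map_rttLeft (freeLift (unstd T) : FreeAlgebra ℂ (Gen M N) →+* A)
      (freeSeries (1 : Matrix _ _ ℂ))
    have h2 := map_rttRight (freeLift (unstd T) : FreeAlgebra ℂ (Gen M N) →+* A)
      (freeSeries (1 : Matrix _ _ ℂ))
    simp only [hf] at h1 h2
    have := (h1.trans h).trans h2.symm
    have := congrFun (congrFun (congrFun (congrFun this i) j) k) l
    simpa using congrArg (coeff n) (congrArg (coeff m) this)
  · rw [tStd, ← std_map]
    refine Eq.trans ?_ (std_unstd T)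
    congr 1
    funext i j
    rw [← hf]
    ext n
    simp only [tSeries, coeff_map]
    exact RingQuot.liftAlgHom_mkAlgHom_apply _ _ _ _

end Lift

/-! ### Constructions of solutions of the relations -/

section Conj

variable {M N : ℕ} {A B : Type*} [Ring A] [Algebra ℂ A] [Ring B] [Algebra ℂ B]

theorem str_map (φ : A →+* B) (X : Matrix (Idx M N) (Idx M N) A) :
    str (X.map φ) = (str X).map φ := by
  ext i j; simp [str]

/-- The coefficients of the series in `T` supercommute with those of the series in `S`. -/
def SCommSeries (T S : Matrix (Idx M N) (Idx M N) (PowerSeries A)) : Prop :=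
  ∀ m n, SComm (T.map (coeff m)) (S.map (coeff n))

variable {T S : Matrix (Idx M N) (Idx M N) (PowerSeries A)}

theorem SCommSeries.symm (h : SCommSeries T S) : SCommSeries S T := fun m n => (h n m).symm

theorem coeff_neg_one_pow_mul (e m : ℕ) (f : PowerSeries A) :
    coeff m ((-1) ^ e * f) = (-1) ^ e * coeff m f := by
  rcases neg_one_pow_eq_or (PowerSeries A) e with h | h <;>
    rcases neg_one_pow_eq_or A e with h' | h' <;>
    rcases Nat.even_or_odd e with h'' | h'' <;> simp [h'', Odd.neg_one_pow]

theorem SCommSeries.subst_left (h : SCommSeries T S) (w : PowerSeries ℂ) :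
    SCommSeries (T.map (substInv w)) S := by
  intro m n i j k l
  simp only [Matrix.map_apply, substInv, coeff_mk, Finset.sum_mul, Finset.mul_sum]
  refine Finset.sum_congr rfl fun r _ => ?_
  have := h r n i j k l
  simp only [Matrix.map_apply] at this
  rw [smul_mul_assoc, this]
  simp

theorem SCommSeries.subst_right (h : SCommSeries T S) (w : PowerSeries ℂ) :
    SCommSeries T (S.map (substInv w)) := (h.symm.subst_left w).symm

theorem SCommSeries.inU_inV (h : SCommSeries T S) : SComm (T.map inU) (S.map inV) := by
  intro i j k l
  ext m n
  have := h m n i j k l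
  simp only [Matrix.map_apply] at this ⊢
  rw [coeff_neg_one_pow_mul, coeff_neg_one_pow_mul]
  simpa [inU, inV] using this

theorem SCommSeries.same (h : SCommSeries T S) : SComm T S := by
  intro i j k l
  ext n
  rw [coeff_neg_one_pow_mul, coeff_mul, coeff_mul,
    ← Finset.Nat.sum_antidiagonal_swap, Finset.mul_sum]
  exact Finset.sum_congr rfl fun p _ => h p.2 p.1 i j k l

theorem negArg_negArg (f : PowerSeries A) : negArg (negArg f) = f := by
  rw [negArg, negArg, substInv_substInv (by simp) (by simp)]
  convert substInv_self f using 2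
  have h := map_neg (negHom (A := ℂ)) PowerSeries.X
  rw [negHom_apply, negHom_apply] at h
  change negArg (-PowerSeries.X) = _
  rw [h, negArg, substInv_X (by simp)]
  simp

theorem map_substInv_X (T : Matrix (Idx M N) (Idx M N) (PowerSeries A)) :
    T.map (substInv PowerSeries.X) = T := by
  ext i j : 2
  simp [substInv_self]

/-- All instances of the `RTT` relation required by `IsQuat.conj` and `IsSymm.conj` come from one
relation by u, v ↦ ±u, ±v, exchanging the variables, or setting v = u. -/
theorem IsTwSeries.conj (hT : IsRTTSeries T) (hS : IsTwSeries S) (h : SCommSeries T S) :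
    IsTwSeries (T * S * str (T.map negArg)) := by
  have hX : constantCoeff (PowerSeries.X : PowerSeries ℂ) = 0 := by simp
  have hX' : constantCoeff (-PowerSeries.X : PowerSeries ℂ) = 0 := by simp
  have eU : inU (-PowerSeries.X : PowerSeries ℂ) = -inU PowerSeries.X := map_neg inUHom _
  have eV : inV (-PowerSeries.X : PowerSeries ℂ) = -inV PowerSeries.X := map_neg inVHom _
  constructor
  · have h1 := hT
    have h2 := hT.subst₂ hX' hX
    have h3 := hT.swap₂ hX' hX
    have h4 := hT.swap₂ hX' hX'
    rw [eU, map_substInv_X] at h2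
    rw [eV, map_substInv_X] at h3
    rw [eV, eU] at h4
    have := IsQuat.conj hS.quat h1 h2 h3 h4 h.symm.inU_inV (h.subst_left _).inU_inV h.inU_inV
      (h.subst_left _).symm.inU_inV
    convert this using 1
    · change (T * S * str (T.map negArg)).map inUHom = _
      rw [Matrix.map_mul, Matrix.map_mul, ← str_map]
      rfl
    · change (T * S * str (T.map negArg)).map inVHom = _
      rw [Matrix.map_mul, Matrix.map_mul, ← str_map]
      rfl
  · have h1 := hT.subst₁ hX' hX
    rw [map_substInv_X] at h1
    have := IsSymm.conj (K := PowerSeries ℂ) (fun x hx => ?_) hS.symm h1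
      (h.subst_right _).same.symm (h.subst_left _).same.symm
    · have e : (T * S * str (T.map negArg)).map negArg =
          T.map negArg * S.map negArg * str T := by
        change (T * S * str (T.map negArg)).map ((negHom : PowerSeries A →ₐ[ℂ] PowerSeries A) :
          PowerSeries A →+* PowerSeries A) = _
        rw [Matrix.map_mul, Matrix.map_mul, ← str_map]
        congr 2
        ext i j : 2
        simp [negHom_apply, negArg_negArg]
      rw [e]
      exact this
    · rw [series_X_smul] at hx
      ext n
      have := congrArg (coeff (n + 1)) hx
      simpa [PowerSeries.coeff_succ_X_mul] using this

/-- The quaternary relation is homogeneous of degree one in S(u) and in S(v), so f(u) f(v) factors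
out. The symmetry relation is linear but mixes S(u) with S(-u), which is why f must be even. -/
theorem IsTwSeries.scale (hS : IsTwSeries S) {f : PowerSeries A} (hf : negArg f = f)
    (h : ∀ m n i j, Commute (coeff m f) (coeff n (S i j)))
    (h' : ∀ m n, Commute (coeff m f) (coeff n f)) :
    IsTwSeries (S.map (f * ·)) := by
  have cUV : ∀ x y : PowerSeries A, (∀ m n, Commute (coeff m x)
      (coeff n y)) → Commute (inU x) (inV y) := by
    intro x y hxy
    ext m n
    simpa [inU, inV] using (hxy m n).eq
  have eU : ∀ i j, (S.map (f * ·)).map inU i j = inU f * (S.map inU) i j := fun i j =>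
    map_mul inUHom _ _
  have eV : ∀ i j, (S.map (f * ·)).map inV i j = inV f * (S.map inV) i j := fun i j =>
    map_mul inVHom _ _
  have c1 : ∀ i j, Commute (inV f) ((S.map inU) i j) := fun i j =>
    (cUV _ _ fun m n => (h n m i j).symm).symm
  have c2 : ∀ i j, Commute (inU f) ((S.map inV) i j) := fun i j => cUV _ _ fun m n => h m n i j
  have c3 : Commute (inU f) (inV f) := cUV _ _ h'
  have p1 : ∀ i j k l, (S.map (f * ·)).map inU i j * (S.map (f * ·)).map inV k l =
      (inU f * inV f) * (S.map inU i j * S.map inV k l) := by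
    intro i j k l
    rw [eU, eV, mul_assoc, ← mul_assoc (S.map inU i j), ← (c1 i j).eq]
    simp only [mul_assoc]
  have p2 : ∀ i j k l, (S.map (f * ·)).map inV k l * (S.map (f * ·)).map inU i j =
      (inU f * inV f) * (S.map inV k l * S.map inU i j) := by
    intro i j k l
    rw [eU, eV, mul_assoc, ← mul_assoc (S.map inV k l), ← (c2 k l).eq, c3.eq]
    simp only [mul_assoc]
  have sgn : ∀ (e : ℕ) (x y : PowerSeries (PowerSeries A)), (-1) ^ e * (x * y) =
      x * ((-1) ^ e * y) := by
    intro e x y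
    rcases neg_one_pow_eq_or (PowerSeries (PowerSeries A)) e with h | h <;> simp [h]
  constructor
  · have hq := hS.quat
    rw [isQuat_iff] at hq ⊢
    intro i k j l
    have hL : ∀ i k j l, quatL (inU PowerSeries.X : PowerSeries (PowerSeries ℂ)) (inV PowerSeries.X)
        ((S.map (f * ·)).map inU) ((S.map (f * ·)).map inV) i k j l = (inU f * inV f) *
        quatL (inU PowerSeries.X : PowerSeries (PowerSeries ℂ)) (inV PowerSeries.X)
          (S.map inU) (S.map inV) i k j l := by
      intro i k j l
      simp only [quatL, p1, sgn, mul_sub, mul_smul_comm]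
    have hR : ∀ i k j l, quatR (inU PowerSeries.X : PowerSeries (PowerSeries ℂ)) (inV PowerSeries.X)
        ((S.map (f * ·)).map inU) ((S.map (f * ·)).map inV) i k j l = (inU f * inV f) *
        quatR (inU PowerSeries.X : PowerSeries (PowerSeries ℂ)) (inV PowerSeries.X)
          (S.map inU) (S.map inV) i k j l := by
      intro i k j l
      simp only [quatR, p2, sgn, mul_sub, mul_smul_comm]
    simp only [hL, hR, sgn]
    have := congrArg ((inU f * inV f) * ·) (hq i k j l)
    simpa only [mul_sub, mul_smul_comm] using this
  · intro i j
    have := congrArg (f * ·) (hS.symm i j)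
    have e : ∀ i j, (S.map (f * ·)).map negArg i j = f * (S.map negArg) i j := by
      intro i j
      simp only [Matrix.map_apply]
      rw [← negHom_apply, map_mul, negHom_apply, negHom_apply, hf]
    have sgn' : ∀ (e : ℕ) (y : PowerSeries A), (-1) ^ e * (f * y) = f * ((-1) ^ e * y) := by
      intro e y
      rcases neg_one_pow_eq_or (PowerSeries A) e with h | h <;> simp [h]
    simp only [e, sgn', Matrix.map_apply (f := (f * ·))]
    simpa only [mul_add, mul_sub, mul_smul_comm] using this

/-- A matrix of scalars as a matrix of series. -/
def constSeries (A : Type*) [Ring A] [Algebra ℂ A] (G : Matrix (Idx M N) (Idx M N) ℂ) :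
    Matrix (Idx M N) (Idx M N) (PowerSeries A) := G.map fun c => PowerSeries.C (algebraMap ℂ A c)

theorem constSeries_apply (G : Matrix (Idx M N) (Idx M N) ℂ) (i j : Idx M N) :
    constSeries A G i j = PowerSeries.C (algebraMap ℂ A (G i j)) := rfl

/-- The matrix is even: entries in odd positions vanish. -/
def IsEven (G : Matrix (Idx M N) (Idx M N) ℂ) : Prop := ∀ i j, par i ≠ par j → G i j = 0

theorem IsEven.sCommSeries {D : Matrix (Idx M N) (Idx M N) ℂ} (hD : IsEven D)
    (S : Matrix (Idx M N) (Idx M N) (PowerSeries A)) : SCommSeries (constSeries A D) S := by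
  intro m n i j k l
  by_cases h : par i = par j
  · have : Even ((par i + par j) * (par k + par l)) := by
      rw [h]; exact Even.mul_right ⟨_, rfl⟩ _
    rw [this.neg_one_pow, one_mul]
    simp only [Matrix.map_apply, constSeries_apply, PowerSeries.coeff_C]
    split_ifs
    · exact Algebra.commutes _ _
    · simp
  · simp [constSeries_apply, hD i j h]

theorem inU_C (a : A) : inU (PowerSeries.C a) = PowerSeries.C (PowerSeries.C a) := by
  simp [inU]

theorem IsEven.isRTTSeries {D : Matrix (Idx M N) (Idx M N) ℂ} (hD : IsEven D) :
    IsRTTSeries (constSeries A D) := by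
  intro i j k l
  have h1 : ∀ i j k l, (-1) ^ (par j * (par k + par l)) * (D i j * D k l) =
      (-1) ^ (par i * (par k + par l)) * (D k l * D i j) := by
    intro i j k l
    by_cases h : par i = par j
    · rw [h, mul_comm (D i j)]
    · simp [hD i j h]
  have h2 : (-1) ^ (par i * par k + par j * (par i + par l)) * (D k j * D i l) =
      (-1) ^ (par j * par l + par i * (par k + par j)) * (D k j * D i l) := by
    by_cases h : par k = par j
    · by_cases h' : par i = par l
      · rw [h, h']
        congr 2; ring
      · simp [hD i l h']
    · simp [hD k j h]
  let ψ : ℂ →+* PowerSeries (PowerSeries A) :=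
    (PowerSeries.C.comp PowerSeries.C).comp (algebraMap ℂ A)
  have e1 : ∀ i j, (constSeries A D).map inU i j = ψ (D i j) := fun i j => by
    rw [Matrix.map_apply, constSeries_apply, inU_C]; rfl
  have e2 : ∀ i j, (constSeries A D).map inV i j = ψ (D i j) := fun i j => rfl
  have h1' := congrArg ψ (h1 i j k l)
  have h2' := congrArg ψ h2
  simp only [map_mul, map_pow, map_neg, map_one] at h1' h2'
  simp only [e1, e2]
  rw [h1', h2', sub_self, sub_self, smul_zero, smul_zero]

theorem IsSupersymmetric.isEven {G : Matrix (Idx M N) (Idx M N) ℂ} (hG : IsSupersymmetric G) :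
    IsEven G := by
  rintro (i | i) (j | j) h
  · simp [par] at h
  · exact congrFun (congrFun hG.upperRight i) j
  · exact congrFun (congrFun hG.lowerLeft i) j
  · simp [par] at h

theorem IsSupersymmetric.swap {G : Matrix (Idx M N) (Idx M N) ℂ} (hG : IsSupersymmetric G)
    (i j : Idx M N) : (-1) ^ (par i * par j) * G j i = G i j := by
  rcases i with i | i <;> rcases j with j | j
  · have := congrFun (congrFun hG.symm i) j
    simp only [Matrix.toBlocks₁₁, Matrix.of_apply, Matrix.transpose_apply] at this
    simp [par, this]
  · have h1 := congrFun (congrFun hG.upperRight i) j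
    have h2 := congrFun (congrFun hG.lowerLeft j) i
    simp only [Matrix.toBlocks₁₂, Matrix.toBlocks₂₁, Matrix.of_apply, Matrix.zero_apply] at h1 h2
    rw [h1, h2, mul_zero]
  · have h1 := congrFun (congrFun hG.upperRight j) i
    have h2 := congrFun (congrFun hG.lowerLeft i) j
    simp only [Matrix.toBlocks₁₂, Matrix.toBlocks₂₁, Matrix.of_apply, Matrix.zero_apply] at h1 h2
    rw [h1, h2, mul_zero]
  · have := congrFun (congrFun hG.skew i) j
    simp only [Matrix.toBlocks₂₂, Matrix.of_apply, Matrix.transpose_apply, Matrix.neg_apply] at this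
    simp [par, this]

theorem IsEven.std_eq {G : Matrix (Idx M N) (Idx M N) ℂ} (hG : IsEven G) : std G = G := by
  ext i j
  by_cases h : par i = par j
  · rcases par_cases j with hj | hj <;> simp [std, h, hj]
  · simp [std, hG i j h]

theorem IsEven.unstd_eq {G : Matrix (Idx M N) (Idx M N) ℂ} (hG : IsEven G) : unstd G = G :=
  hG.std_eq

theorem negArg_C (a : A) : negArg (PowerSeries.C a) = PowerSeries.C a :=
  substInv_C (by simp) a

/-- For constant G the supersymmetry already gives G₁ R^{t₁} G₂ = G₂ R^{t₂} G₁ (`h1`), and this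
matrix commutes with P (`h2`), hence with R(u - v). -/
theorem IsSupersymmetric.isTwSeries {G : Matrix (Idx M N) (Idx M N) ℂ} (hG : IsSupersymmetric G) :
    IsTwSeries (constSeries A G) := by
  let ψ : ℂ →+* PowerSeries (PowerSeries A) :=
    (PowerSeries.C.comp PowerSeries.C).comp (algebraMap ℂ A)
  have e1 : ∀ i j, (constSeries A G).map inU i j = ψ (G i j) := fun i j => by
    rw [Matrix.map_apply, constSeries_apply, inU_C]; rfl
  have e2 : ∀ i j, (constSeries A G).map inV i j = ψ (G i j) := fun i j => rfl
  have c : ∀ i j k l, G k l * G i j = G i j * G k l := fun i j k l => mul_comm _ _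
  constructor
  · rw [isQuat_iff]
    have a1 : ∀ i j k l, (-1) ^ (par j * (par k + par l)) * (ψ (G i j) * ψ (G k l)) =
        (-1) ^ (par i * (par k + par l)) * (ψ (G k l) * ψ (G i j)) := by
      intro i j k l
      by_cases h : par i = par j
      · rw [h, ← map_mul, ← map_mul, c i j k l]
      · simp [hG.isEven i j h]
    have sw : ∀ i j, (-1) ^ (par i * par j) * ψ (G j i) = ψ (G i j) := by
      intro i j
      rw [← hG.swap i j, map_mul, map_pow, map_neg, map_one]
    have a2 : ∀ i k j l, (-1) ^ (par j * par l) * (ψ (G i k) * ψ (G j l)) =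
        (-1) ^ (par i * par k) * (ψ (G k i) * ψ (G l j)) := by
      intro i k j l
      rw [← mul_assoc _ (ψ (G k i)), sw, ← sw l j, mul_comm (par l)]
      rcases neg_one_pow_eq_or (PowerSeries (PowerSeries A)) (par j * par l) with h | h <;> simp [h]
    have h1 : ∀ i k j l, quatL (inU PowerSeries.X : PowerSeries (PowerSeries ℂ)) (inV PowerSeries.X)
        ((constSeries A G).map inU) ((constSeries A G).map inV) i k j l =
        quatR (inU PowerSeries.X : PowerSeries (PowerSeries ℂ)) (inV PowerSeries.X)
        ((constSeries A G).map inU) ((constSeries A G).map inV) i k j l := by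
      intro i k j l
      simp only [quatL, quatR, e1, e2]
      rw [a1, a2]
    have h2 : ∀ i k j l, (-1) ^ (par i * par k) *
        quatL (inU PowerSeries.X : PowerSeries (PowerSeries ℂ)) (inV PowerSeries.X)
        ((constSeries A G).map inU) ((constSeries A G).map inV) k i j l = (-1) ^ (par j * par l) *
        quatL (inU PowerSeries.X : PowerSeries (PowerSeries ℂ)) (inV PowerSeries.X)
        ((constSeries A G).map inU) ((constSeries A G).map inV) i k l j := by
      intro i k j l
      simp only [quatL, e1, e2, mul_sub, mul_smul_comm]
      congr 2
      · by_cases h : par k = par j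
        · by_cases h' : par i = par l
          · rw [← map_mul, ← map_mul, mul_comm (G k j), ← mul_assoc, ← mul_assoc, ← pow_add,
              ← pow_add, h, h']
            congr 1
            rcases par_cases j with hj | hj <;> rcases par_cases l with hl | hl <;> simp [hj, hl]
          · simp [hG.isEven i l h']
        · simp [hG.isEven k j h]
      · rw [mul_comm (par l), neg_one_pow_mul_self, ← sw l j, ← sw i k]
        rw [mul_comm (par l)]
        rcases neg_one_pow_eq_or (PowerSeries (PowerSeries A)) (par j * par l) with h | h <;>
          rcases neg_one_pow_eq_or (PowerSeries (PowerSeries A)) (par i * par k) with h' | h' <;>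
          simp [h, h']
    intro i k j l
    rw [h1, ← h1 i k l j, h2]
  · intro i j
    have : ∀ i j, (constSeries A G).map negArg i j = constSeries A G i j := fun i j => by
      rw [Matrix.map_apply, constSeries_apply, negArg_C]
    rw [this, this, sub_self, smul_zero, add_zero, constSeries_apply, constSeries_apply,
      ← hG.swap i j]
    simp

end Conj

/-! ### Homomorphisms determined by constant terms, and the twisted map -/

section Hom

variable {M N : ℕ} {A : Type*} [Ring A] [Algebra ℂ A] {G : Matrix (Idx M N) (Idx M N) ℂ}

theorem str_one : str (1 : Matrix (Idx M N) (Idx M N) A) = 1 := by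
  ext i j
  rcases eq_or_ne i j with rfl | h
  · rcases par_cases i with hi | hi <;> simp [str, hi]
  · simp [str, h, h.symm]

theorem exists_ytw_hom_of_constantCoeff (hG : IsSupersymmetric G)
    (S : Matrix (Idx M N) (Idx M N) (PowerSeries A)) (h : IsTwSeries S)
    (h0 : S.map constantCoeff = G.map (algebraMap ℂ A)) :
    ∃ φ : YTw G →ₐ[ℂ] A, (sStd G).map (PowerSeries.map (φ : YTw G →+* A)) = S := by
  refine exists_ytw_hom S h fun i j => ?_
  have := congrFun (congrFun (unstd_map (constantCoeff (R := A)) S) i) j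
  rw [← this, h0, unstd_map]
  exact congrArg _ (congrFun (congrFun hG.isEven.unstd_eq i) j)

theorem isEven_one : IsEven (1 : Matrix (Idx M N) (Idx M N) ℂ) := fun i j h =>
  Matrix.one_apply_ne fun h' => h (by rw [h'])

theorem exists_ygl_hom_of_constantCoeff
    (T : Matrix (Idx M N) (Idx M N) (PowerSeries A)) (h : IsRTTSeries T)
    (h0 : T.map constantCoeff = 1) :
    ∃ φ : YGl M N →ₐ[ℂ] A, (tStd M N).map (PowerSeries.map (φ : YGl M N →+* A)) = T := by
  refine exists_ygl_hom T h fun i j => ?_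
  have := congrFun (congrFun (unstd_map (constantCoeff (R := A)) T) i) j
  rw [← this, h0, ← Matrix.map_one (algebraMap ℂ A) (map_zero _) (map_one _), unstd_map]
  exact congrArg _ (congrFun (congrFun isEven_one.unstd_eq i) j)

theorem sStd_map_constantCoeff (hG : IsSupersymmetric G) :
    (sStd G).map constantCoeff = G.map (algebraMap ℂ (YTw G)) := by
  have h := std_map (algebraMap ℂ (YTw G)) G
  rw [hG.isEven.std_eq] at h
  rw [sStd, ← std_map, ← h]
  congr 1
  funext i j
  exact constantCoeff_sSeries i j

theorem tStd_map_constantCoeff : (tStd M N).map constantCoeff = 1 := by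
  have h := std_map (algebraMap ℂ (YGl M N)) (1 : Matrix (Idx M N) (Idx M N) ℂ)
  rw [isEven_one.std_eq] at h
  rw [tStd, ← std_map, ← Matrix.map_one (algebraMap ℂ (YGl M N)) (map_zero _) (map_one _), ← h]
  congr 1
  funext i j
  exact constantCoeff_tSeries i j

theorem constSeries_map_constantCoeff (G : Matrix (Idx M N) (Idx M N) ℂ) :
    (constSeries A G).map constantCoeff = G.map (algebraMap ℂ A) := by
  ext i j
  simp [constSeries_apply]

theorem map_negArg_map_constantCoeff (T : Matrix (Idx M N) (Idx M N) (PowerSeries A)) :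
    (T.map negArg).map constantCoeff = T.map constantCoeff := by
  ext i j
  simp [negArg, constantCoeff_substInv]

theorem conj_map_constantCoeff {T S : Matrix (Idx M N) (Idx M N) (PowerSeries A)}
    (hT : T.map constantCoeff = 1) :
    (T * S * str (T.map negArg)).map constantCoeff =
      S.map constantCoeff := by
  rw [Matrix.map_mul, Matrix.map_mul, ← str_map, map_negArg_map_constantCoeff, hT, str_one,
    one_mul, mul_one]

/-- The embedding `S(u) ↦ T(u) G T^t(-u)` exists. -/
theorem exists_twisted_hom (hG : IsSupersymmetric G) : ∃ φ : YTw G →ₐ[ℂ] YGl M N,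
    (sStd G).map (PowerSeries.map (φ : YTw G →+* YGl M N)) =
      tStd M N * constSeries _ G * str ((tStd M N).map negArg) := by
  refine exists_ytw_hom_of_constantCoeff hG _ (hG.isTwSeries.conj isRTTSeries_tStd
    (hG.isEven.sCommSeries _).symm) ?_
  rw [conj_map_constantCoeff tStd_map_constantCoeff, constSeries_map_constantCoeff]

theorem isTwistedMap_of (hG : IsSupersymmetric G) {φ : YTw G →ₐ[ℂ] YGl M N}
    (h : (sStd G).map (PowerSeries.map (φ : YTw G →+* YGl M N)) =
      tStd M N * constSeries _ G * str ((tStd M N).map negArg)) : IsTwistedMap G φ := by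
  intro i j
  have e1 : std (fun a b => PowerSeries.C (algebraMap ℂ (YGl M N) (G a b))) =
      constSeries (YGl M N) G := by
    have := std_map ((PowerSeries.C (R := YGl M N)).comp (algebraMap ℂ (YGl M N))) G
    rw [hG.isEven.std_eq] at this
    exact this
  have e2 : std (fun a b => negArg (tSeries M N a b)) = (tStd M N).map negArg :=
    std_map ((negHom : PowerSeries (YGl M N) →ₐ[ℂ] PowerSeries (YGl M N)) :
      PowerSeries (YGl M N) →+* PowerSeries (YGl M N)) (tSeries M N)
  rw [sStd, ← std_map, ← e1, ← e2, ← std_transp, tStd, ← std_mul1, ← std_mul1] at h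
  have := congrArg unstd h
  rw [unstd_std, unstd_std] at this
  exact congrFun (congrFun this i) j

end Hom

/-! ### The parity involution and the slot coaction -/

section Slot

variable {M N : ℕ} {A : Type*} [Ring A] [Algebra ℂ A]

theorem IsRTTSeries.mul {T Y : Matrix (Idx M N) (Idx M N) (PowerSeries A)} (hT : IsRTTSeries T)
    (hY : IsRTTSeries Y) (h : SCommSeries T Y) : IsRTTSeries (T * Y) := by
  have := IsRTT.mul hT hY h.inU_inV h.symm.inU_inV
  have e1 : (T * Y).map inU = T.map inU * Y.map inU := Matrix.map_mul (f := inUHom)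
  have e2 : (T * Y).map inV = T.map inV * Y.map inV := Matrix.map_mul (f := inVHom)
  unfold IsRTTSeries
  rw [e1, e2]
  exact this

theorem neg_one_pow_add_self (n : ℕ) : (-1 : A) ^ (n + n) = 1 := Even.neg_one_pow ⟨n, rfl⟩

variable (M N) in
/-- The diagonal matrix with entries `(-1)^{|i|}`. -/
def parMat : Matrix (Idx M N) (Idx M N) ℂ := Matrix.diagonal fun i => (-1) ^ par i

theorem isEven_parMat : IsEven (parMat M N) := fun i j h =>
  Matrix.diagonal_apply_ne _ fun h' => h (by rw [h'])

theorem constSeries_parMat : constSeries A (parMat M N) =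
    Matrix.diagonal fun i => (-1) ^ par i := by
  ext i j : 2
  rcases eq_or_ne i j with rfl | h
  · simp [constSeries_apply, parMat]
  · simp [constSeries_apply, parMat, h]

theorem parMat_mul_mul (S : Matrix (Idx M N) (Idx M N) (PowerSeries A)) (i j : Idx M N) :
    (constSeries A (parMat M N) * S * constSeries A (parMat M N)) i j =
      (-1) ^ (par i + par j) * S i j := by
  rw [constSeries_parMat, Matrix.mul_diagonal, Matrix.diagonal_mul, pow_add]
  rcases par_cases i with hi | hi <;> rcases par_cases j with hj | hj <;> simp [hi, hj]

theorem str_parMat : str ((constSeries A (parMat M N)).map negArg) =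
    constSeries A (parMat M N) := by
  ext i j : 2
  rw [str, Matrix.of_apply, Matrix.map_apply, constSeries_apply, negArg_C, constSeries_apply]
  rcases eq_or_ne i j with rfl | h
  · rcases par_cases i with hi | hi <;> simp [hi]
  · simp [parMat, h, h.symm]

/-- The involution is S(u) ↦ J S(u) J: the constant matrix J is even, solves the `RTT` relation and
equals its own transpose, so this is a case of dressing. -/
theorem exists_parTw {G : Matrix (Idx M N) (Idx M N) ℂ} (hG : IsSupersymmetric G) :
    ∃ γ : YTw G →ₐ[ℂ] YTw G, ∀ i j, PowerSeries.map (γ : YTw G →+* YTw G) (sStd G i j) =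
      (-1) ^ (par i + par j) * sStd G i j := by
  have h := (isTwSeries_sStd (G := G)).conj (isEven_parMat (M := M) (N := N)).isRTTSeries
    (isEven_parMat.sCommSeries _)
  rw [str_parMat] at h
  have h1 : (constSeries (YTw G) (parMat M N) * sStd G * constSeries (YTw G) (parMat M N)).map
      constantCoeff = G.map (algebraMap ℂ (YTw G)) := by
    have h0 := sStd_map_constantCoeff hG
    ext i j
    have h1 := congrFun (congrFun h0 i) j
    rw [Matrix.map_apply, Matrix.map_apply] at h1
    rw [Matrix.map_apply, parMat_mul_mul, map_mul, map_pow, map_neg, map_one, Matrix.map_apply, h1]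
    by_cases h : par i = par j
    · rw [h, neg_one_pow_add_self, one_mul]
    · simp [hG.isEven i j h]
  obtain ⟨γ, hγ⟩ := exists_ytw_hom_of_constantCoeff hG _ h h1
  exact ⟨γ, fun i j => by rw [← parMat_mul_mul, ← hγ, Matrix.map_apply]⟩

variable (M N) in
theorem exists_parGl : ∃ γ : YGl M N →ₐ[ℂ] YGl M N, ∀ i j,
    PowerSeries.map (γ : YGl M N →+* YGl M N) (tStd M N i j) =
      (-1) ^ (par i + par j) * tStd M N i j := by
  have hD := isEven_parMat (M := M) (N := N)
  have h := ((hD.isRTTSeries (A := YGl M N)).mul isRTTSeries_tStd (hD.sCommSeries _)).mul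
    hD.isRTTSeries (hD.sCommSeries _).symm
  have h1 : (constSeries (YGl M N) (parMat M N) * tStd M N *
      constSeries (YGl M N) (parMat M N)).map constantCoeff = 1 := by
    rw [← tStd_map_constantCoeff]
    ext i j
    have h1 := congrFun (congrFun (tStd_map_constantCoeff (M := M) (N := N)) i) j
    rw [Matrix.map_apply] at h1
    rw [Matrix.map_apply, parMat_mul_mul, map_mul, map_pow, map_neg, map_one, Matrix.map_apply, h1]
    rcases eq_or_ne i j with rfl | h
    · rw [neg_one_pow_add_self, one_mul]
    · simp [h]
  obtain ⟨γ, hγ⟩ := exists_ygl_hom_of_constantCoeff _ h h1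
  exact ⟨γ, fun i j => by rw [← parMat_mul_mul, ← hγ, Matrix.map_apply]⟩

/-- The parity involution of `Y^{tw}`. -/
def parTw {G : Matrix (Idx M N) (Idx M N) ℂ} (hG : IsSupersymmetric G) : YTw G →ₐ[ℂ] YTw G :=
  (exists_parTw hG).choose

variable (M N) in
/-- The parity involution of `Y(gl)`. -/
def parGl : YGl M N →ₐ[ℂ] YGl M N := (exists_parGl M N).choose

theorem map_parTw {G : Matrix (Idx M N) (Idx M N) ℂ} (hG : IsSupersymmetric G) (i j : Idx M N) :
    PowerSeries.map (parTw hG : YTw G →+* YTw G) (sStd G i j) =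
      (-1) ^ (par i + par j) * sStd G i j := (exists_parTw hG).choose_spec i j

theorem map_parGl (i j : Idx M N) :
    PowerSeries.map (parGl M N : YGl M N →+* YGl M N) (tStd M N i j) =
      (-1) ^ (par i + par j) * tStd M N i j := (exists_parGl M N).choose_spec i j

theorem series_map_comp {B C : Type*} [Ring B] [Ring C] [Algebra ℂ B] [Algebra ℂ C]
    (φ : B →ₐ[ℂ] C) (ψ : A →ₐ[ℂ] B) (f : PowerSeries A) :
    PowerSeries.map ((φ.comp ψ : A →ₐ[ℂ] C) : A →+* C) f =
      PowerSeries.map (φ : B →+* C) (PowerSeries.map (ψ : A →+* B) f) := by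
  ext n; simp

theorem series_map_id (f : PowerSeries A) :
    PowerSeries.map ((AlgHom.id ℂ A : A →ₐ[ℂ] A) : A →+* A) f = f := by
  ext n; simp

/-- The series `(u - a)⁻¹` over `ℂ[a]`. -/
def geomSeries₀ : PowerSeries (Polynomial ℂ) :=
  PowerSeries.mk fun n => if n = 0 then 0 else Polynomial.X ^ (n - 1)

theorem geomSeries₀_eq :
    geomSeries₀ * (1 - PowerSeries.C Polynomial.X * PowerSeries.X) = PowerSeries.X := by
  rw [mul_sub, mul_one, ← mul_assoc]
  ext n : 1
  rcases n with _ | _ | n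
  · simp [geomSeries₀]
  · simp [geomSeries₀, PowerSeries.coeff_succ_mul_X, PowerSeries.coeff_X]
  · rw [map_sub, PowerSeries.coeff_succ_mul_X, mul_comm, coeff_C_mul, geomSeries₀,
      coeff_mk, coeff_mk, PowerSeries.coeff_X]
    simp [pow_succ']

theorem map_commute {R B : Type*} [Ring R] [Ring B] {φ : R →+* B} (h : ∀ c y, Commute (φ c) y)
    (f : PowerSeries R) (g : PowerSeries B) : Commute (PowerSeries.map φ f) g := by
  ext n
  rw [coeff_mul, coeff_mul, ← Finset.Nat.sum_antidiagonal_swap]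
  refine Finset.sum_congr rfl fun p _ => ?_
  rw [coeff_map]
  exact h _ _

theorem inU_map {R B : Type*} [Ring R] [Ring B] (φ : R →+* B) (f : PowerSeries R) :
    inU (PowerSeries.map φ f) = PowerSeries.map (PowerSeries.map φ) (inU f) := by
  ext m n
  simp only [inU, coeff_map, PowerSeries.coeff_C]
  split_ifs <;> simp

theorem inV_map {R B : Type*} [Ring R] [Ring B] (φ : R →+* B) (f : PowerSeries R) :
    inV (PowerSeries.map φ f) = PowerSeries.map (PowerSeries.map φ) (inV f) := by
  simp [inV]

/-! ### Evaluation solutions 1 + e/(u - a) of the `RTT` relation -/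

section Generic

variable {R : Type*} [Ring R] [Algebra ℂ R]

/-- The series `(u - a)⁻¹`. -/
def geomSeries (a : R) : PowerSeries R :=
  PowerSeries.map ((Polynomial.aeval a : Polynomial ℂ →ₐ[ℂ] R) : Polynomial ℂ →+* R) geomSeries₀

theorem coeff_geomSeries (a : R) (n : ℕ) :
    coeff n (geomSeries a) = if n = 0 then 0 else a ^ (n - 1) := by
  rw [geomSeries, coeff_map, geomSeries₀, coeff_mk]
  split_ifs <;> simp

theorem aeval_commute {a : R} (ha : ∀ y, Commute a y) (p : Polynomial ℂ) (y : R) :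
    Commute (Polynomial.aeval a p) y := by
  induction p using Polynomial.induction_on' with
  | add p p' h h' => rw [map_add]; exact h.add_left h'
  | monomial n c =>
    rw [Polynomial.aeval_monomial]
    exact Commute.mul_left (Algebra.commutes c y) ((ha y).pow_left n)

theorem geomSeries_commute {a : R} (ha : ∀ y, Commute a y) (g : PowerSeries R) :
    Commute (geomSeries a) g := map_commute (aeval_commute ha) _ _

theorem inU_geomSeries_commute {a : R} (ha : ∀ y, Commute a y) (g : PowerSeries (PowerSeries R)) :
    Commute (inU (geomSeries a)) g := by
  rw [geomSeries, inU_map]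
  exact map_commute (map_commute (aeval_commute ha)) _ _

theorem inV_geomSeries_commute {a : R} (ha : ∀ y, Commute a y) (g : PowerSeries (PowerSeries R)) :
    Commute (inV (geomSeries a)) g := by
  rw [geomSeries, inV_map]
  exact map_commute (map_commute (aeval_commute ha)) _ _

/-- This is the partial fraction identity (u - v)/((u - a)(v - a)) = 1/(v - a) - 1/(u - a), cleared
of denominators. It is proved over ℂ[a], where everything commutes, and then mapped. -/
theorem geomSeries_identity (a : R) :
    (inV PowerSeries.X - inU PowerSeries.X : PowerSeries (PowerSeries ℂ)) •
        (inU (geomSeries a) * inV (geomSeries a)) =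
      (inU PowerSeries.X * inV PowerSeries.X : PowerSeries (PowerSeries ℂ)) •
        (inV (geomSeries a) - inU (geomSeries a)) := by
  have h := congrArg inUHom geomSeries₀_eq
  have h' := congrArg inVHom geomSeries₀_eq
  simp only [map_mul, map_sub, map_one] at h h'
  have hc : inUHom (PowerSeries.C (Polynomial.X : Polynomial ℂ)) =
      inVHom (PowerSeries.C Polynomial.X) := by
    rw [inUHom_apply, inU_C]; rfl
  rw [hc] at h
  simp only [inUHom_apply, inVHom_apply] at h h'
  have key : (inV PowerSeries.X - inU PowerSeries.X) * (inU geomSeries₀ * inV geomSeries₀) =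
      inU PowerSeries.X * inV PowerSeries.X * (inV geomSeries₀ - inU geomSeries₀) := by
    linear_combination (inV PowerSeries.X * inV geomSeries₀) * h -
      (inU PowerSeries.X * inU geomSeries₀) * h'
  have := congrArg (PowerSeries.map (PowerSeries.map ((Polynomial.aeval a : Polynomial ℂ →ₐ[ℂ] R) :
    Polynomial ℂ →+* R))) key
  simp only [map_mul, map_sub, ← inU_map, ← inV_map, PowerSeries.map_X] at this
  rw [sub_smul, mul_smul, inV_smul, inU_smul, inU_smul, inV_smul, PowerSeries.map_X, ← sub_mul,
    ← mul_assoc (inU PowerSeries.X)]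
  exact this

/-- With x = 1/(u - a) and x' = 1/(v - a), the left side of the `RTT` relation contributes the
commutator of e with itself times x x', while on the right only terms linear in e survive, times x'
- x. Partial fractions equate the two. -/
theorem isRTT_of_comm {K B : Type*} [CommRing K] [Ring B] [Algebra K B] {α β : K}
    (e : Matrix (Idx M N) (Idx M N) B) {x x' : B} (hx : ∀ y, Commute x y) (hx' : ∀ y, Commute x' y)
    (h : (β - α) • (x * x') = (α * β) • (x' - x))
    (he : ∀ i j k l, (-1) ^ (par j * (par k + par l)) * (e i j * e k l) -
      (-1) ^ (par i * (par k + par l)) * (e k l * e i j) =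
      (if k = j then (-1) ^ (par j * par l) * e i l else 0) -
        if i = l then (-1) ^ (par i * par k) * e k j else 0) :
    IsRTT α β (Matrix.of fun i j => (1 : Matrix (Idx M N) (Idx M N) B) i j + e i j * x)
      (Matrix.of fun i j => (1 : Matrix (Idx M N) (Idx M N) B) i j + e i j * x') := by
  intro i j k l
  simp only [Matrix.of_apply]
  have hxx : ∀ a b : B, a * x * (b * x') = a * b * (x * x') := fun a b => by
    rw [mul_assoc, ← mul_assoc x, (hx b).eq]; simp only [mul_assoc]
  have hxx' : ∀ a b : B, a * x' * (b * x) = a * b * (x * x') := fun a b => by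
    rw [mul_assoc, ← mul_assoc x', (hx' b).eq, ← (hx' x).eq]; simp only [mul_assoc]
  have sgn : ∀ i j : Idx M N, ∀ n : ℕ, ∀ y : B, (1 : Matrix (Idx M N) (Idx M N) B) i j *
      ((-1) ^ n * y) = (-1) ^ n * ((1 : Matrix (Idx M N) (Idx M N) B) i j * y) := by
    intro i j n y
    rcases eq_or_ne i j with rfl | h <;> simp [*]
  have L : (-1) ^ (par j * (par k + par l)) * (((1 : Matrix (Idx M N) (Idx M N) B) i j + e i j * x) *
        ((1 : Matrix (Idx M N) (Idx M N) B) k l + e k l * x')) -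
      (-1) ^ (par i * (par k + par l)) * (((1 : Matrix (Idx M N) (Idx M N) B) k l + e k l * x') *
        ((1 : Matrix (Idx M N) (Idx M N) B) i j + e i j * x)) =
      ((if k = j then (-1) ^ (par j * par l) * e i l else 0) -
        if i = l then (-1) ^ (par i * par k) * e k j else 0) * (x * x') := by
    rw [← he, sub_mul, mul_assoc ((-1) ^ _) (e i j * e k l), mul_assoc ((-1) ^ _) (e k l * e i j),
      ← hxx (e i j), ← hxx' (e k l)]
    rcases eq_or_ne i j with rfl | h1 <;> rcases eq_or_ne k l with rfl | h2
    · simp only [Matrix.one_apply_eq]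
      noncomm_ring
    · simp only [Matrix.one_apply_eq, Matrix.one_apply_ne h2]
      noncomm_ring
    · have : ∀ a, Even (a * (par k + par k)) := fun a => Even.mul_left ⟨_, rfl⟩ _
      simp only [Matrix.one_apply_eq, Matrix.one_apply_ne h1, (this _).neg_one_pow]
      noncomm_ring
    · simp only [Matrix.one_apply_ne h2, Matrix.one_apply_ne h1, zero_add]
  have R : (-1) ^ (par i * par k + par j * (par i + par l)) *
        (((1 : Matrix (Idx M N) (Idx M N) B) k j + e k j * x) *
          ((1 : Matrix (Idx M N) (Idx M N) B) i l + e i l * x')) -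
      (-1) ^ (par j * par l + par i * (par k + par j)) *
        (((1 : Matrix (Idx M N) (Idx M N) B) k j + e k j * x') *
          ((1 : Matrix (Idx M N) (Idx M N) B) i l + e i l * x)) =
      ((if k = j then (-1) ^ (par j * par l) * e i l else 0) -
        if i = l then (-1) ^ (par i * par k) * e k j else 0) * (x' - x) := by
    have e1 : (-1 : B) ^ (par j * par l + par i * (par k + par j)) =
        (-1) ^ (par i * par k + par j * (par i + par l)) := by
      congr 1; ring
    rw [e1, ← mul_sub]
    have e2 : ∀ a b c d : B, (a + b * x) * (c + d * x') - (a + b * x') * (c + d * x) =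
        a * d * (x' - x) - b * c * (x' - x) := by
      intro a b c d
      have : (a + b * x) * (c + d * x') - (a + b * x') * (c + d * x) =
        a * d * (x' - x) + (b * (x * c) - b * (x' * c)) + ((b * x * (d * x')) - b * x' * (d * x)) := by
        noncomm_ring
      rw [this, hxx, hxx', (hx c).eq, (hx' c).eq]
      noncomm_ring
    rw [e2, sub_mul, mul_sub]
    congr 1
    · rcases eq_or_ne k j with rfl | h
      · rw [Matrix.one_apply_eq, if_pos rfl, one_mul, ← mul_assoc]
        congr 2
        rcases par_cases i with hi | hi <;> rcases par_cases k with hj | hj <;>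
          rcases par_cases l with hk | hk <;> simp [hi, hj, hk, pow_succ]
      · simp [h]
    · rcases eq_or_ne i l with rfl | h
      · rw [Matrix.one_apply_eq, if_pos rfl, mul_one, ← mul_assoc]
        congr 2
        rcases par_cases i with hi | hi <;> rcases par_cases k with hj | hj <;>
          rcases par_cases j with hk | hk <;> simp [hi, hj, hk, pow_succ]
      · simp [h]
  rw [L, R, ← mul_smul_comm, h, mul_smul_comm]

/-- The matrix `1 + e / (u - a)`. -/
def evalSeries (e : Matrix (Idx M N) (Idx M N) R) (a : R) :
    Matrix (Idx M N) (Idx M N) (PowerSeries R) := Matrix.of fun i j =>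
  (1 : Matrix (Idx M N) (Idx M N) (PowerSeries R)) i j + PowerSeries.C (e i j) * geomSeries a

/-- The commutation relations of `gl_{M|N}`. -/
def IsGl (e : Matrix (Idx M N) (Idx M N) R) : Prop := ∀ i j k l,
  (-1) ^ (par j * (par k + par l)) * (e i j * e k l) -
      (-1) ^ (par i * (par k + par l)) * (e k l * e i j) =
    (if k = j then (-1) ^ (par j * par l) * e i l else 0) -
      if i = l then (-1) ^ (par i * par k) * e k j else 0

theorem IsGl.map {R' : Type*} [Ring R'] {e : Matrix (Idx M N) (Idx M N) R} (he : IsGl e)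
    (φ : R →+* R') : IsGl (e.map φ) := by
  intro i j k l
  have := congrArg φ (he i j k l)
  simp only [Matrix.map_apply]
  simpa only [map_sub, map_mul, map_pow, map_neg, map_one, apply_ite φ, map_zero] using this

theorem IsGl.isRTTSeries {e : Matrix (Idx M N) (Idx M N) R} (he : IsGl e) {a : R}
    (ha : ∀ y, Commute a y) : IsRTTSeries (evalSeries e a) := by
  have h := isRTT_of_comm (K := PowerSeries (PowerSeries ℂ))
    (B := PowerSeries (PowerSeries R)) (α := inU PowerSeries.X)
    (β := inV PowerSeries.X) (e.map (PowerSeries.C.comp PowerSeries.C))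
    (inU_geomSeries_commute ha) (inV_geomSeries_commute ha) (geomSeries_identity a)
    (he.map (PowerSeries.C.comp PowerSeries.C))
  have e1 : (evalSeries e a).map inU = Matrix.of fun i j =>
      (1 : Matrix (Idx M N) (Idx M N) (PowerSeries (PowerSeries R))) i j +
        (e.map (PowerSeries.C.comp PowerSeries.C)) i j * inU (geomSeries a) := by
    ext i j : 1
    simp only [evalSeries, Matrix.map_apply, Matrix.of_apply, ← inUHom_apply, map_add, map_mul]
    rw [inUHom_apply (PowerSeries.C _), inU_C]
    exact congrArg (· + _) (congrFun (congrFun (Matrix.map_one inUHom (map_zero _)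
      (map_one _)) i) j)
  have e2 : (evalSeries e a).map inV = Matrix.of fun i j =>
      (1 : Matrix (Idx M N) (Idx M N) (PowerSeries (PowerSeries R))) i j +
        (e.map (PowerSeries.C.comp PowerSeries.C)) i j * inV (geomSeries a) := by
    ext i j : 1
    simp only [evalSeries, Matrix.map_apply, Matrix.of_apply, ← inVHom_apply, map_add, map_mul]
    exact congrArg (· + _) (congrFun (congrFun (Matrix.map_one inVHom (map_zero _)
      (map_one _)) i) j)
  unfold IsRTTSeries
  rw [e1, e2]
  exact h

theorem evalSeries_map_constantCoeff (e : Matrix (Idx M N) (Idx M N) R) (a : R) :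
    (evalSeries e a).map constantCoeff = 1 := by
  ext i j : 2
  have : constantCoeff (geomSeries a) = 0 := by
    rw [← coeff_zero_eq_constantCoeff_apply, coeff_geomSeries, if_pos rfl]
  rw [Matrix.map_apply, evalSeries, Matrix.of_apply, map_add, map_mul, this, mul_zero, add_zero]
  exact congrFun (congrFun (Matrix.map_one (constantCoeff (R := R)) (map_zero _)
    (map_one _)) i) j

theorem sCommSeries_evalSeries {e : Matrix (Idx M N) (Idx M N) R} {a : R} (ha : ∀ y, Commute a y)
    {S : Matrix (Idx M N) (Idx M N) (PowerSeries R)}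
    (h : ∀ n, SComm e (S.map (coeff n))) : SCommSeries (evalSeries e a) S := by
  intro m n i j k l
  have h1 := h n i j k l
  simp only [Matrix.map_apply] at h1
  simp only [Matrix.map_apply, evalSeries, Matrix.of_apply, map_add, coeff_C_mul]
  have hc : Commute (coeff m (geomSeries a)) (coeff n (S k l)) := by
    rw [coeff_geomSeries]
    split_ifs
    · exact Commute.zero_left _
    · exact (ha _).pow_left _
  rw [add_mul, mul_add (coeff n (S k l)),
    mul_add ((-1) ^ ((par i + par j) * (par k + par l)))]
  congr 1
  · rcases eq_or_ne i j with rfl | h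
    · have : Even ((par i + par i) * (par k + par l)) := Even.mul_right ⟨_, rfl⟩ _
      rw [Matrix.one_apply_eq, coeff_one, this.neg_one_pow, one_mul]
      split_ifs <;> simp
    · rw [Matrix.one_apply_ne h]
      simp
  · rw [mul_assoc, hc.eq, ← mul_assoc, h1]
    simp only [mul_assoc]

theorem map_evalSeries {R' : Type*} [Ring R'] [Algebra ℂ R'] (φ : R →ₐ[ℂ] R')
    (e : Matrix (Idx M N) (Idx M N) R) (a : R) :
    (evalSeries e a).map (PowerSeries.map (φ : R →+* R')) = evalSeries (e.map φ) (φ a) := by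
  have e2 : PowerSeries.map (φ : R →+* R') (geomSeries a) = geomSeries (φ a) := by
    ext n : 1
    rw [coeff_map, coeff_geomSeries, coeff_geomSeries]
    split_ifs <;> simp
  ext i j : 1
  rw [Matrix.map_apply, evalSeries, evalSeries, Matrix.of_apply, Matrix.of_apply, map_add, map_mul,
    e2, PowerSeries.map_C]
  exact congrArg (· + _) (congrFun (congrFun (Matrix.map_one (PowerSeries.map (φ : R →+* R'))
    (map_zero _) (map_one _)) i) j)

end Generic

variable (M N A) in
/-- The target of the slot coaction: matrices over `A` with polynomial dependence on a point. -/
def SlotAlg : Type _ := Polynomial (Matrix (Idx M N) (Idx M N) A)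

instance : Ring (SlotAlg M N A) :=
  inferInstanceAs (Ring (Polynomial (Matrix (Idx M N) (Idx M N) A)))

instance : Algebra ℂ (SlotAlg M N A) :=
  inferInstanceAs (Algebra ℂ (Polynomial (Matrix (Idx M N) (Idx M N) A)))

/-- The entries of the coefficients of an element of the slot algebra. -/
def slotEntry (n : ℕ) (p q : Idx M N) : SlotAlg M N A →ₗ[ℂ] A where
  toFun x := (show Polynomial (Matrix (Idx M N) (Idx M N) A) from x).coeff n p q
  map_add' x y := by
    exact congrArg (fun Z : Matrix (Idx M N) (Idx M N) A => Z p q) (Polynomial.coeff_add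
      (show Polynomial (Matrix (Idx M N) (Idx M N) A) from x) y n)
  map_smul' c x := by
    exact congrArg (fun Z : Matrix (Idx M N) (Idx M N) A => Z p q) (Polynomial.coeff_smul c
      (show Polynomial (Matrix (Idx M N) (Idx M N) A) from x) n)

theorem slot_ext {x y : SlotAlg M N A} (h : ∀ n p q, slotEntry n p q x = slotEntry n p q y) :
    x = y :=
  Polynomial.ext fun n => Matrix.ext fun p q => h n p q

theorem slotEntry_mul (n : ℕ) (p q : Idx M N) (x y : SlotAlg M N A) : slotEntry n p q (x * y) =
    ∑ k ∈ Finset.HasAntidiagonal.antidiagonal n, ∑ m,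
      slotEntry k.1 p m x * slotEntry k.2 m q y := by
  refine (congrArg (fun Z : Matrix (Idx M N) (Idx M N) A => Z p q) (Polynomial.coeff_mul
    (show Polynomial (Matrix (Idx M N) (Idx M N) A) from x) y n)).trans ?_
  rw [Matrix.sum_apply]
  rfl

variable (M N) in
/-- A matrix as an element of the slot algebra. -/
def slotC : Matrix (Idx M N) (Idx M N) A →ₐ[ℂ] SlotAlg M N A := Polynomial.CAlgHom

theorem slotEntry_slotC (n : ℕ) (p q : Idx M N) (X : Matrix (Idx M N) (Idx M N) A) :
    slotEntry n p q (slotC M N X) = if n = 0 then X p q else 0 := by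
  refine (congrArg (fun Z : Matrix (Idx M N) (Idx M N) A => Z p q) (Polynomial.coeff_C (a := X) (n := n))).trans ?_
  split_ifs <;> rfl

variable (M N A) in
/-- The point of the slot. -/
def slotPt : SlotAlg M N A := (Polynomial.X : Polynomial (Matrix (Idx M N) (Idx M N) A))

theorem slotPt_commute (y : SlotAlg M N A) : Commute (slotPt M N A) y := Polynomial.commute_X y

theorem slotEntry_slotPt_pow_mul (n k : ℕ) (p q : Idx M N) (x : SlotAlg M N A) :
    slotEntry n p q (slotPt M N A ^ k * x) = if k ≤ n then slotEntry (n - k) p q x else 0 := by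
  refine (congrArg (fun Z : Matrix (Idx M N) (Idx M N) A => Z p q) (Polynomial.coeff_X_pow_mul'
    (show Polynomial (Matrix (Idx M N) (Idx M N) A) from x) k n)).trans ?_
  split_ifs <;> rfl

variable (M N) in
/-- The action of `A` on `A ⊗ V`, with signs given by the involution `γ`. -/
def slotIncl (γ : A →ₐ[ℂ] A) : A →ₐ[ℂ] SlotAlg M N A :=
  (slotC M N).comp ((Matrix.diagonalAlgHom ℂ).comp (AlgHom.pi fun i => γ ^ par i))

theorem slotIncl_apply (γ : A →ₐ[ℂ] A) (y : A) :
    slotIncl M N γ y = slotC M N (Matrix.diagonal fun i => (γ ^ par i) y) := rfl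

/-- The operators by which the generators of `gl_{M|N}` act on `V`. -/
def slotUnit (A : Type*) [Ring A] (i j : Idx M N) : Matrix (Idx M N) (Idx M N) A :=
  Matrix.single j i (-(-1) ^ (par i * par j))

theorem slotUnit_mul (i j k l : Idx M N) : slotUnit A i j * slotUnit A k l =
    if i = l then Matrix.single j k ((-1) ^ (par i * par j + par k * par l)) else 0 := by
  rw [slotUnit, slotUnit]
  split_ifs with h
  · subst h
    rw [Matrix.single_mul_single_same, neg_mul_neg, pow_add]
  · rw [Matrix.single_mul_single_of_ne _ _ _ _ h]

theorem sign_mul_single (e : ℕ) (i j : Idx M N) (a : A) :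
    (-1) ^ e * Matrix.single i j a = Matrix.single i j ((-1) ^ e * a) := by
  rcases Nat.even_or_odd e with h | h <;> simp [h, Matrix.single_neg]

/-- The operators are the negative super transposes of the matrix units, i.e. the representation of
gl_{M|N} on the dual of the defining one; the sign is needed for the commutators to come out right.
-/
theorem slotUnit_comm (i j k l : Idx M N) :
    (-1) ^ (par j * (par k + par l)) * (slotUnit A i j * slotUnit A k l) -
      (-1) ^ (par i * (par k + par l)) * (slotUnit A k l * slotUnit A i j) =
    (if k = j then (-1) ^ (par j * par l) * slotUnit A i l else 0) -
      if i = l then (-1) ^ (par i * par k) * slotUnit A k j else 0 := by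
  rw [slotUnit_mul, slotUnit_mul]
  have h1 : (-1) ^ (par j * (par k + par l)) * (if i = l then Matrix.single j k
      ((-1 : A) ^ (par i * par j + par k * par l)) else 0) =
      -if i = l then (-1) ^ (par i * par k) * slotUnit A k j else 0 := by
    split_ifs with h
    · subst h
      rw [slotUnit, sign_mul_single, sign_mul_single, mul_neg, ← Matrix.single_neg, neg_neg,
        ← pow_add, ← pow_add]
      congr 1
      rcases par_cases i with hi | hi <;> rcases par_cases j with hj | hj <;>
        rcases par_cases k with hk | hk <;> simp [hi, hj, hk, pow_succ]
    · simp
  have h2 : (-1) ^ (par i * (par k + par l)) * (if k = j then Matrix.single l i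
      ((-1 : A) ^ (par k * par l + par i * par j)) else 0) =
      -if k = j then (-1) ^ (par j * par l) * slotUnit A i l else 0 := by
    split_ifs with h
    · subst h
      rw [slotUnit, sign_mul_single, sign_mul_single, mul_neg, ← Matrix.single_neg, neg_neg,
        ← pow_add, ← pow_add]
      congr 1
      rcases par_cases i with hi | hi <;> rcases par_cases l with hl | hl <;>
        rcases par_cases k with hk | hk <;> simp [hi, hl, hk, pow_succ]
    · simp
  rw [h1, h2]
  abel

variable (M N A) in
/-- The operators of the slot as elements of the slot algebra. -/
def slotUnits : Matrix (Idx M N) (Idx M N) (SlotAlg M N A) :=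
  Matrix.of fun i j => slotC M N (slotUnit A i j)

theorem isGl_slotUnits : IsGl (slotUnits M N A) := by
  intro i j k l
  have := congrArg (slotC M N) (slotUnit_comm (A := A) i j k l)
  simp only [slotUnits, Matrix.of_apply]
  simpa only [map_sub, map_mul, map_pow, map_neg, map_one, apply_ite (slotC M N), map_zero]
    using this

variable (M N A) in
/-- The generating matrix of the slot, `1 + e / (u - a)`. -/
def slotSeries : Matrix (Idx M N) (Idx M N) (PowerSeries (SlotAlg M N A)) :=
  evalSeries (slotUnits M N A) (slotPt M N A)

theorem isRTTSeries_slotSeries : IsRTTSeries (slotSeries M N A) :=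
  isGl_slotUnits.isRTTSeries slotPt_commute

theorem pow_par_apply {γ : A →ₐ[ℂ] A} {y : A} {e : ℕ} (h : γ y = (-1) ^ e * y) (i : Idx M N) :
    (γ ^ par i) y = (-1) ^ (par i * e) * y := by
  rcases par_cases i with hi | hi <;> simp [hi, h]

/-- The powers of γ on the diagonal of `slotIncl` implement the sign picked up by y when it passes a
basis vector of V. -/
theorem slotUnit_mul_slotIncl {γ : A →ₐ[ℂ] A} {y : A} {e : ℕ} (h : γ y = (-1) ^ e * y)
    (i j : Idx M N) : slotC M N (slotUnit A i j) * slotIncl M N γ y =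
      (-1) ^ ((par i + par j) * e) * (slotIncl M N γ y * slotC M N (slotUnit A i j)) := by
  rw [slotIncl_apply, ← map_mul, ← map_mul]
  have sg : ∀ (e : ℕ) X, (-1) ^ e * slotC M N X =
      slotC M N ((-1) ^ e * X : Matrix (Idx M N) (Idx M N) A) := fun e X => by
    rw [map_mul, map_pow, map_neg, map_one]
  rw [sg]
  congr 1
  have h1 : Matrix.diagonal (fun i : Idx M N => (γ ^ par i) y) * slotUnit A i j =
      Matrix.single j i ((-1) ^ (par j * e) * y * -(-1) ^ (par i * par j)) := by
    ext a b
    rw [Matrix.diagonal_mul, slotUnit, Matrix.single_apply, Matrix.single_apply, mul_ite, mul_zero]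
    split_ifs with hab
    · rw [← hab.1, pow_par_apply h]
    · rfl
  have h2 : slotUnit A i j * Matrix.diagonal (fun i : Idx M N => (γ ^ par i) y) =
      Matrix.single j i (-(-1) ^ (par i * par j) * ((-1) ^ (par i * e) * y)) := by
    ext a b
    rw [Matrix.mul_diagonal, slotUnit, Matrix.single_apply, Matrix.single_apply, ite_mul, zero_mul]
    split_ifs with hab
    · rw [← hab.2, pow_par_apply h]
    · rfl
  rw [h1, h2, sign_mul_single]
  congr 1
  rcases neg_one_pow_eq_or A e with he | he <;>
  rcases par_cases i with hi | hi <;> rcases par_cases j with hj | hj <;>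
    simp [hi, hj, he]

theorem sCommSeries_slotSeries {γ : A →ₐ[ℂ] A} {S : Matrix (Idx M N) (Idx M N) (PowerSeries A)}
    (h : ∀ i j, PowerSeries.map (γ : A →+* A) (S i j) = (-1) ^ (par i + par j) * S i j) :
    SCommSeries (slotSeries M N A)
      (S.map (PowerSeries.map (slotIncl M N γ : A →+* SlotAlg M N A))) := by
  refine sCommSeries_evalSeries slotPt_commute fun n i j k l => ?_
  have h' : γ (coeff n (S k l)) = (-1) ^ (par k + par l) *
      coeff n (S k l) := by
    have := congrArg (coeff n) (h k l)
    rw [coeff_neg_one_pow_mul, coeff_map] at this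
    exact this
  exact slotUnit_mul_slotIncl h' i j

theorem slotSeries_map_constantCoeff :
    (slotSeries M N A).map constantCoeff = 1 := evalSeries_map_constantCoeff _ _

theorem map_map_constantCoeff {B : Type*} [Ring B] [Algebra ℂ B] (φ : A →ₐ[ℂ] B)
    (S : Matrix (Idx M N) (Idx M N) (PowerSeries A)) :
    (S.map (PowerSeries.map (φ : A →+* B))).map constantCoeff =
      (S.map constantCoeff).map φ := by
  ext i j
  rw [Matrix.map_apply, Matrix.map_apply, Matrix.map_apply, Matrix.map_apply,
    ← coeff_zero_eq_constantCoeff_apply, coeff_map,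
    coeff_zero_eq_constantCoeff_apply]
  rfl

theorem map_algebraMap {B : Type*} [Ring B] [Algebra ℂ B] (φ : A →ₐ[ℂ] B)
    (G : Matrix (Idx M N) (Idx M N) ℂ) :
    (G.map (algebraMap ℂ A)).map φ = G.map (algebraMap ℂ B) := by
  ext i j
  exact φ.commutes _

/-- Dressing the generators of Y^{tw} by the evaluation solution. The target is polynomial in the
point a because the coefficients of (u - a)⁻¹ are powers of a. -/
theorem exists_slotTw {G : Matrix (Idx M N) (Idx M N) ℂ} (hG : IsSupersymmetric G) :
    ∃ φ : YTw G →ₐ[ℂ] SlotAlg M N (YTw G),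
      (sStd G).map (PowerSeries.map (φ : YTw G →+* SlotAlg M N (YTw G))) =
        slotSeries M N (YTw G) * (sStd G).map (PowerSeries.map
          (slotIncl M N (parTw hG) : YTw G →+* SlotAlg M N (YTw G))) *
          str ((slotSeries M N (YTw G)).map negArg) := by
  refine exists_ytw_hom_of_constantCoeff hG _ ((isTwSeries_sStd.map _).conj
    isRTTSeries_slotSeries (sCommSeries_slotSeries (map_parTw hG))) ?_
  rw [conj_map_constantCoeff slotSeries_map_constantCoeff, map_map_constantCoeff,
    sStd_map_constantCoeff hG, map_algebraMap]

theorem exists_slotGl (M N : ℕ) : ∃ φ : YGl M N →ₐ[ℂ] SlotAlg M N (YGl M N),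
    (tStd M N).map (PowerSeries.map (φ : YGl M N →+* SlotAlg M N (YGl M N))) =
      slotSeries M N (YGl M N) * (tStd M N).map (PowerSeries.map
        (slotIncl M N (parGl M N) : YGl M N →+* SlotAlg M N (YGl M N))) := by
  refine exists_ygl_hom_of_constantCoeff _ (isRTTSeries_slotSeries.mul
    (isRTTSeries_tStd.map _) (sCommSeries_slotSeries map_parGl)) ?_
  rw [Matrix.map_mul, slotSeries_map_constantCoeff, one_mul, map_map_constantCoeff,
    tStd_map_constantCoeff, Matrix.map_one _ (map_zero _) (map_one _)]

/-- The slot coaction of `Y^{tw}`. -/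
def slotTw {G : Matrix (Idx M N) (Idx M N) ℂ} (hG : IsSupersymmetric G) :
    YTw G →ₐ[ℂ] SlotAlg M N (YTw G) := (exists_slotTw hG).choose

variable (M N) in
/-- The slot coaction of `Y(gl)`. -/
def slotGl : YGl M N →ₐ[ℂ] SlotAlg M N (YGl M N) := (exists_slotGl M N).choose

theorem map_slotTw {G : Matrix (Idx M N) (Idx M N) ℂ} (hG : IsSupersymmetric G) :
    (sStd G).map (PowerSeries.map (slotTw hG : YTw G →+* SlotAlg M N (YTw G))) =
      slotSeries M N (YTw G) * (sStd G).map (PowerSeries.map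
        (slotIncl M N (parTw hG) : YTw G →+* SlotAlg M N (YTw G))) *
        str ((slotSeries M N (YTw G)).map negArg) := (exists_slotTw hG).choose_spec

theorem map_slotGl : (tStd M N).map (PowerSeries.map
    (slotGl M N : YGl M N →+* SlotAlg M N (YGl M N))) =
      slotSeries M N (YGl M N) * (tStd M N).map (PowerSeries.map
        (slotIncl M N (parGl M N) : YGl M N →+* SlotAlg M N (YGl M N))) :=
  (exists_slotGl M N).choose_spec

/-- The extension of a homomorphism to the slot algebras. -/
def slotMap (M N : ℕ) {B : Type*} [Ring B] [Algebra ℂ B] (φ : A →ₐ[ℂ] B) :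
    SlotAlg M N A →ₐ[ℂ] SlotAlg M N B := Polynomial.mapAlgHom φ.mapMatrix

theorem slotEntry_slotMap {B : Type*} [Ring B] [Algebra ℂ B] (φ : A →ₐ[ℂ] B)
    (n : ℕ) (i j : Idx M N) (x : SlotAlg M N A) :
    slotEntry n i j (slotMap M N φ x) = φ (slotEntry n i j x) :=
  congrArg (fun Z : Matrix (Idx M N) (Idx M N) B => Z i j) (Polynomial.coeff_map _ n)

theorem slotMap_slotC {B : Type*} [Ring B] [Algebra ℂ B] (φ : A →ₐ[ℂ] B)
    (X : Matrix (Idx M N) (Idx M N) A) :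
    slotMap M N φ (slotC M N X) = slotC M N (X.map φ) := Polynomial.map_C _

theorem slotMap_slotPt {B : Type*} [Ring B] [Algebra ℂ B] (φ : A →ₐ[ℂ] B) :
    slotMap M N φ (slotPt M N A) = slotPt M N B := Polynomial.map_X _

theorem map_slotUnits {B : Type*} [Ring B] [Algebra ℂ B] (φ : A →ₐ[ℂ] B) :
    (slotUnits M N A).map (slotMap M N φ) = slotUnits M N B := by
  ext i j : 2
  rw [Matrix.map_apply, slotUnits, slotUnits, Matrix.of_apply, Matrix.of_apply, slotMap_slotC]
  congr 1
  ext a b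
  simp only [slotUnit, Matrix.map_apply, Matrix.single_apply]
  split_ifs <;> simp

theorem map_slotSeries {B : Type*} [Ring B] [Algebra ℂ B] (φ : A →ₐ[ℂ] B) :
    (slotSeries M N A).map (PowerSeries.map
      (slotMap M N φ : SlotAlg M N A →+* SlotAlg M N B)) = slotSeries M N B := by
  rw [slotSeries, map_evalSeries, map_slotUnits, slotMap_slotPt]
  rfl

theorem slotMap_slotIncl {B : Type*} [Ring B] [Algebra ℂ B] (φ : A →ₐ[ℂ] B) {γ : A →ₐ[ℂ] A}
    {γ' : B →ₐ[ℂ] B} (h : ∀ y, φ (γ y) = γ' (φ y)) (y : A) :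
    slotMap M N φ (slotIncl M N γ y) = slotIncl M N γ' (φ y) := by
  rw [slotIncl_apply, slotIncl_apply, slotMap_slotC]
  congr 1
  ext a b
  rcases eq_or_ne a b with rfl | hab
  · rcases par_cases a with ha | ha <;> simp [ha, h]
  · simp [hab]

end Slot

/-! ### The filtration -/

section Commutator

variable {M N : ℕ} {K A : Type*} [CommRing K] [Ring A] [Algebra K A]

/-- The quaternary relation as a formula for the supercommutator. -/
theorem IsQuat.comm {α β : K} {S S' : Matrix (Idx M N) (Idx M N) A} (h : IsQuat α β S S')
    (i j k l : Idx M N) {c q : A}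
    (hc : c = (-1) ^ (par j * (par k + par l)) * (S i j * S' k l) -
      (-1) ^ (par i * (par k + par l)) * (S' k l * S i j))
    (hq : q = (-1) ^ (par j * par l) * (S i k * S' j l) - (-1) ^ (par i * par k) * (S' k i * S l j)) :
    α • α • c - β • β • c = α • β • β • q - α • β • α • q + α • β •
      ((-1) ^ (par i * par k) * (-(α • ((-1) ^ (par j * (par i + par l)) * (S k j * S' i l)) +
          β • ((-1) ^ (par j * (par i + par l)) * (S k j * S' i l))) -
        α • β • ((-1) ^ (par j * par l) * (S k i * S' j l))) -
      (-1) ^ (par j * par l) * (-(α • ((-1) ^ (par i * (par k + par j)) * (S' k j * S i l)) +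
          β • ((-1) ^ (par i * (par k + par j)) * (S' k j * S i l))) -
        α • β • ((-1) ^ (par i * par k) * (S' k i * S j l)))) := by
  have h := isQuat_iff.1 h i k j l
  simp only [quatL, quatR] at h
  rw [hc, hq]
  rcases neg_one_pow_eq_or A (par i * par k) with h1 | h1 <;>
    rcases neg_one_pow_eq_or A (par j * par l) with h2 | h2 <;>
    simp only [h1, h2, one_mul, neg_mul] at h ⊢ <;>
    linear_combination (norm := module) h

end Commutator

section Filtration

variable {M N : ℕ} {A : Type*} [Ring A] [Algebra ℂ A]

/-- The algebra `A` with parity involution `γ` is generated by the coefficients of a series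
satisfying the relations of the twisted super Yangian. -/
structure IsTwGen (G : Matrix (Idx M N) (Idx M N) ℂ) (S : Matrix (Idx M N) (Idx M N) (PowerSeries A))
    (γ : A →ₐ[ℂ] A) : Prop where
  supersymm : IsSupersymmetric G
  rel : IsTwSeries S
  zero : ∀ i j, coeff 0 (S i j) = algebraMap ℂ A (G i j)
  gen : ∀ B : Subalgebra ℂ A, (∀ i j n, coeff n (S i j) ∈ B) → B = ⊤
  par : ∀ i j, PowerSeries.map (γ : A →+* A) (S i j) = (-1) ^ (par i + par j) * S i j

variable (S : Matrix (Idx M N) (Idx M N) (PowerSeries A))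

/-- The weight of a generator: `2r - 1` for upper index `r`. -/
def wt (g : Gen M N) : ℕ := 2 * g.2.2 + 1

/-- The coefficients of `S(u)`. -/
def sCoeff (i j : Idx M N) (n : ℕ) : A := coeff n (S i j)

/-- The generator with a given label. -/
def letter (g : Gen M N) : A := sCoeff S g.1 g.2.1 (g.2.2 + 1)

/-- The product of a list of generators. -/
def word (l : List (Gen M N)) : A := (l.map (letter S)).prod

/-- The weight of a list of generators. -/
def wtList (l : List (Gen M N)) : ℕ := (l.map wt).sum

/-- The span of the words of weight at most `d`. -/
def filt (d : ℤ) : Submodule ℂ (A) :=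
  Submodule.span ℂ {x | ∃ l : List (Gen M N), (wtList l : ℤ) ≤ d ∧ word S l = x}

variable {S} {G : Matrix (Idx M N) (Idx M N) ℂ} {γ : A →ₐ[ℂ] A}

theorem word_mem {l : List (Gen M N)} {d : ℤ} (h : (wtList l : ℤ) ≤ d) : word S l ∈ filt S d :=
  Submodule.subset_span ⟨l, h, rfl⟩

theorem filt_mono {d e : ℤ} (h : d ≤ e) : filt S d ≤ filt S e :=
  Submodule.span_mono fun _ ⟨l, hl, hx⟩ => ⟨l, hl.trans h, hx⟩

theorem wtList_append (l l' : List (Gen M N)) : wtList (l ++ l') = wtList l + wtList l' := by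
  simp [wtList]

theorem word_append (l l' : List (Gen M N)) : word S (l ++ l') = word S l * word S l' := by
  simp [word]

theorem word_cons (g : Gen M N) (l : List (Gen M N)) : word S (g :: l) = letter S g * word S l := by
  simp [word]

theorem wtList_cons (g : Gen M N) (l : List (Gen M N)) : wtList (g :: l) = wt g + wtList l := by
  simp [wtList]

theorem mul_mem_filt {d e : ℤ} {x y : A} (hx : x ∈ filt S d) (hy : y ∈ filt S e) :
    x * y ∈ filt S (d + e) := by
  have h : filt S d * filt S e ≤ filt S (d + e) := by
    unfold filt
    rw [Submodule.span_mul_span]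
    refine Submodule.span_mono ?_
    rintro _ ⟨_, ⟨l, hl, rfl⟩, _, ⟨l', hl', rfl⟩, rfl⟩
    refine ⟨l ++ l', ?_, word_append l l'⟩
    rw [wtList_append]; push_cast; omega
  exact h (Submodule.mul_mem_mul hx hy)

theorem one_mem_filt : (1 : A) ∈ filt S 0 := word_mem (l := []) (by simp [wtList])

theorem algebraMap_mem_filt (c : ℂ) : algebraMap ℂ (A) c ∈ filt S 0 := by
  rw [Algebra.algebraMap_eq_smul_one]
  exact Submodule.smul_mem _ _ one_mem_filt

theorem filt_neg {d : ℤ} (h : d < 0) {x : A} (hx : x ∈ filt S d) : x = 0 := by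
  have : filt S d = ⊥ := by
    unfold filt
    rw [Submodule.span_eq_bot]
    rintro _ ⟨l, hl, _⟩
    omega
  rw [this] at hx
  exact hx

theorem mem_filt_zero {x : A} (hx : x ∈ filt S 0) : ∃ c : ℂ, x = algebraMap ℂ _ c := by
  refine Submodule.span_induction ?_ ⟨0, by simp⟩ ?_ ?_ hx
  · rintro _ ⟨l, hl, rfl⟩
    cases l with
    | nil => exact ⟨1, by simp [word]⟩
    | cons g l => rw [wtList_cons, wt] at hl; omega
  · rintro x y _ _ ⟨c, rfl⟩ ⟨d, rfl⟩
    exact ⟨c + d, by simp⟩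
  · rintro c x _ ⟨d, rfl⟩
    exact ⟨c * d, by rw [map_mul, Algebra.smul_def]⟩

theorem word_mem_top (hS : IsTwGen G S γ) (x : A) : x ∈ Submodule.span ℂ (Set.range (word S)) := by
  let B : Subalgebra ℂ A := (Submodule.span ℂ (Set.range (word S))).toSubalgebra
    (Submodule.subset_span ⟨[], by simp [word]⟩) (by
      intro x y hx hy
      have := Submodule.mul_mem_mul hx hy
      rw [Submodule.span_mul_span] at this
      refine Submodule.span_mono ?_ this
      rintro _ ⟨_, ⟨l, rfl⟩, _, ⟨l', rfl⟩, rfl⟩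
      exact ⟨l ++ l', word_append l l'⟩)
  have hB : B = ⊤ := hS.gen B fun i j n => by
    cases n with
    | zero => rw [hS.zero]; exact B.algebraMap_mem _
    | succ n => exact Submodule.subset_span ⟨[(i, j, n)], by simp [word, letter, sCoeff]⟩
  have : x ∈ B := by rw [hB]; trivial
  exact this

theorem exists_mem_filt (hS : IsTwGen G S γ) (x : A) : ∃ d : ℕ, x ∈ filt S d := by
  refine Submodule.span_induction ?_ ⟨0, Submodule.zero_mem _⟩ ?_ ?_ (word_mem_top hS x)
  · rintro _ ⟨l, rfl⟩
    exact ⟨wtList l, word_mem le_rfl⟩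
  · rintro x y _ _ ⟨d, hd⟩ ⟨e, he⟩
    exact ⟨d + e, Submodule.add_mem _ (filt_mono (by push_cast; omega) hd)
      (filt_mono (by push_cast; omega) he)⟩
  · rintro c x _ ⟨d, hd⟩
    exact ⟨d, Submodule.smul_mem _ _ hd⟩

theorem sCoeff_zero (hS : IsTwGen G S γ) (i j : Idx M N) :
    sCoeff S i j 0 = algebraMap ℂ _ (G i j) := hS.zero i j

theorem sign_mul_mem {A : Type*} [Ring A] [Algebra ℂ A] {P : Submodule ℂ A} {x : A} (e : ℕ) :
    (-1) ^ e * x ∈ P ↔ x ∈ P := by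
  rcases neg_one_pow_eq_or A e with h | h
  · rw [h, one_mul]
  · rw [h, neg_one_mul, Submodule.neg_mem_iff]

theorem letter_mem (g : Gen M N) : letter S g ∈ filt S (wt g) := by
  have := word_mem (S := S) (l := [g]) (d := wt g) (by simp [wtList])
  simpa [word] using this

theorem sCoeff_succ_mem (i j : Idx M N) (r : ℕ) : sCoeff S i j (r + 1) ∈ filt S (2 * r + 1) :=
  filt_mono (by simp [wt]) (letter_mem (S := S) (i, j, r))

/-- The weight bound for coefficients of `S(u)`. -/
def bd (n : ℕ) : ℤ := max (2 * n - 1) 0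

theorem sCoeff_mem (hS : IsTwGen G S γ) (i j : Idx M N) (n : ℕ) :
    sCoeff S i j n ∈ filt S (bd n) := by
  cases n with
  | zero => rw [sCoeff_zero hS]; exact filt_mono (by simp [bd]) (algebraMap_mem_filt _)
  | succ r => exact filt_mono (by simp only [bd]; push_cast; omega) (sCoeff_succ_mem i j r)

/-- If both indices are positive there is one unit of weight to spare; the bound is sharp when one
index is 0, where the coefficient is a scalar. -/
theorem sCoeff_mul_mem (hS : IsTwGen G S γ) (i j k l : Idx M N) (m n : ℕ) :
    sCoeff S i j m * sCoeff S k l n ∈ filt S (bd (m + n)) :=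
  filt_mono (by simp only [bd]; push_cast; omega)
    (mul_mem_filt (sCoeff_mem hS i j m) (sCoeff_mem hS k l n))

theorem coeff_negArg {A : Type*} [Ring A] [Algebra ℂ A] (f : PowerSeries A) (n : ℕ) :
    coeff n (negArg f) = (-1) ^ n * coeff n f := by
  rw [negArg, coeff_substInv (by simp) _ (K := n + 1) (by omega), Finset.sum_eq_single n]
  · rw [neg_pow, ← map_one PowerSeries.C, ← map_neg, ← map_pow, coeff_C_mul,
      PowerSeries.coeff_X_pow, if_pos rfl, mul_one]
    rcases neg_one_pow_eq_or ℂ n with h | h <;> rcases Nat.even_or_odd n with h' | h' <;>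
      simp [h']
  · intro r _ hr
    rw [neg_pow, ← map_one PowerSeries.C, ← map_neg, ← map_pow, coeff_C_mul,
      PowerSeries.coeff_X_pow, if_neg hr.symm, mul_zero, zero_smul]
  · simp

/-- The generators are symmetric up to terms of lower weight. -/
theorem sCoeff_symm (hS : IsTwGen G S γ) (i j : Idx M N) (r : ℕ) :
    (-1) ^ (par i * par j + (r + 1)) * sCoeff S j i (r + 1) - sCoeff S i j (r + 1) ∈
      filt S (2 * r) := by
  have h := congrArg (coeff (r + 1)) (hS.rel.symm i j)
  rw [series_X_smul, series_ofNat_smul, series_ofNat_smul] at h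
  simp only [map_add, coeff_neg_one_pow_mul, Matrix.map_apply, coeff_negArg,
    PowerSeries.coeff_succ_X_mul, map_sub] at h
  rw [← mul_assoc, ← pow_add] at h
  have h' : (-1) ^ (par i * par j + (r + 1)) * sCoeff S j i (r + 1) - sCoeff S i j (r + 1) =
      (1 / 2 : ℂ) • (sCoeff S i j r - (-1) ^ r * sCoeff S i j r) := by
    have h2 : ∀ y : A, y = (1 / 2 : ℂ) • (y + y) := by
      intro y; rw [← two_smul ℂ, smul_smul]; norm_num
    rw [h2 ((-1) ^ (par i * par j + (r + 1)) * sCoeff S j i (r + 1) - sCoeff S i j (r + 1))]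
    congr 1
    simp only [sCoeff] at h ⊢
    rw [show ∀ a b : A, a - b + (a - b) = a + a - (b + b) by intros; abel, h]
    abel
  rw [h']
  have := filt_mono (e := 2 * (r : ℤ)) (by simp only [bd]; omega) (sCoeff_mem hS i j r)
  exact Submodule.smul_mem _ _ (Submodule.sub_mem _ this ((sign_mul_mem r).2 this))

end Filtration

/-! ### Supercommutators lower the weight -/

section Commutators

variable {M N : ℕ} {A : Type*} [Ring A] [Algebra ℂ A]
  {S : Matrix (Idx M N) (Idx M N) (PowerSeries A)} {G : Matrix (Idx M N) (Idx M N) ℂ}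
  {γ : A →ₐ[ℂ] A}

variable (S) in
/-- Series in two variables whose coefficients of total degree `m + n` have weight at most `bd n`. -/
def degSub (m : ℕ) : Submodule ℂ (PowerSeries (PowerSeries (A))) where
  carrier := {f | ∀ a b, (a + b < m → coeff b (coeff a f) = 0) ∧
    ∀ n, a + b = n + m → coeff b (coeff a f) ∈ filt S (bd n)}
  zero_mem' := fun a b => ⟨fun _ => by simp, fun n _ => by simp⟩
  add_mem' := fun {f g} hf hg a b => ⟨fun h => by
      rw [map_add, map_add, (hf a b).1 h, (hg a b).1 h, add_zero], fun n h => by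
      rw [map_add, map_add]; exact Submodule.add_mem _ ((hf a b).2 n h) ((hg a b).2 n h)⟩
  smul_mem' := fun c f hf a b => ⟨fun h => by simp [(hf a b).1 h], fun n h => by
    simpa using Submodule.smul_mem _ c ((hf a b).2 n h)⟩

theorem inU_X_smul {A : Type*} [Ring A] [Algebra ℂ A] (f : PowerSeries (PowerSeries A)) :
    (inU PowerSeries.X : PowerSeries (PowerSeries ℂ)) • f = PowerSeries.X * f := by
  rw [inU_smul, PowerSeries.map_X, inU, PowerSeries.map_X]

theorem inV_X_smul {A : Type*} [Ring A] [Algebra ℂ A] (f : PowerSeries (PowerSeries A)) :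
    (inV PowerSeries.X : PowerSeries (PowerSeries ℂ)) • f = PowerSeries.C PowerSeries.X * f := by
  rw [inV_smul, PowerSeries.map_X, inV]

theorem X_mul_mem {m : ℕ} {f : PowerSeries (PowerSeries (A))} (hf : f ∈ degSub S m) :
    PowerSeries.X * f ∈ degSub S (m + 1) := by
  intro a b
  cases a with
  | zero => simp
  | succ a =>
    rw [PowerSeries.coeff_succ_X_mul]
    exact ⟨fun h => (hf a b).1 (by omega), fun n h => (hf a b).2 n (by omega)⟩

theorem CX_mul_mem {m : ℕ} {f : PowerSeries (PowerSeries (A))} (hf : f ∈ degSub S m) :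
    PowerSeries.C PowerSeries.X * f ∈ degSub S (m + 1) := by
  intro a b
  rw [coeff_C_mul]
  cases b with
  | zero => simp
  | succ b =>
    rw [PowerSeries.coeff_succ_X_mul]
    exact ⟨fun h => (hf a b).1 (by omega), fun n h => (hf a b).2 n (by omega)⟩

theorem sign_mul_mem_degSub {m : ℕ} (e : ℕ) {f : PowerSeries (PowerSeries (A))}
    (hf : f ∈ degSub S m) : (-1) ^ e * f ∈ degSub S m := by
  rcases neg_one_pow_eq_or (PowerSeries (PowerSeries (A))) e with h | h <;> simpa [h] using hf

theorem coeff_inU_mul_inV {A : Type*} [Ring A] (f g : PowerSeries A) (a b : ℕ) :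
    coeff b (coeff a (inU f * inV g)) =
      coeff a f * coeff b g := by
  simp [inU, inV]

theorem coeff_inV_mul_inU {A : Type*} [Ring A] (f g : PowerSeries A) (a b : ℕ) :
    coeff b (coeff a (inV f * inU g)) =
      coeff b f * coeff a g := by
  simp [inU, inV]

theorem inU_mul_inV_mem (hS : IsTwGen G S γ) (i j k l : Idx M N) :
    (S).map inU i j * (S).map inV k l ∈ degSub S 0 := by
  intro a b
  rw [Matrix.map_apply, Matrix.map_apply, coeff_inU_mul_inV]
  exact ⟨fun h => absurd h (by omega), fun n h => by
    rw [add_zero] at h; rw [← h]; exact sCoeff_mul_mem hS i j k l a b⟩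

theorem inV_mul_inU_mem (hS : IsTwGen G S γ) (i j k l : Idx M N) :
    (S).map inV i j * (S).map inU k l ∈ degSub S 0 := by
  intro a b
  rw [Matrix.map_apply, Matrix.map_apply, coeff_inV_mul_inU]
  exact ⟨fun h => absurd h (by omega), fun n h => by
    rw [add_zero, add_comm] at h; rw [← h]; exact sCoeff_mul_mem hS i j k l b a⟩

/-- The supercommutator of two entries of `S(u)` and `S(v)`, up to a sign. -/
def commSeries (S : Matrix (Idx M N) (Idx M N) (PowerSeries A)) (i j k l : Idx M N) :
    PowerSeries (PowerSeries (A)) :=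
  (-1) ^ (par j * (par k + par l)) * ((S).map inU i j * (S).map inV k l) -
    (-1) ^ (par i * (par k + par l)) * ((S).map inV k l * (S).map inU i j)

/-- The quaternary relation expresses (u⁻² - v⁻²) times the supercommutator by products of entries
carrying at least three factors u⁻¹ or v⁻¹. The terms with four such factors satisfy the bound all
the more (`low`). -/
theorem commSeries_mem (hS : IsTwGen G S γ) (i j k l : Idx M N) :
    PowerSeries.X * (PowerSeries.X * commSeries S i j k l) - PowerSeries.C PowerSeries.X *
      (PowerSeries.C PowerSeries.X * commSeries S i j k l) ∈ degSub S 3 := by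
  have h := hS.rel.quat.comm i j k l (c := commSeries S i j k l) rfl rfl
  simp only [inU_X_smul, inV_X_smul] at h
  rw [h]
  have m1 := inU_mul_inV_mem hS
  have m2 := inV_mul_inU_mem hS
  have low : ∀ f, f ∈ degSub S 2 → f ∈ degSub S 1 := fun f hf a b =>
    ⟨fun h => (hf a b).1 (by omega), fun n h => by
      cases n with
      | zero => rw [(hf a b).1 (by omega)]; exact Submodule.zero_mem _
      | succ n => exact filt_mono (by simp only [bd]; push_cast; omega) ((hf a b).2 n (by omega))⟩
  have q := Submodule.sub_mem _ (sign_mul_mem_degSub (par j * par l) (m1 i k j l))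
    (sign_mul_mem_degSub (par i * par k) (m2 k i l j))
  refine Submodule.add_mem _ (Submodule.sub_mem _ (X_mul_mem (CX_mul_mem (CX_mul_mem q)))
    (X_mul_mem (CX_mul_mem (X_mul_mem q)))) (X_mul_mem (CX_mul_mem ?_))
  refine Submodule.sub_mem _ (sign_mul_mem_degSub _ (Submodule.sub_mem _ (Submodule.neg_mem _
    (Submodule.add_mem _ (X_mul_mem (sign_mul_mem_degSub _ (m1 _ _ _ _)))
      (CX_mul_mem (sign_mul_mem_degSub _ (m1 _ _ _ _))))) (low _ (X_mul_mem (CX_mul_mem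
      (sign_mul_mem_degSub _ (m1 _ _ _ _))))))) (sign_mul_mem_degSub _ (Submodule.sub_mem _
      (Submodule.neg_mem _ (Submodule.add_mem _ (X_mul_mem (sign_mul_mem_degSub _ (m2 _ _ _ _)))
      (CX_mul_mem (sign_mul_mem_degSub _ (m2 _ _ _ _))))) (low _ (X_mul_mem (CX_mul_mem
      (sign_mul_mem_degSub _ (m2 _ _ _ _)))))))

theorem coeff_commSeries (i j k l : Idx M N) (a b : ℕ) :
    coeff b (coeff a (commSeries S i j k l)) =
      (-1) ^ (par j * (par k + par l)) * (sCoeff S i j a * sCoeff S k l b) -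
        (-1) ^ (par i * (par k + par l)) * (sCoeff S k l b * sCoeff S i j a) := by
  rw [commSeries, map_sub, map_sub, coeff_neg_one_pow_mul, coeff_neg_one_pow_mul,
    coeff_neg_one_pow_mul, coeff_neg_one_pow_mul]
  simp only [Matrix.map_apply, coeff_inU_mul_inV, coeff_inV_mul_inU, sCoeff]

/-- Comparing coefficients in `commSeries_mem` relates the supercommutator at (a + 2, b) to the one
at (a, b + 2), so the first index can be lowered by 2 until it is 0 or 1. -/
theorem coeff_commSeries_mem (hS : IsTwGen G S γ) (i j k l : Idx M N) (a b : ℕ) (hb : 1 ≤ b) :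
    coeff b (coeff a (commSeries S i j k l)) ∈
      filt S (2 * a + 2 * b - 3) := by
  have h := commSeries_mem hS i j k l
  induction a using Nat.strong_induction_on generalizing b with
  | _ a ih =>
  -- For a = 0 one entry is a scalar and the supercommutator vanishes. For a = 1 the comparison term
  -- would have index -1, so the bound holds at once; 2b - 1 is the value of `bd b` only because b ≥
  -- 1.
  rcases a with _ | _ | a
  · rw [coeff_commSeries, sCoeff_zero hS, ← Algebra.commutes (G i j)]
    by_cases hp : par i = par j
    · rw [hp, sub_self]; exact Submodule.zero_mem _
    · rw [hS.supersymm.isEven i j hp]; simp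
  · have := (h 1 (b + 2)).2 b (by omega)
    rw [map_sub, map_sub, ← zero_add 1, PowerSeries.coeff_succ_X_mul, PowerSeries.coeff_zero_X_mul,
      coeff_C_mul, coeff_C_mul, PowerSeries.coeff_succ_X_mul,
      PowerSeries.coeff_succ_X_mul, map_zero, zero_sub, Submodule.neg_mem_iff] at this
    exact filt_mono (by simp only [bd]; push_cast; omega) this
  · have := (h (a + 2) (b + 2)).2 (a + b + 1) (by omega)
    rw [map_sub, map_sub, PowerSeries.coeff_succ_X_mul, PowerSeries.coeff_succ_X_mul,
      coeff_C_mul, coeff_C_mul, PowerSeries.coeff_succ_X_mul,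
      PowerSeries.coeff_succ_X_mul] at this
    have h1 := ih a (by omega) (b + 2) (by omega)
    have h2 := Submodule.sub_mem _ (filt_mono (e := 2 * (a : ℤ) + 2 * b + 1)
      (by push_cast; omega) h1) (filt_mono (e := 2 * (a : ℤ) + 2 * b + 1)
        (by simp only [bd]; push_cast; omega) this)
    rw [sub_sub_cancel] at h2
    exact filt_mono (by push_cast; omega) h2

/-- The generators supercommute up to terms of lower weight. -/
theorem sCoeff_comm_mem (hS : IsTwGen G S γ) (i j k l : Idx M N) (a b : ℕ) :
    sCoeff S i j (a + 1) * sCoeff S k l (b + 1) - (-1) ^ ((par i + par j) * (par k + par l)) *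
      (sCoeff S k l (b + 1) * sCoeff S i j (a + 1)) ∈ filt S (2 * a + 2 * b + 1) := by
  have h := coeff_commSeries_mem hS i j k l (a + 1) (b + 1) (by omega)
  rw [coeff_commSeries] at h
  rw [← sign_mul_mem (par j * (par k + par l)), mul_sub, ← mul_assoc ((-1) ^ _) ((-1) ^ _),
    ← pow_add, show par j * (par k + par l) + (par i + par j) * (par k + par l) =
      par i * (par k + par l) + (par j * (par k + par l) + par j * (par k + par l)) by ring,
    pow_add, neg_one_pow_add_self, mul_one]
  exact filt_mono (by push_cast; omega) h

theorem par_sCoeff (hS : IsTwGen G S γ) (i j : Idx M N) (n : ℕ) :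
    γ (sCoeff S i j n) = (-1) ^ (par i + par j) * sCoeff S i j n := by
  have := congrArg (coeff n) (hS.par i j)
  rw [coeff_neg_one_pow_mul, coeff_map] at this
  exact this

theorem map_sign_mul {A B : Type*} [Ring A] [Ring B] [Algebra ℂ A] [Algebra ℂ B] (φ : A →ₐ[ℂ] B)
    (e : ℕ) (x : A) : φ ((-1) ^ e * x) = (-1) ^ e * φ x := by
  rw [map_mul, map_pow, map_neg, map_one]

theorem sign_comm {A : Type*} [Ring A] (e : ℕ) (x y : A) : x * ((-1) ^ e * y) =
    (-1) ^ e * (x * y) := by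
  rcases neg_one_pow_eq_or A e with h | h <;> simp [h]

theorem par_letter (hS : IsTwGen G S γ) (g : Gen M N) :
    γ (letter S g) = (-1) ^ (par g.1 + par g.2.1) * letter S g := par_sCoeff hS _ _ _

theorem par_mem (hS : IsTwGen G S γ) {d : ℤ} {x : A} (hx : x ∈ filt S d) :
    γ x ∈ filt S d := by
  have hw : ∀ l, ∃ e : ℕ, γ (word S l) = (-1) ^ e * word S l := by
    intro l
    induction l with
    | nil => exact ⟨0, by simp [word]⟩
    | cons g l ih =>
      obtain ⟨e, he⟩ := ih
      refine ⟨par g.1 + par g.2.1 + e, ?_⟩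
      rw [word_cons, map_mul, he, par_letter hS, sign_comm, ← mul_assoc, ← mul_assoc, ← pow_add,
        mul_assoc, add_comm]
  refine Submodule.span_induction ?_ (by simp) ?_ ?_ hx
  · rintro _ ⟨l, hl, rfl⟩
    obtain ⟨e, he⟩ := hw l
    rw [he, sign_mul_mem]
    exact word_mem hl
  · intro x y _ _ hx hy
    rw [map_add]; exact Submodule.add_mem _ hx hy
  · intro c x _ hx
    rw [map_smul]; exact Submodule.smul_mem _ _ hx

theorem par_pow_mem (hS : IsTwGen G S γ) {d : ℤ} {x : A} (hx : x ∈ filt S d)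
    (n : ℕ) : (γ ^ n) x ∈ filt S d := by
  induction n with
  | zero => simpa
  | succ n ih => rw [pow_succ', AlgHom.mul_apply]; exact par_mem hS ih

theorem pow_apply_of_sign {A : Type*} [Ring A] [Algebra ℂ A] {γ : A →ₐ[ℂ] A} {y : A} {e : ℕ}
    (h : γ y = (-1) ^ e * y) (n : ℕ) : (γ ^ n) y = (-1) ^ (n * e) * y := by
  induction n with
  | zero => simp
  | succ n ih => rw [pow_succ', AlgHom.mul_apply, ih, map_sign_mul, h, ← mul_assoc, ← pow_add,
      add_mul, one_mul]

/-- A generator supercommutes with any element up to terms of lower weight. -/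
theorem sCoeff_mul_sub_mem (hS : IsTwGen G S γ) (k l : Idx M N) (m : ℕ) {d : ℤ} {x : A}
    (hx : x ∈ filt S d) : sCoeff S k l (m + 1) * (γ ^ (par k + par l)) x -
      x * sCoeff S k l (m + 1) ∈ filt S (d + 2 * m) := by
  have hgen : ∀ g : Gen M N, sCoeff S k l (m + 1) * (γ ^ (par k + par l)) (letter S g) -
      letter S g * sCoeff S k l (m + 1) ∈ filt S (wt g + 2 * m) := by
    intro g
    have h := sCoeff_comm_mem hS g.1 g.2.1 k l g.2.2 m
    rw [pow_apply_of_sign (par_letter hS g), sign_comm, mul_comm (par k + par l)]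
    rw [← neg_sub, Submodule.neg_mem_iff] at h
    exact filt_mono (by simp only [wt]; push_cast; omega) h
  have hw : ∀ w, sCoeff S k l (m + 1) * (γ ^ (par k + par l)) (word S w) -
      word S w * sCoeff S k l (m + 1) ∈ filt S (wtList w + 2 * m) := by
    intro w
    induction w with
    | nil =>
      rw [show word S [] = 1 from rfl, map_one, mul_one, one_mul, sub_self]
      exact Submodule.zero_mem _
    | cons g w ih =>
      have e : sCoeff S k l (m + 1) * (γ ^ (par k + par l)) (word S (g :: w)) -
          word S (g :: w) * sCoeff S k l (m + 1) =
          (sCoeff S k l (m + 1) * (γ ^ (par k + par l)) (letter S g) -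
            letter S g * sCoeff S k l (m + 1)) * (γ ^ (par k + par l)) (word S w) +
          letter S g * (sCoeff S k l (m + 1) * (γ ^ (par k + par l)) (word S w) -
            word S w * sCoeff S k l (m + 1)) := by
        rw [word_cons, map_mul]; noncomm_ring
      rw [e, wtList_cons]
      refine Submodule.add_mem _ (filt_mono ?_ (mul_mem_filt (hgen g)
        (par_pow_mem hS (word_mem le_rfl) _))) (filt_mono ?_ (mul_mem_filt (letter_mem g) ih)) <;>
        push_cast <;> omega
  refine Submodule.span_induction ?_ (by simp) ?_ ?_ hx
  · rintro _ ⟨w, hl, rfl⟩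
    exact filt_mono (by omega) (hw w)
  · intro x y _ _ hx hy
    rw [map_add, mul_add, add_mul, add_sub_add_comm]; exact Submodule.add_mem _ hx hy
  · intro c x _ hx
    rw [map_smul, mul_smul_comm, smul_mul_assoc, ← smul_sub]; exact Submodule.smul_mem _ _ hx

end Commutators

/-! ### The coaction and the filtration -/

section LinearAlgebra

variable {V : Type*} [AddCommGroup V] [Module ℂ V]

theorem aeval_mem {W : Submodule ℂ V} {E : Module.End ℂ V} (hE : ∀ w ∈ W, E w ∈ W)
    (p : Polynomial ℂ) {w : V} (hw : w ∈ W) : Polynomial.aeval E p w ∈ W := by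
  induction p using Polynomial.induction_on generalizing w with
  | C a => simpa [Module.algebraMap_end_apply] using W.smul_mem a hw
  | add p q hp hq => rw [map_add, LinearMap.add_apply]; exact W.add_mem (hp hw) (hq hw)
  | monomial n a h =>
    rw [pow_succ, ← mul_assoc, map_mul, Polynomial.aeval_X, Module.End.mul_apply]
    exact h (hE _ hw)

/-- An operator that acts modulo `W` with eigenvalues in `{1, …, d}` is injective modulo `W`. -/
theorem mem_of_apply_mem {W : Submodule ℂ V} {E : Module.End ℂ V} (hE : ∀ w ∈ W, E w ∈ W)
    {s : Set V} (d : ℕ) (hs : ∀ v ∈ s, v ∈ W ∨ ∃ n : ℕ, 1 ≤ n ∧ n ≤ d ∧ E v - (n : ℂ) • v ∈ W)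
    {y : V} (hy : y ∈ Submodule.span ℂ s) (h : E y ∈ W) : y ∈ W := by
  -- This polynomial annihilates the span modulo W when evaluated at E, and its constant term is
  -- nonzero because 0 is not among the eigenvalues.
  let q : Polynomial ℂ := ∏ k ∈ Finset.Icc 1 d, (Polynomial.X - Polynomial.C (k : ℂ))
  have hq : ∀ v ∈ Submodule.span ℂ s, Polynomial.aeval E q v ∈ W := by
    intro v hv
    refine Submodule.span_induction ?_ (by simp) ?_ ?_ hv
    · intro v hv
      obtain hv | ⟨n, h1, h2, h3⟩ := hs v hv
      · exact aeval_mem hE q hv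
      · have : q = (∏ k ∈ (Finset.Icc 1 d).erase n, (Polynomial.X - Polynomial.C (k : ℂ))) *
            (Polynomial.X - Polynomial.C (n : ℂ)) :=
          (Finset.prod_erase_mul _ _ (Finset.mem_Icc.2 ⟨h1, h2⟩)).symm
        rw [this, map_mul, Module.End.mul_apply]
        refine aeval_mem hE _ ?_
        simpa [Module.algebraMap_end_apply, Nat.cast_smul_eq_nsmul] using h3
    · intro x y _ _ hx hy
      rw [map_add]; exact W.add_mem hx hy
    · intro c x _ hx
      rw [map_smul]; exact W.smul_mem _ hx
  have h0 : q.coeff 0 ≠ 0 := by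
    rw [Polynomial.coeff_zero_eq_eval_zero, Polynomial.eval_prod]
    refine Finset.prod_ne_zero_iff.2 fun k hk => ?_
    have := (Finset.mem_Icc.1 hk).1
    simp; omega
  have h1 := hq y hy
  -- Write q = q₁ X + q(0). Since E y lies in W, so does q₁(E) E y, and hence q(0) y.
  rw [← Polynomial.divX_mul_X_add q, map_add, map_mul, Polynomial.aeval_X, Polynomial.aeval_C,
    LinearMap.add_apply, Module.End.mul_apply, Module.algebraMap_end_apply,
    Submodule.add_mem_iff_right _ (aeval_mem hE _ h)] at h1
  exact (Submodule.smul_mem_iff _ h0).1 h1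

end LinearAlgebra

section Coaction

variable {M N : ℕ} {A : Type*} [Ring A] [Algebra ℂ A]
  {S : Matrix (Idx M N) (Idx M N) (PowerSeries A)} {G : Matrix (Idx M N) (Idx M N) ℂ}
  {γ : A →ₐ[ℂ] A}

variable (S) in
/-- The filtration of the slot algebra: the entries at `a ^ n` have weight at most `d - 2 n`. -/
def slotFilt (d : ℤ) : Submodule ℂ (SlotAlg M N A) where
  carrier := {x | ∀ (n : ℕ) p q, slotEntry n p q x ∈ filt S (d - 2 * n)}
  zero_mem' := fun n p q => by rw [map_zero]; exact Submodule.zero_mem _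
  add_mem' := fun {x y} hx hy n p q => by
    rw [map_add]; exact Submodule.add_mem _ (hx n p q) (hy n p q)
  smul_mem' := fun c x hx n p q => by rw [map_smul]; exact Submodule.smul_mem _ c (hx n p q)

theorem slotFilt_mono {d e : ℤ} (h : d ≤ e) {x : SlotAlg M N A} (hx : x ∈ slotFilt S d) :
    x ∈ slotFilt S e := fun n p q => filt_mono (by omega) (hx n p q)

theorem mul_mem_slotFilt {d e : ℤ} {x y : SlotAlg M N A} (hx : x ∈ slotFilt S d)
    (hy : y ∈ slotFilt S e) : x * y ∈ slotFilt S (d + e) := by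
  intro n p q
  rw [slotEntry_mul]
  refine Submodule.sum_mem _ fun k hk => Submodule.sum_mem _ fun m _ =>
    filt_mono ?_ (mul_mem_filt (hx k.1 p m) (hy k.2 m q))
  have := Finset.HasAntidiagonal.mem_antidiagonal.1 hk
  omega

theorem slotC_mem {d : ℤ} {X : Matrix (Idx M N) (Idx M N) A} (h : ∀ p q, X p q ∈ filt S d) :
    slotC M N X ∈ slotFilt S d := by
  intro n p q
  rw [slotEntry_slotC]
  split_ifs with hn
  · exact filt_mono (by omega) (h p q)
  · exact Submodule.zero_mem _

theorem one_mem_slotFilt : (1 : SlotAlg M N A) ∈ slotFilt S 0 := by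
  rw [← map_one (slotC M N)]
  refine slotC_mem fun p q => ?_
  rw [Matrix.one_apply]
  split_ifs
  · exact one_mem_filt
  · exact Submodule.zero_mem _

theorem slotUnits_mem (i j : Idx M N) : slotUnits M N A i j ∈ slotFilt S 0 := by
  refine slotC_mem fun p q => ?_
  rw [slotUnit, Matrix.single_apply]
  split_ifs
  · rw [Submodule.neg_mem_iff, ← mul_one ((-1) ^ _), sign_mul_mem]; exact one_mem_filt
  · exact Submodule.zero_mem _

theorem slotPt_pow_mem (r : ℕ) : slotPt M N A ^ r ∈ slotFilt S (2 * r) := by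
  intro n p q
  rw [← mul_one (slotPt M N A ^ r), slotEntry_slotPt_pow_mul]
  split_ifs with h
  · exact filt_mono (by push_cast [h]; omega) (one_mem_slotFilt (n - r) p q)
  · exact Submodule.zero_mem _

theorem slotIncl_mem (hS : IsTwGen G S γ) {d : ℤ} {y : A} (hy : y ∈ filt S d) :
    slotIncl M N γ y ∈ slotFilt S d := by
  rw [slotIncl_apply]
  refine slotC_mem fun p q => ?_
  rw [Matrix.diagonal_apply]
  split_ifs
  · exact par_pow_mem hS hy _
  · exact Submodule.zero_mem _

variable (S) in
/-- Series whose coefficient at `u⁻ⁿ` has weight at most `2 n - m`. -/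
def slotSub (m : ℤ) : Submodule ℂ (PowerSeries (SlotAlg M N A)) where
  carrier := {f | ∀ n : ℕ, coeff n f ∈ slotFilt S (2 * n - m)}
  zero_mem' := fun n => by rw [map_zero]; exact Submodule.zero_mem _
  add_mem' := fun {x y} hx hy n => by
    rw [map_add]; exact Submodule.add_mem _ (hx n) (hy n)
  smul_mem' := fun c x hx n => by
    rw [PowerSeries.coeff_smul]; exact Submodule.smul_mem _ c (hx n)

theorem slotSub_mono {m m' : ℤ} (h : m' ≤ m) {f : PowerSeries (SlotAlg M N A)}
    (hf : f ∈ slotSub S m) : f ∈ slotSub S m' := fun n => slotFilt_mono (by omega) (hf n)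

theorem mul_mem_slotSub {m m' : ℤ} {f g : PowerSeries (SlotAlg M N A)} (hf : f ∈ slotSub S m)
    (hg : g ∈ slotSub S m') : f * g ∈ slotSub S (m + m') := by
  intro n
  rw [coeff_mul]
  refine Submodule.sum_mem _ fun k hk => slotFilt_mono ?_ (mul_mem_slotFilt (hf k.1) (hg k.2))
  have := Finset.HasAntidiagonal.mem_antidiagonal.1 hk
  omega

theorem C_mem_slotSub {x : SlotAlg M N A} (hx : x ∈ slotFilt S 0) :
    PowerSeries.C x ∈ slotSub S 0 := by
  intro n
  rw [PowerSeries.coeff_C]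
  split_ifs with h
  · exact slotFilt_mono (by omega) hx
  · exact Submodule.zero_mem _

theorem matrix_mul_mem_slotSub {m m' : ℤ}
    {X Y : Matrix (Idx M N) (Idx M N) (PowerSeries (SlotAlg M N A))}
    (hX : ∀ i j, X i j ∈ slotSub S m) (hY : ∀ i j, Y i j ∈ slotSub S m') (i j : Idx M N) :
    (X * Y) i j ∈ slotSub S (m + m') := by
  rw [Matrix.mul_apply]
  exact Submodule.sum_mem _ fun k _ => mul_mem_slotSub (hX i k) (hY k j)

theorem geomSeries_slotPt_mem : geomSeries (slotPt M N A) ∈ slotSub S 2 := by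
  intro n
  rw [coeff_geomSeries]
  split_ifs with h
  · exact Submodule.zero_mem _
  · exact slotFilt_mono (by omega) (slotPt_pow_mem (n - 1))

theorem negArg_mem_slotSub {m : ℤ} {f : PowerSeries (SlotAlg M N A)} (hf : f ∈ slotSub S m) :
    negArg f ∈ slotSub S m := by
  intro n
  rw [coeff_negArg, sign_mul_mem]
  exact hf n

theorem sign_mul_mem_slotSub {m : ℤ} {f : PowerSeries (SlotAlg M N A)} (e : ℕ)
    (hf : f ∈ slotSub S m) : (-1) ^ e * f ∈ slotSub S m := by
  intro n
  rw [coeff_neg_one_pow_mul, sign_mul_mem]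
  exact hf n

theorem slotSeries_sub_one (i j : Idx M N) : (slotSeries M N A - 1) i j =
    PowerSeries.C (slotUnits M N A i j) * geomSeries (slotPt M N A) := by
  rw [Matrix.sub_apply, slotSeries, evalSeries, Matrix.of_apply, add_sub_cancel_left]

theorem negArg_one : negArg (1 : PowerSeries A) = 1 := by
  rw [← map_one PowerSeries.C, negArg_C]

theorem negArg_sub (f g : PowerSeries A) : negArg (f - g) = negArg f - negArg g := by
  ext n; rw [map_sub, coeff_negArg, coeff_negArg, coeff_negArg, map_sub, mul_sub]

theorem negArg_C_mul (a : A) (f : PowerSeries A) :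
    negArg (PowerSeries.C a * f) = PowerSeries.C a * negArg f := by
  ext n
  rw [coeff_negArg, coeff_C_mul, coeff_C_mul, coeff_negArg, sign_comm]

theorem str_negArg_slotSeries_sub_one (i j : Idx M N) :
    (str ((slotSeries M N A).map negArg) - 1) i j =
      (-1) ^ (par i * par j + par i) * (PowerSeries.C (slotUnits M N A j i) *
        negArg (geomSeries (slotPt M N A))) := by
  have h : str (1 : Matrix (Idx M N) (Idx M N) (PowerSeries (SlotAlg M N A))) i j =
      (-1) ^ (par i * par j + par i) * negArg ((1 : Matrix _ _ (PowerSeries _)) j i) := by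
    rw [str, Matrix.of_apply, Matrix.one_apply]
    split_ifs
    · rw [negArg_one]
    · rw [← map_zero (PowerSeries.C (R := SlotAlg M N A)), negArg_C]
  rw [← negArg_C_mul, ← slotSeries_sub_one, Matrix.sub_apply, Matrix.sub_apply, negArg_sub,
    show (1 : Matrix (Idx M N) (Idx M N) (PowerSeries (SlotAlg M N A))) i j = _ from
      (congrArg (fun Z : Matrix _ _ (PowerSeries (SlotAlg M N A)) => Z i j) str_one).symm.trans h,
    str, Matrix.of_apply, Matrix.map_apply, ← mul_sub]

variable {Δ : A →ₐ[ℂ] SlotAlg M N A}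

/-- The homomorphism `Δ` sends `S(u)` to `T(u) S(u) Tᵗ(-u)` for the slot series `T(u)`. -/
def IsSlotTw (S : Matrix (Idx M N) (Idx M N) (PowerSeries A)) (γ : A →ₐ[ℂ] A)
    (Δ : A →ₐ[ℂ] SlotAlg M N A) : Prop :=
  S.map (PowerSeries.map (Δ : A →+* SlotAlg M N A)) =
    slotSeries M N A * S.map (PowerSeries.map (slotIncl M N γ : A →+* SlotAlg M N A)) *
      str ((slotSeries M N A).map negArg)

variable (M N) in
/-- The difference of the coaction and the inclusion. -/
def slotDiff (γ : A →ₐ[ℂ] A) (Δ : A →ₐ[ℂ] SlotAlg M N A) : A →ₗ[ℂ] SlotAlg M N A :=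
  Δ.toLinearMap - (slotIncl M N γ).toLinearMap

theorem slotDiff_apply (y : A) : slotDiff M N γ Δ y = Δ y - slotIncl M N γ y := rfl

theorem mul_sub_mul_identity {R : Type*} [Ring R] (a b c d : R) :
    a * b - c * d = (a - c) * (b - d) + c * (b - d) + (a - c) * d := by noncomm_ring

/-- A difference of two homomorphisms is a derivation up to the product of the differences, and that
product is of lower weight. -/
theorem slotDiff_mul (x y : A) : slotDiff M N γ Δ (x * y) =
    slotDiff M N γ Δ x * slotDiff M N γ Δ y + slotIncl M N γ x * slotDiff M N γ Δ y +
      slotDiff M N γ Δ x * slotIncl M N γ y := by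
  rw [slotDiff_apply, slotDiff_apply, slotDiff_apply, map_mul, map_mul]
  exact mul_sub_mul_identity _ _ _ _

theorem slotDiff_one : slotDiff M N γ Δ 1 = 0 := by
  rw [slotDiff_apply, map_one, map_one, sub_self]

/-- It isolates the first-order part of T S Tᵗ - S at S = G; every remaining term contains two small
factors among T - 1, Tᵗ - 1 and S - G. -/
theorem sandwich_identity {R : Type*} [Ring R] (a s b g : R) :
    a * s * b - s - ((a - 1) * g + g * (b - 1)) =
      (a - 1) * (s - g) + (s - g) * (b - 1) + (a - 1) * s * (b - 1) := by noncomm_ring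

theorem smul_sign {R : Type*} [Ring R] [Algebra ℂ R] (c : ℂ) (s : ℕ) (x : R) :
    c • ((-1) ^ s * x) = (-1) ^ s * (c • x) := (mul_smul_comm _ _ _).symm

theorem coeff_smul_lead (e : SlotAlg M N A) (c : ℂ) (r : ℕ) :
    coeff (r + 1) (PowerSeries.C e * geomSeries (slotPt M N A) *
      PowerSeries.C (algebraMap ℂ _ c)) = slotPt M N A ^ r * (c • e) := by
  rw [PowerSeries.coeff_mul_C, coeff_C_mul, coeff_geomSeries, if_neg (by omega),
    add_tsub_cancel_right, ← Algebra.commutes, ← Algebra.smul_def, mul_smul_comm,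
    ((slotPt_commute e).pow_left r).eq]

theorem coeff_smul_lead' (e : SlotAlg M N A) (c : ℂ) (r s : ℕ) :
    coeff (r + 1) (PowerSeries.C (algebraMap ℂ _ c) * ((-1) ^ s *
      (PowerSeries.C e * negArg (geomSeries (slotPt M N A))))) =
      slotPt M N A ^ r * ((-1) ^ (r + 1 + s) * (c • e)) := by
  rw [coeff_C_mul, coeff_neg_one_pow_mul, coeff_C_mul, coeff_negArg,
    coeff_geomSeries, if_neg (by omega), add_tsub_cancel_right, sign_comm, ← Algebra.smul_def,
    sign_comm, ← ((slotPt_commute e).pow_left r).eq, smul_sign, ← mul_assoc, ← pow_add,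
    add_comm s, sign_comm (r + 1 + s)]
  simp only [mul_smul_comm]

variable (A G) in
/-- The leading term of the coaction on a generator. -/
def slotLead (i j : Idx M N) (r : ℕ) : SlotAlg M N A := slotPt M N A ^ r *
  (∑ k, G k j • slotUnits M N A i k + ∑ k, (-1) ^ (r + 1 + (par k * par j + par k)) *
    (G i k • slotUnits M N A j k))

/-- T - 1 and Tᵗ - 1 lie in `slotSub S 2`, S - G lies in `slotSub S 1`. Thus the error in
`sandwich_identity` lies in `slotSub S 3`, one unit of weight below the leading term. -/
theorem slotDiff_sCoeff (hS : IsTwGen G S γ) (hΔ : IsSlotTw S γ Δ) (i j : Idx M N) (r : ℕ) :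
    slotDiff M N γ Δ (sCoeff S i j (r + 1)) - slotLead A G i j r ∈ slotFilt S (2 * r - 1) := by
  have h1 : ∀ i j, (slotSeries M N A - 1) i j ∈ slotSub S 2 := fun i j => by
    rw [slotSeries_sub_one]
    exact slotSub_mono (m := 0 + 2) (by norm_num)
      (mul_mem_slotSub (C_mem_slotSub (slotUnits_mem i j)) geomSeries_slotPt_mem)
  have h2 : ∀ i j, (str ((slotSeries M N A).map negArg) - 1) i j ∈ slotSub S 2 := fun i j => by
    rw [str_negArg_slotSeries_sub_one]
    exact sign_mul_mem_slotSub _ (slotSub_mono (m := 0 + 2) (by norm_num) (mul_mem_slotSub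
      (C_mem_slotSub (slotUnits_mem j i)) (negArg_mem_slotSub geomSeries_slotPt_mem)))
  have h3 : ∀ i j, (S.map (PowerSeries.map (slotIncl M N γ : A →+* SlotAlg M N A))) i j ∈
      slotSub S 0 := fun i j n => by
    rw [Matrix.map_apply, coeff_map]
    exact slotFilt_mono (by simp [bd]) (slotIncl_mem hS (sCoeff_mem hS i j n))
  have h4 : ∀ i j, (S.map (PowerSeries.map (slotIncl M N γ : A →+* SlotAlg M N A)) -
      constSeries (SlotAlg M N A) G : Matrix _ _ _) i j ∈ slotSub S 1 := fun i j n => by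
    rw [Matrix.sub_apply, map_sub, Matrix.map_apply, coeff_map, constSeries_apply,
      PowerSeries.coeff_C]
    cases n with
    | zero =>
      rw [hS.zero, if_pos rfl]
      have : slotIncl M N γ (algebraMap ℂ A (G i j)) = algebraMap ℂ _ (G i j) := AlgHom.commutes _ _
      exact (sub_eq_zero.2 this).symm ▸ Submodule.zero_mem _
    | succ n =>
      rw [if_neg (by omega), sub_zero]
      exact slotFilt_mono (by push_cast; omega) (slotIncl_mem hS (sCoeff_succ_mem i j n))
  have h5 := Submodule.add_mem _ (Submodule.add_mem _ (matrix_mul_mem_slotSub h1 h4 i j)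
    (slotSub_mono (by norm_num) (matrix_mul_mem_slotSub h4 h2 i j)))
    (slotSub_mono (by norm_num) (matrix_mul_mem_slotSub (matrix_mul_mem_slotSub h1 h3) h2 i j))
  rw [← Matrix.add_apply, ← Matrix.add_apply, ← sandwich_identity, ← hΔ] at h5
  have h6 := h5 (r + 1)
  rw [Matrix.sub_apply, Matrix.sub_apply, Matrix.add_apply, Matrix.mul_apply, Matrix.mul_apply,
    map_sub, map_sub, map_add, map_sum, map_sum] at h6
  simp only [slotSeries_sub_one, str_negArg_slotSeries_sub_one, constSeries_apply,
    coeff_smul_lead, coeff_smul_lead', ← Finset.mul_sum, ← mul_add] at h6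
  exact slotFilt_mono (by push_cast; omega) h6

theorem slotEntry_slotLead (i j : Idx M N) (r n : ℕ) (p q : Idx M N) :
    slotEntry n p q (slotLead A G i j r) =
      if n = r then (if q = i then -(-1) ^ (par i * par p) * algebraMap ℂ A (G p j) else 0) +
        (if q = j then -(-1) ^ (r + 1 + par p) * algebraMap ℂ A (G i p) else 0) else 0 := by
  symm
  rw [slotLead, slotEntry_slotPt_pow_mul]
  have e : ∀ k i j, slotEntry k p q (slotUnits M N A i j) =
      if k = 0 then (if j = p ∧ i = q then -(-1) ^ (par i * par j) else 0) else 0 := by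
    intro k i j
    rw [slotUnits, Matrix.of_apply, slotEntry_slotC, slotUnit, Matrix.single_apply]
  have sg : ∀ (s : ℕ) k (x : SlotAlg M N A), slotEntry k p q ((-1) ^ s * x) =
      (-1) ^ s * slotEntry k p q x := by
    intro s k x
    rcases Nat.even_or_odd s with hs | hs <;> simp [hs.neg_one_pow]
  simp only [map_add, map_sum, sg, map_smul, e]
  by_cases hn : n = r
  · subst hn
    simp only [le_refl, if_true, tsub_self]
    congr 1
    · rw [Finset.sum_eq_single p (fun k _ hk => by simp [hk]) (by simp)]
      by_cases hq : q = i
      · simp [hq, Algebra.smul_def, Algebra.commutes]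
      · simp [hq, Ne.symm hq]
    · rw [Finset.sum_eq_single p (fun k _ hk => by simp [hk]) (by simp)]
      by_cases hq : q = j
      · subst hq
        have : ∀ x : A, -(-1) ^ (n + 1 + par p) * x =
            (-1) ^ (n + 1 + (par p * par q + par p)) * (x * -(-1) ^ (par q * par p)) := fun x => by
          rw [mul_neg, ← mul_one ((-1) ^ (par q * par p)), sign_comm, mul_neg,
            ← mul_assoc, ← pow_add, mul_one, neg_mul,
            show n + 1 + (par p * par q + par p) + par q * par p =
              n + 1 + par p + (par p * par q + par p * par q) by ring, pow_add _ (n + 1 + par p),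
            neg_one_pow_add_self, mul_one]
        rw [if_pos rfl, if_pos ⟨rfl, rfl⟩, Algebra.smul_def, this]
      · simp [hq, Ne.symm hq]
  · rw [if_neg hn]
    split_ifs <;> first | omega | simp

end Coaction

/-! ### The Euler operator -/

section Euler

variable {M N : ℕ} {A : Type*} [Ring A] [Algebra ℂ A]
  {S : Matrix (Idx M N) (Idx M N) (PowerSeries A)} {G : Matrix (Idx M N) (Idx M N) ℂ}
  {γ : A →ₐ[ℂ] A} {Δ : A →ₐ[ℂ] SlotAlg M N A}

theorem slotEntry_slotC_mul (X : Matrix (Idx M N) (Idx M N) A) (w : SlotAlg M N A) (n : ℕ)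
    (p q : Idx M N) : slotEntry n p q (slotC M N X * w) = ∑ m, X p m * slotEntry n m q w := by
  rw [slotEntry_mul, Finset.sum_eq_single (0, n)]
  · simp [slotEntry_slotC]
  · rintro ⟨a, b⟩ hk hne
    have := Finset.HasAntidiagonal.mem_antidiagonal.1 hk
    have ha : a ≠ 0 := fun h => hne (by simp only [h, zero_add] at this; rw [h, this])
    simp [slotEntry_slotC, ha]
  · intro h
    exact absurd (Finset.HasAntidiagonal.mem_antidiagonal.2 (zero_add n)) h

theorem slotEntry_mul_slotC (X : Matrix (Idx M N) (Idx M N) A) (w : SlotAlg M N A) (n : ℕ)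
    (p q : Idx M N) : slotEntry n p q (w * slotC M N X) = ∑ m, slotEntry n p m w * X m q := by
  rw [slotEntry_mul, Finset.sum_eq_single (n, 0)]
  · simp [slotEntry_slotC]
  · rintro ⟨a, b⟩ hk hne
    have := Finset.HasAntidiagonal.mem_antidiagonal.1 hk
    have hb : b ≠ 0 := fun h => hne (by simp only [h, add_zero] at this; rw [h, this])
    simp [slotEntry_slotC, hb]
  · intro h
    exact absurd (Finset.HasAntidiagonal.mem_antidiagonal.2 (add_zero n)) h

theorem slotEntry_slotIncl_mul (y : A) (w : SlotAlg M N A) (n : ℕ) (p q : Idx M N) :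
    slotEntry n p q (slotIncl M N γ y * w) = (γ ^ par p) y * slotEntry n p q w := by
  rw [slotIncl_apply, slotEntry_slotC_mul, Finset.sum_eq_single p] <;> simp +contextual [Ne.symm]

theorem slotEntry_mul_slotIncl (y : A) (w : SlotAlg M N A) (n : ℕ) (p q : Idx M N) :
    slotEntry n p q (w * slotIncl M N γ y) = slotEntry n p q w * (γ ^ par q) y := by
  rw [slotIncl_apply, slotEntry_mul_slotC, Finset.sum_eq_single q] <;> simp +contextual

theorem IsTwGen.par_par (hS : IsTwGen G S γ) (y : A) : γ (γ y) = y := by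
  have h := hS.gen (AlgHom.equalizer (γ.comp γ) (AlgHom.id ℂ A)) fun i j n => by
    have := par_sCoeff hS i j n
    rw [AlgHom.mem_equalizer, AlgHom.comp_apply]
    change γ (γ (sCoeff S i j n)) = sCoeff S i j n
    rw [this, map_sign_mul, this, neg_one_pow_mul_self]
  have hy : y ∈ AlgHom.equalizer (γ.comp γ) (AlgHom.id ℂ A) := h ▸ trivial
  exact hy

theorem pow_par_pow_par (hS : IsTwGen G S γ) (q : Idx M N) (y : A) :
    (γ ^ par q) ((γ ^ par q) y) = y := by
  rcases par_cases q with h | h <;> simp [h, hS.par_par]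

theorem IsEven.inv {G : Matrix (Idx M N) (Idx M N) ℂ} (hG : IsEven G) : IsEven G⁻¹ := by
  have hD : parMat M N * parMat M N = 1 := by
    rw [parMat, Matrix.diagonal_mul_diagonal, ← Matrix.diagonal_one]
    congr 1
    funext i
    rw [← pow_add, neg_one_pow_add_self]
  have h1 : parMat M N * G * parMat M N = G := by
    ext i j
    rw [parMat, Matrix.mul_diagonal, Matrix.diagonal_mul]
    by_cases h : par i = par j
    · rw [h, mul_right_comm, ← pow_add, neg_one_pow_add_self, one_mul]
    · rw [hG i j h]; simp
  have h2 : parMat M N * G⁻¹ * parMat M N = G⁻¹ := by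
    conv_rhs => rw [← h1]
    rw [Matrix.mul_inv_rev, Matrix.mul_inv_rev, Matrix.inv_eq_left_inv hD, mul_assoc]
  intro i j h
  have h3 := congrFun (congrFun h2 i) j
  rw [parMat, Matrix.mul_diagonal, Matrix.diagonal_mul] at h3
  have h4 : ((-1 : ℂ) ^ par i) * (-1) ^ par j = -1 := by
    rcases par_cases i with hi | hi <;> rcases par_cases j with hj | hj <;> simp_all
  rw [mul_right_comm, h4] at h3
  linear_combination (-1 / 2 : ℂ) * h3

variable (S G) in
/-- The generators dual to the leading terms of the coaction. -/
def dualGen (p q : Idx M N) (n : ℕ) : A :=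
  -(-1) ^ (par p * par q) * ∑ k, (G⁻¹ k p) • sCoeff S q k (n + 1)

theorem dualGen_mem (p q : Idx M N) (n : ℕ) : dualGen S G p q n ∈ filt S (2 * n + 1) := by
  rw [dualGen, neg_mul, Submodule.neg_mem_iff, sign_mul_mem]
  exact Submodule.sum_mem _ fun k _ => Submodule.smul_mem _ _ (sCoeff_succ_mem q k n)

theorem sum_identity {R ι : Type*} [Ring R] [Algebra ℂ R] (s : Finset ι) (c : ι → ℂ) (f : ι → R)
    (ε x y : R) (h1 : ε * x = x * ε) : -ε * (∑ k ∈ s, c k • f k) * y - x * (-ε * ∑ k ∈ s, c k • f k) =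
      -(ε * ∑ k ∈ s, c k • (f k * y - x * f k)) := by
  have h2 : ∑ k ∈ s, c k • (f k * y - x * f k) =
      (∑ k ∈ s, c k • f k) * y - x * ∑ k ∈ s, c k • f k := by
    simp only [smul_sub, Finset.sum_sub_distrib, Finset.sum_mul, Finset.mul_sum, smul_mul_assoc,
      mul_smul_comm]
  rw [h2]
  generalize ∑ k ∈ s, c k • f k = z
  rw [mul_sub, ← mul_assoc ε x, h1]
  noncomm_ring

theorem dualGen_comm_mem (hS : IsTwGen G S γ) (p q : Idx M N) (n : ℕ) {d : ℤ} {x : A}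
    (hx : x ∈ filt S d) : dualGen S G p q n * (γ ^ (par q + par p)) x - x * dualGen S G p q n ∈
      filt S (d + 2 * n) := by
  have h1 : (-1 : A) ^ (par p * par q) * x = x * (-1) ^ (par p * par q) := by
    rw [← mul_one ((-1) ^ _), sign_comm, mul_one, mul_one]
  rw [dualGen, sum_identity _ _ _ _ _ _ h1, Submodule.neg_mem_iff, sign_mul_mem]
  refine Submodule.sum_mem _ fun k _ => ?_
  by_cases h : par k = par p
  · rw [← h]
    exact Submodule.smul_mem _ _ (sCoeff_mul_sub_mem hS q k n hx)
  · rw [hS.supersymm.isEven.inv k p h, zero_smul]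
    exact Submodule.zero_mem _

variable (S G γ) in
/-- Contraction with the dual generators. -/
def contract (K : ℕ) : SlotAlg M N A →ₗ[ℂ] A :=
  (1 / 2 : ℂ) • ∑ n ∈ Finset.range K, ∑ p, ∑ q, LinearMap.mulLeft ℂ (dualGen S G p q n) ∘ₗ
    (γ ^ par q).toLinearMap ∘ₗ slotEntry n p q

theorem contract_apply (K : ℕ) (w : SlotAlg M N A) : contract S G γ K w = (1 / 2 : ℂ) •
    ∑ n ∈ Finset.range K, ∑ p, ∑ q, dualGen S G p q n * (γ ^ par q) (slotEntry n p q w) := by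
  simp [contract, LinearMap.sum_apply]

/-- The weight 2n + 1 of a dual generator compensates the weight d - 1 - 2n of the entry at aⁿ. -/
theorem contract_mem (hS : IsTwGen G S γ) {d : ℤ} {w : SlotAlg M N A} (K : ℕ)
    (hw : w ∈ slotFilt S (d - 1)) : contract S G γ K w ∈ filt S d := by
  rw [contract_apply]
  refine Submodule.smul_mem _ _ (Submodule.sum_mem _ fun n _ => Submodule.sum_mem _ fun p _ =>
    Submodule.sum_mem _ fun q _ => ?_)
  exact filt_mono (by omega) (mul_mem_filt (dualGen_mem p q n) (par_pow_mem hS (hw n p q) _))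

/-- Right linearity is exact: the twist by γ in the contraction undoes the twist in `slotIncl`. -/
theorem contract_mul_slotIncl (hS : IsTwGen G S γ) (K : ℕ) (w : SlotAlg M N A) (y : A) :
    contract S G γ K (w * slotIncl M N γ y) = contract S G γ K w * y := by
  rw [contract_apply, contract_apply, smul_mul_assoc]
  simp only [slotEntry_mul_slotIncl, map_mul, pow_par_pow_par hS, Finset.sum_mul, mul_assoc]

/-- Left linearity holds only up to lower weight, as y has to pass the dual generators. -/
theorem contract_slotIncl_mul (hS : IsTwGen G S γ) (K : ℕ) {d e : ℤ} {w : SlotAlg M N A} {y : A}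
    (hy : y ∈ filt S d) (hw : w ∈ slotFilt S (e - 1)) :
    contract S G γ K (slotIncl M N γ y * w) - y * contract S G γ K w ∈ filt S (d + e - 1) := by
  rw [contract_apply, contract_apply, mul_smul_comm, ← smul_sub]
  simp only [slotEntry_slotIncl_mul, map_mul, Finset.mul_sum, ← Finset.sum_sub_distrib,
    ← mul_assoc, ← sub_mul, ← AlgHom.mul_apply, ← pow_add]
  refine Submodule.smul_mem _ _ (Submodule.sum_mem _ fun n _ => Submodule.sum_mem _ fun p _ =>
    Submodule.sum_mem _ fun q _ => ?_)
  exact filt_mono (by omega) (mul_mem_filt (dualGen_comm_mem hS p q n hy)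
    (par_pow_mem hS (hw n p q) _))

theorem slotLead_mem (i j : Idx M N) (r : ℕ) : slotLead A G i j r ∈ slotFilt S (2 * r) := by
  have h := fun i j => slotUnits_mem (S := S) i j
  have h' := Submodule.add_mem _ (Submodule.sum_mem (t := Finset.univ) _ fun k _ =>
      Submodule.smul_mem _ (G k j) (h i k))
    (Submodule.sum_mem (t := Finset.univ) _ fun k _ => (sign_mul_mem (r + 1 + (par k * par j + par k))).2
      (Submodule.smul_mem _ (G i k) (h j k)))
  exact slotFilt_mono (add_zero _).le (mul_mem_slotFilt (slotPt_pow_mem r) h')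

theorem slotDiff_sCoeff_mem (hS : IsTwGen G S γ) (hΔ : IsSlotTw S γ Δ) (i j : Idx M N) (r : ℕ) :
    slotDiff M N γ Δ (sCoeff S i j (r + 1)) ∈ slotFilt S (2 * r) := by
  have := Submodule.add_mem _ (slotFilt_mono (by omega) (slotDiff_sCoeff hS hΔ i j r))
    (slotLead_mem (S := S) (G := G) i j r)
  rwa [sub_add_cancel] at this

theorem slotDiff_mem (hS : IsTwGen G S γ) (hΔ : IsSlotTw S γ Δ) {d : ℤ} {y : A}
    (hy : y ∈ filt S d) : slotDiff M N γ Δ y ∈ slotFilt S (d - 1) := by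
  have hw : ∀ w, slotDiff M N γ Δ (word S w) ∈ slotFilt S (wtList w - 1) := by
    intro w
    induction w with
    | nil =>
      rw [show word S ([] : List (Gen M N)) = 1 from rfl, slotDiff_one]
      exact Submodule.zero_mem _
    | cons g w ih =>
      have h := slotDiff_sCoeff_mem hS hΔ g.1 g.2.1 g.2.2
      rw [word_cons, slotDiff_mul, wtList_cons]
      refine Submodule.add_mem _ (Submodule.add_mem _ (slotFilt_mono ?_ (mul_mem_slotFilt h ih))
        (slotFilt_mono ?_ (mul_mem_slotFilt (slotIncl_mem hS (letter_mem g)) ih)))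
        (slotFilt_mono ?_ (mul_mem_slotFilt h (slotIncl_mem hS (word_mem le_rfl)))) <;>
        simp only [wt] <;> push_cast <;> omega
  refine Submodule.span_induction ?_ (by simp) ?_ ?_ hy
  · rintro _ ⟨w, hl, rfl⟩
    exact slotFilt_mono (by omega) (hw w)
  · intro x y _ _ hx hy
    rw [map_add]; exact Submodule.add_mem _ hx hy
  · intro c x _ hx
    rw [map_smul]; exact Submodule.smul_mem _ _ hx

variable (S G γ Δ) in
/-- An operator that acts on words by their length, up to terms of lower weight. -/
def euler (K : ℕ) : Module.End ℂ A := contract S G γ K ∘ₗ slotDiff M N γ Δ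

theorem euler_mem (hS : IsTwGen G S γ) (hΔ : IsSlotTw S γ Δ) (K : ℕ) {d : ℤ} {y : A}
    (hy : y ∈ filt S d) : euler S G γ Δ K y ∈ filt S d :=
  contract_mem hS K (slotDiff_mem hS hΔ hy)

/-- The derivation property modulo lower weight. The product of two `slotDiff` values is too small
to matter, and the contraction is linear on both sides modulo lower weight. -/
theorem euler_mul_mem (hS : IsTwGen G S γ) (hΔ : IsSlotTw S γ Δ) (K : ℕ) {d e : ℤ} {x y : A}
    (hx : x ∈ filt S d) (hy : y ∈ filt S e) : euler S G γ Δ K (x * y) -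
      (x * euler S G γ Δ K y + euler S G γ Δ K x * y) ∈ filt S (d + e - 1) := by
  have h1 := slotDiff_mem hS hΔ hx
  have h2 := slotDiff_mem hS hΔ hy
  have h3 := contract_mem hS (d := d + e - 1) K (slotFilt_mono (by omega) (mul_mem_slotFilt h1 h2))
  have h4 := Submodule.add_mem _ h3 (contract_slotIncl_mul hS K hx h2)
  simp only [euler, LinearMap.comp_apply]
  rw [slotDiff_mul, map_add, map_add, contract_mul_slotIncl hS]
  convert h4 using 1
  abel

theorem sign_mul_sign_mul {R : Type*} [Ring R] (e : ℕ) (a b : R) :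
    (-(-1) ^ e * a) * (-(-1) ^ e * b) = a * b := by
  rcases neg_one_pow_eq_or R e with h | h <;> simp [h]

theorem sum_dualGen (hS : IsTwGen G S γ) (i j : Idx M N) (r : ℕ) :
    ∑ p, dualGen S G p i r * (-(-1) ^ (par i * par p) * algebraMap ℂ A (G p j)) =
      sCoeff S i j (r + 1) := by
  have h := Matrix.nonsing_inv_mul G hS.supersymm.nondegenerate
  have e : ∀ p, dualGen S G p i r * (-(-1) ^ (par i * par p) * algebraMap ℂ A (G p j)) =
      ∑ k, (G⁻¹ k p * G p j) • sCoeff S i k (r + 1) := by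
    intro p
    rw [dualGen, mul_comm (par i), sign_mul_sign_mul, ← Algebra.commutes, ← Algebra.smul_def,
      Finset.smul_sum]
    simp only [smul_smul, mul_comm (G p j)]
  simp only [e]
  rw [Finset.sum_comm]
  simp only [← Finset.sum_smul, ← Matrix.mul_apply, h, Matrix.one_apply, ite_smul, one_smul,
    zero_smul, Finset.sum_ite_eq', Finset.mem_univ, if_true]

theorem sign_swap (hG : IsSupersymmetric G) (i p j : Idx M N) (r : ℕ) :
    -(-1) ^ (r + 1 + par p) * algebraMap ℂ A (G i p) =
      (-1) ^ (par i * par j + (r + 1)) * (-(-1) ^ (par j * par p) * algebraMap ℂ A (G p i)) := by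
  by_cases h : par i = par p
  · rw [← hG.swap i p, map_mul, map_pow, map_neg, map_one, h, pow_add _ (r + 1), pow_add _ _ (r + 1)]
    rcases par_cases p with hp | hp <;> rcases par_cases j with hj | hj <;> simp [hp, hj]
  · rw [hG.isEven i p h, hG.isEven p i (Ne.symm h)]
    simp

theorem pow_par_sign_algebraMap (n e : ℕ) (c : ℂ) : (γ ^ n) (-(-1) ^ e * algebraMap ℂ A c) =
    -(-1) ^ e * algebraMap ℂ A c := by
  rw [neg_mul, map_neg, map_sign_mul, AlgHom.commutes]

/-- The two halves of the leading term come from T and from Tᵗ. The first reproduces the generator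
and the second its mirror image, which agrees with it modulo lower weight by the symmetry relation;
hence the factor 1/2 in `contract`. -/
theorem contract_slotLead (hS : IsTwGen G S γ) {K : ℕ} (i j : Idx M N) {r : ℕ} (hr : r < K) :
    contract S G γ K (slotLead A G i j r) = (1 / 2 : ℂ) • (sCoeff S i j (r + 1) +
      (-1) ^ (par i * par j + (r + 1)) * sCoeff S j i (r + 1)) := by
  rw [contract_apply, Finset.sum_eq_single r]
  · congr 1
    rw [← sum_dualGen hS i j, ← sum_dualGen hS j i, Finset.mul_sum, ← Finset.sum_add_distrib]
    refine Finset.sum_congr rfl fun p _ => ?_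
    simp only [slotEntry_slotLead, if_true, map_add, mul_add, Finset.sum_add_distrib,
      apply_ite ((γ ^ _ : A →ₐ[ℂ] A)), pow_par_sign_algebraMap, map_zero, mul_ite, mul_zero,
      Finset.sum_ite_eq', Finset.mem_univ]
    rw [sign_swap hS.supersymm i p j, sign_comm]
  · intro n _ hn
    simp [slotEntry_slotLead, hn]
  · intro h
    exact absurd (Finset.mem_range.2 hr) h

theorem euler_sCoeff_mem (hS : IsTwGen G S γ) (hΔ : IsSlotTw S γ Δ) {K : ℕ} (i j : Idx M N) {r : ℕ}
    (hr : r < K) : euler S G γ Δ K (sCoeff S i j (r + 1)) - sCoeff S i j (r + 1) ∈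
      filt S (2 * r) := by
  have h1 := contract_mem hS K (d := 2 * r) (slotDiff_sCoeff hS hΔ i j r)
  have h2 := Submodule.add_mem _ h1 (Submodule.smul_mem _ (1 / 2 : ℂ) (sCoeff_symm hS i j r))
  rw [map_sub, contract_slotLead hS i j hr] at h2
  convert h2 using 1
  simp only [euler, LinearMap.comp_apply]
  generalize (-1) ^ (par i * par j + (r + 1)) * sCoeff S j i (r + 1) = x
  module

theorem euler_word_mem (hS : IsTwGen G S γ) (hΔ : IsSlotTw S γ Δ) {K : ℕ} (w : List (Gen M N))
    (hw : wtList w ≤ K) : euler S G γ Δ K (word S w) - (w.length : ℂ) • word S w ∈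
      filt S (wtList w - 1) := by
  induction w with
  | nil =>
    rw [show word S ([] : List (Gen M N)) = 1 from rfl, euler, LinearMap.comp_apply, slotDiff_one]
    simp
  | cons g w ih =>
    rw [wtList_cons] at hw
    have h1 := ih (by omega)
    have h2 := euler_sCoeff_mem hS hΔ (K := K) g.1 g.2.1 (r := g.2.2) (by rw [wt] at hw; omega)
    have h3 := euler_mul_mem hS hΔ K (letter_mem (S := S) g) (word_mem (S := S) (l := w) le_rfl)
    have h4 := mul_mem_filt (letter_mem (S := S) g) h1
    have h5 := mul_mem_filt h2 (word_mem (S := S) (l := w) le_rfl)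
    have h6 := Submodule.add_mem _ (Submodule.add_mem _
      (filt_mono (e := wtList (g :: w) - 1) (by rw [wtList_cons]; push_cast; omega) h3)
      (filt_mono (by rw [wtList_cons]; push_cast; omega) h4))
      (filt_mono (by rw [wtList_cons, wt]; push_cast; omega) h5)
    convert h6 using 1
    rw [word_cons, List.length_cons, ← letter]
    push_cast
    rw [add_smul, one_smul, mul_sub, sub_mul, mul_smul_comm]
    abel

/-- A word of weight exactly m + 1 is nonempty and has length at most m + 1, since every letter has
weight at least 1. So `euler` acts on it modulo W with an eigenvalue in {1, …, m + 1}. -/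
theorem mem_of_euler_mem (hS : IsTwGen G S γ) (hΔ : IsSlotTw S γ Δ) {m : ℕ} {W : Submodule ℂ A}
    (hW : ∀ w ∈ W, euler S G γ Δ (m + 1) w ∈ W) (hm : filt S m ≤ W) {y : A}
    (hy : y ∈ filt S (m + 1 : ℕ)) (h : euler S G γ Δ (m + 1) y ∈ W) : y ∈ W := by
  refine mem_of_apply_mem hW (m + 1) ?_ hy h
  rintro _ ⟨w, hw, rfl⟩
  by_cases h : (wtList w : ℤ) ≤ m
  · exact Or.inl (hm (word_mem h))
  · right
    have hl : w.length ≤ wtList w := by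
      clear hw h
      induction w with
      | nil => simp
      | cons g w ih => rw [wtList_cons, wt, List.length_cons]; omega
    have h1 := euler_word_mem hS hΔ (K := m + 1) w (by omega)
    refine ⟨w.length, ?_, by omega, hm (filt_mono (by omega) h1)⟩
    cases w with
    | nil => simp [wtList] at h
    | cons g w => simp

/-- The coaction detects the filtration. -/
theorem mem_filt_of_slotDiff (hS : IsTwGen G S γ) (hΔ : IsSlotTw S γ Δ) {d : ℕ} {y : A}
    (hy : slotDiff M N γ Δ y ∈ slotFilt S (d - 1)) : y ∈ filt S d := by
  obtain ⟨m, hm⟩ := exists_mem_filt hS y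
  induction m with
  | zero => exact filt_mono (by omega) hm
  | succ m ih =>
    by_cases hmd : m + 1 ≤ d
    · exact filt_mono (by omega) hm
    -- If the current weight bound m + 1 exceeds d, then `euler` already sends y to weight at most
    -- m, so y itself has weight at most m.
    exact ih (mem_of_euler_mem hS hΔ (fun w hw => euler_mem hS hΔ _ hw) le_rfl hm
      (contract_mem hS _ (slotFilt_mono (by omega) hy)))

/-- A homomorphism compatible with the coactions is injective. -/
theorem injective_of_slotTw (hS : IsTwGen G S γ) (hΔ : IsSlotTw S γ Δ) {B : Type*} [Ring B]
    [Algebra ℂ B] [Nontrivial B] {γ' : B →ₐ[ℂ] B} {Δ' : B →ₐ[ℂ] SlotAlg M N B} (φ : A →ₐ[ℂ] B)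
    (hγ : ∀ y, φ (γ y) = γ' (φ y)) (hφ : ∀ y, slotMap M N φ (Δ y) = Δ' (φ y)) :
    Function.Injective φ := by
  rw [injective_iff_map_eq_zero]
  have key : ∀ d : ℕ, ∀ y ∈ filt S d, φ y = 0 → y = 0 := by
    intro d
    induction d using Nat.strong_induction_on with
    | _ d ih =>
    intro y hy h
    -- The entries of `slotDiff` lie in the kernel by compatibility with the coactions and have
    -- smaller weight, so the induction hypothesis applies to each of them.
    have h1 : slotDiff M N γ Δ y = 0 := by
      refine slot_ext fun n p q => ?_
      have h2 : φ (slotEntry n p q (slotDiff M N γ Δ y)) = 0 := by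
        rw [← slotEntry_slotMap, slotDiff_apply, map_sub, hφ, slotMap_slotIncl φ hγ, h, map_zero,
          map_zero, sub_zero, map_zero]
      have h3 := slotDiff_mem hS hΔ hy n p q
      rw [map_zero]
      by_cases hd : (d : ℤ) - 1 - 2 * n < 0
      · exact filt_neg hd h3
      · exact ih (d - 1 - 2 * n) (by omega) _ (filt_mono (by omega) h3) h2
    -- Vanishing of `slotDiff` forces weight 0, so y is a scalar, and scalars are not killed.
    have h4 : y ∈ filt S (0 : ℕ) := mem_filt_of_slotDiff hS hΔ (by rw [h1]; exact Submodule.zero_mem _)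
    obtain ⟨c, rfl⟩ := mem_filt_zero h4
    rw [AlgHom.commutes] at h
    rw [(FaithfulSMul.algebraMap_eq_zero_iff ℂ B).1 h, map_zero]
  intro y h
  obtain ⟨d, hd⟩ := exists_mem_filt hS y
  exact key d y hd h

end Euler

/-! ### The embedding -/

section Embedding

variable {M N : ℕ} {G : Matrix (Idx M N) (Idx M N) ℂ}

theorem isTwGen_sStd (hG : IsSupersymmetric G) : IsTwGen G (sStd G) (parTw hG) where
  supersymm := hG
  rel := isTwSeries_sStd
  zero i j := by
    have := congrArg (fun Z : Matrix (Idx M N) (Idx M N) (YTw G) => Z i j)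
      (sStd_map_constantCoeff hG)
    rw [coeff_zero_eq_constantCoeff_apply]
    exact this
  gen B hB := by
    have h1 : ∀ i j n, coeff n (sSeries G i j) ∈ B := by
      intro i j n
      have h2 : coeff n (sStd G i j) =
          (-1) ^ (par i * par j + par j) * coeff n (sSeries G i j) := by
        rw [sStd, std, Matrix.of_apply, coeff_neg_one_pow_mul]
      have h3 := hB i j n
      rw [h2] at h3
      exact (sign_mul_mem (P := Subalgebra.toSubmodule B) _).1 h3
    rw [eq_top_iff]
    intro x _
    obtain ⟨f, rfl⟩ := RingQuot.mkAlgHom_surjective ℂ (TwRel G) x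
    induction f using FreeAlgebra.induction with
    | grade0 c => rw [AlgHom.commutes]; exact B.algebraMap_mem c
    | grade1 g =>
      have := h1 g.1 g.2.1 (g.2.2 + 1)
      rw [sSeries, coeff_map, freeSeries, coeff_mk] at this
      exact this
    | mul a b ha hb => rw [map_mul]; exact B.mul_mem (ha trivial) (hb trivial)
    | add a b ha hb => rw [map_add]; exact B.add_mem (ha trivial) (hb trivial)
  par := map_parTw hG

theorem isSlotTw_slotTw (hG : IsSupersymmetric G) : IsSlotTw (sStd G) (parTw hG) (slotTw hG) :=
  map_slotTw hG

/-- The counit T(u) ↦ 1 maps onto a nonzero ring. -/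
theorem nontrivial_ygl : Nontrivial (YGl M N) := by
  obtain ⟨φ, -⟩ := exists_ygl_hom_of_constantCoeff (M := M) (N := N) (A := ℂ)
    (constSeries ℂ 1) isEven_one.isRTTSeries (by
      rw [constSeries_map_constantCoeff, Matrix.map_one _ (map_zero _) (map_one _)])
  exact φ.toRingHom.domain_nontrivial

section

variable {A B : Type*} [Ring A] [Algebra ℂ A] [Ring B] [Algebra ℂ B]

theorem map_constSeries (φ : A →ₐ[ℂ] B) (D : Matrix (Idx M N) (Idx M N) ℂ) :
    (constSeries A D).map (PowerSeries.map (φ : A →+* B)) = constSeries B D := by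
  refine Matrix.ext fun i j => ?_
  rw [Matrix.map_apply, constSeries_apply, constSeries_apply, PowerSeries.map_C]
  exact congrArg PowerSeries.C (φ.commutes _)

theorem map_map_negArg (φ : A →ₐ[ℂ] B) (X : Matrix (Idx M N) (Idx M N) (PowerSeries A)) :
    (X.map negArg).map (PowerSeries.map (φ : A →+* B)) =
      (X.map (PowerSeries.map (φ : A →+* B))).map negArg := by
  refine Matrix.ext fun i j => ?_
  exact map_negArg φ _

theorem map_conj (φ : A →ₐ[ℂ] B) (T S : Matrix (Idx M N) (Idx M N) (PowerSeries A)) :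
    (T * S * str (T.map negArg)).map (PowerSeries.map (φ : A →+* B)) =
      T.map (PowerSeries.map (φ : A →+* B)) * S.map (PowerSeries.map (φ : A →+* B)) *
        str ((T.map (PowerSeries.map (φ : A →+* B))).map negArg) := by
  rw [Matrix.map_mul, Matrix.map_mul, ← str_map, map_map_negArg]

theorem IsTwGen.hom_ext {S : Matrix (Idx M N) (Idx M N) (PowerSeries A)} {γ : A →ₐ[ℂ] A}
    (hS : IsTwGen G S γ) {φ ψ : A →ₐ[ℂ] B}
    (h : S.map (PowerSeries.map (φ : A →+* B)) = S.map (PowerSeries.map (ψ : A →+* B))) : φ = ψ := by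
  have h1 := hS.gen (AlgHom.equalizer φ ψ) fun i j n => by
    have := congrArg (fun Z : Matrix (Idx M N) (Idx M N) (PowerSeries B) =>
      coeff n (Z i j)) h
    simp only [Matrix.map_apply, coeff_map] at this
    exact this
  ext y
  have hy : y ∈ AlgHom.equalizer φ ψ := h1 ▸ trivial
  exact hy

/-- The entry in position `(i, j)` has parity `|i| + |j|`. -/
def HasPar {R : Type*} [Ring R] (γ : R →+* R) (X : Matrix (Idx M N) (Idx M N) R) : Prop :=
  ∀ i j, γ (X i j) = (-1) ^ (par i + par j) * X i j

section

variable {R : Type*} [Ring R] {γ : R →+* R} {X Y : Matrix (Idx M N) (Idx M N) R}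

theorem HasPar.mul (hX : HasPar γ X) (hY : HasPar γ Y) : HasPar γ (X * Y) := by
  intro i j
  rw [Matrix.mul_apply, map_sum, Finset.mul_sum]
  refine Finset.sum_congr rfl fun k _ => ?_
  rw [map_mul, hX, hY, sign_comm, ← mul_assoc, ← mul_assoc, ← pow_add, ← mul_assoc,
    show par k + par j + (par i + par k) = par i + par j + (par k + par k) by ring, pow_add _ (_ + _),
    Even.neg_one_pow ⟨par k, rfl⟩, mul_one]

theorem HasPar.str (hX : HasPar γ X) : HasPar γ (str X) := by
  intro i j
  rw [SuperYangian.str, Matrix.of_apply, map_mul, map_pow, map_neg, map_one, hX, sign_comm,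
    add_comm (par j)]

end

theorem HasPar.map_negArg {γ : A →ₐ[ℂ] A} {X : Matrix (Idx M N) (Idx M N) (PowerSeries A)}
    (hX : HasPar (PowerSeries.map (γ : A →+* A)) X) :
    HasPar (PowerSeries.map (γ : A →+* A)) (X.map negArg) := by
  intro i j
  rw [Matrix.map_apply, SuperYangian.map_negArg, hX]
  ext n
  rw [coeff_negArg, coeff_neg_one_pow_mul, coeff_neg_one_pow_mul, coeff_negArg, sign_comm]

theorem IsEven.hasPar {D : Matrix (Idx M N) (Idx M N) ℂ} (hD : IsEven D) (γ : A →ₐ[ℂ] A) :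
    HasPar (PowerSeries.map (γ : A →+* A)) (constSeries A D) := by
  intro i j
  rw [constSeries_apply, PowerSeries.map_C]
  by_cases h : par i = par j
  · rw [h, neg_one_pow_add_self, one_mul]
    exact congrArg PowerSeries.C (γ.commutes _)
  · rw [hD i j h]; simp

end

section

variable {A B : Type*} [Ring A] [Algebra ℂ A] [Ring B] [Algebra ℂ B]
  {S : Matrix (Idx M N) (Idx M N) (PowerSeries A)} {γ : A →ₐ[ℂ] A}
  {Δ : A →ₐ[ℂ] SlotAlg M N A} {T : Matrix (Idx M N) (Idx M N) (PowerSeries B)} {γ' : B →ₐ[ℂ] B}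
  {Δ' : B →ₐ[ℂ] SlotAlg M N B} {φ : A →ₐ[ℂ] B}

theorem twistedMap_par (hS : IsTwGen G S γ) (hT : HasPar (PowerSeries.map (γ' : B →+* B)) T)
    (hφ : S.map (PowerSeries.map (φ : A →+* B)) = T * constSeries _ G * str (T.map negArg)) (y : A) :
    φ (γ y) = γ' (φ y) := by
  have h : HasPar (PowerSeries.map (γ' : B →+* B)) (S.map (PowerSeries.map (φ : A →+* B))) := by
    rw [hφ]
    exact (hT.mul (hS.supersymm.isEven.hasPar γ')).mul hT.map_negArg.str
  have e : φ.comp γ = γ'.comp φ := hS.hom_ext <| Matrix.ext fun i j => by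
    rw [Matrix.map_apply, Matrix.map_apply, series_map_comp, series_map_comp, hS.par, map_mul,
      map_pow, map_neg, map_one]
    exact (h i j).symm
  exact DFunLike.congr_fun e y

theorem str_negArg_mul (X Y : Matrix (Idx M N) (Idx M N) (PowerSeries A)) (h : SCommSeries X Y) :
    str ((X * Y).map negArg) = str (Y.map negArg) * str (X.map negArg) := by
  have h1 := ((h.subst_left (-PowerSeries.X)).subst_right (-PowerSeries.X)).same
  have h2 : (X * Y).map negArg = X.map negArg * Y.map negArg := Matrix.map_mul (f := negHom)
  rw [h2]
  exact h1.str_mul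

theorem matrix_map_comp {C : Type*} [Ring C] [Algebra ℂ C] (f : B →ₐ[ℂ] C) (g : A →ₐ[ℂ] B)
    (S : Matrix (Idx M N) (Idx M N) (PowerSeries A)) :
    S.map (PowerSeries.map ((f.comp g : A →ₐ[ℂ] C) : A →+* C)) =
      (S.map (PowerSeries.map (g : A →+* B))).map (PowerSeries.map (f : B →+* C)) :=
  Matrix.ext fun _ _ => series_map_comp f g _

/-- The coideal property: for the slot series X and the solution T in B, both composites send S to
(X T) G (X T)ᵗ(-u), since transposition reverses the product of the supercommuting factors X and T.
-/
theorem twistedMap_slot (hS : IsTwGen G S γ) (hΔ : IsSlotTw S γ Δ)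
    (hT : HasPar (PowerSeries.map (γ' : B →+* B)) T)
    (hΔ' : T.map (PowerSeries.map (Δ' : B →+* SlotAlg M N B)) = slotSeries M N B *
      T.map (PowerSeries.map (slotIncl M N γ' : B →+* SlotAlg M N B)))
    (hφ : S.map (PowerSeries.map (φ : A →+* B)) = T * constSeries _ G * str (T.map negArg)) (y : A) :
    slotMap M N φ (Δ y) = Δ' (φ y) := by
  have e0 : (slotMap M N φ).comp (slotIncl M N γ) = (slotIncl M N γ').comp φ :=
    AlgHom.ext fun y => slotMap_slotIncl φ (twistedMap_par hS hT hφ) y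
  have e : (slotMap M N φ).comp Δ = Δ'.comp φ := hS.hom_ext <| by
    rw [matrix_map_comp, matrix_map_comp, hφ, map_conj, hΔ, map_conj, map_constSeries, hΔ', map_slotSeries, ← matrix_map_comp, e0,
      matrix_map_comp, hφ, map_conj, map_constSeries, str_negArg_mul _ _ (sCommSeries_slotSeries hT)]
    simp only [mul_assoc]
  exact DFunLike.congr_fun e y

end

theorem injective_twistedMap (hG : IsSupersymmetric G) {φ : YTw G →ₐ[ℂ] YGl M N}
    (hφ : (sStd G).map (PowerSeries.map (φ : YTw G →+* YGl M N)) =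
      tStd M N * constSeries _ G * str ((tStd M N).map negArg)) : Function.Injective φ := by
  have := nontrivial_ygl (M := M) (N := N)
  exact injective_of_slotTw (isTwGen_sStd hG) (isSlotTw_slotTw hG) φ
    (twistedMap_par (isTwGen_sStd hG) map_parGl hφ)
    (twistedMap_slot (isTwGen_sStd hG) (isSlotTw_slotTw hG) map_parGl map_slotGl hφ)

end Embedding

/-! ### Inverses of `RTT` matrices -/

section Relations

variable {M N : ℕ} {K A : Type*} [CommRing K] [Ring A] [Algebra K A]

theorem IsRTT.str {α β : K} {T T' : Matrix (Idx M N) (Idx M N) A} (h : IsRTT β α T' T) :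
    IsRTT (-α) (-β) (str T) (str T') := by
  have := h.leg12_str
  rw [isRTT_iff, neg_mul_neg, show -β - -α = α - β by ring]
  exact this

/-- The `RTT` relation multiplied by T(v)⁻¹ in the second leg from both sides. -/
theorem leg2M_mul_rMat_mul_leg1M {α β : K} {X T' Y : Matrix (Idx M N) (Idx M N) A}
    (h : IsRTT α β X T') (h1 : T' * Y = 1) (h2 : Y * T' = 1) :
    leg2M Y * rMat M N A (β - α) (α * β) * leg1M X =
      leg1M X * rMat M N A (β - α) (α * β) * leg2M Y := by
  have h := isRTT_iff.1 h
  have e1 : leg2M T' * leg2M Y = 1 := by rw [← leg2M_mul, h1, leg2M_one]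
  have e2 : leg2M Y * leg2M T' = 1 := by rw [← leg2M_mul, h2, leg2M_one]
  calc leg2M Y * rMat M N A (β - α) (α * β) * leg1M X
      = leg2M Y * (rMat M N A (β - α) (α * β) * leg1M X * leg2M T') * leg2M Y := by
        simp only [mul_assoc, e1, mul_one]
    _ = (leg2M Y * leg2M T') * leg1M X * rMat M N A (β - α) (α * β) * leg2M Y := by
        rw [h]; simp only [mul_assoc]
    _ = _ := by rw [e2, one_mul]

/-- Inversion reverses products, so the inverses satisfy the relation with the parameters exchanged
and negated. -/
theorem IsRTT.inv {α β : K} {T T' Y Y' : Matrix (Idx M N) (Idx M N) A}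
    (h : IsRTT α β T T') (h1 : T * Y = 1) (h2 : Y * T = 1) (h1' : T' * Y' = 1) (h2' : Y' * T' = 1) :
    IsRTT (-β) (-α) Y' Y := by
  have h3 := leg2M_mul_rMat_mul_leg1M h h1' h2'
  have e1 : leg1M T * leg1M Y = 1 := by rw [← leg1M_mul, h1, leg1M_one]
  have e2 : leg1M Y * leg1M T = 1 := by rw [← leg1M_mul, h2, leg1M_one]
  have h4 : leg1M Y * leg2M Y' * rMat M N A (β - α) (α * β) =
      rMat M N A (β - α) (α * β) * leg2M Y' * leg1M Y := by
    calc leg1M Y * leg2M Y' * rMat M N A (β - α) (α * β)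
        = leg1M Y * (leg2M Y' * rMat M N A (β - α) (α * β) * leg1M T) * leg1M Y := by
          simp only [mul_assoc, e1, mul_one]
      _ = (leg1M Y * leg1M T) * rMat M N A (β - α) (α * β) * leg2M Y' * leg1M Y := by
          rw [h3]; simp only [mul_assoc]
      _ = _ := by rw [e2, one_mul]
  intro i j k l
  have := congrArg (fun Z : Matrix _ _ A => Z (k, i) (l, j)) h4
  beta_reduce at this
  rw [mul_assoc (rMat M N A _ _), rMat_mul_apply, mul_rMat_apply] at this
  simp only [mul_sub, leg1M_mul_leg2M, leg2M_mul_leg1M] at this ⊢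
  rcases par_cases i with hi | hi <;> rcases par_cases j with hj | hj <;>
      rcases par_cases k with hk | hk <;> rcases par_cases l with hl | hl <;>
    simp only [hi, hj, hk, hl, add_zero, zero_add, mul_zero, mul_one, pow_zero, one_mul,
      Nat.reduceAdd, Nat.reduceMul, neg_mul, mul_neg, pow_succ, neg_neg] at this ⊢ <;>
    first
      | linear_combination (norm := module) this
      | linear_combination (norm := module) (-1 : K) • this

theorem leg2M_mul_flipM (Y : Matrix (Idx M N) (Idx M N) A) :
    leg2M Y * flipM M N A = flipM M N A * leg1M Y := by
  ext ⟨i, k⟩ ⟨j, l⟩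
  rw [mul_flipM, flipM_mul]
  simp only [leg1M, leg2M, Matrix.of_apply]
  by_cases h : i = l
  · subst h
    simp only [if_true, ← mul_assoc, ← pow_add]
    congr 1
    rcases par_cases i with hi | hi <;> rcases par_cases j with hj | hj <;>
      rcases par_cases k with hk | hk <;> simp [hi, hj, hk, pow_succ]
  · simp [h]

theorem flipM_mul_leg2M (Y : Matrix (Idx M N) (Idx M N) A) :
    flipM M N A * leg2M Y = leg1M Y * flipM M N A := by
  ext ⟨i, k⟩ ⟨j, l⟩
  rw [mul_flipM, flipM_mul]
  simp only [leg1M, leg2M, Matrix.of_apply]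
  by_cases h : k = j
  · subst h
    simp only [if_true, ← mul_assoc, ← pow_add]
    congr 1
    rcases par_cases i with hi | hi <;> rcases par_cases l with hj | hj <;>
      rcases par_cases k with hk | hk <;> simp [hi, hj, hk, pow_succ]
  · simp [h]

/-- The commutation relation between the entries of `T(u)` and `T(v)⁻¹`. -/
theorem IsRTT.comm_inv {α β : K} {X T' Y : Matrix (Idx M N) (Idx M N) A}
    (h : IsRTT α β X T') (h1 : T' * Y = 1) (h2 : Y * T' = 1) (i k j l : Idx M N) :
    (β - α) • ((-1) ^ (par i * (par k + par l)) * (Y k l * X i j) -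
      (-1) ^ (par j * (par k + par l)) * (X i j * Y k l)) =
    (α * β) • ((if i = l then (-1) ^ (par i * par k) * (Y * X) k j else 0) -
      (if k = j then (-1) ^ (par k * par l) * (X * Y) i l else 0)) := by
  have h3 := leg2M_mul_rMat_mul_leg1M h h1 h2
  have e : leg1M X * flipM M N A * leg2M Y = leg1M (X * Y) * flipM M N A := by
    rw [mul_assoc, flipM_mul_leg2M, leg1M_mul, mul_assoc]
  rw [rMat, mul_sub, sub_mul, mul_sub, sub_mul, mul_smul_comm, mul_smul_comm, mul_smul_comm,
    mul_smul_comm, mul_one, mul_one, smul_mul_assoc, smul_mul_assoc, smul_mul_assoc,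
    smul_mul_assoc, leg2M_mul_flipM, mul_assoc _ (leg1M Y), ← leg1M_mul, e] at h3
  have := congrArg (fun Z : Matrix _ _ A => Z (i, k) (j, l)) h3
  simp only [Matrix.sub_apply, Matrix.smul_apply, leg2M_mul_leg1M, leg1M_mul_leg2M] at this
  rw [flipM_mul, mul_flipM] at this
  have e1 : (-1) ^ (par i * par k) * leg1M (Y * X) (k, i) (j, l) =
      if i = l then (-1) ^ (par i * par k) * (Y * X) k j else 0 := by
    simp only [leg1M, Matrix.of_apply]; split_ifs <;> simp
  have e2 : (-1) ^ (par j * par l) * leg1M (X * Y) (i, k) (l, j) =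
      if k = j then (-1) ^ (par k * par l) * (X * Y) i l else 0 := by
    simp only [leg1M, Matrix.of_apply]
    by_cases hk : k = j
    · rw [if_pos hk, if_pos hk, hk]
    · rw [if_neg hk, if_neg hk, mul_zero]
  rw [e1, e2] at this
  rw [smul_sub, smul_sub, sub_eq_sub_iff_sub_eq_sub, this]

theorem sign_mul_sign_mul' (e f : ℕ) (a b : A) :
    ((-1) ^ e * a) * ((-1) ^ f * b) = (-1) ^ (e + f) * (a * b) := by
  rw [sign_comm, ← mul_assoc, ← mul_assoc, ← pow_add, add_comm f, mul_assoc]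

/-- The supertrace of the identity. -/
theorem sum_sign : ∑ i : Idx M N, (-1 : A) ^ par i = (M : A) - N := by
  simp [Fintype.sum_sum_type, par, sub_eq_add_neg]

/-- The partial transpose of `T(v)⁻¹` and `T(v + M - N)` are inverse up to a central factor. -/
theorem IsRTT.str_inv_mul_str {α β : K} {X T' Y : Matrix (Idx M N) (Idx M N) A}
    (h : IsRTT α β X T') (h1 : T' * Y = 1) (h2 : Y * T' = 1)
    (hαβ : β - α = ((M : K) - N) * (α * β)) (hc : ∀ x : A, (α * β) • x = 0 → x = 0)
    (i j : Idx M N) : ((M : K) - N) • (SuperYangian.str Y * SuperYangian.str X) j i =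
      if i = j then ∑ k, (-1) ^ par k * (Y * X) k k else 0 := by
  have key : ∀ i j k l, ((M : K) - N) • ((-1) ^ (par i * (par k + par l)) * (Y k l * X i j) -
      (-1) ^ (par j * (par k + par l)) * (X i j * Y k l)) =
      (if i = l then (-1) ^ (par i * par k) * (Y * X) k j else 0) -
      (if k = j then (-1) ^ (par k * par l) * (X * Y) i l else 0) := by
    intro i j k l
    have := h.comm_inv h1 h2 i k j l
    rw [hαβ, mul_comm ((M : K) - N), mul_smul] at this
    rw [← sub_eq_zero] at this ⊢
    rw [← smul_sub] at this
    exact hc _ this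
  -- The summand of the transposed product is rewritten with the entries of X first; the correction
  -- terms involve only the diagonal of Y X and one fixed entry of X Y.
  have h3 : ∀ k, ((M : K) - N) • ((-1) ^ (par j * par k + par j + (par k * par i + par k)) *
      (Y k j * X i k)) = (if i = j then (-1) ^ par k * (Y * X) k k else 0) +
      (-1) ^ (par i * par j + par j) * (((M : K) - N) • (X i k * Y k j) - (-1) ^ par k * (X * Y) i j) := by
    intro k
    have h4 := key i k k j
    rw [if_pos rfl] at h4
    by_cases hij : i = j
    · subst hij
      rw [if_pos rfl] at h4 ⊢
      rcases par_cases i with hi | hi <;> rcases par_cases k with hk | hk <;>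
        simp only [hi, hk, add_zero, zero_add, mul_zero, mul_one, pow_zero, one_mul,
          Nat.reduceAdd, Nat.reduceMul, neg_mul, mul_neg, pow_succ, neg_neg] at h4 ⊢ <;>
        first
          | linear_combination (norm := module) h4
          | linear_combination (norm := module) (-1 : K) • h4
    · rw [if_neg hij] at h4 ⊢
      rcases par_cases i with hi | hi <;> rcases par_cases j with hj | hj <;>
        rcases par_cases k with hk | hk <;>
        simp only [hi, hj, hk, add_zero, zero_add, mul_zero, mul_one, pow_zero, one_mul,
          Nat.reduceAdd, Nat.reduceMul, neg_mul, mul_neg, pow_succ, neg_neg] at h4 ⊢ <;>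
        first
          | linear_combination (norm := module) h4
          | linear_combination (norm := module) (-1 : K) • h4
  have h5 : (SuperYangian.str Y * SuperYangian.str X) j i =
      ∑ k, (-1) ^ (par j * par k + par j + (par k * par i + par k)) * (Y k j * X i k) := by
    rw [Matrix.mul_apply]
    refine Finset.sum_congr rfl fun k _ => ?_
    rw [SuperYangian.str, SuperYangian.str, Matrix.of_apply, Matrix.of_apply, sign_mul_sign_mul']
  rw [h5, Finset.smul_sum]
  simp only [h3]
  -- Summation over k turns the correction by X Y into its supertrace multiple M - N, and this
  -- cancels the sum of the products X i k * Y k j.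
  rw [Finset.sum_add_distrib, ← Finset.mul_sum, Finset.sum_sub_distrib, ← Finset.smul_sum,
    ← Finset.sum_mul, sum_sign, ← Matrix.mul_apply, Algebra.smul_def, map_sub, map_natCast,
    map_natCast, sub_self, mul_zero, add_zero]
  split_ifs <;> simp

theorem contr2M_mul (Z : Matrix (Idx M N × Idx M N) (Idx M N × Idx M N) A) (i k : Idx M N)
    (b : Idx M N × Idx M N) : (contr2M M N A * Z) (i, k) b =
      if i = k then (-1) ^ par i * ∑ m, Z (m, m) b else 0 := by
  rw [Matrix.mul_apply, Fintype.sum_prod_type]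
  split_ifs with h
  · subst h
    rw [Finset.mul_sum]
    refine Finset.sum_congr rfl fun m _ => ?_
    rw [Finset.sum_eq_single m] <;> simp +contextual [contr2M, eq_comm]
  · simp [contr2M, h]

theorem mul_contr2M (Z : Matrix (Idx M N × Idx M N) (Idx M N × Idx M N) A) (j l : Idx M N)
    (a : Idx M N × Idx M N) : (Z * contr2M M N A) a (j, l) =
      if j = l then ∑ m, (-1) ^ par m * Z a (m, m) else 0 := by
  rw [Matrix.mul_apply, Fintype.sum_prod_type]
  split_ifs with h
  · subst h
    refine Finset.sum_congr rfl fun m _ => ?_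
    rw [Finset.sum_eq_single m]
    · rcases neg_one_pow_eq_or A (par m) with h | h <;> simp [contr2M, h]
    · intro b _ hb; simp [contr2M, hb.symm]
    · simp
  · simp [contr2M, h]

/-- The closed loop formed by two contractions contributes the supertrace of the identity. -/
theorem contr2M_mul_self : contr2M M N A * contr2M M N A = ((M : K) - N) • contr2M M N A := by
  ext ⟨i, k⟩ ⟨j, l⟩
  rw [mul_contr2M, Matrix.smul_apply]
  by_cases hi : i = k <;> by_cases hj : j = l
  · subst hi hj
    simp only [contr2M, Matrix.of_apply, if_true, and_self]
    rw [← Finset.sum_mul, sum_sign, Algebra.smul_def, map_sub, map_natCast, map_natCast]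
  · simp [contr2M, hj]
  · simp [contr2M, hi]
  · simp [contr2M, hj]

/-- `IsRTT.comm_inv` with the second leg transposed; transposition moves the contraction to the
outside on both sides. -/
theorem IsRTT.rMat2_mul_leg2M_mul_leg1M {α β : K} {X T' Y : Matrix (Idx M N) (Idx M N) A}
    (h : IsRTT α β X T') (h1 : T' * Y = 1) (h2 : Y * T' = 1) :
    rMat2 M N A (β - α) (α * β) * leg2M (SuperYangian.str Y) * leg1M X =
      leg1M X * leg2M (SuperYangian.str Y) * rMat2 M N A (β - α) (α * β) := by
  have s1 : ∀ j l, ∑ m, (leg2M (SuperYangian.str Y) * leg1M X) (m, m) (j, l) = (Y * X) l j := by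
    intro j l
    rw [Matrix.mul_apply]
    refine Finset.sum_congr rfl fun m _ => ?_
    rw [leg2M_mul_leg1M, SuperYangian.str, Matrix.of_apply]
    rcases par_cases m with hm | hm <;> rcases par_cases l with hl | hl <;> simp [hm, hl, pow_succ]
  have s2 : ∀ i k, ∑ m, (-1) ^ par m * (leg1M X * leg2M (SuperYangian.str Y)) (i, k) (m, m) =
      (-1) ^ par k * (X * Y) i k := by
    intro i k
    rw [Matrix.mul_apply, Finset.mul_sum]
    refine Finset.sum_congr rfl fun m _ => ?_
    rw [leg1M_mul_leg2M, SuperYangian.str, Matrix.of_apply]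
    rcases par_cases m with hm | hm <;> rcases par_cases k with hl | hl <;> simp [hm, hl, pow_succ]
  rw [mul_assoc, rMat2, sub_mul, mul_sub, smul_mul_assoc, smul_mul_assoc, mul_smul_comm,
    mul_smul_comm, one_mul, mul_one]
  ext ⟨i, k⟩ ⟨j, l⟩
  simp only [Matrix.sub_apply, Matrix.smul_apply, contr2M_mul, mul_contr2M, s1, s2]
  have h3 := h.comm_inv h1 h2 i l j k
  rw [leg2M_mul_leg1M, leg1M_mul_leg2M, SuperYangian.str, Matrix.of_apply]
  have e1 : (if l = j then (-1) ^ (par l * par k) * (X * Y) i k else 0) =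
      if j = l then (-1) ^ (par l * par k) * (X * Y) i k else 0 := by simp only [eq_comm]
  rw [e1] at h3
  by_cases hik : i = k
  · subst hik
    by_cases hjl : j = l
    · subst hjl
      simp only [if_true] at h3 ⊢
      rcases par_cases i with hi | hi <;> rcases par_cases j with hj | hj <;>
        simp only [hi, hj, add_zero, zero_add, mul_zero, mul_one, pow_zero, one_mul,
          Nat.reduceAdd, Nat.reduceMul, neg_mul, mul_neg, pow_succ, neg_neg] at h3 ⊢ <;>
        first
          | linear_combination (norm := module) h3
          | linear_combination (norm := module) (-1 : K) • h3
    · simp only [if_true, if_neg hjl] at h3 ⊢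
      rcases par_cases i with hi | hi <;> rcases par_cases j with hj | hj <;>
        rcases par_cases l with hl | hl <;>
        simp only [hi, hj, hl, add_zero, zero_add, mul_zero, mul_one, pow_zero, one_mul,
          Nat.reduceAdd, Nat.reduceMul, neg_mul, mul_neg, pow_succ, neg_neg] at h3 ⊢ <;>
        first
          | linear_combination (norm := module) h3
          | linear_combination (norm := module) (-1 : K) • h3
  · by_cases hjl : j = l
    · subst hjl
      simp only [if_true, if_neg hik] at h3 ⊢
      rcases par_cases i with hi | hi <;> rcases par_cases j with hj | hj <;>
        rcases par_cases k with hk | hk <;>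
        simp only [hi, hj, hk, add_zero, zero_add, mul_zero, mul_one, pow_zero, one_mul,
          Nat.reduceAdd, Nat.reduceMul, neg_mul, mul_neg, pow_succ, neg_neg] at h3 ⊢ <;>
        first
          | linear_combination (norm := module) h3
          | linear_combination (norm := module) (-1 : K) • h3
    · simp only [if_neg hik, if_neg hjl] at h3 ⊢
      rcases par_cases i with hi | hi <;> rcases par_cases j with hj | hj <;>
        rcases par_cases k with hk | hk <;> rcases par_cases l with hl | hl <;>
        simp only [hi, hj, hk, hl, add_zero, zero_add, mul_zero, mul_one, pow_zero, one_mul,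
          Nat.reduceAdd, Nat.reduceMul, neg_mul, mul_neg, pow_succ, neg_neg] at h3 ⊢ <;>
        first
          | linear_combination (norm := module) h3
          | linear_combination (norm := module) (-1 : K) • h3

theorem leg2M_diagonal_mul_apply (z : A) (Z : Matrix (Idx M N × Idx M N) (Idx M N × Idx M N) A)
    (a b : Idx M N × Idx M N) : (leg2M (Matrix.diagonal fun _ : Idx M N => z) * Z : Matrix (Idx M N × Idx M N) (Idx M N × Idx M N) A) a b = z * Z a b := by
  have : leg2M (Matrix.diagonal fun _ : Idx M N => z) = Matrix.diagonal fun _ => z := by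
    ext ⟨i, k⟩ ⟨j, l⟩
    by_cases h : i = j
    · by_cases h' : k = l
      · subst h h'
        simp [leg2M]
      · simp [leg2M, h, h']
    · simp [leg2M, h]
  rw [this, Matrix.diagonal_mul]

theorem mul_leg2M_diagonal_apply (z : A) (Z : Matrix (Idx M N × Idx M N) (Idx M N × Idx M N) A)
    (a b : Idx M N × Idx M N) : (Z * leg2M (Matrix.diagonal fun _ : Idx M N => z) : Matrix (Idx M N × Idx M N) (Idx M N × Idx M N) A) a b = Z a b * z := by
  have : leg2M (Matrix.diagonal fun _ : Idx M N => z) = Matrix.diagonal fun _ => z := by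
    ext ⟨i, k⟩ ⟨j, l⟩
    by_cases h : i = j
    · by_cases h' : k = l
      · subst h h'
        simp [leg2M]
      · simp [leg2M, h, h']
    · simp [leg2M, h]
  rw [this, Matrix.mul_diagonal]

theorem leg2M_diagonal_commute (z : A) (a b : K) : Commute (leg2M (Matrix.diagonal fun _ => z))
    (rMat2 M N A a b) := by
  ext c d
  rw [leg2M_diagonal_mul_apply, mul_leg2M_diagonal_apply, rMat2, Matrix.sub_apply,
    Matrix.smul_apply, Matrix.smul_apply, contr2M, Matrix.of_apply, Matrix.one_apply]
  rcases neg_one_pow_eq_or A (par c.1) with h | h <;> simp only [h] <;> split_ifs <;>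
    simp [mul_sub, sub_mul, mul_add, add_mul, mul_smul_comm, smul_mul_assoc]

/-- The coefficients of `z(v)` commute with the entries of `T(u)`. -/
theorem IsRTT.commute {α β w : K} {X T' Y W : Matrix (Idx M N) (Idx M N) A}
    (h : IsRTT α β X T') (h1 : T' * Y = 1) (h2 : Y * T' = 1) (h' : IsRTT w α W X) {z : A}
    (hz : SuperYangian.str Y * SuperYangian.str W = Matrix.diagonal fun _ => z)
    (hw : β - w = ((M : K) - N) * (w * β))
    (hc : ∀ x : A, ((β - α) * (α - w)) • x = 0 → x = 0) (i j : Idx M N) : z * X i j = X i j * z := by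
  -- With α = 1/u, β = 1/v and w = 1/(v + M - N), the factors are multiples of R^{t₂}(u - v) and
  -- R^{t₂}(v + M - N - u). The value M - N of the loop is exactly what makes the contraction terms
  -- cancel.
  have hρ : rMat2 M N A (β - α) (α * β) * rMat2 M N A (α - w) (α * w) =
      ((β - α) * (α - w)) • (1 : Matrix _ _ A) := by
    have e := contr2M_mul_self (M := M) (N := N) (K := K) (A := A)
    have : (α * β) * (α * w) * ((M : K) - N) = (β - α) * (α * w) + (α * β) * (α - w) := by
      linear_combination (-α ^ 2) * hw
    have : (α * β) • (α * w) • ((M : K) - N) • contr2M M N A =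
        (β - α) • (α * w) • contr2M M N A + (α * β) • (α - w) • contr2M M N A := by
      simp only [smul_smul, ← add_smul, ← mul_assoc] at this ⊢
      rw [this]
    have e2 : rMat2 M N A (β - α) (α * β) * rMat2 M N A (α - w) (α * w) =
        (β - α) • (α - w) • (1 : Matrix _ _ A) - (β - α) • (α * w) • contr2M M N A -
        (α * β) • (α - w) • contr2M M N A +
        (α * β) • (α * w) • (contr2M M N A * contr2M M N A) := by
      simp only [rMat2, mul_sub, sub_mul, smul_mul_assoc, mul_smul_comm, one_mul, mul_one, smul_sub]
      module
    rw [e2, e, this]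
    module
  have h3 := h.rMat2_mul_leg2M_mul_leg1M h1 h2
  have h4 := h'.leg2_str
  have h5 := leg2M_diagonal_commute (M := M) (N := N) z (β - α) (α * β)
  rw [← hz] at h5
  -- T₁(u) is carried through the two transposed factors of z(v). A pair of mutually inverse
  -- R-matrices is inserted on one side and removed on the other.
  have h6 : ((β - α) * (α - w)) • (leg2M (SuperYangian.str Y * SuperYangian.str W) * leg1M X) =
      ((β - α) * (α - w)) • (leg1M X * leg2M (SuperYangian.str Y * SuperYangian.str W)) := by
    calc ((β - α) * (α - w)) • (leg2M (SuperYangian.str Y * SuperYangian.str W) * leg1M X)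
        = leg2M (SuperYangian.str Y * SuperYangian.str W) * (((β - α) * (α - w)) • 1) * leg1M X := by
          rw [mul_smul_comm, mul_one, smul_mul_assoc]
      _ = (leg2M (SuperYangian.str Y * SuperYangian.str W) * rMat2 M N A (β - α) (α * β)) *
            rMat2 M N A (α - w) (α * w) * leg1M X := by
          rw [← hρ]; simp only [mul_assoc]
      _ = rMat2 M N A (β - α) (α * β) * leg2M (SuperYangian.str Y) * (leg2M (SuperYangian.str W) *
            rMat2 M N A (α - w) (α * w) * leg1M X) := by
          rw [h5.eq, leg2M_mul]; simp only [mul_assoc]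
      _ = (rMat2 M N A (β - α) (α * β) * leg2M (SuperYangian.str Y) * leg1M X) *
            rMat2 M N A (α - w) (α * w) * leg2M (SuperYangian.str W) := by
          rw [h4]; simp only [mul_assoc]
      _ = leg1M X * leg2M (SuperYangian.str Y) * (rMat2 M N A (β - α) (α * β) *
            rMat2 M N A (α - w) (α * w)) * leg2M (SuperYangian.str W) := by
          rw [h3]; simp only [mul_assoc]
      _ = _ := by
          rw [hρ, mul_smul_comm, mul_one, smul_mul_assoc, mul_assoc, ← leg2M_mul]
  have h7 := congrArg (fun Z : Matrix (Idx M N × Idx M N) (Idx M N × Idx M N) A => Z (i, i) (j, i)) h6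
  beta_reduce at h7
  rw [hz, Matrix.smul_apply, Matrix.smul_apply, leg2M_diagonal_mul_apply, mul_leg2M_diagonal_apply,
    ← sub_eq_zero, ← smul_sub] at h7
  have h8 := sub_eq_zero.1 (hc _ h7)
  simpa [leg1M] using h8

end Relations

/-! ### Shifts of the spectral parameter -/

section Shift

variable {A B : Type*} [Ring A] [Algebra ℂ A] [Ring B] [Algebra ℂ B]

theorem shiftedInv_mul (c : ℂ) :
    shiftedInv c * (1 + PowerSeries.C c * PowerSeries.X) = PowerSeries.X := by
  rw [shiftedInv, mul_assoc, PowerSeries.inv_mul_cancel _ (by simp), mul_one]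

theorem constantCoeff_shiftedInv (c : ℂ) : constantCoeff (shiftedInv c) = 0 := by
  simp [shiftedInv]

theorem one_add_C_mul_X_ne_zero (c : ℂ) : (1 + PowerSeries.C c * PowerSeries.X : PowerSeries ℂ) ≠ 0 :=
  fun h => by simpa using congrArg constantCoeff h

theorem eq_shiftedInv {c : ℂ} {f : PowerSeries ℂ}
    (h : f * (1 + PowerSeries.C c * PowerSeries.X) = PowerSeries.X) : f = shiftedInv c :=
  mul_right_cancel₀ (one_add_C_mul_X_ne_zero c) (h.trans (shiftedInv_mul c).symm)

theorem shiftedInv_zero : shiftedInv 0 = PowerSeries.X := (eq_shiftedInv (by simp)).symm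

theorem substInv_X_scalar {w : PowerSeries ℂ} (hw : constantCoeff w = 0) :
    substInv w (PowerSeries.X : PowerSeries ℂ) = w := by
  rw [substInv_X hw]; ext n; simp

/-- `f(u) ↦ f(u + c)` as a homomorphism. -/
def shiftHom (c : ℂ) : PowerSeries A →ₐ[ℂ] PowerSeries A :=
  substHom (shiftedInv c) (constantCoeff_shiftedInv c)

theorem shiftHom_apply (c : ℂ) (f : PowerSeries A) : shiftHom c f = shiftArg c f := rfl

theorem shiftArg_shiftArg (a b : ℂ) (f : PowerSeries A) :
    shiftArg a (shiftArg b f) = shiftArg (a + b) f := by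
  rw [shiftArg, shiftArg, substInv_substInv (constantCoeff_shiftedInv a) (constantCoeff_shiftedInv b)]
  refine congrArg (substInv · f) (eq_shiftedInv ?_)
  have h := congrArg (shiftHom a) (shiftedInv_mul b)
  rw [map_mul, map_add, map_one, map_mul, shiftHom_apply, shiftHom_apply, shiftHom_apply, shiftArg,
    shiftArg, shiftArg, substInv_C (constantCoeff_shiftedInv a),
    substInv_X_scalar (constantCoeff_shiftedInv a)] at h
  have h2 := shiftedInv_mul a
  rw [map_add]
  linear_combination (1 + PowerSeries.C a * PowerSeries.X) * h + (1 - PowerSeries.C b * substInv (shiftedInv a) (shiftedInv b)) * h2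

theorem shiftArg_zero (f : PowerSeries A) : shiftArg 0 f = f := by
  rw [shiftArg, shiftedInv_zero, substInv_self]

theorem negShiftArg_eq (c : ℂ) (f : PowerSeries A) : negShiftArg c f = shiftArg c (negArg f) := by
  rw [shiftArg, negArg, substInv_substInv (constantCoeff_shiftedInv c) (by simp), negShiftArg]
  congr 1
  rw [← substHom_apply _ (constantCoeff_shiftedInv c), map_neg, substHom_apply,
    substInv_X_scalar (constantCoeff_shiftedInv c)]

theorem negArg_shiftArg (c : ℂ) (f : PowerSeries A) :
    negArg (shiftArg c f) = shiftArg (-c) (negArg f) := by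
  rw [← negShiftArg_eq, shiftArg, negArg, substInv_substInv (by simp) (constantCoeff_shiftedInv c),
    negShiftArg]
  refine congrArg (substInv · f) (neg_eq_iff_eq_neg.1 (eq_shiftedInv ?_))
  have h := congrArg negHom (shiftedInv_mul c)
  rw [map_mul, map_add, map_one, map_mul, negHom_apply, negHom_apply, negHom_apply, negArg_C,
    negArg, negArg, substInv_X_scalar (by simp)] at h
  rw [map_neg]
  linear_combination -h

theorem map_shiftArg (φ : A →ₐ[ℂ] B) (c : ℂ) (f : PowerSeries A) :
    PowerSeries.map (φ : A →+* B) (shiftArg c f) = shiftArg c (PowerSeries.map (φ : A →+* B) f) :=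
  map_substInv φ _ f

theorem shiftArg_C (c : ℂ) (a : A) : shiftArg c (PowerSeries.C a) = PowerSeries.C a :=
  substInv_C (constantCoeff_shiftedInv c) a

theorem coeff_one_substInv {w : PowerSeries ℂ} (f : PowerSeries A) :
    coeff 1 (substInv w f) = coeff 1 w • coeff 1 f := by
  rw [substInv, coeff_mk]
  simp [Finset.sum_range_succ, coeff_one]

theorem coeff_one_mul' (f g : PowerSeries A) : coeff 1 (f * g) =
    constantCoeff f * coeff 1 g +
      coeff 1 f * constantCoeff g := by
  rw [coeff_mul]
  simp [Finset.Nat.antidiagonal_succ]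

theorem coeff_one_shiftedInv (c : ℂ) : coeff 1 (shiftedInv c) = 1 := by
  have := congrArg (coeff 1) (shiftedInv_mul c)
  rw [coeff_one_mul'] at this
  simpa [constantCoeff_shiftedInv] using this

theorem coeff_one_shiftArg (c : ℂ) (f : PowerSeries A) :
    coeff 1 (shiftArg c f) = coeff 1 f := by
  rw [shiftArg, coeff_one_substInv, coeff_one_shiftedInv, one_smul]

theorem commute_substInv {f g : PowerSeries A}
    (h : ∀ m n, Commute (coeff m f) (coeff n g)) (w : PowerSeries ℂ) (m n : ℕ) :
    Commute (coeff m (substInv w f)) (coeff n g) := by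
  rw [substInv, coeff_mk]
  exact Commute.sum_left _ _ _ fun r _ => (h r n).smul_left _

theorem commute_of_coeff {f g : PowerSeries A}
    (h : ∀ m n, Commute (coeff m f) (coeff n g)) : Commute f g := by
  ext n
  rw [coeff_mul, coeff_mul, ← Finset.Nat.sum_antidiagonal_swap]
  exact Finset.sum_congr rfl fun p _ => h _ _

end Shift

/-! ### Invertibility of matrices of series -/

section Inverse

variable {n A : Type*} [Fintype n] [DecidableEq n] [Ring A]

/-- A series of matrices as a matrix of series. -/
def seriesMatrix : PowerSeries (Matrix n n A) →+* Matrix n n (PowerSeries A) where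
  toFun F := Matrix.of fun i j => PowerSeries.mk fun r => coeff r F i j
  map_zero' := by ext i j r; simp
  map_add' F G := by ext i j r; simp
  map_one' := by
    ext i j r
    rcases eq_or_ne i j with rfl | h <;> by_cases hr : r = 0 <;>
      simp_all [coeff_one]
  map_mul' F G := by
    ext i j r
    simp only [Matrix.of_apply, coeff_mk, Matrix.mul_apply, map_sum,
      coeff_mul, Matrix.sum_apply]
    rw [Finset.sum_comm]

/-- A matrix of series is read as a series with matrix coefficients, where an invertible constant
term suffices even over a noncommutative ring. -/
theorem isUnit_of_constantCoeff {T : Matrix n n (PowerSeries A)}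
    (h : IsUnit (T.map constantCoeff)) : IsUnit T := by
  have h1 : seriesMatrix (PowerSeries.mk fun r => T.map (coeff r)) = T := by
    ext i j r; simp [seriesMatrix]
  rw [← h1]
  refine IsUnit.map _ (PowerSeries.isUnit_iff_constantCoeff.2 ?_)
  simpa [← coeff_zero_eq_constantCoeff_apply] using h

end Inverse

/-! ### The central series z(u) of a solution of the `RTT` relation -/

section Central

variable {M N : ℕ} {A B : Type*} [Ring A] [Algebra ℂ A] [Ring B] [Algebra ℂ B]
  {T Y : Matrix (Idx M N) (Idx M N) (PowerSeries A)}

/-- The relation depends only on the ratio of β - α to αβ, which is u - v. -/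
theorem IsRTT.of_smul {K A : Type*} [CommRing K] [Ring A] [Algebra K A] {α β α' β' : K} (k : K)
    (h1 : k * (β - α) = β' - α') (h2 : k * (α * β) = α' * β')
    {T T' : Matrix (Idx M N) (Idx M N) A} (h : IsRTT α β T T') : IsRTT α' β' T T' := by
  intro i j k' l
  rw [← h1, ← h2, mul_smul, mul_smul, h i j k' l]

theorem inU_shiftedInv_mul (c : ℂ) : (inU (shiftedInv c) : PowerSeries (PowerSeries ℂ)) *
    (1 + inU (PowerSeries.C c) * inU PowerSeries.X) = inU PowerSeries.X := by
  have := congrArg inUHom (shiftedInv_mul c)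
  simpa only [map_mul, map_add, map_one, inUHom_apply] using this

theorem inV_shiftedInv_mul (c : ℂ) : (inV (shiftedInv c) : PowerSeries (PowerSeries ℂ)) *
    (1 + inV (PowerSeries.C c) * inV PowerSeries.X) = inV PowerSeries.X := by
  have := congrArg inVHom (shiftedInv_mul c)
  simpa only [map_mul, map_add, map_one, inVHom_apply] using this

/-- Shifting u and v together leaves u - v unchanged; the multiplier is (1 + c/u)(1 + c/v). -/
theorem IsRTTSeries.shift (h : IsRTTSeries T) (c : ℂ) : IsRTTSeries (T.map (shiftArg c)) := by
  have e : (inU (PowerSeries.C c) : PowerSeries (PowerSeries ℂ)) = inV (PowerSeries.C c) :=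
    inU_C c
  have h1 := inU_shiftedInv_mul c
  have h2 := inV_shiftedInv_mul c
  rw [e] at h1
  refine IsRTT.of_smul ((1 + inV (PowerSeries.C c) * inU PowerSeries.X) *
    (1 + inV (PowerSeries.C c) * inV PowerSeries.X)) ?_ ?_
    (h.subst₂ (constantCoeff_shiftedInv c) (constantCoeff_shiftedInv c))
  · linear_combination (-(1 + inV (PowerSeries.C c) * inV PowerSeries.X)) * h1 +
      (1 + inV (PowerSeries.C c) * inU PowerSeries.X) * h2
  · linear_combination (1 + inV (PowerSeries.C c) * inV PowerSeries.X) * inV (shiftedInv c) * h1 +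
      inU PowerSeries.X * h2

theorem inU_neg (f : PowerSeries A) : inU (-f) = -inU f := map_neg inUHom f
theorem inV_neg (f : PowerSeries A) : inV (-f) = -inV f := map_neg inVHom f

theorem map_mul_eq_one {B C : Type*} [Ring B] [Ring C] (φ : B →+* C)
    {T Y : Matrix (Idx M N) (Idx M N) B} (h : T * Y = 1) : T.map φ * Y.map φ = 1 := by
  rw [← Matrix.map_mul, h, Matrix.map_one _ (map_zero φ) (map_one φ)]

theorem map_inU_mul_eq_one (h : T * Y = 1) : T.map inU * Y.map inU = 1 := by
  have e : (inU : PowerSeries A → _) = inUHom := rfl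
  rw [e, ← Matrix.map_mul, h, Matrix.map_one _ (map_zero inUHom) (map_one inUHom)]

theorem map_inV_mul_eq_one (h : T * Y = 1) : T.map inV * Y.map inV = 1 := by
  have e : (inV : PowerSeries A → _) = inVHom := rfl
  rw [e, ← Matrix.map_mul, h, Matrix.map_one _ (map_zero inVHom) (map_one inVHom)]

theorem map_substInv_mul_eq_one {w : PowerSeries ℂ} (hw : constantCoeff w = 0)
    (h : T * Y = 1) : T.map (substInv w) * Y.map (substInv w) = 1 :=
  map_mul_eq_one (substHom w hw : PowerSeries A →ₐ[ℂ] PowerSeries A).toRingHom h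

theorem IsRTTSeries.negArg_inv (h : IsRTTSeries T) (h1 : T * Y = 1) (h2 : Y * T = 1) :
    IsRTTSeries (Y.map negArg) := by
  have hX : constantCoeff (-PowerSeries.X : PowerSeries ℂ) = 0 := by simp
  have e1 := map_substInv_mul_eq_one hX h1
  have e2 := map_substInv_mul_eq_one hX h2
  have := (h.swap₂ hX hX).inv (map_inV_mul_eq_one e1) (map_inV_mul_eq_one e2)
    (map_inU_mul_eq_one e1) (map_inU_mul_eq_one e2)
  rw [inU_neg, inV_neg, neg_neg, neg_neg] at this
  exact this

theorem IsRTTSeries.str_negArg (h : IsRTTSeries T) : IsRTTSeries (str (T.map negArg)) := by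
  have hX : constantCoeff (-PowerSeries.X : PowerSeries ℂ) = 0 := by simp
  have := (h.swap₂ hX hX).str
  rw [inU_neg, inV_neg, neg_neg, neg_neg] at this
  have e1 := str_map inUHom (T.map negArg)
  have e2 := str_map inVHom (T.map negArg)
  change IsRTT _ _ (str ((T.map negArg).map inUHom)) (str ((T.map negArg).map inVHom)) at this
  rwa [e1, e2] at this

/-- The transpose of `T(u - (M - N)/2)⁻¹`. -/
def transpInv (Y : Matrix (Idx M N) (Idx M N) (PowerSeries A)) :
    Matrix (Idx M N) (Idx M N) (PowerSeries A) :=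
  (str Y).map (shiftArg (-(((M : ℂ) - N) / 2)))

theorem map_negArg_map_negArg (T : Matrix (Idx M N) (Idx M N) (PowerSeries A)) :
    (T.map negArg).map negArg = T := Matrix.ext fun _ _ => negArg_negArg _

/-- Both T(u) ↦ T(-u)⁻¹ and T(u) ↦ Tᵗ(-u) preserve the relation; composing them cancels the sign of
u and leaves the transposed inverse, which is then shifted. -/
theorem IsRTTSeries.transpInv (h : IsRTTSeries T) (h1 : T * Y = 1) (h2 : Y * T = 1) :
    IsRTTSeries (transpInv Y) := by
  have := ((h.negArg_inv h1 h2).str_negArg).shift (-(((M : ℂ) - N) / 2))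
  rwa [map_negArg_map_negArg] at this

theorem shiftedInv_smul_eq_zero {c : ℂ} {f : PowerSeries A} (h : shiftedInv c • f = 0) : f = 0 := by
  have h1 : (PowerSeries.X : PowerSeries ℂ) • f = 0 := by
    rw [← shiftedInv_mul c, mul_comm, mul_smul, h, smul_zero]
  rw [series_X_smul] at h1
  ext n
  simpa using congrArg (coeff (n + 1)) h1

/-- Comparing coefficients of powers of u⁻¹ gives w F₀ = 0 and w F_{n+1} = F_n, so all F_n vanish in
turn. -/
theorem series_smul_sub_eq_zero {w : PowerSeries ℂ} (hw : ∀ f : PowerSeries A, w • f = 0 → f = 0)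
    {F : PowerSeries (PowerSeries A)}
    (h : (inV w - inU PowerSeries.X : PowerSeries (PowerSeries ℂ)) • F = 0) : F = 0 := by
  rw [sub_smul, inU_smul, inV_smul, PowerSeries.map_X, sub_eq_zero] at h
  have e : inU (PowerSeries.X : PowerSeries A) = PowerSeries.X := PowerSeries.map_X _
  rw [e, inV] at h
  ext n : 1
  induction n with
  | zero =>
    have := congrArg (coeff 0) h
    rw [coeff_C_mul, PowerSeries.coeff_zero_X_mul] at this
    rw [hw _ this, map_zero]
  | succ n ih =>
    have := congrArg (coeff (n + 1)) h
    rw [coeff_C_mul, PowerSeries.coeff_succ_X_mul, ih, map_zero] at this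
    rw [hw _ this, map_zero]

theorem sub_ne_zero_of_ne (hne : M ≠ N) : ((M : ℂ) - N) ≠ 0 :=
  sub_ne_zero.2 (by exact_mod_cast hne)

theorem X_sub_shiftedInv (c : ℂ) :
    PowerSeries.X - shiftedInv c = PowerSeries.C c * (shiftedInv c * PowerSeries.X) := by
  linear_combination -(shiftedInv_mul c)

theorem series_C_eq : ((M : PowerSeries ℂ) - N) = PowerSeries.C ((M : ℂ) - N) := by simp

/-- The central series attached to a solution of the `RTT` relation. -/
theorem IsRTTSeries.exists_central (h : IsRTTSeries T) (hne : M ≠ N) (h1 : T * Y = 1)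
    (h2 : Y * T = 1) : ∃ z : PowerSeries A,
      str Y * str (T.map (shiftArg ((M : ℂ) - N))) = Matrix.diagonal fun _ => z := by
  have h3 := h.subst₁ (constantCoeff_shiftedInv ((M : ℂ) - N)) (x := PowerSeries.X) (by simp)
  rw [map_substInv_X] at h3
  have h4 := h3.str_inv_mul_str h1 h2 (by rw [series_C_eq, X_sub_shiftedInv]) (fun x hx => by
    rw [mul_smul] at hx
    have := shiftedInv_smul_eq_zero hx
    rw [← shiftedInv_zero] at this
    exact shiftedInv_smul_eq_zero this)
  -- `IsRTT.str_inv_mul_str` determines (M - N) z(u) as the supertrace of T(u)⁻¹ T(u + M - N);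
  -- dividing requires M ≠ N.
  refine ⟨((M : ℂ) - N)⁻¹ • ∑ k, (-1) ^ par k * (Y * T.map (shiftArg ((M : ℂ) - N))) k k,
    Matrix.ext fun j i => ?_⟩
  have h5 := h4 i j
  have e : ∀ x : PowerSeries A, ((M : PowerSeries ℂ) - N) • x = ((M : ℂ) - N) • x := by
    intro x
    rw [series_C_eq, series_smul_def, PowerSeries.map_C, ← PowerSeries.smul_eq_C_mul,
      algebraMap_smul]
  rw [e] at h5
  have h6 := congrArg (((M : ℂ) - N)⁻¹ • ·) h5
  beta_reduce at h6
  rw [inv_smul_smul₀ (sub_ne_zero_of_ne hne)] at h6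
  refine h6.trans ?_
  rcases eq_or_ne i j with rfl | hij
  · rw [if_pos rfl, Matrix.diagonal_apply_eq]; rfl
  · rw [if_neg hij, Matrix.diagonal_apply_ne _ hij.symm, smul_zero]

/-- `IsRTT.commute` in two variables, with z in the variable v and T in the variable u, so that
comparing coefficients separates the two series. -/
theorem IsRTTSeries.commute_central (h : IsRTTSeries T) (h1 : T * Y = 1)
    (h2 : Y * T = 1) {z : PowerSeries A}
    (hz : str Y * str (T.map (shiftArg ((M : ℂ) - N))) = Matrix.diagonal fun _ => z)
    (m n : ℕ) (i j : Idx M N) :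
    Commute (coeff m z) (coeff n (T i j)) := by
  have h3 := h.swap₂ (constantCoeff_shiftedInv ((M : ℂ) - N)) (x := PowerSeries.X) (by simp)
  rw [map_substInv_X] at h3
  have hz' : str (Y.map inV) * str ((T.map (shiftArg ((M : ℂ) - N))).map inV) =
      Matrix.diagonal fun _ => inV z := by
    have := congrArg (fun Z : Matrix _ _ (PowerSeries A) => Z.map inVHom) hz
    beta_reduce at this
    rw [Matrix.map_mul, ← str_map, ← str_map, Matrix.diagonal_map (map_zero _)] at this
    exact this
  have hw : (inV PowerSeries.X - inV (shiftedInv ((M : ℂ) - N)) : PowerSeries (PowerSeries ℂ)) =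
      ((M : PowerSeries (PowerSeries ℂ)) - (N : PowerSeries (PowerSeries ℂ))) *
        (inV (shiftedInv ((M : ℂ) - N)) * inV PowerSeries.X) := by
    have := congrArg inVHom (X_sub_shiftedInv ((M : ℂ) - N))
    rw [← series_C_eq] at this
    simpa only [map_mul, map_sub, map_natCast, inVHom_apply] using this
  have hc : ∀ x : PowerSeries (PowerSeries A), ((inV PowerSeries.X - inU PowerSeries.X) *
      (inU PowerSeries.X - inV (shiftedInv ((M : ℂ) - N))) : PowerSeries (PowerSeries ℂ)) • x = 0 →
      x = 0 := by
    intro x hx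
    rw [mul_smul] at hx
    have h5 := series_smul_sub_eq_zero (fun f hf => by
      rw [← shiftedInv_zero] at hf; exact shiftedInv_smul_eq_zero hf) hx
    refine series_smul_sub_eq_zero (fun f hf => shiftedInv_smul_eq_zero hf)
      (?_ : (inV (shiftedInv ((M : ℂ) - N)) - inU PowerSeries.X :
        PowerSeries (PowerSeries ℂ)) • x = 0)
    rw [← neg_sub, neg_smul, h5, neg_zero]
  have h4 := IsRTT.commute h (map_inV_mul_eq_one h1) (map_inV_mul_eq_one h2) h3 hz' hw hc i j
  have h5 := congrArg (fun F => coeff m (coeff n F)) h4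
  simpa [inU, inV, Commute, SemiconjBy] using h5

end Central

/-! ### The central series of the twisted super Yangian -/

section Zeta

variable {M N : ℕ} {A B : Type*} [Ring A] [Algebra ℂ A] [Ring B] [Algebra ℂ B]
  {T Y S R : Matrix (Idx M N) (Idx M N) (PowerSeries A)}

theorem SComm.inv_right {A : Type*} [Ring A] {X Y Z : Matrix (Idx M N) (Idx M N) A} (h : SComm X Y)
    (h1 : Y * Z = 1) (h2 : Z * Y = 1) : SComm X Z := by
  have e1 : leg2M Y * leg2M Z = 1 := by rw [← leg2M_mul, h1, leg2M_one]
  have e2 : leg2M Z * leg2M Y = 1 := by rw [← leg2M_mul, h2, leg2M_one]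
  have h3 : leg1M X * leg2M Z = leg2M Z * leg1M X := by
    calc leg1M X * leg2M Z = leg2M Z * leg2M Y * leg1M X * leg2M Z := by rw [e2, one_mul]
      _ = leg2M Z * (leg1M X * leg2M Y) * leg2M Z := by rw [h.legs]; simp only [mul_assoc]
      _ = _ := by simp only [mul_assoc, e1, mul_one]
  intro i j k l
  have h4 := congrArg (fun W : Matrix _ _ A => W (i, k) (j, l)) h3
  beta_reduce at h4
  rw [leg1M_mul_leg2M, leg2M_mul_leg1M] at h4
  rw [← neg_one_pow_mul_self (par j * (par k + par l)) (X i j * Z k l), h4, ← mul_assoc, ← pow_add,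
    ← add_mul, add_comm (par j)]

theorem SCommSeries.of_inU_inV (h : SComm (T.map inU) (S.map inV)) : SCommSeries T S := by
  intro m n i j k l
  have h1 := congrArg (fun F => coeff n (coeff m F)) (h i j k l)
  simp only [Matrix.map_apply] at h1 ⊢
  rw [coeff_neg_one_pow_mul, coeff_neg_one_pow_mul] at h1
  simpa [inU, inV] using h1

theorem SCommSeries.inv_right (h : SCommSeries T S) (h1 : S * R = 1) (h2 : R * S = 1) :
    SCommSeries T R :=
  .of_inU_inV (h.inU_inV.inv_right (map_inV_mul_eq_one h1) (map_inV_mul_eq_one h2))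

theorem SCommSeries.inv_left (h : SCommSeries T S) (h1 : T * Y = 1) (h2 : Y * T = 1) :
    SCommSeries Y S := (h.symm.inv_right h1 h2).symm

theorem IsSymm.mul_left {K A : Type*} [CommRing K] [Ring A] [Algebra K A] {α : K}
    {S S' : Matrix (Idx M N) (Idx M N) A} (h : IsSymm α S S') (c : A) :
    IsSymm α (S.map (c * ·)) (S'.map (c * ·)) := by
  intro i j
  have := congrArg (c * ·) (h i j)
  simp only [Matrix.map_apply] at this ⊢
  rw [mul_add, mul_smul_comm, mul_smul_comm, mul_smul_comm, mul_sub, sign_comm] at this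
  exact this

/-- The half shift `(M - N) / 2`. -/
def halfShift (M N : ℕ) : ℂ := ((M : ℂ) - N) / 2

theorem halfShift_add : halfShift M N + halfShift M N = (M : ℂ) - N := add_halves _

/-- The matrix `R(-u - (M - N)/2) J`. -/
def sigmaSeries (R : Matrix (Idx M N) (Idx M N) (PowerSeries A)) :
    Matrix (Idx M N) (Idx M N) (PowerSeries A) :=
  R.map (negShiftArg (halfShift M N)) * constSeries A (parMat M N)

/-- The series `ζ(u)` for which `ζ(u) S(-u - (M - N)/2)⁻¹ J` satisfies the symmetry relation. -/
def IsZeta (S : Matrix (Idx M N) (Idx M N) (PowerSeries A)) (ζ : PowerSeries A) : Prop :=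
  ∃ R, S * R = 1 ∧ R * S = 1 ∧ IsSymm (PowerSeries.X : PowerSeries ℂ)
    ((sigmaSeries R).map (ζ * ·)) ((sigmaSeries R).map negArg)

/-- `f(u) ↦ f(-u - c)` as a homomorphism. -/
def negShiftHom (c : ℂ) : PowerSeries A →ₐ[ℂ] PowerSeries A := (shiftHom c).comp negHom

theorem negShiftHom_apply (c : ℂ) (f : PowerSeries A) : negShiftHom c f = negShiftArg c f :=
  (negShiftArg_eq c f).symm

theorem map_negShiftHom (c : ℂ) (T : Matrix (Idx M N) (Idx M N) (PowerSeries A)) :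
    T.map (negShiftHom c) = T.map (negShiftArg c) :=
  Matrix.ext fun _ _ => negShiftHom_apply c _

theorem matrix_map_mul_hom (φ : PowerSeries A →ₐ[ℂ] PowerSeries B)
    (T S : Matrix (Idx M N) (Idx M N) (PowerSeries A)) : (T * S).map φ = T.map φ * S.map φ :=
  Matrix.map_mul

theorem parMat_mul_parMat :
    constSeries A (parMat M N) * constSeries A (parMat M N) = 1 := by
  rw [constSeries_parMat, Matrix.diagonal_mul_diagonal, ← Matrix.diagonal_one]
  congr 1
  funext i
  rw [← mul_one ((-1) ^ par i * _), mul_assoc, neg_one_pow_mul_self]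

theorem map_negShiftArg_mul_eq_one (c : ℂ) (h : T * Y = 1) :
    T.map (negShiftArg c) * Y.map (negShiftArg c) = 1 := by
  rw [← map_negShiftHom, ← map_negShiftHom, ← matrix_map_mul_hom, h,
    Matrix.map_one _ (map_zero _) (map_one _)]

theorem sigmaSeries_mul (h : R * S = 1) : sigmaSeries R *
    (constSeries A (parMat M N) * S.map (negShiftArg (halfShift M N))) = 1 := by
  rw [sigmaSeries, mul_assoc, ← mul_assoc (constSeries A _), parMat_mul_parMat, one_mul]
  exact map_negShiftArg_mul_eq_one _ h

theorem map_sigmaSeries (φ : A →ₐ[ℂ] B) : (sigmaSeries R).map (PowerSeries.map (φ : A →+* B)) =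
    sigmaSeries (R.map (PowerSeries.map (φ : A →+* B))) := by
  rw [sigmaSeries, Matrix.map_mul, map_constSeries, sigmaSeries]
  congr 1
  exact Matrix.ext fun i j => map_substInv φ _ _

theorem isUnit_two_add_X : IsUnit (2 + PowerSeries.X : PowerSeries ℂ) := by
  rw [PowerSeries.isUnit_iff_constantCoeff, map_add, map_ofNat]; simp

/-- The symmetry relation solved for its first argument. As 2 + u⁻¹ is a unit, the first argument is
determined by the second. -/
theorem isSymm_iff_smul {S S' : Matrix (Idx M N) (Idx M N) (PowerSeries A)} :
    IsSymm (PowerSeries.X : PowerSeries ℂ) S S' ↔ ∀ i j, (2 + PowerSeries.X : PowerSeries ℂ) • S i j =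
      (2 : PowerSeries ℂ) • ((-1) ^ (par i * par j) * S' j i) + (PowerSeries.X : PowerSeries ℂ) •
        S' i j := by
  refine forall_congr' fun i => forall_congr' fun j => ?_
  rw [smul_sub, add_smul, eq_comm, ← add_sub_assoc, sub_eq_iff_eq_add]

theorem isUnit_smul_cancel {K A : Type*} [CommRing K] [Ring A] [Algebra K A] {c : K} (hc : IsUnit c)
    {x y : A} (h : c • x = c • y) : x = y := by
  obtain ⟨u, rfl⟩ := hc
  rw [← one_smul K x, ← u.inv_mul, mul_smul, h, ← mul_smul, u.inv_mul, one_smul]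

theorem eq_of_map_mul_eq {A : Type*} [Ring A] {U V : Matrix (Idx M N) (Idx M N) A} (h : U * V = 1)
    {x y : A} (e : U.map (x * ·) = U.map (y * ·)) (i : Idx M N) : x = y := by
  have key : ∀ x, x = ∑ j, U.map (x * ·) i j * V j i := by
    intro x
    have := congrArg (fun W : Matrix (Idx M N) (Idx M N) A => W i i) h
    beta_reduce at this
    rw [Matrix.mul_apply, Matrix.one_apply_eq] at this
    simp only [Matrix.map_apply, mul_assoc, ← Finset.mul_sum, this, mul_one]
  rw [key x, e, ← key y]

/-- The symmetry relation determines ζ(u) σ(u) from σ(-u), where σ is `sigmaSeries` of the inverse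
of S, and σ(u) is invertible. -/
theorem IsZeta.unique {ζ ζ' : PowerSeries A} (h : IsZeta S ζ) (h' : IsZeta S ζ') (i : Idx M N) :
    ζ = ζ' := by
  obtain ⟨R, h1, h2, h3⟩ := h
  obtain ⟨R', h1', h2', h3'⟩ := h'
  obtain rfl : R = R' := left_inv_eq_right_inv h2 h1'
  refine eq_of_map_mul_eq (sigmaSeries_mul h2) (Matrix.ext fun i j => ?_) i
  exact isUnit_smul_cancel isUnit_two_add_X
    ((isSymm_iff_smul.1 h3 i j).trans (isSymm_iff_smul.1 h3' i j).symm)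

theorem IsSymm.map {K : Type*} [CommRing K] {α : K} {A B : Type*} [Ring A] [Ring B] [Algebra K A]
    [Algebra K B] {S S' : Matrix (Idx M N) (Idx M N) A} (h : IsSymm α S S')
    (φ : A →+* B) (hφ : ∀ x, φ (α • x) = α • φ x) : IsSymm α (S.map φ) (S'.map φ) := by
  intro i j
  have := congrArg φ (h i j)
  have e : ∀ x, φ ((2 : K) • x) = (2 : K) • φ x := fun x => by rw [two_smul, map_add, two_smul]
  simpa only [Matrix.map_apply, e, hφ, map_add, map_sub, map_mul, map_pow, map_neg, map_one]
    using this

theorem map_X_smul (φ : A →ₐ[ℂ] B) (x : PowerSeries A) :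
    PowerSeries.map (φ : A →+* B) ((PowerSeries.X : PowerSeries ℂ) • x) =
      (PowerSeries.X : PowerSeries ℂ) • PowerSeries.map (φ : A →+* B) x := by
  rw [series_X_smul, map_mul, PowerSeries.map_X, series_X_smul]

theorem map_map_mul (φ : A →ₐ[ℂ] B) (U : Matrix (Idx M N) (Idx M N) (PowerSeries A))
    (ζ : PowerSeries A) : (U.map (ζ * ·)).map (PowerSeries.map (φ : A →+* B)) =
      (U.map (PowerSeries.map (φ : A →+* B))).map (PowerSeries.map (φ : A →+* B) ζ * ·) :=
  Matrix.ext fun _ _ => map_mul (PowerSeries.map (φ : A →+* B)) _ _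

theorem IsZeta.map {ζ : PowerSeries A} (h : IsZeta S ζ) (φ : A →ₐ[ℂ] B) :
    IsZeta (S.map (PowerSeries.map (φ : A →+* B))) (PowerSeries.map (φ : A →+* B) ζ) := by
  obtain ⟨R, h1, h2, h3⟩ := h
  refine ⟨R.map (PowerSeries.map (φ : A →+* B)), map_mul_eq_one _ h1, map_mul_eq_one _ h2, ?_⟩
  have := h3.map (PowerSeries.map (φ : A →+* B)) (map_X_smul φ)
  rwa [map_map_mul, map_map_negArg, map_sigmaSeries] at this

/-- Existence of `ζ(u)` descends along injective homomorphisms. -/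
theorem IsZeta.of_map {φ : A →ₐ[ℂ] B} (hφ : Function.Injective φ) (h1 : S * R = 1) (h2 : R * S = 1)
    {ζ' : PowerSeries B} (h : IsZeta (S.map (PowerSeries.map (φ : A →+* B))) ζ') (i : Idx M N) :
    ∃ ζ, IsZeta S ζ ∧ PowerSeries.map (φ : A →+* B) ζ = ζ' := by
  have inj : Function.Injective (PowerSeries.map (φ : A →+* B)) := PowerSeries.map_injective _ hφ
  obtain ⟨R', h1', h2', h3⟩ := h
  obtain rfl : R' = R.map (PowerSeries.map (φ : A →+* B)) :=
    left_inv_eq_right_inv h2' (map_mul_eq_one _ h1)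
  rw [← map_sigmaSeries, ← map_map_negArg] at h3
  obtain ⟨c, hc⟩ := isUnit_two_add_X
  -- This is the only candidate for ζ σ over A, obtained by solving the symmetry relation for its
  -- first argument.
  set b : Matrix (Idx M N) (Idx M N) (PowerSeries A) := Matrix.of fun i j =>
    (c⁻¹ : (PowerSeries ℂ)ˣ).1 • ((2 : PowerSeries ℂ) • ((-1) ^ (par i * par j) *
      (sigmaSeries R).map negArg j i) +
      (PowerSeries.X : PowerSeries ℂ) • (sigmaSeries R).map negArg i j) with hb
  have hb1 : ∀ i j, (2 + PowerSeries.X : PowerSeries ℂ) • b i j = (2 : PowerSeries ℂ) •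
      ((-1) ^ (par i * par j) * (sigmaSeries R).map negArg j i) +
      (PowerSeries.X : PowerSeries ℂ) • (sigmaSeries R).map negArg i j := fun i j => by
    rw [hb, Matrix.of_apply, ← hc, ← mul_smul, c.mul_inv, one_smul]
  have smul2 : ∀ x : PowerSeries A, PowerSeries.map (φ : A →+* B) ((2 : PowerSeries ℂ) • x) =
      (2 : PowerSeries ℂ) • PowerSeries.map (φ : A →+* B) x := fun x => by
    rw [two_smul, map_add, two_smul]
  have hb2 : b.map (PowerSeries.map (φ : A →+* B)) =
      ((sigmaSeries R).map (PowerSeries.map (φ : A →+* B))).map (ζ' * ·) := by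
    refine Matrix.ext fun i j => isUnit_smul_cancel isUnit_two_add_X ?_
    rw [isSymm_iff_smul.1 h3 i j]
    have := congrArg (PowerSeries.map (φ : A →+* B)) (hb1 i j)
    rw [add_smul, map_add, map_add, map_X_smul, map_X_smul, smul2, smul2, map_mul, map_pow, map_neg,
      map_one, ← add_smul] at this
    exact this
  have hV := sigmaSeries_mul h2
  set V := constSeries A (parMat M N) * S.map (negShiftArg (halfShift M N))
  -- Multiplying by V = σ⁻¹ isolates ζ: over B the product is the scalar matrix ζ', so any diagonal
  -- entry of b V is the required preimage.
  have h4 : (b * V).map (PowerSeries.map (φ : A →+* B)) = Matrix.diagonal fun _ => ζ' := by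
    have e : ∀ U W : Matrix (Idx M N) (Idx M N) (PowerSeries B), U.map (ζ' * ·) * W =
        (Matrix.diagonal fun _ => ζ') * (U * W) := fun U W => by
      rw [← mul_assoc]
      exact congrArg (· * W) (Matrix.ext fun i j => by rw [Matrix.diagonal_mul, Matrix.map_apply])
    rw [Matrix.map_mul, hb2, e, ← Matrix.map_mul, hV, Matrix.map_one _ (map_zero _) (map_one _),
      mul_one]
  have h5 : PowerSeries.map (φ : A →+* B) ((b * V) i i) = ζ' := by
    have := congrArg (fun W : Matrix (Idx M N) (Idx M N) (PowerSeries B) => W i i) h4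
    simpa using this
  refine ⟨(b * V) i i, ⟨R, h1, h2, isSymm_iff_smul.2 fun k l => ?_⟩, h5⟩
  rw [← hb1]
  congr 1
  refine inj ?_
  have := congrArg (fun W : Matrix (Idx M N) (Idx M N) (PowerSeries B) => W k l) hb2
  simp only [Matrix.map_apply] at this ⊢
  rw [map_mul, h5, this]

theorem negShiftArg_C (c : ℂ) (a : A) : negShiftArg c (PowerSeries.C a) = PowerSeries.C a := by
  rw [negShiftArg_eq, negArg_C, shiftArg_C]

theorem constSeries_mul (P Q : Matrix (Idx M N) (Idx M N) ℂ) :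
    constSeries A (P * Q) = constSeries A P * constSeries A Q :=
  Matrix.map_mul (f := PowerSeries.C.comp (algebraMap ℂ A))

/-- The matrix G⁻¹ J inherits the supersymmetry of G and is constant, so it satisfies the symmetry
relation without a factor. -/
theorem isZeta_constSeries {G : Matrix (Idx M N) (Idx M N) ℂ} (hG : IsSupersymmetric G) :
    IsZeta (constSeries A G) 1 := by
  have e : ∀ P Q : Matrix (Idx M N) (Idx M N) ℂ, P * Q = 1 →
      constSeries A P * constSeries A Q = 1 := fun P Q h =>
    map_mul_eq_one (PowerSeries.C.comp (algebraMap ℂ A)) h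
  have h1 := Matrix.mul_nonsing_inv G hG.nondegenerate
  have h2 := Matrix.nonsing_inv_mul G hG.nondegenerate
  refine ⟨constSeries A G⁻¹, e _ _ h1, e _ _ h2, ?_⟩
  have hD : G.transpose = G * parMat M N := by
    ext i j
    rw [Matrix.transpose_apply, parMat, Matrix.mul_diagonal, ← hG.swap i j]
    by_cases h : par i = par j
    · rcases par_cases j with hj | hj <;> simp [h, hj]
    · simp [hG.isEven j i (Ne.symm h)]
  have hDD : parMat M N * parMat M N = 1 := by
    rw [parMat, Matrix.diagonal_mul_diagonal, ← Matrix.diagonal_one]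
    congr 1
    funext i
    rw [← pow_add, neg_one_pow_add_self]
  have h3 : G⁻¹.transpose = parMat M N * G⁻¹ := by
    rw [Matrix.transpose_nonsing_inv, hD]
    exact Matrix.inv_eq_right_inv (by rw [mul_assoc, ← mul_assoc (parMat M N), hDD, one_mul, h1])
  have h4 : sigmaSeries (constSeries A G⁻¹) = constSeries A (G⁻¹ * parMat M N) := by
    rw [sigmaSeries, constSeries_mul]
    congr 1
    exact Matrix.ext fun i j => negShiftArg_C _ _
  have h5 : (constSeries A (G⁻¹ * parMat M N)).map negArg = constSeries A (G⁻¹ * parMat M N) :=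
    Matrix.ext fun i j => negArg_C _
  have h6 : ∀ i j, (-1 : ℂ) ^ (par i * par j) * (G⁻¹ * parMat M N) j i =
      (G⁻¹ * parMat M N) i j := by
    intro i j
    have := congrFun (congrFun h3 i) j
    rw [Matrix.transpose_apply, parMat, Matrix.diagonal_mul] at this
    rw [parMat, Matrix.mul_diagonal, Matrix.mul_diagonal, this]
    by_cases h : par i = par j
    · rcases par_cases j with hj | hj <;> simp [h, hj]
    · simp [hG.isEven.inv i j h]
  rw [h4, h5]
  intro i j
  simp only [Matrix.map_apply, one_mul, sub_self, smul_zero, add_zero]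
  congr 1
  rw [constSeries_apply, constSeries_apply, ← h6 i j, map_mul, map_mul, map_pow, map_pow, map_neg,
    map_neg, map_one, map_one]

/-- Replacing S by f S multiplies σ(u) by g(-u - h) = g(u + h) and σ(-u) by g(u - h), where h is
`halfShift M N` and g is the even inverse of f. Hence ζ' = ζ f(u + h)/f(u - h). -/
theorem IsZeta.scale {ζ ζ' : PowerSeries A} (h : IsZeta S ζ) {f g : PowerSeries A}
    (hfg : f * g = 1) (hgf : g * f = 1) (hg : negArg g = g)
    (hc : ∀ n y, Commute (coeff n g) y)
    (hζ : ζ' * shiftArg (halfShift M N) g = shiftArg (-halfShift M N) g * ζ) :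
    IsZeta (S.map (f * ·)) ζ' := by
  obtain ⟨R, h1, h2, h3⟩ := h
  have e1 : S.map (f * ·) = (Matrix.diagonal fun _ => f) * S :=
    Matrix.ext fun i j => by rw [Matrix.diagonal_mul, Matrix.map_apply]
  have e2 : (Matrix.diagonal fun _ : Idx M N => f) * (Matrix.diagonal fun _ => g) = 1 := by
    rw [Matrix.diagonal_mul_diagonal, hfg, Matrix.diagonal_one]
  have e3 : (Matrix.diagonal fun _ : Idx M N => g) * (Matrix.diagonal fun _ => f) = 1 := by
    rw [Matrix.diagonal_mul_diagonal, hgf, Matrix.diagonal_one]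
  have cg : ∀ (w : PowerSeries ℂ) (y : PowerSeries A), Commute (substInv w g) y := fun w y =>
    commute_of_coeff fun m n => by
      rw [substInv, coeff_mk]
      exact Commute.sum_left _ _ _ fun r _ => (hc r _).smul_left _
  refine ⟨R * Matrix.diagonal fun _ => g, ?_, ?_, ?_⟩
  · rw [e1, mul_assoc, ← mul_assoc S, h1, one_mul, e2]
  · rw [e1, mul_assoc, ← mul_assoc (Matrix.diagonal _), e3, one_mul, h2]
  · have e4 : sigmaSeries (R * Matrix.diagonal fun _ => g) =
        (sigmaSeries R).map (shiftArg (halfShift M N) g * ·) := by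
      refine Matrix.ext fun i j => ?_
      rw [sigmaSeries, sigmaSeries, constSeries_parMat, Matrix.map_apply, Matrix.mul_diagonal,
        Matrix.mul_diagonal, Matrix.map_apply, Matrix.mul_diagonal, Matrix.map_apply,
        ← negShiftHom_apply, map_mul, negShiftHom_apply, negShiftHom_apply, negShiftArg_eq _ g, hg,
        ← mul_assoc]
      congr 1
      exact ((cg _ _).eq).symm
    have e5 : (sigmaSeries (R * Matrix.diagonal fun _ => g)).map negArg =
        ((sigmaSeries R).map negArg).map (shiftArg (-halfShift M N) g * ·) := by
      refine Matrix.ext fun i j => ?_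
      rw [e4, Matrix.map_apply, Matrix.map_apply, Matrix.map_apply, Matrix.map_apply, ← negHom_apply,
        map_mul, negHom_apply, negHom_apply, negArg_shiftArg, hg]
    have e6 : (sigmaSeries (R * Matrix.diagonal fun _ => g)).map (ζ' * ·) =
        ((sigmaSeries R).map (ζ * ·)).map (shiftArg (-halfShift M N) g * ·) := by
      refine Matrix.ext fun i j => ?_
      rw [e4, Matrix.map_apply, Matrix.map_apply, Matrix.map_apply, Matrix.map_apply, ← mul_assoc,
        hζ, mul_assoc]
    rw [e5, e6]
    exact h3.mul_left _

theorem IsZeta.parMat_conj {ζ : PowerSeries A} (h : IsZeta S ζ) :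
    IsZeta (constSeries A (parMat M N) * S * constSeries A (parMat M N)) ζ := by
  obtain ⟨R, h1, h2, h3⟩ := h
  have hD := parMat_mul_parMat (M := M) (N := N) (A := A)
  set D := constSeries A (parMat M N) with hDdef
  have e : ∀ P Q, P * Q = 1 → D * P * D * (D * Q * D) = 1 := fun P Q h => by
    calc D * P * D * (D * Q * D) = D * (P * (D * D) * Q) * D := by simp only [mul_assoc]
      _ = 1 := by rw [hD, mul_one, h, mul_one, hD]
  refine ⟨D * R * D, e _ _ h1, e _ _ h2, ?_⟩
  have e1 : sigmaSeries (D * R * D) = D * sigmaSeries R * D := by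
    have : D.map (negShiftArg (halfShift M N)) = D := Matrix.ext fun i j => negShiftArg_C _ _
    rw [sigmaSeries, sigmaSeries, ← map_negShiftHom, matrix_map_mul_hom, matrix_map_mul_hom,
      map_negShiftHom, map_negShiftHom, this]
    simp only [mul_assoc, hDdef]
  rw [e1]
  intro i j
  have h4 := h3 i j
  simp only [Matrix.map_apply] at h4 ⊢
  rw [hDdef, parMat_mul_mul, parMat_mul_mul, negArg_neg_one_pow_mul,
    negArg_neg_one_pow_mul, sign_comm, add_comm (par j)]
  rcases neg_one_pow_eq_or (PowerSeries A) (par i + par j) with h | h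
  · simpa only [h, one_mul] using h4
  · rw [h]
    simp only [neg_one_mul, mul_neg]
    rw [smul_neg, smul_neg, h4, neg_sub_neg, ← neg_sub (ζ * sigmaSeries R i j), smul_neg, neg_add]

/-- The coefficients of a solution of the `RTT` relation act on `ζ(u)` through the central series. -/
theorem IsZeta.conj {ζ ζ' z : PowerSeries A} (h : IsZeta S ζ) (hT : IsRTTSeries T)
    (hc : SCommSeries T S) (h1 : T * Y = 1) (h2 : Y * T = 1) {Q : Matrix (Idx M N) (Idx M N) (PowerSeries A)}
    (hQ1 : str T * Q = 1) (hQ2 : Q * str T = 1)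
    (hz : str Y * str (T.map (shiftArg ((M : ℂ) - N))) = Matrix.diagonal fun _ => z)
    (hζ : ∀ i j m n, Commute (coeff m ζ) (coeff n (Y i j)))
    (hz1 : IsUnit z) (hζ' : negArg (shiftArg (-halfShift M N) z) * ζ' =
      ζ * shiftArg (-halfShift M N) z) :
    IsZeta (T * S * str (T.map negArg)) ζ' := by
  obtain ⟨R, r1, r2, h3⟩ := h
  set c := halfShift M N with hcdef
  have strHom : ∀ (φ : PowerSeries A →ₐ[ℂ] PowerSeries A) (X : Matrix (Idx M N) (Idx M N) (PowerSeries A)),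
      str (X.map φ) = (str X).map φ := fun φ X => str_map (φ : PowerSeries A →+* PowerSeries A) X
  have homOne : ∀ (φ : PowerSeries A →ₐ[ℂ] PowerSeries A) {P P' : Matrix (Idx M N) (Idx M N) (PowerSeries A)},
      P * P' = 1 → P.map φ * P'.map φ = 1 := fun φ P P' h => by
    rw [← matrix_map_mul_hom, h, Matrix.map_one _ (map_zero _) (map_one _)]
  have n1 : str (T.map negArg) * Q.map negArg = 1 := (strHom negHom T) ▸ homOne negHom hQ1
  have n2 : Q.map negArg * str (T.map negArg) = 1 := (strHom negHom T) ▸ homOne negHom hQ2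
  set U := transpInv Y with hU
  have hU' : U = str (Y.map (shiftArg (-c))) := (strHom (shiftHom (-c)) Y).symm
  refine ⟨Q.map negArg * R * Y, ?_, ?_, ?_⟩
  · calc T * S * str (T.map negArg) * (Q.map negArg * R * Y)
        = T * (S * ((str (T.map negArg) * Q.map negArg) * R)) * Y := by simp only [mul_assoc]
      _ = 1 := by rw [n1, one_mul, r1, mul_one, h1]
  · calc Q.map negArg * R * Y * (T * S * str (T.map negArg))
        = Q.map negArg * (R * ((Y * T) * S)) * str (T.map negArg) := by simp only [mul_assoc]
      _ = 1 := by rw [h2, one_mul, r2, mul_one, n2]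
  -- The defining equation of z(u), shifted by -c, says that (Tᵗ)⁻¹(u + c) and the transpose of
  -- T⁻¹(u - c) agree up to the factor z(u - c).
  have k1 : (Matrix.diagonal fun _ => shiftArg (-c) z) * Q.map (shiftArg c) = U := by
    have e1 := congrArg (fun W : Matrix (Idx M N) (Idx M N) (PowerSeries A) => W.map (shiftHom (-c))) hz
    beta_reduce at e1
    rw [matrix_map_mul_hom, Matrix.diagonal_map (map_zero _), ← strHom, ← strHom] at e1
    have e2 : (T.map (shiftArg ((M : ℂ) - N))).map (shiftHom (-c)) = T.map (shiftHom c) :=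
      Matrix.ext fun i j => (shiftArg_shiftArg _ _ _).trans
        (congrArg (shiftArg · (T i j)) (by rw [hcdef, ← halfShift_add]; ring))
    rw [e2, strHom (shiftHom c)] at e1
    have e3 := congrArg (· * Q.map (shiftHom c)) e1
    beta_reduce at e3
    rw [mul_assoc, homOne _ hQ1, mul_one] at e3
    rw [hU']
    exact e3.symm
  -- The square of the super transposition is conjugation by J.
  have k2 : (Y.map (negShiftArg c)) * constSeries A (parMat M N) =
      constSeries A (parMat M N) * str (U.map negArg) := by
    have e1 : U.map negArg = str (Y.map (negShiftHom c)) := by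
      rw [hU']
      refine (strHom negHom _).symm.trans (congrArg str <| Matrix.ext fun i j => by
        change negArg (shiftArg (-c) (Y i j)) = negShiftHom c (Y i j)
        rw [negShiftHom_apply, negShiftArg_eq]
        exact (negArg_shiftArg _ _).trans (by rw [neg_neg]))
    rw [e1, map_negShiftHom]
    refine Matrix.ext fun i j => ?_
    rw [constSeries_parMat, Matrix.mul_diagonal, Matrix.diagonal_mul, str, Matrix.of_apply, str,
      Matrix.of_apply]
    rcases par_cases i with hi | hi <;> rcases par_cases j with hj | hj <;> simp [hi, hj]
  -- Up to the factor z(u - c), passing from S to T S Tᵗ dresses σ by U. Since U is again a solution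
  -- of the `RTT` relation, `IsSymm.conj` applies to σ as it does to S.
  have k3 : (Matrix.diagonal fun _ => shiftArg (-c) z) * sigmaSeries (Q.map negArg * R * Y) =
      U * sigmaSeries R * str (U.map negArg) := by
    have e1 : (Q.map negArg).map (negShiftHom c) = Q.map (shiftArg c) := Matrix.ext fun i j => by
      rw [Matrix.map_apply, Matrix.map_apply, negShiftHom_apply, negShiftArg_eq, negArg_negArg]
      rfl
    rw [sigmaSeries, ← map_negShiftHom, matrix_map_mul_hom, matrix_map_mul_hom, e1, map_negShiftHom,
      map_negShiftHom, ← hcdef, mul_assoc _ (Y.map _), k2, ← mul_assoc, ← mul_assoc, ← mul_assoc, k1, sigmaSeries]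
    simp only [mul_assoc, ← hcdef]
  have k4 : (Matrix.diagonal fun _ => negArg (shiftArg (-c) z)) *
      (sigmaSeries (Q.map negArg * R * Y)).map negArg =
      U.map negArg * (sigmaSeries R).map negArg * str U := by
    have e1 := congrArg (fun W : Matrix (Idx M N) (Idx M N) (PowerSeries A) => W.map negHom) k3
    beta_reduce at e1
    rw [matrix_map_mul_hom, matrix_map_mul_hom, matrix_map_mul_hom, Matrix.diagonal_map (map_zero _),
      ← strHom] at e1
    exact e1.trans (congrArg (_ * str ·) (map_negArg_map_negArg U))
  have hD : ∀ W : Matrix (Idx M N) (Idx M N) (PowerSeries A), SComm (constSeries A (parMat M N)) W :=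
    fun W => (isEven_parMat.sCommSeries W).same
  have sR : SCommSeries Y R := (hc.inv_left h1 h2).inv_right r1 r2
  have hUn : U.map negArg = str ((Y.map (shiftArg (-c))).map (substInv (-PowerSeries.X))) := by
    rw [hU']
    exact (strHom negHom _).symm
  have sU : SComm (sigmaSeries R) (U.map negArg) := by
    rw [hUn, sigmaSeries]
    exact ((((sR.subst_left _).subst_left _).subst_right _).same.symm.mul_left (hD _)).str_right
  have sU' : SComm ((sigmaSeries R).map negArg) U := by
    have e1 : (sigmaSeries R).map negArg = (R.map (negShiftArg c)).map (substInv (-PowerSeries.X)) *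
        constSeries A (parMat M N) := by
      rw [sigmaSeries, ← map_negShiftHom]
      refine (matrix_map_mul_hom negHom _ _).trans ?_
      rw [map_negShiftHom]
      exact congrArg (_ * ·) (Matrix.ext fun i j => negArg_C _)
    rw [e1, hU']
    exact ((((sR.subst_left _).subst_right _).subst_right _).same.symm.mul_left (hD _)).str_right
  have ζY : ∀ (w : PowerSeries ℂ) i j, ∀ m n, Commute (coeff m ζ)
      (coeff n (Y.map (substInv w) i j)) := fun w i j m n =>
    (commute_substInv (fun m n => (hζ _ _ n m).symm) _ _ _).symm
  have ζstr : ∀ {W : Matrix (Idx M N) (Idx M N) (PowerSeries A)}, (∀ i j, Commute ζ (W i j)) →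
      ∀ i j, Commute ζ (str W i j) := fun h i j => by
    rw [str, Matrix.of_apply]
    exact ((Commute.neg_one_right ζ).pow_right _).mul_right (h j i)
  have ζU : ∀ i j, Commute ζ (U i j) := by
    rw [hU']
    exact ζstr fun i j => commute_of_coeff (ζY _ i j)
  have ζU' : ∀ i j, Commute ζ (U.map negArg i j) := by
    rw [hUn]
    exact ζstr fun i j => commute_of_coeff fun m n =>
      (commute_substInv (fun m n => (ζY _ i j n m).symm) _ _ _).symm
  have sζ : SComm ((sigmaSeries R).map (ζ * ·)) (U.map negArg) := fun i j k l => by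
    rw [Matrix.map_apply, mul_assoc, sU, ← mul_assoc (U.map negArg k l), ← (ζU' k l).eq, mul_assoc ζ,
      sign_comm]
  have hrtt : IsRTT (-PowerSeries.X : PowerSeries ℂ) PowerSeries.X (U.map negArg) U := by
    have := (hT.transpInv h1 h2).subst₁ (w := -PowerSeries.X) (x := PowerSeries.X) (by simp)
      (by simp)
    rwa [map_substInv_X] at this
  have k5 := h3.conj (fun x hx => by
    rw [← shiftedInv_zero] at hx; exact shiftedInv_smul_eq_zero hx) hrtt sU' sζ
  obtain ⟨w, hw⟩ : IsUnit (negArg (shiftArg (-c) z)) := (hz1.map (shiftHom (-c))).map negHom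
  -- The hypothesis relating ζ' to ζ is used to exchange the factor ζ(u) z(u - c) for z(-u - c)
  -- ζ'(u); the common factor z(-u - c) of both arguments of the symmetry relation is then removed.
  have k6 : U * (sigmaSeries R).map (ζ * ·) * str (U.map negArg) =
      ((sigmaSeries (Q.map negArg * R * Y)).map (ζ' * ·)).map (w.1 * ·) := by
    have e1 : ∀ W : Matrix (Idx M N) (Idx M N) (PowerSeries A), ∀ a : PowerSeries A,
        W.map (a * ·) = (Matrix.diagonal fun _ => a) * W := fun W a =>
      Matrix.ext fun i j => by rw [Matrix.diagonal_mul, Matrix.map_apply]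
    have e2 : U * (Matrix.diagonal fun _ => ζ) = (Matrix.diagonal fun _ => ζ) * U :=
      Matrix.ext fun i j => by rw [Matrix.mul_diagonal, Matrix.diagonal_mul, (ζU i j).eq]
    rw [e1, e1, e1, ← mul_assoc, e2, hw, ← mul_assoc, Matrix.diagonal_mul_diagonal, hζ',
      ← Matrix.diagonal_mul_diagonal, mul_assoc (Matrix.diagonal _) (Matrix.diagonal _), k3]
    simp only [mul_assoc]
  have k7 : U.map negArg * (sigmaSeries R).map negArg * str U =
      ((sigmaSeries (Q.map negArg * R * Y)).map negArg).map (w.1 * ·) := by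
    rw [← k4, hw]
    exact Matrix.ext fun i j => by rw [Matrix.diagonal_mul]; rfl
  have k8 := k5.mul_left (w⁻¹.1)
  have e3 : ∀ W : Matrix (Idx M N) (Idx M N) (PowerSeries A), (W.map (w.1 * ·)).map (w⁻¹.1 * ·) = W :=
    fun W => Matrix.ext fun i j => by
      rw [Matrix.map_apply, Matrix.map_apply, ← mul_assoc, w.inv_mul, one_mul]
  change IsSymm _ _ ((U.map negArg * (sigmaSeries R).map negArg * str U).map _) at k8
  rw [k6] at k8
  rw [k7, e3, e3] at k8
  exact k8

end Zeta

/-! ### Shifts and squares of (u - a)⁻¹ -/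

section GeomShift

/-- Partial fractions for 1/(u - a) - 1/(u + c - a). -/
theorem geomSeries₀_shift (c : ℂ) : geomSeries₀ - shiftArg c geomSeries₀ =
    PowerSeries.C (Polynomial.C c) * (geomSeries₀ * shiftArg c geomSeries₀) := by
  have h1 := geomSeries₀_eq
  have h2 := congrArg (shiftHom c) h1
  have h3 := congrArg (PowerSeries.map (algebraMap ℂ (Polynomial ℂ))) (shiftedInv_mul c)
  rw [map_mul, map_sub, map_one, map_mul, shiftHom_apply, shiftHom_apply, shiftHom_apply, shiftArg_C,
    shiftArg, shiftArg, substInv_X (constantCoeff_shiftedInv c)] at h2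
  rw [map_mul, map_add, map_one, map_mul, PowerSeries.map_C, PowerSeries.map_X,
    Polynomial.algebraMap_eq] at h3
  refine mul_left_cancel₀ (PowerSeries.X_ne_zero (R := Polynomial ℂ)) ?_
  rw [← Polynomial.algebraMap_eq] at *
  set y := shiftArg c geomSeries₀
  change y * _ = _ at h2
  set w := PowerSeries.map (algebraMap ℂ (Polynomial ℂ)) (shiftedInv c)
  linear_combination y * h1 - geomSeries₀ * (1 + PowerSeries.C (algebraMap ℂ (Polynomial ℂ) c) *
    PowerSeries.X) * h2 - (geomSeries₀ + geomSeries₀ * y * PowerSeries.C Polynomial.X) * h3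

theorem geomSeries_shift {R : Type*} [Ring R] [Algebra ℂ R] (a : R) (c : ℂ) :
    geomSeries a - shiftArg c (geomSeries a) = c • (geomSeries a * shiftArg c (geomSeries a)) := by
  have := congrArg (PowerSeries.map ((Polynomial.aeval a : Polynomial ℂ →ₐ[ℂ] R) :
    Polynomial ℂ →+* R)) (geomSeries₀_shift c)
  rw [map_sub, map_mul, map_mul, map_shiftArg, PowerSeries.map_C] at this
  refine this.trans ?_
  ext n
  simp only [coeff_C_mul, PowerSeries.coeff_smul]
  simp [Algebra.smul_def, geomSeries]

theorem coeff_geomSeries_sq {R : Type*} [Ring R] [Algebra ℂ R] (a : R) (n : ℕ) :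
    coeff (n + 2) (geomSeries a * geomSeries a) = ((n : R) + 1) * a ^ n := by
  have e : geomSeries a = PowerSeries.X * PowerSeries.mk fun k => a ^ k := by
    ext k : 1
    rcases k with _ | k
    · simp [coeff_geomSeries]
    · rw [PowerSeries.coeff_succ_X_mul, coeff_geomSeries]; simp
  have e2 : geomSeries a * geomSeries a = PowerSeries.X * (PowerSeries.X *
      ((PowerSeries.mk fun k => a ^ k) * PowerSeries.mk fun k => a ^ k)) := by
    nth_rewrite 1 [e]
    rw [mul_assoc]
    congr 1
    rw [e, ← mul_assoc, (PowerSeries.commute_X _).eq, mul_assoc]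
  rw [e2, PowerSeries.coeff_succ_X_mul, PowerSeries.coeff_succ_X_mul, coeff_mul]
  rw [Finset.sum_congr rfl (g := fun _ => a ^ n)]
  · simp
  · intro p hp
    rw [Finset.HasAntidiagonal.mem_antidiagonal] at hp
    rw [coeff_mk, coeff_mk, ← pow_add, hp]

end GeomShift

/-! ### The central series of the evaluation solution -/

section SlotCentral

variable {M N : ℕ} {A : Type*} [Ring A] [Algebra ℂ A]

theorem slotUnits_mul_slotUnits : slotUnits M N A * slotUnits M N A = 1 := by
  refine Matrix.ext fun i j => ?_
  rw [Matrix.mul_apply]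
  have h1 : ∀ k, slotUnits M N A i k * slotUnits M N A k j = if i = j then
      slotC M N (Matrix.single k k 1) else 0 := fun k => by
    rw [slotUnits, Matrix.of_apply, Matrix.of_apply, ← map_mul, slotUnit_mul]
    rcases eq_or_ne i j with rfl | h
    · rw [if_pos rfl, if_pos rfl, mul_comm (par k), neg_one_pow_add_self]
    · rw [if_neg h, if_neg h, map_zero]
  simp only [h1]
  rcases eq_or_ne i j with rfl | h
  · simp only [if_true, Matrix.one_apply_eq]
    rw [← map_sum, ← map_one (slotC M N (A := A))]
    congr 1
    ext a b
    rw [Matrix.sum_apply]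
    rcases eq_or_ne a b with rfl | h
    · rw [Finset.sum_eq_single a] <;> simp +contextual
    · rw [Matrix.one_apply_ne h, Finset.sum_eq_zero]
      intro k _
      rw [Matrix.single_apply, if_neg]
      rintro ⟨rfl, rfl⟩; exact h rfl
  · simp [h]

/-- After transposition the operators form, up to signs, one contraction matrix, whose square
produces the loop factor M - N. -/
theorem str_slotUnits_mul_str_slotUnits : str (slotUnits M N A) * str (slotUnits M N A) =
    -((M : ℂ) - N) • str (slotUnits M N A) := by
  have h0 : ∀ i j, str (slotUnits M N A) i j = slotC M N (Matrix.single i j (-(-1) ^ par i)) := by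
    intro i j
    rw [str, Matrix.of_apply, slotUnits, Matrix.of_apply, slotUnit]
    rcases neg_one_pow_eq_or A (par i) with h | h <;> rcases par_cases i with hi | hi <;>
      rcases par_cases j with hj | hj <;> simp [hi, hj, pow_succ] <;>
      rw [← map_neg, ← Matrix.single_neg, neg_neg]
  refine Matrix.ext fun i j => ?_
  rw [Matrix.mul_apply, Matrix.smul_apply]
  simp only [h0, ← map_mul, Matrix.single_mul_single_same, ← map_smul, ← map_sum]
  congr 1
  ext a b
  rw [Matrix.sum_apply, Matrix.smul_apply]
  simp only [Matrix.single_apply]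
  split_ifs
  · simp only [neg_mul_neg, ← Finset.mul_sum, sum_sign]
    rw [neg_smul, smul_neg, neg_neg, Algebra.smul_def, map_sub, map_natCast, map_natCast]
    exact ((Commute.neg_one_left ((M : A) - N)).pow_left (par i)).eq
  · simp

variable {Y : Matrix (Idx M N) (Idx M N) (PowerSeries (SlotAlg M N A))} {z : PowerSeries (SlotAlg M N A)}

theorem slotSeries_eq : slotSeries M N A = 1 + (slotUnits M N A).map PowerSeries.C *
    Matrix.diagonal fun _ => geomSeries (slotPt M N A) := by
  refine Matrix.ext fun i j => ?_
  rw [← sub_add_cancel (slotSeries M N A) 1, add_comm, Matrix.add_apply, slotSeries_sub_one,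
    Matrix.add_apply, Matrix.mul_diagonal, Matrix.map_apply]

theorem commute_diagonal {B : Type*} [Ring B] {x : B} (hx : ∀ y, Commute x y)
    (W : Matrix (Idx M N) (Idx M N) B) : (Matrix.diagonal fun _ => x) * W =
      W * Matrix.diagonal fun _ => x :=
  Matrix.ext fun i j => by rw [Matrix.diagonal_mul, Matrix.mul_diagonal, (hx _).eq]

theorem str_mul_diagonal {B : Type*} [Ring B] (x : B) (W : Matrix (Idx M N) (Idx M N) B) :
    str (W * Matrix.diagonal fun _ => x) = str W * Matrix.diagonal fun _ => x :=
  Matrix.ext fun i j => by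
    rw [str, Matrix.of_apply, Matrix.mul_diagonal, Matrix.mul_diagonal, str, Matrix.of_apply, mul_assoc]

theorem str_add {B : Type*} [Ring B] (X W : Matrix (Idx M N) (Idx M N) B) :
    str (X + W) = str X + str W :=
  Matrix.ext fun i j => by simp [str, mul_add]

theorem str_neg {B : Type*} [Ring B] (X : Matrix (Idx M N) (Idx M N) B) : str (-X) = -str X :=
  Matrix.ext fun i j => by simp [str]

/-- The central series of the slot series. -/
theorem slotSeries_central (h : slotSeries M N A * Y = 1)
    (hz : str Y * str ((slotSeries M N A).map (shiftArg ((M : ℂ) - N))) =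
      Matrix.diagonal fun _ => z) (i : Idx M N) :
    (1 - geomSeries (slotPt M N A) * geomSeries (slotPt M N A)) * z = 1 := by
  set x := geomSeries (slotPt M N A) with hx
  set x' := shiftArg ((M : ℂ) - N) x with hx'
  set E := (slotUnits M N A).map (PowerSeries.C (R := SlotAlg M N A)) with hE
  have cx : ∀ y, Commute x y := geomSeries_commute slotPt_commute
  have cx' : ∀ y, Commute x' y := fun y => by
    rw [hx', hx, geomSeries, ← map_shiftArg]
    exact map_commute (aeval_commute slotPt_commute) _ _
  have hEE : E * E = 1 := by
    rw [hE, ← Matrix.map_mul, slotUnits_mul_slotUnits, Matrix.map_one _ (map_zero _) (map_one _)]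
  have hEE' : str E * str E = -((M : ℂ) - N) • str E := by
    rw [hE, str_map, ← Matrix.map_mul, str_slotUnits_mul_str_slotUnits]
    refine Matrix.ext fun i j => ?_
    rw [Matrix.map_apply, Matrix.smul_apply, Matrix.smul_apply, Matrix.map_apply]
    ext n
    simp only [PowerSeries.coeff_smul, PowerSeries.coeff_C]
    split_ifs <;> simp
  set D : PowerSeries (SlotAlg M N A) → Matrix (Idx M N) (Idx M N) (PowerSeries (SlotAlg M N A)) :=
    fun s => Matrix.diagonal fun _ => s with hD
  have D_mul : ∀ s t, D s * D t = D (s * t) := fun s t => Matrix.diagonal_mul_diagonal _ _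
  have hT : slotSeries M N A = 1 + E * D x := slotSeries_eq
  -- Since E² = 1, the inverse of 1 + E x is (1 - E x)/(1 - x²).
  have hV : (1 - E * D x) * slotSeries M N A = D (1 - x * x) := by
    have e1 : E * D x * (E * D x) = D (x * x) := by
      rw [mul_assoc, ← mul_assoc (D x), commute_diagonal cx E, mul_assoc E, D_mul, ← mul_assoc, hEE,
        one_mul]
    have e2 : D (1 - x * x) = 1 - D (x * x) := by
      rw [hD, ← Matrix.diagonal_one]; exact (Matrix.diagonal_sub _ _).symm
    rw [hT, e2, ← e1]; noncomm_ring
  have hVY : 1 - E * D x = D (1 - x * x) * Y := by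
    rw [← hV, mul_assoc, h, mul_one]
  have c1 : ∀ y, Commute (1 - x * x) y := fun y =>
    (Commute.one_left y).sub_left ((cx y).mul_left (cx y))
  have hstr : str (1 - E * D x) = 1 - str E * D x := by
    rw [sub_eq_add_neg, str_add, str_neg, str_one, str_mul_diagonal, ← sub_eq_add_neg]
  have hT' : str ((slotSeries M N A).map (shiftArg ((M : ℂ) - N))) = 1 + str E * D x' := by
    have : (slotSeries M N A).map (shiftArg ((M : ℂ) - N)) = 1 + E * D x' := by
      refine Matrix.ext fun i j => ?_
      rw [hT, Matrix.map_apply, Matrix.add_apply, Matrix.add_apply, Matrix.mul_diagonal,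
        Matrix.mul_diagonal, ← shiftHom_apply, map_add, map_mul, hE, Matrix.map_apply, shiftHom_apply,
        shiftHom_apply, shiftArg_C, shiftHom_apply]
      congr 1
      rcases eq_or_ne i j with rfl | h
      · rw [Matrix.one_apply_eq, ← shiftHom_apply, map_one]
      · rw [Matrix.one_apply_ne h, ← shiftHom_apply, map_zero]
    rw [this, str_add, str_one, str_mul_diagonal]
  -- The linear terms give (M - N) x x' times the transpose of E by partial fractions, and the
  -- square of that transpose cancels exactly this; so only the factor 1/(1 - x²) survives in z.
  have h1 : (1 - str E * D x) * (1 + str E * D x') = 1 := by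
    have e1 : str E * D x * (str E * D x') = -(((M : ℂ) - N) • (str E * D (x * x'))) := by
      rw [mul_assoc, ← mul_assoc (D x), commute_diagonal cx (str E), mul_assoc (str E), D_mul,
        ← mul_assoc, hEE', neg_smul, neg_mul, smul_mul_assoc]
    have e2 : str E * D x - str E * D x' = ((M : ℂ) - N) • (str E * D (x * x')) := by
      have : D x - D x' = ((M : ℂ) - N) • D (x * x') := by
        rw [hD]
        refine (Matrix.diagonal_sub _ _).trans ?_
        rw [← Matrix.diagonal_smul]
        exact congrArg _ (funext fun _ => geomSeries_shift _ _)
      rw [← mul_sub, this, mul_smul_comm]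
    calc (1 - str E * D x) * (1 + str E * D x') =
        1 - (str E * D x - str E * D x') - str E * D x * (str E * D x') := by noncomm_ring
      _ = 1 := by rw [e1, e2]; abel
  have h2 : D ((1 - x * x) * z) = 1 := by
    rw [← h1, ← hstr, ← hT', hVY, commute_diagonal c1 Y, str_mul_diagonal, ← commute_diagonal c1,
      mul_assoc, hz, D_mul]
  have := congrArg (fun W : Matrix (Idx M N) (Idx M N) _ => W i i) h2
  simpa [hD] using this

end SlotCentral

/-! ### Existence of inverses, and the first coefficients of z(u) -/

section Existence

variable {M N : ℕ} {A : Type*} [Ring A] [Algebra ℂ A]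

theorem exists_inverse {C : Matrix (Idx M N) (Idx M N) ℂ} (hC : IsUnit C.det)
    {T : Matrix (Idx M N) (Idx M N) (PowerSeries A)}
    (h : T.map constantCoeff = C.map (algebraMap ℂ A)) : ∃ Y, T * Y = 1 ∧ Y * T = 1 := by
  have h1 : IsUnit (T.map constantCoeff) := by
    rw [h]
    exact ((Matrix.isUnit_iff_isUnit_det C).2 hC).map (algebraMap ℂ A).mapMatrix
  obtain ⟨u, rfl⟩ := isUnit_of_constantCoeff h1
  exact ⟨u⁻¹.1, u.mul_inv, u.inv_mul⟩

theorem exists_inverse_of_one {T : Matrix (Idx M N) (Idx M N) (PowerSeries A)}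
    (h : T.map constantCoeff = 1) : ∃ Y, T * Y = 1 ∧ Y * T = 1 :=
  exists_inverse (C := 1) (by simp) (by rw [h, Matrix.map_one _ (map_zero _) (map_one _)])

theorem str_map_constantCoeff {T : Matrix (Idx M N) (Idx M N) (PowerSeries A)}
    (h : T.map constantCoeff = 1) : (str T).map constantCoeff = 1 := by
  rw [← str_map, h, str_one]

/-- In first order a product with constant terms 1 adds the coefficients; those of T and T⁻¹ cancel,
and the shift of the argument does not affect them. -/
theorem coeff_central {T Y : Matrix (Idx M N) (Idx M N) (PowerSeries A)} {z : PowerSeries A}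
    (h0 : T.map constantCoeff = 1) (h1 : T * Y = 1)
    (hz : str Y * str (T.map (shiftArg ((M : ℂ) - N))) = Matrix.diagonal fun _ => z)
    (i : Idx M N) : constantCoeff z = 1 ∧ coeff 1 z = 0 := by
  have y0 : Y.map constantCoeff = 1 := by
    have := congrArg (fun W : Matrix _ _ (PowerSeries A) => W.map constantCoeff) h1
    beta_reduce at this
    rwa [Matrix.map_mul, h0, one_mul, Matrix.map_one _ (map_zero _) (map_one _)] at this
  have t0 : (T.map (shiftArg ((M : ℂ) - N))).map constantCoeff = 1 := by
    rw [← h0]; exact Matrix.ext fun i j => constantCoeff_substInv _ _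
  have sT := str_map_constantCoeff t0
  have sY := str_map_constantCoeff y0
  have c1 : ∀ P Q : Matrix (Idx M N) (Idx M N) (PowerSeries A), P.map constantCoeff = 1 →
      Q.map constantCoeff = 1 → coeff 1 ((P * Q) i i) =
        coeff 1 (P i i) + coeff 1 (Q i i) := fun P Q hP hQ => by
    have hP' : ∀ k, constantCoeff (P i k) = (1 : Matrix _ _ A) i k := fun k => by
      rw [← hP]; rfl
    have hQ' : ∀ k, constantCoeff (Q k i) = (1 : Matrix _ _ A) k i := fun k => by
      rw [← hQ]; rfl
    simp only [Matrix.mul_apply, map_sum, coeff_one_mul', hP', hQ', Finset.sum_add_distrib]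
    rw [add_comm]
    simp [Matrix.one_apply]
  have hi := congrArg (fun W : Matrix _ _ (PowerSeries A) => W i i) hz
  simp only [Matrix.diagonal_apply_eq] at hi
  refine ⟨?_, ?_⟩
  · have := congrArg (fun W : Matrix _ _ (PowerSeries A) => W.map constantCoeff i i) hz
    beta_reduce at this
    rw [Matrix.map_mul, sY, sT, one_mul, Matrix.one_apply_eq, Matrix.map_apply,
      Matrix.diagonal_apply_eq] at this
    exact this.symm
  · have e1 := c1 T Y h0 y0
    rw [h1, Matrix.one_apply_eq, coeff_one, if_neg one_ne_zero] at e1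
    rw [← hi, c1 _ _ sY sT, str, str, Matrix.of_apply, Matrix.of_apply, coeff_neg_one_pow_mul,
      coeff_neg_one_pow_mul, ← mul_add, Matrix.map_apply, coeff_one_shiftArg, add_comm (coeff 1 (Y i i)), ← e1,
      mul_zero]

end Existence

/-! ### Existence and basic properties of ζ(u) -/

section Existence

variable {M N : ℕ} {A : Type*} [Ring A] [Algebra ℂ A]

theorem ygl_commute {y : YGl M N} (h : ∀ n i j, Commute y (coeff n (tStd M N i j)))
    (x : YGl M N) : Commute y x := by
  obtain ⟨f, rfl⟩ := RingQuot.mkAlgHom_surjective ℂ (GlRel M N) x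
  induction f using FreeAlgebra.induction with
  | grade0 c => rw [AlgHom.commutes]; exact (Algebra.commutes c y).symm
  | grade1 g =>
    have h1 := h (g.2.2 + 1) g.1 g.2.1
    rw [tStd, std, Matrix.of_apply, coeff_neg_one_pow_mul, tSeries, coeff_map, freeSeries,
      coeff_mk] at h1
    have h2 := ((Commute.neg_one_right y).pow_right
      (par g.1 * par g.2.1 + par g.2.1)).mul_right h1
    rw [neg_one_pow_mul_self] at h2
    exact h2
  | mul a b ha hb => rw [map_mul]; exact ha.mul_right hb
  | add a b ha hb => rw [map_add]; exact ha.add_right hb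

theorem commute_coeff_substInv {w : PowerSeries ℂ} {f : PowerSeries A}
    (h : ∀ n y, Commute (coeff n f) y) (n : ℕ) (y : A) :
    Commute (coeff n (substInv w f)) y := by
  rw [substInv, coeff_mk]
  exact Commute.sum_left _ _ _ fun r _ => (h r y).smul_left _

theorem commute_C_iff {f : PowerSeries A} {y : A} :
    Commute f (PowerSeries.C y) ↔ ∀ n, Commute (coeff n f) y := by
  refine ⟨fun h n => ?_, fun h => ?_⟩
  · have := congrArg (coeff n) h.eq
    rwa [PowerSeries.coeff_mul_C, coeff_C_mul] at this
  · ext n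
    rw [PowerSeries.coeff_mul_C, coeff_C_mul]
    exact h n

theorem std_injective : Function.Injective (std : Mat1 M N A → _) :=
  Function.LeftInverse.injective unstd_std

theorem isCentralSeries_of {Y : Matrix (Idx M N) (Idx M N) (PowerSeries (YGl M N))}
    {z : PowerSeries (YGl M N)} (h1 : tStd M N * Y = 1) (h2 : Y * tStd M N = 1)
    (hz : str Y * str ((tStd M N).map (shiftArg ((M : ℂ) - N))) = Matrix.diagonal fun _ => z) :
    IsCentralSeries z := by
  refine ⟨unstd Y, std_injective ?_, std_injective ?_, fun i j => ?_⟩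
  · rw [std_mul1, std_unstd, std_one1]; exact h1
  · rw [std_mul1, std_unstd, std_one1]; exact h2
  · have h := congrArg (fun W : Matrix _ _ (PowerSeries (YGl M N)) => W j i) hz
    beta_reduce at h
    rw [Matrix.mul_apply, Matrix.diagonal_apply] at h
    simp only [eq_comm (a := i)]
    rw [← h]
    refine Finset.sum_congr rfl fun k _ => ?_
    rw [str, str, Matrix.of_apply, Matrix.of_apply, Matrix.map_apply, unstd, tStd, std,
      Matrix.of_apply, ← shiftHom_apply, ← shiftHom_apply, map_mul, map_pow, map_neg, map_one,
      sign_mul_sign_mul', sign_comm, pow_add _ (_ + _), mul_comm (par k) (par i)]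
    rw [mul_assoc ((-1) ^ (par j * par k + par j)), neg_one_pow_mul_self, mul_comm (par j)]
    exact mul_assoc _ _ _

/-- The existence of the central series `ζ(u)` of the twisted super Yangian. -/
theorem exists_zeta {G : Matrix (Idx M N) (Idx M N) ℂ} (hG : IsSupersymmetric G) (hne : M ≠ N)
    (i : Idx M N) {φ : YTw G →ₐ[ℂ] YGl M N}
    (hφ : (sStd G).map (PowerSeries.map (φ : YTw G →+* YGl M N)) =
      tStd M N * constSeries _ G * str ((tStd M N).map negArg)) :
    ∃ (z : PowerSeries (YGl M N)) (ζ : PowerSeries (YTw G)), IsCentralSeries z ∧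
      PowerSeries.map (φ : YTw G →+* YGl M N) (shiftArg (halfShift M N) ζ) *
        negShiftArg ((M : ℂ) - N) z = z ∧
      IsZeta (sStd G) ζ ∧ (∀ n y, Commute (coeff n ζ) y) ∧
      ζ * negArg ζ = 1 ∧
      coeff 0 ζ = 1 ∧ coeff 1 ζ = 0 ∧ coeff 2 ζ = 0 := by
  have inj := injective_twistedMap hG hφ
  have hT := isRTTSeries_tStd (M := M) (N := N)
  obtain ⟨Y, h1, h2⟩ := exists_inverse_of_one (tStd_map_constantCoeff (M := M) (N := N))
  obtain ⟨Q, hQ1, hQ2⟩ := exists_inverse_of_one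
    (str_map_constantCoeff (tStd_map_constantCoeff (M := M) (N := N)))
  obtain ⟨R, r1, r2⟩ := exists_inverse hG.nondegenerate (sStd_map_constantCoeff hG)
  obtain ⟨z, hz⟩ := hT.exists_central hne h1 h2
  have hzc : ∀ n y, Commute (coeff n z) y := fun n =>
    ygl_commute fun m i j => hT.commute_central h1 h2 hz n m i j
  obtain ⟨z0, z1⟩ := coeff_central tStd_map_constantCoeff h1 hz i
  set p := shiftArg (-halfShift M N) z with hp
  have hpc := commute_coeff_substInv (w := shiftedInv (-halfShift M N)) hzc
  have hwc := commute_coeff_substInv (w := -PowerSeries.X) hpc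
  have p0 : constantCoeff p = 1 := (constantCoeff_substInv _ _).trans z0
  have p1 : coeff 1 p = 0 := (coeff_one_shiftArg _ _).trans z1
  have hw0 : constantCoeff (negArg p) = 1 := (constantCoeff_substInv _ _).trans p0
  -- With p(u) = z(u - h), the series over Y(gl) is p(u)/p(-u).
  obtain ⟨w, hw⟩ : IsUnit (negArg p) := PowerSeries.isUnit_iff_constantCoeff.2 (by rw [hw0]; exact isUnit_one)
  have e1 : negArg p * (w⁻¹.1 * p) = p := by rw [← hw, ← mul_assoc, w.mul_inv, one_mul]
  have h0 : IsZeta ((sStd G).map (PowerSeries.map (φ : YTw G →+* YGl M N))) (w⁻¹.1 * p) := by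
    rw [hφ]
    refine (isZeta_constSeries hG).conj hT (hG.isEven.sCommSeries _).symm h1 h2 hQ1 hQ2 hz
      (fun i j m n => ?_) (PowerSeries.isUnit_iff_constantCoeff.2 (by rw [z0]; exact isUnit_one))
      (e1.trans (one_mul _).symm)
    rw [coeff_one]
    split_ifs
    · exact Commute.one_left _
    · exact Commute.zero_left _
  obtain ⟨ζ, hζ, hζ'⟩ := IsZeta.of_map inj r1 r2 h0 i
  have hcoeff : ∀ n, φ (coeff n ζ) = coeff n (w⁻¹.1 * p) := fun n => by
    rw [← hζ', coeff_map]; rfl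
  refine ⟨z, ζ, isCentralSeries_of h1 h2 hz, ?_, hζ, fun n y => ?_, ?_, ?_⟩
  -- Shifting ζ(u) = p(u)/p(-u) by h gives z(u)/z(-u - M + N).
  · have e2 : w⁻¹.1 * p * negArg p = p := by
      rw [← hw, mul_assoc, (commute_of_coeff fun m n => hpc m _ : Commute p w.1).eq, ← mul_assoc,
        w.inv_mul, one_mul]
    have e3 := congrArg (shiftHom (halfShift M N)) e2
    rw [map_mul, shiftHom_apply, shiftHom_apply, shiftHom_apply, hp, negArg_shiftArg, neg_neg,
      shiftArg_shiftArg, shiftArg_shiftArg, halfShift_add, add_neg_cancel, shiftArg_zero] at e3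
    rw [map_shiftArg, hζ', negShiftArg_eq]
    exact e3
  · refine inj ?_
    rw [map_mul, map_mul, hcoeff]
    refine commute_C_iff.1 (Commute.mul_left ?_ (commute_C_iff.2 fun n => hpc n _)) n
    refine Commute.units_inv_left ?_
    rw [hw]
    exact commute_C_iff.2 fun n => hwc n _
  · refine PowerSeries.map_injective (φ : YTw G →+* YGl M N) inj ?_
    have e2 := congrArg negHom e1
    rw [map_mul, negHom_apply, negHom_apply, negHom_apply, negArg_negArg, ← hw] at e2
    rw [map_mul, map_negArg, hζ', map_one, mul_assoc, e2, w.inv_mul]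
  -- p has no coefficient at u⁻¹, and its coefficient at u⁻² is common to p(u) and p(-u); so the
  -- quotient is 1 up to order u⁻³.
  · have c0 := congrArg (coeff 0) e1
    have c1 := congrArg (coeff 1) e1
    have c2 := congrArg (coeff 2) e1
    rw [coeff_mul] at c0 c1 c2
    simp only [Finset.Nat.antidiagonal_succ, Finset.Nat.antidiagonal_zero, Finset.sum_cons,
      Finset.map_singleton, Finset.sum_singleton, Function.Embedding.coeFn_mk,
      Function.Embedding.prodMap, Prod.map, coeff_negArg, p1, Finset.map_cons,
      coeff_zero_eq_constantCoeff_apply, p0] at c0 c1 c2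
    simp only [pow_zero, mul_one, one_mul, Function.Embedding.refl_apply, mul_zero, zero_mul,
      add_zero, Nat.succ_eq_add_one, Nat.reduceAdd] at c0 c1 c2
    refine ⟨inj ?_, inj ?_, inj ?_⟩
    · rw [hcoeff, map_one, coeff_zero_eq_constantCoeff_apply]; exact c0
    · rw [hcoeff, map_zero]; simpa [p1, c0] using c1
    · rw [hcoeff, map_zero]; 
      have c2' : coeff 2 (w⁻¹.1 * p) + (-1) ^ 2 * coeff 2 p =
        coeff 2 p := by simpa [p1, c0] using c2
      exact add_eq_right.1 ((congrArg (_ + ·)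
        ((congrArg (· * _) neg_one_sq).trans (one_mul _)).symm).trans c2')

end Existence

/-! ### The coaction on the central series -/

section SlotZeta

variable {M N : ℕ} {A : Type*} [Ring A] [Algebra ℂ A]
  {S : Matrix (Idx M N) (Idx M N) (PowerSeries A)} {G : Matrix (Idx M N) (Idx M N) ℂ}
  {γ : A →ₐ[ℂ] A} {Δ : A →ₐ[ℂ] SlotAlg M N A} {ζ : PowerSeries A}

/-- The involution is conjugation of S by J, under which the characterisation of ζ is invariant;
uniqueness shows that its coefficients are even. -/
theorem IsTwGen.map_zeta (hS : IsTwGen G S γ) (hζ : IsZeta S ζ) (i : Idx M N) :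
    PowerSeries.map (γ : A →+* A) ζ = ζ := by
  have h1 := hζ.map γ
  have h2 : S.map (PowerSeries.map (γ : A →+* A)) =
      constSeries A (parMat M N) * S * constSeries A (parMat M N) :=
    Matrix.ext fun i j => by rw [Matrix.map_apply, hS.par, parMat_mul_mul]
  rw [h2] at h1
  exact h1.unique hζ.parMat_conj i

theorem slotIncl_commute {y : A} (h : ∀ x, Commute y x) (hγ : γ y = y) (w : SlotAlg M N A) :
    Commute (slotIncl M N γ y) w := by
  have e : ∀ p : Idx M N, (γ ^ par p) y = y := fun p => by
    rcases par_cases p with hp | hp <;> simp [hp, hγ]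
  refine slot_ext fun n p q => ?_
  rw [slotEntry_slotIncl_mul, slotEntry_mul_slotIncl, e, e]
  exact h _

/-- The square of the shifted series `(u - a)⁻¹`. -/
def slotSq (M N : ℕ) (A : Type*) [Ring A] [Algebra ℂ A] : PowerSeries (SlotAlg M N A) :=
  shiftArg (-halfShift M N) (geomSeries (slotPt M N A)) *
    shiftArg (-halfShift M N) (geomSeries (slotPt M N A))

theorem slotSq_commute (y : PowerSeries (SlotAlg M N A)) : Commute (slotSq M N A) y := by
  have : ∀ y, Commute (shiftArg (-halfShift M N) (geomSeries (slotPt M N A))) y := fun y => by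
    rw [geomSeries, ← map_shiftArg]
    exact map_commute (aeval_commute slotPt_commute) _ _
  exact (this y).mul_left (this y)

/-- Δ(ζ) is the series attached to the dressed matrix T S Tᵗ, so by uniqueness it equals ζ z(u -
h)/z(-u - h) for the slot series, whose z is 1/(1 - (u - a)⁻²). -/
theorem slot_zeta (hne : M ≠ N) (hS : IsTwGen G S γ) (hΔ : IsSlotTw S γ Δ) (hζ : IsZeta S ζ)
    (hζc : ∀ n y, Commute (coeff n ζ) y) (i : Idx M N) :
    (1 - slotSq M N A) * PowerSeries.map (Δ : A →+* SlotAlg M N A) ζ =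
      (1 - negArg (slotSq M N A)) *
        PowerSeries.map (slotIncl M N γ : A →+* SlotAlg M N A) ζ := by
  have hT := isRTTSeries_slotSeries (M := M) (N := N) (A := A)
  have t0 := slotSeries_map_constantCoeff (M := M) (N := N) (A := A)
  obtain ⟨Y, h1, h2⟩ := exists_inverse_of_one t0
  obtain ⟨Q, hQ1, hQ2⟩ := exists_inverse_of_one (str_map_constantCoeff t0)
  obtain ⟨z, hz⟩ := hT.exists_central hne h1 h2
  have hz1 : IsUnit z := PowerSeries.isUnit_iff_constantCoeff.2
    (by rw [(coeff_central t0 h1 hz i).1]; exact isUnit_one)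
  have k1 : (1 - slotSq M N A) * shiftArg (-halfShift M N) z = 1 := by
    have := congrArg (shiftHom (-halfShift M N)) (slotSeries_central h1 hz i)
    rwa [map_mul, map_sub, map_one, map_mul] at this
  have k2 : (1 - negArg (slotSq M N A)) * negArg (shiftArg (-halfShift M N) z) = 1 := by
    have := congrArg negHom k1
    rwa [map_mul, map_sub, map_one] at this
  obtain ⟨w, hw⟩ : IsUnit (negArg (shiftArg (-halfShift M N) z)) :=
    (hz1.map (shiftHom (-halfShift M N))).map negHom
  have hγ := hS.map_zeta hζ i
  have h3 := (hζ.map (slotIncl M N γ)).conj (ζ' := w⁻¹.1 *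
    (PowerSeries.map (slotIncl M N γ : A →+* SlotAlg M N A) ζ * shiftArg (-halfShift M N) z)) hT
    (sCommSeries_slotSeries hS.par) h1 h2 hQ1 hQ2 hz (fun i j m n => by
      rw [coeff_map]
      refine slotIncl_commute (hζc m) ?_ _
      conv_rhs => rw [← hγ]
      rw [coeff_map]; rfl) hz1 (by rw [← hw, ← mul_assoc, w.mul_inv, one_mul])
  have h4 := hζ.map Δ
  have e5 : S.map (PowerSeries.map (Δ : A →+* SlotAlg M N A)) = _ := hΔ
  rw [e5] at h4
  have h6 : w.1 * PowerSeries.map (Δ : A →+* SlotAlg M N A) ζ =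
      PowerSeries.map (slotIncl M N γ : A →+* SlotAlg M N A) ζ * shiftArg (-halfShift M N) z := by
    rw [h4.unique h3 i, ← mul_assoc, w.mul_inv, one_mul]
  have c1 : ∀ y, Commute (1 - slotSq M N A) y := fun y => (Commute.one_left y).sub_left (slotSq_commute y)
  rw [← hw] at k2
  calc (1 - slotSq M N A) * PowerSeries.map (Δ : A →+* SlotAlg M N A) ζ
      = (1 - slotSq M N A) * (((1 - negArg (slotSq M N A)) * w.1) *
          PowerSeries.map (Δ : A →+* SlotAlg M N A) ζ) := by rw [k2, one_mul]
    _ = (1 - slotSq M N A) * ((1 - negArg (slotSq M N A)) *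
          PowerSeries.map (slotIncl M N γ : A →+* SlotAlg M N A) ζ) *
          shiftArg (-halfShift M N) z := by rw [mul_assoc _ w.1, h6]; simp only [mul_assoc]
    _ = _ := by rw [(c1 _).eq, mul_assoc, k1, mul_one]

theorem substInv_mem_slotSub {w : PowerSeries ℂ} {m : ℤ}
    {f : PowerSeries (SlotAlg M N A)} (hf : f ∈ slotSub S m) : substInv w f ∈ slotSub S m := by
  intro n
  rw [substInv, coeff_mk]
  refine Submodule.sum_mem _ fun r hr => Submodule.smul_mem _ _ (slotFilt_mono ?_ (hf r))
  have := Finset.mem_range.1 hr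
  omega

theorem slotSq_mem : slotSq M N A ∈ slotSub S 4 :=
  slotSub_mono (m := 2 + 2) (by norm_num)
    (mul_mem_slotSub (substInv_mem_slotSub geomSeries_slotPt_mem)
      (substInv_mem_slotSub geomSeries_slotPt_mem))

/-- The shift by h changes (u - a)⁻¹ only in relative weight two, so the leading coefficients can be
read off the unshifted square. -/
theorem slotSq_sub_mem : slotSq M N A - geomSeries (slotPt M N A) * geomSeries (slotPt M N A) ∈
    slotSub S 6 := by
  set x := geomSeries (slotPt M N A) with hx
  have hx2 : x ∈ slotSub S 2 := geomSeries_slotPt_mem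
  set y := shiftArg (-halfShift M N) x with hy
  have hy2 : y ∈ slotSub S 2 := substInv_mem_slotSub geomSeries_slotPt_mem
  have h1 : x - y ∈ slotSub S 4 := by
    rw [hy, geomSeries_shift]
    exact Submodule.smul_mem _ _ (slotSub_mono (m := 2 + 2) (by norm_num) (mul_mem_slotSub hx2 hy2))
  have h2 : slotSq M N A - x * x = -((x - y) * y + x * (x - y)) := by
    rw [slotSq, ← hx, ← hy]; noncomm_ring
  rw [h2]
  refine Submodule.neg_mem _ (Submodule.add_mem _ ?_ ?_)
  · exact slotSub_mono (m := 4 + 2) (by norm_num) (mul_mem_slotSub h1 hy2)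
  · exact slotSub_mono (m := 2 + 4) (by norm_num) (mul_mem_slotSub hx2 h1)

end SlotZeta

/-! ### Leading terms of the coefficients of ζ(u) -/

section ZetaFilt

variable {M N : ℕ} {A : Type*} [Ring A] [Algebra ℂ A]
  {S : Matrix (Idx M N) (Idx M N) (PowerSeries A)} {G : Matrix (Idx M N) (Idx M N) ℂ}
  {γ : A →ₐ[ℂ] A} {Δ : A →ₐ[ℂ] SlotAlg M N A} {ζ : PowerSeries A}

theorem slotFilt_neg {d : ℤ} (h : d < 0) {x : SlotAlg M N A} (hx : x ∈ slotFilt S d) : x = 0 :=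
  slot_ext fun n p q => by rw [map_zero]; exact filt_neg (by omega) (hx n p q)

theorem mem_filt_of_slotDiff' (hS : IsTwGen G S γ) (hΔ : IsSlotTw S γ Δ) {d : ℤ} (hd : 0 ≤ d) {y : A}
    (hy : slotDiff M N γ Δ y ∈ slotFilt S (d - 1)) : y ∈ filt S d := by
  lift d to ℕ using hd
  exact mem_filt_of_slotDiff hS hΔ hy

/-- In first order Δ(ζ) - ζ is q(u) - q(-u), with q the shifted square. The error consists of
products of small terms, estimated by induction on the coefficient index. -/
theorem slotDiff_zeta_sub_mem (hS : IsTwGen G S γ) (hΔ : IsSlotTw S γ Δ)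
    (hζ : (1 - slotSq M N A) * PowerSeries.map (Δ : A →+* SlotAlg M N A) ζ =
      (1 - negArg (slotSq M N A)) * PowerSeries.map (slotIncl M N γ : A →+* SlotAlg M N A) ζ)
    (h0 : coeff 0 ζ = 1) (h1 : coeff 1 ζ = 0) (k : ℕ) :
    slotDiff M N γ Δ (coeff k ζ) -
      coeff k (slotSq M N A - negArg (slotSq M N A)) ∈ slotFilt S (2 * k - 7) := by
  set q := slotSq M N A with hq
  have hqm : q ∈ slotSub S 4 := slotSq_mem
  have hQm : q - negArg q ∈ slotSub S 4 := Submodule.sub_mem _ hqm (negArg_mem_slotSub hqm)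
  set Q := q - negArg q with hQ
  set E := PowerSeries.map (Δ : A →+* SlotAlg M N A) ζ with hE
  set I := PowerSeries.map (slotIncl M N γ : A →+* SlotAlg M N A) ζ with hI
  have hk : ∀ k, slotDiff M N γ Δ (coeff k ζ) = coeff k (E - I) := fun k => by
    rw [map_sub, hE, hI, coeff_map, coeff_map]; rfl
  have e : E - I - Q = q * (E - I) + Q * (I - 1) := by
    rw [← sub_eq_zero]
    rw [← sub_eq_zero] at hζ
    rw [← hζ, hQ]
    noncomm_ring
  induction k using Nat.strong_induction_on with
  | _ k ih =>
  have hb : ∀ b < k, slotDiff M N γ Δ (coeff b ζ) ∈ slotFilt S (2 * b - 4) := fun b hb => by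
    have := Submodule.add_mem _ (slotFilt_mono (e := 2 * b - 4) (by omega) (ih b hb)) (hQm b)
    rwa [sub_add_cancel] at this
  rw [hk, ← map_sub, e, map_add, coeff_mul, coeff_mul]
  -- A series in `slotSub S 4` starts at u⁻², so the other factor has a strictly smaller index and
  -- the induction hypothesis applies.
  have small : ∀ {f : PowerSeries (SlotAlg M N A)} {a : ℕ}, f ∈ slotSub S 4 → a < 2 →
      coeff a f = 0 := fun hf ha => slotFilt_neg (by omega) (hf _)
  refine Submodule.add_mem _ (Submodule.sum_mem _ fun x hx => ?_)
    (Submodule.sum_mem _ fun x hx => ?_) <;>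
    have hx := Finset.HasAntidiagonal.mem_antidiagonal.1 hx <;>
    by_cases ha : x.1 < 2
  · rw [small hqm ha, zero_mul]; exact Submodule.zero_mem _
  · rw [← hk]
    exact slotFilt_mono (by omega) (mul_mem_slotFilt (hqm x.1) (hb x.2 (by omega)))
  · rw [small hQm ha, zero_mul]; exact Submodule.zero_mem _
  · have hI1 : coeff x.2 (I - 1) ∈ slotFilt S (2 * x.2 - 3) := by
      rcases hx2 : x.2 with _ | _ | b
      · rw [map_sub, hI, coeff_map, h0, PowerSeries.coeff_zero_one]
        change slotIncl M N γ 1 - 1 ∈ _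
        rw [map_one, sub_self]; exact Submodule.zero_mem _
      · rw [map_sub, hI, coeff_map, h1, coeff_one, map_zero, if_neg (by omega),
          sub_zero]
        exact Submodule.zero_mem _
      · rw [map_sub, hI, coeff_map, coeff_one, if_neg (by omega), sub_zero]
        refine slotIncl_mem hS (mem_filt_of_slotDiff' hS hΔ (by push_cast; omega)
          (slotFilt_mono ?_ (hb _ (by omega))))
        push_cast; omega
    exact slotFilt_mono (by omega) (mul_mem_slotFilt (hQm x.1) hI1)

/-- The coefficient of (u - a)⁻² at u⁻ⁿ⁻² is (n + 1) aⁿ; subtracting the value at -u leaves the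
factor 1 - (-1)ⁿ. -/
theorem slotDiff_zeta_sub_mem' (hS : IsTwGen G S γ) (hΔ : IsSlotTw S γ Δ)
    (hζ : (1 - slotSq M N A) * PowerSeries.map (Δ : A →+* SlotAlg M N A) ζ =
      (1 - negArg (slotSq M N A)) * PowerSeries.map (slotIncl M N γ : A →+* SlotAlg M N A) ζ)
    (h0 : coeff 0 ζ = 1) (h1 : coeff 1 ζ = 0) (n : ℕ) :
    slotDiff M N γ Δ (coeff (n + 2) ζ) -
      (((n : ℂ) + 1) * (1 - (-1) ^ n)) • slotPt M N A ^ n ∈ slotFilt S (2 * n - 2) := by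
  have h2 := slotFilt_mono (e := 2 * n - 2) (by push_cast; omega)
    (slotDiff_zeta_sub_mem hS hΔ hζ h0 h1 (n + 2))
  have h3 := slotFilt_mono (e := 2 * n - 2) (by push_cast; omega)
    (slotSq_sub_mem (S := S) (M := M) (N := N) (A := A) (n + 2))
  have h4 := Submodule.smul_mem _ (1 - (-1) ^ n : ℂ) h3
  convert Submodule.add_mem _ h2 h4 using 1
  have e : ((n : SlotAlg M N A) + 1) * slotPt M N A ^ n = ((n : ℂ) + 1) • slotPt M N A ^ n := by
    rw [add_mul, one_mul, add_smul, one_smul, ← nsmul_eq_mul, Nat.cast_smul_eq_nsmul]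
  rw [map_sub, map_sub, coeff_negArg, coeff_geomSeries_sq, e, pow_add, neg_one_sq, mul_one]
  rcases Nat.even_or_odd n with h | h <;> simp only [h.neg_one_pow, one_mul, neg_mul] <;> module

variable (S G) in
/-- The supertrace of the dual generators. -/
def trGen (n : ℕ) : A := ∑ p, dualGen S G p p n

theorem trGen_mem (n : ℕ) : trGen S G n ∈ filt S (2 * n + 1) :=
  Submodule.sum_mem _ fun p _ => dualGen_mem p p n

theorem contract_slotPt {K n : ℕ} (hn : n < K) :
    contract S G γ K (slotPt M N A ^ n) = (1 / 2 : ℂ) • trGen S G n := by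
  have e : ∀ k p q, slotEntry k p q (slotPt M N A ^ n) = if k = n ∧ p = q then 1 else 0 := by
    intro k p q
    rw [← mul_one (slotPt M N A ^ n), slotEntry_slotPt_pow_mul, ← map_one (slotC M N),
      slotEntry_slotC, Matrix.one_apply, ← ite_and, ← ite_and]
    congr 1
    simp only [eq_iff_iff]
    constructor <;> rintro h <;> (try obtain ⟨h1, h2, h3⟩ := h) <;> refine ⟨?_, ?_⟩ <;> grind
  rw [contract_apply, trGen, Finset.sum_eq_single n]
  · congr 1
    refine Finset.sum_congr rfl fun p _ => ?_
    rw [Finset.sum_eq_single p]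
    · rw [e, if_pos ⟨rfl, rfl⟩, map_one, mul_one]
    · intro q _ hq
      rw [e, if_neg fun h => hq h.2.symm, map_zero, mul_zero]
    · exact fun h => absurd (Finset.mem_univ p) h
  · intro k _ hk
    simp [e, hk]
  · intro h
    exact absurd (Finset.mem_range.2 hn) h

theorem euler_trGen_mem (hS : IsTwGen G S γ) (hΔ : IsSlotTw S γ Δ) {K n : ℕ} (hn : n < K) :
    euler S G γ Δ K (trGen S G n) - trGen S G n ∈ filt S (2 * n) := by
  rw [trGen, map_sum, ← Finset.sum_sub_distrib]
  refine Submodule.sum_mem _ fun p _ => ?_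
  have e : ∀ x, euler S G γ Δ K (-(-1) ^ (par p * par p) * x) =
      -(-1) ^ (par p * par p) * euler S G γ Δ K x := fun x => by
    rcases neg_one_pow_eq_or A (par p * par p) with h | h <;> simp [h]
  rw [dualGen, e, ← mul_sub, map_sum, ← Finset.sum_sub_distrib, neg_mul, Submodule.neg_mem_iff,
    sign_mul_mem]
  refine Submodule.sum_mem _ fun k _ => ?_
  rw [map_smul, ← smul_sub]
  exact Submodule.smul_mem _ _ (euler_sCoeff_mem hS hΔ p k hn)

/-- Contracting the scalar matrix aⁿ gives half the trace of the dual generators. Thus `euler` maps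
ζ^{(n+2)} to the stated multiple of the trace, and it remains to replace its image by ζ^{(n+2)}
itself. -/
theorem zeta_sub_trGen_mem (hS : IsTwGen G S γ) (hΔ : IsSlotTw S γ Δ)
    (hζ : (1 - slotSq M N A) * PowerSeries.map (Δ : A →+* SlotAlg M N A) ζ =
      (1 - negArg (slotSq M N A)) * PowerSeries.map (slotIncl M N γ : A →+* SlotAlg M N A) ζ)
    (h0 : coeff 0 ζ = 1) (h1 : coeff 1 ζ = 0) (n : ℕ) :
    coeff (n + 2) ζ - (((n : ℂ) + 1) * (1 - (-1) ^ n) / 2) • trGen S G n ∈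
      filt S (2 * n) := by
  have h2 := slotDiff_zeta_sub_mem' hS hΔ hζ h0 h1 n
  set c : ℂ := ((n : ℂ) + 1) * (1 - (-1) ^ n) with hc
  have h3 := contract_mem hS (d := 2 * n - 1) (2 * n + 1) (slotFilt_mono (by omega) h2)
  rw [map_sub, map_smul, contract_slotPt (by omega)] at h3
  change euler S G γ Δ (2 * n + 1) _ - _ ∈ _ at h3
  have h4 := euler_mem hS hΔ (2 * n + 1) h3
  have h5 := Submodule.smul_mem _ (c * (1 / 2)) (euler_trGen_mem hS hΔ (K := 2 * n + 1) (n := n) (by omega))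
  have h6 : coeff (n + 2) ζ ∈ filt S (2 * n + 1) := by
    refine mem_filt_of_slotDiff' hS hΔ (by omega) ?_
    have := Submodule.add_mem _ (slotFilt_mono (e := 2 * n + 1 - 1) (by omega) h2)
      (Submodule.smul_mem _ c (slotFilt_mono (by omega) (slotPt_pow_mem n)))
    rwa [sub_add_cancel] at this
  set y := coeff (n + 2) ζ with hy
  have h3' := filt_mono (e := 2 * n) (by omega) h3
  have h4' := filt_mono (e := 2 * n) (by omega) h4
  -- The trace is fixed by `euler` modulo lower weight, so `euler` maps `euler y - y` to lower
  -- weight; by `mem_of_euler_mem` this difference is itself of lower weight.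
  have h7 : euler S G γ Δ (2 * n + 1) y - y ∈ filt S (2 * n : ℕ) := by
    refine mem_of_euler_mem hS hΔ (fun w hw => euler_mem hS hΔ _ hw) le_rfl
      (filt_mono (by push_cast; omega) (Submodule.sub_mem _ (euler_mem hS hΔ _ h6) h6)) ?_
    have := Submodule.add_mem _ (Submodule.sub_mem _ h4' h3') h5
    push_cast
    convert this using 1
    simp only [map_sub, map_smul]
    module
  push_cast at h7
  convert Submodule.sub_mem _ h3' h7 using 1
  module

theorem inv_swap (hG : IsSupersymmetric G) (i j : Idx M N) :
    (-1) ^ par i * G⁻¹ j i = G⁻¹ i j := by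
  have h1 : Matrix.transpose G = parMat M N * G := Matrix.ext fun i j => by
    rw [Matrix.transpose_apply, parMat, Matrix.diagonal_mul]
    by_cases h : par i = par j
    · rw [← hG.swap i j, ← mul_assoc, ← pow_add, ← h]
      rcases par_cases i with hi | hi <;> simp [hi]
    · rw [hG.isEven j i (Ne.symm h), hG.isEven i j h, mul_zero]
  have hD : parMat M N * parMat M N = 1 := by
    rw [parMat, Matrix.diagonal_mul_diagonal, ← Matrix.diagonal_one]
    congr 1
    funext i
    rw [← pow_add, neg_one_pow_add_self]
  have h2 := Matrix.transpose_nonsing_inv G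
  rw [h1, Matrix.mul_inv_rev, Matrix.inv_eq_left_inv hD] at h2
  have h3 := congrFun (congrFun h2 j) i
  rw [Matrix.transpose_apply, parMat, Matrix.mul_diagonal] at h3
  rw [h3, mul_comm]

/-- For even n the symmetry relation makes the generators of upper index n + 1 antisymmetric with
respect to G⁻¹ modulo lower weight, so their trace equals its own negative there. -/
theorem trGen_mem_of_even (hS : IsTwGen G S γ) {n : ℕ} (hn : Even n) :
    trGen S G n ∈ filt S (2 * n) := by
  have e1 : trGen S G n = -∑ p, ∑ k, (-1) ^ par p * (G⁻¹ k p • sCoeff S p k (n + 1)) := by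
    rw [trGen, ← Finset.sum_neg_distrib]
    refine Finset.sum_congr rfl fun p _ => ?_
    rw [dualGen, show par p * par p = par p by rcases par_cases p with h | h <;> simp [h],
      neg_mul, Finset.mul_sum]
  have e2 : trGen S G n = -∑ p, ∑ k, G⁻¹ k p • sCoeff S k p (n + 1) := by
    rw [e1, Finset.sum_comm]
    congr 1
    refine Finset.sum_congr rfl fun p _ => Finset.sum_congr rfl fun k _ => ?_
    rw [← inv_swap hS.supersymm k p]
    rcases par_cases k with h | h <;> simp [h]
  have h : trGen S G n + trGen S G n ∈ filt S (2 * n) := by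
    have e3 : trGen S G n + trGen S G n = -∑ p, ∑ k, G⁻¹ k p • ((-1) ^ par p *
        (sCoeff S p k (n + 1) - (-1) ^ (par p * par k + (n + 1)) * sCoeff S k p (n + 1))) := by
      nth_rw 1 [e1]
      rw [e2, ← neg_add, ← Finset.sum_add_distrib]
      congr 1
      refine Finset.sum_congr rfl fun p _ => ?_
      rw [← Finset.sum_add_distrib]
      refine Finset.sum_congr rfl fun k _ => ?_
      by_cases hk : par k = par p
      · rw [hk, pow_add _ _ (n + 1), pow_succ _ n, hn.neg_one_pow]
        rcases par_cases p with hp | hp <;> simp [hp, smul_add, sub_eq_add_neg, add_comm]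
      · rw [hS.supersymm.isEven.inv k p hk]; simp
    rw [e3, Submodule.neg_mem_iff]
    refine Submodule.sum_mem _ fun p _ => Submodule.sum_mem _ fun k _ => Submodule.smul_mem _ _ ?_
    rw [sign_mul_mem, ← neg_sub, Submodule.neg_mem_iff]
    exact sCoeff_symm hS p k n
  have := Submodule.smul_mem _ (1 / 2 : ℂ) h
  convert this using 1
  module

end ZetaFilt

/-! ### The coaction and the parity involution -/

section SlotPar

variable {M N : ℕ} {A : Type*} [Ring A] [Algebra ℂ A]
  {S : Matrix (Idx M N) (Idx M N) (PowerSeries A)} {G : Matrix (Idx M N) (Idx M N) ℂ}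
  {γ : A →ₐ[ℂ] A} {Δ : A →ₐ[ℂ] SlotAlg M N A}

/-- Conjugation by an involution. -/
def conjHom {R : Type*} [Ring R] [Algebra ℂ R] (e : R) (he : e * e = 1) : R →ₐ[ℂ] R :=
  AlgHom.ofLinearMap (LinearMap.mulLeft ℂ e ∘ₗ LinearMap.mulRight ℂ e)
    (by simp [he]) fun x y => by
    simp only [LinearMap.comp_apply, LinearMap.mulLeft_apply, LinearMap.mulRight_apply]
    calc e * (x * y * e) = e * (x * 1 * (y * e)) := by simp only [mul_assoc, one_mul]
      _ = _ := by rw [← he]; simp only [mul_assoc]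

variable (M N A) in
/-- The parity operator of `End V`. -/
def slotSign : SlotAlg M N A := slotC M N (Matrix.diagonal fun i => (-1) ^ par i)

theorem slotSign_mul_self : slotSign M N A * slotSign M N A = 1 := by
  rw [slotSign, ← map_mul, Matrix.diagonal_mul_diagonal, ← map_one (slotC M N), ← Matrix.diagonal_one]
  congr 2
  funext i
  rw [← pow_add, neg_one_pow_add_self]

variable (M N) in
/-- The parity involution of the slot algebra. -/
def slotPar (γ : A →ₐ[ℂ] A) : SlotAlg M N A →ₐ[ℂ] SlotAlg M N A :=
  (conjHom (slotSign M N A) slotSign_mul_self).comp (slotMap M N γ)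

theorem slotEntry_slotPar (n : ℕ) (p q : Idx M N) (w : SlotAlg M N A) :
    slotEntry n p q (slotPar M N γ w) = (-1) ^ (par p + par q) * γ (slotEntry n p q w) := by
  change slotEntry n p q (slotSign M N A * (slotMap M N γ w * slotSign M N A)) = _
  rw [slotSign, slotEntry_slotC_mul, Finset.sum_eq_single p, Matrix.diagonal_apply_eq,
    slotEntry_mul_slotC, Finset.sum_eq_single q, Matrix.diagonal_apply_eq, slotEntry_slotMap, pow_add,
    mul_assoc, ← mul_one (γ _ * _), mul_assoc, sign_comm, mul_one]
  · simp +contextual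
  · simp
  · simp +contextual [Ne.symm]
  · simp

theorem slotPar_slotUnits (i j : Idx M N) : slotPar M N γ (slotUnits M N A i j) =
    (-1) ^ (par i + par j) * slotUnits M N A i j := by
  refine slot_ext fun n p q => ?_
  have sg : ∀ (s : ℕ) (x : SlotAlg M N A), slotEntry n p q ((-1) ^ s * x) =
      (-1) ^ s * slotEntry n p q x := by
    intro s x
    rcases Nat.even_or_odd s with hs | hs <;> simp [hs.neg_one_pow]
  rw [slotEntry_slotPar, sg, slotUnits, Matrix.of_apply, slotEntry_slotC, slotUnit,
    Matrix.single_apply]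
  split_ifs with h1 h2
  · rw [map_neg, map_pow, map_neg, map_one, h2.1, h2.2, add_comm]
  · simp
  · simp

theorem slotPar_slotPt : slotPar M N γ (slotPt M N A) = slotPt M N A := by
  refine slot_ext fun n p q => ?_
  have := fun x => slotEntry_slotPt_pow_mul n 1 p q (slotC M N x : SlotAlg M N A)
  have h1 := this 1
  rw [map_one, mul_one, pow_one] at h1
  rw [slotEntry_slotPar, h1, ← map_one (slotC M N), slotEntry_slotC, Matrix.one_apply]
  split_ifs with h1 h2 h3
  · rw [h3, map_one, mul_one, neg_one_pow_add_self]
  all_goals simp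

theorem slotPar_slotIncl (y : A) :
    slotPar M N γ (slotIncl M N γ y) = slotIncl M N γ (γ y) := by
  refine slot_ext fun n p q => ?_
  rw [slotEntry_slotPar, slotIncl_apply, slotIncl_apply, slotEntry_slotC, slotEntry_slotC,
    Matrix.diagonal_apply, Matrix.diagonal_apply]
  split_ifs with h1 h2
  · rw [h2, neg_one_pow_add_self, one_mul, ← AlgHom.mul_apply, ← AlgHom.mul_apply, ← pow_succ,
      ← pow_succ']
  all_goals simp

theorem hasPar_evalSeries {R : Type*} [Ring R] [Algebra ℂ R] {φ : R →ₐ[ℂ] R}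
    {e : Matrix (Idx M N) (Idx M N) R} {a : R}
    (he : ∀ i j, φ (e i j) = (-1) ^ (par i + par j) * e i j) (ha : φ a = a) :
    HasPar (PowerSeries.map (φ : R →+* R)) (evalSeries e a) := by
  intro i j
  have h := congrArg (fun W : Matrix _ _ (PowerSeries R) => W i j) (map_evalSeries φ e a)
  beta_reduce at h
  rw [Matrix.map_apply] at h
  rw [h, evalSeries, evalSeries, Matrix.of_apply, Matrix.of_apply, Matrix.map_apply, he, ha, map_mul,
    map_pow, map_neg, map_one, mul_add, mul_assoc, Matrix.one_apply]
  split_ifs with h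
  · rw [h, neg_one_pow_add_self, one_mul, one_mul]
  · rw [mul_zero]

theorem HasPar.map {R : Type*} [Ring R] [Algebra ℂ R] {φ : R →ₐ[ℂ] R} {ι : A →ₐ[ℂ] R}
    (h : ∀ y, φ (ι y) = ι (γ y)) {X : Matrix (Idx M N) (Idx M N) (PowerSeries A)}
    (hX : HasPar (PowerSeries.map (γ : A →+* A)) X) :
    HasPar (PowerSeries.map (φ : R →+* R)) (X.map (PowerSeries.map (ι : A →+* R))) := by
  intro i j
  rw [Matrix.map_apply, ← series_map_comp, show φ.comp ι = ι.comp γ from AlgHom.ext h,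
    series_map_comp, hX, map_mul, map_pow, map_neg, map_one]

theorem hom_par_comm {R : Type*} [Ring R] [Algebra ℂ R] (hS : IsTwGen G S γ) {φ : R →ₐ[ℂ] R}
    {ψ : A →ₐ[ℂ] R} (h : HasPar (PowerSeries.map (φ : R →+* R)) (S.map (PowerSeries.map (ψ : A →+* R)))) :
    ψ.comp γ = φ.comp ψ := hS.hom_ext <| Matrix.ext fun i j => by
  rw [Matrix.map_apply, Matrix.map_apply, series_map_comp, series_map_comp, hS.par, map_mul,
    map_pow, map_neg, map_one]
  exact (h i j).symm

/-- The involution of the slot algebra combines γ with conjugation by the parity operator of V; all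
three factors of the dressed matrix are homogeneous for it. -/
theorem slotTw_par (hS : IsTwGen G S γ) (hΔ : IsSlotTw S γ Δ) (y : A) :
    Δ (γ y) = slotPar M N γ (Δ y) := by
  refine DFunLike.congr_fun (hom_par_comm hS (φ := slotPar M N γ) ?_) y
  have h1 : HasPar (PowerSeries.map (slotPar M N γ : SlotAlg M N A →+* SlotAlg M N A))
    (slotSeries M N A) := hasPar_evalSeries slotPar_slotUnits slotPar_slotPt
  have e : S.map (PowerSeries.map (Δ : A →+* SlotAlg M N A)) = _ := hΔ
  rw [e]
  exact (h1.mul (HasPar.map slotPar_slotIncl hS.par)).mul h1.map_negArg.str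

theorem slotEntry_slotDiff_par (hS : IsTwGen G S γ) (hΔ : IsSlotTw S γ Δ) (n : ℕ) (p : Idx M N)
    (y : A) : slotEntry n p p (slotDiff M N γ Δ (γ y)) = γ (slotEntry n p p (slotDiff M N γ Δ y)) := by
  rw [slotDiff_apply, slotTw_par hS hΔ, ← slotPar_slotIncl, ← map_sub, slotEntry_slotPar,
    neg_one_pow_add_self, one_mul, slotDiff_apply]

end SlotPar

/-! ### The coaction on nearly central elements -/

section NearlyCentral

variable {M N : ℕ} {A : Type*} [Ring A] [Algebra ℂ A]
  {S : Matrix (Idx M N) (Idx M N) (PowerSeries A)} {G : Matrix (Idx M N) (Idx M N) ℂ}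
  {γ : A →ₐ[ℂ] A} {Δ : A →ₐ[ℂ] SlotAlg M N A} {p : ℕ} {d : ℤ} {y : A}

variable (S γ) in
/-- An element of parity `p` and weight at most `d` whose supercommutators drop the weight by one
more than those of a general element. -/
structure IsNearlyCentral (p : ℕ) (d : ℤ) (y : A) : Prop where
  mem : y ∈ filt S d
  par_eq : γ y = (-1) ^ p * y
  comm : ∀ (e : ℤ), ∀ x ∈ filt S e, x * y - y * (γ ^ p) x ∈ filt S (e + d - 2)

theorem IsNearlyCentral.sign_mul (h : IsNearlyCentral S γ p d y) (e : ℕ) :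
    IsNearlyCentral S γ p d ((-1) ^ e * y) := by
  rcases neg_one_pow_eq_or A e with h' | h'
  · rwa [h', one_mul]
  · rw [h', neg_one_mul]
    refine ⟨Submodule.neg_mem _ h.mem, by rw [map_neg, h.par_eq, mul_neg], fun e x hx => ?_⟩
    rw [mul_neg, neg_mul, ← neg_sub', Submodule.neg_mem_iff]
    exact h.comm e x hx

/-- Supercommutators drop the weight by one. -/
theorem mul_sub_mul_mem (hS : IsTwGen G S γ) {f e : ℤ} {c u : A} (hc : c ∈ filt S f)
    (hp : γ c = (-1) ^ p * c) (hu : u ∈ filt S e) : u * c - c * (γ ^ p) u ∈ filt S (e + f - 1) := by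
  have hw : ∀ w, word S w * c - c * (γ ^ p) (word S w) ∈ filt S (wtList w + f - 1) := by
    intro w
    induction w with
    | nil =>
      rw [show word S ([] : List (Gen M N)) = 1 from rfl, map_one, one_mul, mul_one, sub_self]
      exact Submodule.zero_mem _
    | cons g w ih =>
      have h1 := sCoeff_mul_sub_mem hS g.1 g.2.1 g.2.2 hc
      have h2 : letter S g * c - c * (γ ^ p) (letter S g) ∈ filt S (f + 2 * g.2.2) := by
        rw [pow_apply_of_sign hp, sign_comm, mul_comm (par g.1 + par g.2.1)] at h1
        rw [pow_apply_of_sign (par_letter hS g), sign_comm,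
          ← sign_mul_mem (p * (par g.1 + par g.2.1)), mul_sub, neg_one_pow_mul_self]
        exact h1
      rw [word_cons, wtList_cons, map_mul]
      have e1 : letter S g * word S w * c - c * ((γ ^ p) (letter S g) * (γ ^ p) (word S w)) =
        letter S g * (word S w * c - c * (γ ^ p) (word S w)) +
        (letter S g * c - c * (γ ^ p) (letter S g)) * (γ ^ p) (word S w) := by noncomm_ring
      rw [e1]
      refine Submodule.add_mem _ (filt_mono ?_ (mul_mem_filt (letter_mem g) ih))
        (filt_mono ?_ (mul_mem_filt h2 (par_pow_mem hS (word_mem le_rfl) p))) <;>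
        simp only [wt] <;> push_cast <;> omega
  refine Submodule.span_induction ?_ (by simp) ?_ ?_ hu
  · rintro _ ⟨w, hl, rfl⟩
    exact filt_mono (by omega) (hw w)
  · intro x y _ _ hx hy
    rw [map_add, add_mul, mul_add, add_sub_add_comm]
    exact Submodule.add_mem _ hx hy
  · intro a x _ hx
    rw [map_smul, smul_mul_assoc, mul_smul_comm, ← smul_sub]
    exact Submodule.smul_mem _ _ hx

theorem slotDiff_sign_mul (e : ℕ) (y : A) :
    slotDiff M N γ Δ ((-1) ^ e * y) = (-1) ^ e * slotDiff M N γ Δ y := by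
  rcases Nat.even_or_odd e with h | h <;> simp [h.neg_one_pow]

theorem slotEntry_sign_mul (n : ℕ) (p q : Idx M N) (e : ℕ) (w : SlotAlg M N A) :
    slotEntry n p q ((-1) ^ e * w) = (-1) ^ e * slotEntry n p q w := by
  rcases Nat.even_or_odd e with h | h <;> simp [h.neg_one_pow]

theorem slotUnits_mul_slotIncl (hp : γ y = (-1) ^ p * y) (i j : Idx M N) :
    slotUnits M N A i j * slotIncl M N γ y =
      (-1) ^ (p * (par i + par j)) * (slotIncl M N γ y * slotUnits M N A i j) := by
  rw [slotUnits, Matrix.of_apply, slotUnit_mul_slotIncl hp, mul_comm p]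

/-- The leading terms of the coaction supercommute with that of a nearly central element. -/
theorem IsNearlyCentral.lead_comm_mem (hS : IsTwGen G S γ) (hΔ : IsSlotTw S γ Δ)
    (hy : IsNearlyCentral S γ p d y) (i j : Idx M N) {r : ℕ} (hr : d ≤ r) (n : ℕ) (a b : Idx M N) :
    slotEntry n a b ((∑ k, G k j • slotUnits M N A i k +
        ∑ k, (-1) ^ (r + 1 + (par k * par j + par k)) * (G i k • slotUnits M N A j k)) *
          slotDiff M N γ Δ y -
      (-1) ^ (p * (par i + par j)) * (slotDiff M N γ Δ y * (∑ k, G k j • slotUnits M N A i k +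
        ∑ k, (-1) ^ (r + 1 + (par k * par j + par k)) * (G i k • slotUnits M N A j k)))) ∈
      filt S (d - 2 - 2 * n) := by
  set U := ∑ k, G k j • slotUnits M N A i k +
    ∑ k, (-1) ^ (r + 1 + (par k * par j + par k)) * (G i k • slotUnits M N A j k) with hU
  set ε := p * (par i + par j) with hε
  set Y := slotDiff M N γ Δ y with hY
  set x := sCoeff S i j (r + 1) with hx
  have hsmul : ∀ (c : ℂ) k l, (c ≠ 0 → par k + par l = par i + par j ∨ par k + par l = par j + par i) →
      c • slotUnits M N A k l * slotIncl M N γ y =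
        (-1) ^ ε * (slotIncl M N γ y * (c • slotUnits M N A k l)) := by
    intro c k l h
    by_cases hc : c = 0
    · simp [hc]
    rw [smul_mul_assoc, slotUnits_mul_slotIncl hy.par_eq, mul_smul_comm, mul_smul_comm,
      show par k + par l = par i + par j by rcases h hc with h | h <;> omega]
  have hUy : U * slotIncl M N γ y = (-1) ^ ε * (slotIncl M N γ y * U) := by
    rw [hU, add_mul, mul_add, mul_add, Finset.sum_mul, Finset.sum_mul, Finset.mul_sum, Finset.mul_sum,
      Finset.mul_sum, Finset.mul_sum]
    congr 1 <;> refine Finset.sum_congr rfl fun k _ => ?_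
    · refine hsmul _ _ _ fun h => Or.inl ?_
      rw [show par k = par j from not_not.1 fun h' => h (hS.supersymm.isEven k j h')]
    · rw [sign_comm, mul_assoc, hsmul, sign_comm]
      intro h
      rw [show par i = par k from not_not.1 fun h' => h (hS.supersymm.isEven i k h')]
      exact Or.inr rfl
  set l := slotDiff M N γ Δ x - slotPt M N A ^ r * U with hl
  have hlm : l ∈ slotFilt S (2 * r - 1) := slotDiff_sCoeff hS hΔ i j r
  clear_value U
  have hDx : slotDiff M N γ Δ x = slotPt M N A ^ r * U + l := by rw [hl]; abel
  have hYm : Y ∈ slotFilt S (d - 1) := slotDiff_mem hS hΔ hy.mem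
  have h1 := slotDiff_mem hS hΔ (hy.comm _ x (sCoeff_succ_mem i j r))
  rw [pow_apply_of_sign (par_sCoeff hS i j (r + 1)), ← hε, sign_comm, map_sub, slotDiff_sign_mul,
    slotDiff_mul, slotDiff_mul, hDx, ← hY] at h1
  have hpt := fun w : SlotAlg M N A => ((slotPt_commute w).pow_left r).eq
  have e1 : slotPt M N A ^ r * (U * Y - (-1) ^ ε * (Y * U)) =
      ((slotPt M N A ^ r * U + l) * Y + slotIncl M N γ x * Y +
        (slotPt M N A ^ r * U + l) * slotIncl M N γ y -
      (-1) ^ ε * (Y * (slotPt M N A ^ r * U + l) + slotIncl M N γ y * (slotPt M N A ^ r * U + l) +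
        Y * slotIncl M N γ x)) - (l * Y - (-1) ^ ε * (Y * l)) -
      (slotIncl M N γ x * Y - (-1) ^ ε * (Y * slotIncl M N γ x)) -
      (l * slotIncl M N γ y - (-1) ^ ε * (slotIncl M N γ y * l)) := by
    have e2 : Y * (slotPt M N A ^ r * U) = slotPt M N A ^ r * (Y * U) := by
      rw [← mul_assoc, ← hpt, mul_assoc]
    have e3 : slotIncl M N γ y * (slotPt M N A ^ r * U) =
        slotPt M N A ^ r * (slotIncl M N γ y * U) := by rw [← mul_assoc, ← hpt, mul_assoc]
    have e4 : (slotPt M N A ^ r * U) * slotIncl M N γ y =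
        (-1) ^ ε * (slotPt M N A ^ r * (slotIncl M N γ y * U)) := by rw [mul_assoc, hUy, sign_comm]
    rw [mul_sub, sign_comm, mul_add Y, mul_add (slotIncl M N γ y), add_mul, add_mul, e2, e3, e4]
    noncomm_ring
  have e5 : slotEntry n a b (U * Y - (-1) ^ ε * (Y * U)) =
      slotEntry (n + r) a b (slotPt M N A ^ r * (U * Y - (-1) ^ ε * (Y * U))) := by
    rw [slotEntry_slotPt_pow_mul, if_pos (by omega), Nat.add_sub_cancel]
  -- Because r ≥ d, entries of `slotDiff y` and of the remainder l at aⁿ⁺ʳ would have negative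
  -- weight and so vanish; only the commutator with the leading term and products with both small
  -- factors remain.
  have hneg : ∀ {w : SlotAlg M N A} {m : ℤ}, w ∈ slotFilt S m → m - 2 * (n + r) < 0 →
      ∀ a b, slotEntry (n + r) a b w = 0 := fun hw h a b =>
    filt_neg (by push_cast; omega) (hw (n + r) a b)
  have z1 := hneg hYm (by omega)
  have z2 := hneg hlm (by omega)
  have z3 : slotEntry (n + r) a b (slotIncl M N γ x * Y - (-1) ^ ε * (Y * slotIncl M N γ x)) = 0 := by
    rw [map_sub, slotEntry_sign_mul, slotEntry_slotIncl_mul, slotEntry_mul_slotIncl, z1]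
    simp
  have z4 : slotEntry (n + r) a b (l * slotIncl M N γ y - (-1) ^ ε * (slotIncl M N γ y * l)) = 0 := by
    rw [map_sub, slotEntry_sign_mul, slotEntry_slotIncl_mul, slotEntry_mul_slotIncl, z2]
    simp
  rw [e5, e1, map_sub, map_sub, z3, z4, sub_zero, sub_zero]
  refine filt_mono ?_ (Submodule.sub_mem _ (slotFilt_mono (e := 2 * r + d - 2) (by omega) h1)
    (Submodule.sub_mem _ (slotFilt_mono (by omega) (mul_mem_slotFilt hlm hYm)) ?_) (n + r) a b)
  · push_cast; omega
  · rcases neg_one_pow_eq_or (SlotAlg M N A) ε with h | h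
    · rw [h, one_mul]; exact slotFilt_mono (by omega) (mul_mem_slotFilt hYm hlm)
    · rw [h, neg_one_mul, Submodule.neg_mem_iff]
      exact slotFilt_mono (by omega) (mul_mem_slotFilt hYm hlm)

/-- The leading terms of all generators together span the operators of gl_{M|N} on V, so `slotDiff
y` supercommutes with these operators up to lower weight. -/
theorem IsNearlyCentral.units_comm_mem (hS : IsTwGen G S γ) (hΔ : IsSlotTw S γ Δ)
    (hy : IsNearlyCentral S γ p d y) (i c : Idx M N) (n : ℕ) (a b : Idx M N) :
    slotEntry n a b (slotUnits M N A i c * slotDiff M N γ Δ y -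
      (-1) ^ (p * (par i + par c)) * (slotDiff M N γ Δ y * slotUnits M N A i c)) ∈
      filt S (d - 2 - 2 * n) := by
  set Y := slotDiff M N γ Δ y with hY
  have h1 : ∀ j, slotEntry n a b ((∑ k, G k j • slotUnits M N A i k) * Y -
      (-1) ^ (p * (par i + par j)) * (Y * (∑ k, G k j • slotUnits M N A i k))) ∈
      filt S (d - 2 - 2 * n) := by
    intro j
    -- Two consecutive values of r give opposite signs to the second half of the leading term;
    -- averaging retains the first half.
    have h2 := Submodule.smul_mem _ (1 / 2 : ℂ) (Submodule.add_mem _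
      (hy.lead_comm_mem hS hΔ i j (r := d.toNat) (by omega) n a b)
      (hy.lead_comm_mem hS hΔ i j (r := d.toNat + 1) (by push_cast; omega) n a b))
    rw [← map_add, ← map_smul] at h2
    convert h2 using 2
    have e : ∀ k, (-1 : SlotAlg M N A) ^ (d.toNat + 1 + 1 + (par k * par j + par k)) *
        (G i k • slotUnits M N A j k) = -((-1) ^ (d.toNat + 1 + (par k * par j + par k)) *
        (G i k • slotUnits M N A j k)) := fun k => by
      rw [add_right_comm, pow_succ, mul_neg_one, neg_mul]
    simp only [e, Finset.sum_neg_distrib]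
    generalize ∑ k, G k j • slotUnits M N A i k = U
    generalize ∑ k, (-1) ^ (d.toNat + 1 + (par k * par j + par k)) * (G i k • slotUnits M N A j k) = V
    rcases neg_one_pow_eq_or (SlotAlg M N A) (p * (par i + par j)) with h | h <;> rw [h] <;>
      simp only [add_mul, mul_add, neg_mul, mul_neg, one_mul] <;> module
  -- Multiplication by G⁻¹ extracts a single operator from the combination.
  have h3 := Submodule.sum_mem (t := Finset.univ) _ fun j _ => Submodule.smul_mem _ (G⁻¹ j c) (h1 j)
  have e1 : ∀ j, (G⁻¹ j c) • slotEntry n a b ((∑ k, G k j • slotUnits M N A i k) * Y -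
      (-1) ^ (p * (par i + par j)) * (Y * (∑ k, G k j • slotUnits M N A i k))) =
      slotEntry n a b ((G⁻¹ j c • ∑ k, G k j • slotUnits M N A i k) * Y -
      (-1) ^ (p * (par i + par c)) * (Y * (G⁻¹ j c • ∑ k, G k j • slotUnits M N A i k))) := by
    intro j
    by_cases h : par j = par c
    · rw [← map_smul, smul_sub, smul_mul_assoc, mul_smul_comm, mul_smul_comm, h]
    · rw [hS.supersymm.isEven.inv j c h]; simp
  simp only [e1] at h3
  rw [← map_sum, Finset.sum_sub_distrib, ← Finset.sum_mul, ← Finset.mul_sum, ← Finset.mul_sum] at h3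
  convert h3 using 3 <;> [skip; congr 2] <;>
  · simp only [Finset.smul_sum, smul_smul]
    rw [Finset.sum_comm]
    simp only [← Finset.sum_smul, mul_comm (G⁻¹ _ _), ← Matrix.mul_apply,
      Matrix.mul_nonsing_inv _ hS.supersymm.nondegenerate, Matrix.one_apply, ite_smul, one_smul,
      zero_smul, Finset.sum_ite_eq', Finset.mem_univ, if_true]

/-- Supercommuting with every matrix unit forces a matrix to be scalar up to parity signs. The
off-diagonal and diagonal consequences are `offDiag_mem` and `diag_mem`. -/
theorem IsNearlyCentral.entry_mem (hS : IsTwGen G S γ) (hΔ : IsSlotTw S γ Δ)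
    (hy : IsNearlyCentral S γ p d y) (i c : Idx M N) (n : ℕ) (a b : Idx M N) :
    (if a = c then slotEntry n i b (slotDiff M N γ Δ y) else 0) - (-1) ^ (p * (par i + par c)) *
      (if b = i then slotEntry n a c (slotDiff M N γ Δ y) else 0) ∈ filt S (d - 2 - 2 * n) := by
  have h := hy.units_comm_mem hS hΔ i c n a b
  rw [map_sub, slotEntry_sign_mul, slotUnits, Matrix.of_apply, slotEntry_slotC_mul,
    slotEntry_mul_slotC, slotUnit] at h
  rw [← sign_mul_mem (par i * par c), ← Submodule.neg_mem_iff]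
  convert h using 1
  have e1 : ∑ m, Matrix.single c i (-(-1 : A) ^ (par i * par c)) a m *
      slotEntry n m b (slotDiff M N γ Δ y) = -(-1) ^ (par i * par c) *
        (if a = c then slotEntry n i b (slotDiff M N γ Δ y) else 0) := by
    rw [Finset.sum_eq_single i]
    · by_cases h : a = c
      · subst h; simp
      · simp [h, Ne.symm h]
    · intro m _ hm
      simp [Ne.symm hm]
    · simp
  have e2 : ∑ m, slotEntry n a m (slotDiff M N γ Δ y) *
      Matrix.single c i (-(-1 : A) ^ (par i * par c)) m b = -(-1) ^ (par i * par c) *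
        (if b = i then slotEntry n a c (slotDiff M N γ Δ y) else 0) := by
    rw [Finset.sum_eq_single c]
    · by_cases h : b = i
      · subst h
        rcases neg_one_pow_eq_or A (par b * par c) with h | h <;> simp [h]
      · simp [h, Ne.symm h]
    · intro m _ hm
      simp [Ne.symm hm]
    · simp
  rw [e1, e2]
  rcases neg_one_pow_eq_or A (par i * par c) with h | h <;>
    rcases neg_one_pow_eq_or A (p * (par i + par c)) with h' | h' <;> rw [h, h'] <;> noncomm_ring

theorem IsNearlyCentral.offDiag_mem (hS : IsTwGen G S γ) (hΔ : IsSlotTw S γ Δ)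
    (hy : IsNearlyCentral S γ p d y) (n : ℕ) {a b : Idx M N} (hab : a ≠ b) :
    slotEntry n a b (slotDiff M N γ Δ y) ∈ filt S (d - 2 - 2 * n) := by
  simpa [Ne.symm hab] using hy.entry_mem hS hΔ a a n a b

theorem IsNearlyCentral.diag_mem (hS : IsTwGen G S γ) (hΔ : IsSlotTw S γ Δ)
    (hy : IsNearlyCentral S γ p d y) (n : ℕ) (a b : Idx M N) :
    slotEntry n a a (slotDiff M N γ Δ y) - (-1) ^ (p * (par a + par b)) *
      slotEntry n b b (slotDiff M N γ Δ y) ∈ filt S (d - 2 - 2 * n) := by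
  simpa using hy.entry_mem hS hΔ a b n b a

end NearlyCentral

/-! ### The center is generated by the coefficients of ζ(u) -/

section Center

variable {M N : ℕ} {A : Type*} [Ring A] [Algebra ℂ A]
  {S : Matrix (Idx M N) (Idx M N) (PowerSeries A)} {G : Matrix (Idx M N) (Idx M N) ℂ}
  {γ : A →ₐ[ℂ] A} {Δ : A →ₐ[ℂ] SlotAlg M N A} {p : ℕ} {d : ℤ} {y : A} {ζ : PowerSeries A}

theorem slotEntry_slotDiff_pow_par (hS : IsTwGen G S γ) (hΔ : IsSlotTw S γ Δ) (n m : ℕ) (a : Idx M N)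
    (x : A) : slotEntry n a a (slotDiff M N γ Δ ((γ ^ m) x)) =
      (γ ^ m) (slotEntry n a a (slotDiff M N γ Δ x)) := by
  induction m with
  | zero => simp
  | succ m ih => rw [pow_succ', AlgHom.mul_apply, slotEntry_slotDiff_par hS hΔ, ih, AlgHom.mul_apply]

/-- Apply `slotDiff` to the supercommutator of x with y and read off a diagonal entry. All other
contributions are of low weight, so the entries of `slotDiff y` inherit the property and serve the
induction on the weight. -/
theorem IsNearlyCentral.slotEntry (hS : IsTwGen G S γ) (hΔ : IsSlotTw S γ Δ)
    (hy : IsNearlyCentral S γ p d y) (n : ℕ) (a : Idx M N) :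
    IsNearlyCentral S γ p (d - 1 - 2 * n) (slotEntry n a a (slotDiff M N γ Δ y)) := by
  have hYm : slotDiff M N γ Δ y ∈ slotFilt S (d - 1) := slotDiff_mem hS hΔ hy.mem
  have hYp : ∀ k, γ (SuperYangian.slotEntry k a a (slotDiff M N γ Δ y)) =
      (-1) ^ p * SuperYangian.slotEntry k a a (slotDiff M N γ Δ y) := fun k => by
    rw [← slotEntry_slotDiff_par hS hΔ, hy.par_eq, slotDiff_sign_mul, slotEntry_sign_mul]
  refine ⟨hYm n a a, hYp n, fun e x₀ hx₀ => ?_⟩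
  -- The twist cancels the power of γ with which `slotIncl` acts at position a.
  set x := (γ ^ par a) x₀ with hx
  have hxm : x ∈ filt S e := par_pow_mem hS hx₀ _
  have hx1 : (γ ^ par a) x = x₀ := pow_par_pow_par hS a x₀
  have hx2 : (γ ^ par a) ((γ ^ p) x) = (γ ^ p) x₀ := by
    rw [← AlgHom.mul_apply, (Commute.pow_pow_self γ _ _).eq, AlgHom.mul_apply, hx1]
  set Y := slotDiff M N γ Δ y with hY
  set X := slotDiff M N γ Δ x with hX
  set X' := slotDiff M N γ Δ ((γ ^ p) x) with hX'
  have hXm : X ∈ slotFilt S (e - 1) := slotDiff_mem hS hΔ hxm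
  have hXm' : X' ∈ slotFilt S (e - 1) := slotDiff_mem hS hΔ (par_pow_mem hS hxm p)
  have hXX' : ∀ k, SuperYangian.slotEntry k a a X' = (γ ^ p) (SuperYangian.slotEntry k a a X) :=
    fun k => slotEntry_slotDiff_pow_par hS hΔ k p a x
  have h1 := slotDiff_mem hS hΔ (hy.comm e x hxm) n a a
  rw [map_sub, slotDiff_mul, slotDiff_mul, ← hY, ← hX, ← hX', map_sub, map_add, map_add, map_add,
    map_add, slotEntry_slotIncl_mul, slotEntry_slotIncl_mul, slotEntry_mul_slotIncl,
    slotEntry_mul_slotIncl, hx1, hx2] at h1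
  have h2 : SuperYangian.slotEntry n a a (X * Y) - SuperYangian.slotEntry n a a (Y * X') ∈
      filt S (e + (d - 1 - 2 * n) - 2) := by
    rw [slotEntry_mul, slotEntry_mul, ← Finset.Nat.sum_antidiagonal_swap (n := n),
      ← Finset.sum_sub_distrib]
    refine Submodule.sum_mem _ fun k hk => ?_
    have hk := Finset.HasAntidiagonal.mem_antidiagonal.1 hk
    rw [← Finset.sum_sub_distrib]
    refine Submodule.sum_mem _ fun b _ => ?_
    rw [Prod.fst_swap, Prod.snd_swap]
    -- The diagonal term is an ordinary supercommutator, lowering the weight by one more; the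
    -- off-diagonal terms are already small by `offDiag_mem`.
    by_cases hb : b = a
    · rw [hb, hXX']
      exact filt_mono (by omega) (mul_sub_mul_mem hS (hYm k.1 a a) (hYp k.1) (hXm k.2 a a))
    · exact filt_mono (by omega) (Submodule.sub_mem _
        (filt_mono (e := e - 1 + (d - 2) - 2 * n) (by omega)
          (mul_mem_filt (hXm k.2 a b) (hy.offDiag_mem hS hΔ k.1 hb)))
        (filt_mono (by omega) (mul_mem_filt (hy.offDiag_mem hS hΔ k.1 (Ne.symm hb)) (hXm' k.2 b a))))
  have h3 : SuperYangian.slotEntry n a a X * (γ ^ par a) y -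
      (γ ^ par a) y * SuperYangian.slotEntry n a a X' ∈ filt S (e + (d - 1 - 2 * n) - 2) := by
    rw [pow_apply_of_sign hy.par_eq, hXX', sign_comm, mul_assoc, ← mul_sub, sign_mul_mem]
    exact filt_mono (by omega) (hy.comm _ _ (hXm n a a))
  convert Submodule.sub_mem _ (Submodule.sub_mem _
    (filt_mono (e := e + (d - 1 - 2 * n) - 2) (by omega) h1) h2) h3 using 1
  abel

/-- As `slotDiff y` is scalar modulo low weight, its contraction involves only the trace of the dual
generators, multiplied by the common diagonal entry. -/
theorem IsNearlyCentral.euler_sub_mem (hS : IsTwGen G S γ) (hΔ : IsSlotTw S γ Δ)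
    (hy : IsNearlyCentral S γ p d y) (K : ℕ) (i : Idx M N) :
    euler S G γ Δ K y - (1 / 2 : ℂ) • ∑ n ∈ Finset.range K, trGen S G n *
      ((-1) ^ (p * par i) * SuperYangian.slotEntry n i i (slotDiff M N γ Δ y)) ∈ filt S (d - 1) := by
  rw [euler, LinearMap.comp_apply, contract_apply, ← smul_sub, ← Finset.sum_sub_distrib]
  refine Submodule.smul_mem _ _ (Submodule.sum_mem _ fun n _ => ?_)
  rw [trGen, Finset.sum_mul, ← Finset.sum_sub_distrib]
  refine Submodule.sum_mem _ fun a _ => ?_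
  rw [← Finset.add_sum_erase _ _ (Finset.mem_univ a), add_sub_right_comm, ← mul_sub]
  refine Submodule.add_mem _ ?_ (Submodule.sum_mem _ fun b hb => ?_)
  · refine filt_mono ?_ (mul_mem_filt (dualGen_mem a a n) (e := d - 2 - 2 * n) ?_)
    · omega
    rw [pow_apply_of_sign (hy.slotEntry hS hΔ n a).par_eq, ← sign_mul_mem (p * par a), mul_sub,
      mul_comm (par a), neg_one_pow_mul_self, ← mul_assoc, ← pow_add, ← mul_add]
    exact hy.diag_mem hS hΔ n a i
  · exact filt_mono (by omega) (mul_mem_filt (dualGen_mem a b n)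
      (par_pow_mem hS (hy.offDiag_mem hS hΔ n (Finset.ne_of_mem_erase hb).symm) _))

/-- Nearly central elements agree with polynomials in the central series up to lower weight. -/
theorem IsNearlyCentral.exists_sub_mem (hS : IsTwGen G S γ) (hΔ : IsSlotTw S γ Δ) (i : Idx M N)
    {Z : Subalgebra ℂ A} (hZ : ∀ n, coeff n ζ ∈ Z) (hZc : ∀ z ∈ Z, ∀ y, Commute z y)
    (hZγ : ∀ z ∈ Z, γ z = z)
    (hζ : ∀ n : ℕ, coeff (n + 2) ζ - (((n : ℂ) + 1) * (1 - (-1) ^ n) / 2) • trGen S G n ∈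
      filt S (2 * n)) (d : ℕ) (hy : IsNearlyCentral S γ p d y) :
    ∃ z ∈ Z, z ∈ filt S d ∧ y - z ∈ filt S (d - 1) := by
  induction d using Nat.strong_induction_on generalizing p y with
  | _ d ih =>
  rcases Nat.eq_zero_or_pos d with rfl | hd
  · obtain ⟨c, rfl⟩ := mem_filt_zero hy.mem
    exact ⟨_, Z.algebraMap_mem c, algebraMap_mem_filt c, by rw [sub_self]; exact Submodule.zero_mem _⟩
  -- W consists of the elements of the desired form; the aim is to show first that `euler y` lies in
  -- it, and to recover y by `mem_of_euler_mem`.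
  set W : Submodule ℂ A := (Subalgebra.toSubmodule Z ⊓ filt S d) ⊔ filt S (d - 1) with hW
  have hle : filt S (d - 1) ≤ W := le_sup_right
  have key : ∀ {p : ℕ} {y : A}, IsNearlyCentral S γ p d y → euler S G γ Δ d y ∈ W := by
    intro p y hy
    have h1 := hle (hy.euler_sub_mem hS hΔ d i)
    rw [Submodule.sub_mem_iff_left] at h1
    · exact h1
    refine Submodule.smul_mem _ _ (Submodule.sum_mem _ fun n _ => ?_)
    have hc := (hy.slotEntry hS hΔ n i).sign_mul (p * par i)
    set c := (-1) ^ (p * par i) * SuperYangian.slotEntry n i i (slotDiff M N γ Δ y) with hcdef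
    by_cases hn : (d : ℤ) - 1 - 2 * n < 0
    · rw [filt_neg hn hc.mem, mul_zero]; exact Submodule.zero_mem _
    obtain ⟨z, hz, hzm, hcz⟩ := ih (d - 1 - 2 * n) (by omega) (p := p) (y := c)
      (by convert hc using 1; omega)
    have hzm' : z ∈ filt S (d - 1 - 2 * n) := filt_mono (by omega) hzm
    rw [← sub_add_cancel c z, mul_add]
    refine Submodule.add_mem _ (hle (filt_mono ?_ (mul_mem_filt (trGen_mem n) hcz))) ?_
    · omega
    -- For even n the trace has lower weight. For odd n it is ζ^{(n+2)}/(n + 1) modulo lower weight,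
    -- so its product with z is again in Z up to lower weight.
    rcases Nat.even_or_odd n with he | ho
    · exact hle (filt_mono (by omega) (mul_mem_filt (trGen_mem_of_even hS he) hzm'))
    · have h2 := hζ n
      rw [ho.neg_one_pow, show ((n : ℂ) + 1) * (1 - -1) / 2 = n + 1 by ring] at h2
      have hn1 : (n : ℂ) + 1 ≠ 0 := by exact_mod_cast n.succ_ne_zero
      have h3 : trGen S G n * z = ((n : ℂ) + 1)⁻¹ • (coeff (n + 2) ζ * z) -
          ((n : ℂ) + 1)⁻¹ • ((coeff (n + 2) ζ - ((n : ℂ) + 1) • trGen S G n) * z) := by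
        rw [sub_mul, smul_sub, smul_mul_assoc, smul_smul, inv_mul_cancel₀ hn1, one_smul, sub_sub_cancel]
      have h4 : coeff (n + 2) ζ ∈ filt S (2 * n + 1) := by
        have := Submodule.add_mem _ (filt_mono (by omega) h2)
          (Submodule.smul_mem _ ((n : ℂ) + 1) (trGen_mem (S := S) (G := G) n))
        rwa [sub_add_cancel] at this
      rw [h3]
      refine Submodule.sub_mem _ (Submodule.smul_mem _ _ (Submodule.mem_sup_left ⟨?_, ?_⟩))
        (Submodule.smul_mem _ _ (hle (filt_mono ?_ (mul_mem_filt h2 hzm'))))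
      · exact Z.mul_mem (hZ _) hz
      · exact filt_mono (by omega) (mul_mem_filt h4 hzm')
      · omega
  obtain ⟨m, rfl⟩ : ∃ m, d = m + 1 := ⟨d - 1, by omega⟩
  have hyW : y ∈ W := by
    refine mem_of_euler_mem hS hΔ (fun w hw => ?_) ((filt_mono (by push_cast; omega)).trans hle) hy.mem
      (key hy)
    obtain ⟨z, ⟨hz, hzm⟩, x, hx, rfl⟩ := Submodule.mem_sup.1 hw
    rw [map_add]
    -- W is stable under `euler` because the elements of Z are even and central, hence nearly
    -- central, so `key` applies to them too.
    refine Submodule.add_mem _ (key (p := 0) ⟨hzm, by rw [hZγ z hz, pow_zero, one_mul], fun e x _ => ?_⟩)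
      (hle (euler_mem hS hΔ _ hx))
    rw [pow_zero, AlgHom.one_apply, (hZc z hz x).eq, sub_self]
    exact Submodule.zero_mem _
  obtain ⟨z, ⟨hz, hzm⟩, x, hx, rfl⟩ := Submodule.mem_sup.1 hyW
  exact ⟨z, hz, hzm, by rwa [add_sub_cancel_left]⟩

/-- Supercentral elements are polynomials in the coefficients of the central series. -/
theorem mem_of_supercentral (hS : IsTwGen G S γ) (hΔ : IsSlotTw S γ Δ) (i : Idx M N)
    {Z : Subalgebra ℂ A} (hZ : ∀ n, coeff n ζ ∈ Z) (hZc : ∀ z ∈ Z, ∀ y, Commute z y)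
    (hZγ : ∀ z ∈ Z, γ z = z)
    (hζ : ∀ n : ℕ, coeff (n + 2) ζ - (((n : ℂ) + 1) * (1 - (-1) ^ n) / 2) • trGen S G n ∈
      filt S (2 * n)) (hy : γ y = (-1) ^ p * y) (hyc : ∀ x, x * y = y * (γ ^ p) x) : y ∈ Z := by
  obtain ⟨d, hd⟩ := exists_mem_filt hS y
  induction d using Nat.strong_induction_on generalizing y with
  | _ d ih =>
  have hnc : IsNearlyCentral S γ p d y := ⟨hd, hy, fun e x _ => by
    rw [hyc, sub_self]; exact Submodule.zero_mem _⟩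
  obtain ⟨z, hz, hzm, hyz⟩ := hnc.exists_sub_mem hS hΔ i hZ hZc hZγ hζ
  have lower : ∀ {w : A}, γ w = (-1) ^ p * w → (∀ x, x * w = w * (γ ^ p) x) →
      w ∈ filt S (d - 1) → w ∈ Z := by
    intro w h1 h2 h3
    rcases Nat.eq_zero_or_pos d with rfl | hd
    · rw [filt_neg (by norm_num) h3]; exact Z.zero_mem
    · exact ih (d - 1) (by omega) h1 h2 (filt_mono (by omega) h3)
  rcases Nat.even_or_odd p with he | ho
  · have hp : γ ^ p = 1 := by
      obtain ⟨k, rfl⟩ := he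
      rw [← two_mul, pow_mul, show γ ^ 2 = 1 from AlgHom.ext fun x => by
        rw [pow_two, AlgHom.mul_apply, hS.par_par]; rfl, one_pow]
    rw [← sub_add_cancel y z]
    refine Z.add_mem (lower ?_ (fun x => ?_) hyz) hz
    · rw [he.neg_one_pow, one_mul] at hy ⊢
      rw [map_sub, hy, hZγ z hz]
    · rw [mul_sub, sub_mul, hyc, hp, AlgHom.one_apply, (hZc z hz x).eq]
  · refine lower hy hyc ?_
    -- The approximation z is even whereas y is odd, so taking odd parts shows that y itself is of
    -- lower weight.
    have h1 := Submodule.smul_mem _ (1 / 2 : ℂ) (Submodule.sub_mem _ hyz (par_mem hS hyz))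
    convert h1 using 1
    rw [map_sub, hZγ z hz, hy, ho.neg_one_pow, neg_one_mul]
    module

end Center

/-! ### A difference equation -/

section Difference

variable {A : Type*} [Ring A] [Algebra ℂ A] {ζ : PowerSeries A} {c : ℂ}

theorem coeff_shiftedInv_pow (c : ℂ) (m : ℕ) :
    coeff m (shiftedInv c ^ m) = 1 ∧
      coeff (m + 1) (shiftedInv c ^ m) = -(c * m) := by
  set v := (1 + PowerSeries.C c * PowerSeries.X : PowerSeries ℂ)⁻¹ with hv
  have h0 : constantCoeff (1 + PowerSeries.C c * PowerSeries.X : PowerSeries ℂ) = 1 := by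
    simp
  have hv0 : constantCoeff v = 1 := by
    rw [hv, PowerSeries.constantCoeff_inv, h0, inv_one]
  have hv1 : coeff 1 v = -c := by
    have h := congrArg (coeff 1)
      (PowerSeries.inv_mul_cancel (1 + PowerSeries.C c * PowerSeries.X : PowerSeries ℂ) (by simp))
    rw [← hv, mul_add, mul_one, mul_comm (PowerSeries.C c), ← mul_assoc, map_add,
      PowerSeries.coeff_mul_C, PowerSeries.coeff_succ_mul_X, coeff_one, if_neg one_ne_zero,
      coeff_zero_eq_constantCoeff_apply, hv0] at h
    linear_combination h
  have e : shiftedInv c ^ m = PowerSeries.X ^ m * v ^ m := mul_pow _ _ _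
  have e0 := PowerSeries.coeff_X_pow_mul (v ^ m) m 0
  have e1 := PowerSeries.coeff_X_pow_mul (v ^ m) m 1
  rw [zero_add, coeff_zero_eq_constantCoeff_apply, map_pow, hv0, one_pow] at e0
  rw [PowerSeries.coeff_one_pow, hv1, hv0, one_pow, mul_one, add_comm 1] at e1
  exact ⟨e ▸ e0, by rw [e, e1]; ring⟩

/-- As ζ = 1 + O(u⁻²), the coefficient of f at n + 2 cancels and the one at n + 1 enters only
through the shift, with factor -c (n + 1). Hence the equation f(u + c) = ζ(u) f(u) is a recursion
determining f from its constant term. -/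
theorem coeff_shiftArg_sub (h0 : coeff 0 ζ = 1) (h1 : coeff 1 ζ = 0)
    (f : PowerSeries A) (n : ℕ) : coeff (n + 2) (shiftArg c f - ζ * f) =
      ∑ k ∈ Finset.range (n + 1), (coeff (n + 2) (shiftedInv c ^ k) •
        coeff k f - coeff (n + 2 - k) ζ * coeff k f) -
      (c * (n + 1 : ℕ)) • coeff (n + 1) f := by
  rw [map_sub, shiftArg, substInv, coeff_mk, Finset.sum_range_succ, Finset.sum_range_succ,
    (coeff_shiftedInv_pow c (n + 2)).1, (coeff_shiftedInv_pow c (n + 1)).2, coeff_mul,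
    ← Finset.Nat.sum_antidiagonal_swap, Finset.Nat.sum_antidiagonal_eq_sum_range_succ_mk,
    Finset.sum_range_succ _ (n + 2), Finset.sum_range_succ _ (n + 1), Finset.sum_sub_distrib]
  simp only [Prod.fst_swap, Prod.snd_swap]
  rw [show n + 2 - (n + 1) = 1 by omega, Nat.sub_self, h0, h1]
  simp only [one_mul, zero_mul, add_zero]
  module

theorem eq_of_shiftArg (hc : c ≠ 0) (h0 : coeff 0 ζ = 1) (h1 : coeff 1 ζ = 0)
    {f g : PowerSeries A} (hf : shiftArg c f = ζ * f) (hg : shiftArg c g = ζ * g)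
    (h : coeff 0 f = coeff 0 g) : f = g := by
  rw [← sub_eq_zero]
  have e : shiftArg c (f - g) - ζ * (f - g) = 0 := by
    rw [← shiftHom_apply, map_sub, shiftHom_apply, shiftHom_apply, hf, hg, mul_sub, sub_self]
  ext n
  induction n using Nat.strong_induction_on with
  | _ n ih =>
  rcases n with _ | n
  · rw [map_sub, h, sub_self, map_zero]
  · have h2 := coeff_shiftArg_sub (c := c) h0 h1 (f - g) n
    rw [e, map_zero, Finset.sum_eq_zero fun k hk => by
      rw [ih k (Finset.mem_range.1 hk), map_zero, smul_zero, mul_zero, sub_zero], zero_sub, eq_comm,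
      neg_eq_zero, smul_eq_zero] at h2
    rw [map_zero]
    exact h2.resolve_left (mul_ne_zero hc (Nat.cast_ne_zero.2 n.succ_ne_zero))

/-- The coefficients of the solution of `f(u + c) = ζ(u) f(u)`. -/
def rootCoeff (c : ℂ) (ζ : PowerSeries A) : ℕ → A
  | 0 => 1
  | n + 1 => (c * (n + 1 : ℕ))⁻¹ • ∑ k : Fin (n + 1), (coeff (n + 2) (shiftedInv c ^ k.1) •
      rootCoeff c ζ k.1 - coeff (n + 2 - k.1) ζ * rootCoeff c ζ k.1)
  decreasing_by all_goals exact k.2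

theorem shiftArg_rootCoeff (hc : c ≠ 0) (h0 : coeff 0 ζ = 1)
    (h1 : coeff 1 ζ = 0) :
    shiftArg c (PowerSeries.mk (rootCoeff c ζ)) = ζ * PowerSeries.mk (rootCoeff c ζ) := by
  rw [← sub_eq_zero]
  ext n
  rw [map_zero]
  rcases n with _ | _ | n
  · rw [map_sub, shiftArg, substInv]
    rw [coeff_zero_eq_constantCoeff_apply] at h0
    simp [h0]
  · rw [coeff_zero_eq_constantCoeff_apply] at h0
    rw [map_sub, zero_add, coeff_one_mul', coeff_one_shiftArg, h0, h1, one_mul, zero_mul]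
    simp
  · rw [coeff_shiftArg_sub h0 h1]
    simp only [coeff_mk]
    rw [rootCoeff, smul_smul, mul_inv_cancel₀ (mul_ne_zero hc (Nat.cast_ne_zero.2 n.succ_ne_zero)),
      one_smul, Finset.sum_range, sub_self]

/-- In terms of f(u - c) the symmetric equation is the previous one with the shift 2c. -/
theorem eq_of_half_shift (hc : c ≠ 0) (h0 : coeff 0 ζ = 1)
    (h1 : coeff 1 ζ = 0) {f g : PowerSeries A} (hf : shiftArg c f = ζ * shiftArg (-c) f)
    (hg : shiftArg c g = ζ * shiftArg (-c) g)
    (h : constantCoeff f = constantCoeff g) : f = g := by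
  have key : ∀ {x}, shiftArg c x = ζ * shiftArg (-c) x →
      shiftArg (c + c) (shiftArg (-c) x) = ζ * shiftArg (-c) x := fun {x} h => by
    rw [shiftArg_shiftArg, ← h, add_neg_cancel_right]
  have h4 := eq_of_shiftArg (by rw [← two_mul]; exact mul_ne_zero two_ne_zero hc) h0 h1 (key hf)
    (key hg) (by
      rw [coeff_zero_eq_constantCoeff_apply, coeff_zero_eq_constantCoeff_apply]
      exact (constantCoeff_substInv _ _).trans (h.trans (constantCoeff_substInv _ _).symm))
  have h5 := congrArg (shiftArg c) h4
  rwa [shiftArg_shiftArg, shiftArg_shiftArg, add_neg_cancel, shiftArg_zero, shiftArg_zero] at h5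

/-- The symmetric form of the equation is invariant under u ↦ -u because ζ(u) ζ(-u) = 1; so d(-u) is
another solution with the same constant term, and d is even by uniqueness. -/
theorem exists_root (hc : c ≠ 0) (h0 : coeff 0 ζ = 1) (h1 : coeff 1 ζ = 0)
    (hζ : ζ * negArg ζ = 1) : ∃ d g : PowerSeries A, constantCoeff d = 1 ∧ d * g = 1 ∧ g * d = 1 ∧
      shiftArg c d = ζ * shiftArg (-c) d ∧ negArg d = d := by
  have hcc : c + c ≠ 0 := by rw [← two_mul]; exact mul_ne_zero two_ne_zero hc
  set e := PowerSeries.mk (rootCoeff (c + c) ζ) with he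
  set d := shiftArg c e with hd
  have d0 : constantCoeff d = 1 := by
    rw [hd, shiftArg, constantCoeff_substInv, he, ← coeff_zero_eq_constantCoeff_apply,
      coeff_mk, rootCoeff]
  have hde : shiftArg (-c) d = e := by rw [hd, shiftArg_shiftArg, neg_add_cancel, shiftArg_zero]
  have h2 : shiftArg c d = ζ * shiftArg (-c) d := by
    rw [hde, hd, shiftArg_shiftArg, shiftArg_rootCoeff hcc h0 h1]
  clear_value d
  obtain ⟨u, hu⟩ : IsUnit d := PowerSeries.isUnit_iff_constantCoeff.2 (by rw [d0]; exact isUnit_one)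
  refine ⟨d, u⁻¹.1, d0, by rw [← hu, u.mul_inv], by rw [← hu, u.inv_mul], h2, ?_⟩
  have h3 : shiftArg c (negArg d) = ζ * shiftArg (-c) (negArg d) := by
    have := congrArg negHom h2
    rw [map_mul, negHom_apply, negHom_apply, negHom_apply, negArg_shiftArg, negArg_shiftArg,
      neg_neg] at this
    rw [this, ← mul_assoc, hζ, one_mul]
  exact eq_of_half_shift hc h0 h1 h3 h2 (constantCoeff_substInv _ _)

end Difference

/-! ### Scalings -/

section Scaling

variable {M N : ℕ} {G : Matrix (Idx M N) (Idx M N) ℂ} {R : Type*} [Ring R] [Algebra ℂ R]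
  {ζ d g : PowerSeries (YTw G)}

theorem halfShift_ne_zero (hne : M ≠ N) : halfShift M N ≠ 0 :=
  div_ne_zero (sub_ne_zero_of_ne hne) two_ne_zero

theorem exists_scaled_hom (hG : IsSupersymmetric G) (χ : YTw G →ₐ[ℂ] R) {f : PowerSeries R}
    (hf : negArg f = f) (f0 : constantCoeff f = 1)
    (hc : ∀ n y, Commute (coeff n f) y) : ∃ ψ : YTw G →ₐ[ℂ] R,
      (sStd G).map (PowerSeries.map (ψ : YTw G →+* R)) =
        ((sStd G).map (PowerSeries.map (χ : YTw G →+* R))).map (f * ·) := by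
  refine exists_ytw_hom_of_constantCoeff hG _ ((isTwSeries_sStd.map χ).scale hf
    (fun m n i j => hc m _) fun m n => hc m _) (Matrix.ext fun i j => ?_)
  have h := congrFun (congrFun (sStd_map_constantCoeff hG) i) j
  rw [Matrix.map_apply, Matrix.map_apply] at h
  rw [Matrix.map_apply, Matrix.map_apply, Matrix.map_apply, map_mul, f0, one_mul,
    ← coeff_zero_eq_constantCoeff_apply, coeff_map,
    coeff_zero_eq_constantCoeff_apply, h]
  exact χ.commutes _

/-- A central series `ζ(u) = d(u + h) / d(u - h)` for `h = (M - N) / 2`, with the inverse `g` of `d`. -/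
structure CentralRoot (ζ d g : PowerSeries (YTw G)) : Prop where
  zeta : IsZeta (sStd G) ζ
  zero : coeff 0 ζ = 1
  one : coeff 1 ζ = 0
  d_zero : constantCoeff d = 1
  mul_inv : d * g = 1
  inv_mul : g * d = 1
  shift : shiftArg (halfShift M N) d = ζ * shiftArg (-halfShift M N) d
  neg_d : negArg d = d
  comm_d : ∀ n y, Commute (coeff n d) y
  comm_g : ∀ n y, Commute (coeff n g) y

theorem CentralRoot.neg_g (h : CentralRoot ζ d g) : negArg g = g := by
  have h1 := congrArg negHom h.mul_inv
  rw [map_mul, map_one, negHom_apply, negHom_apply, h.neg_d] at h1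
  calc negArg g = g * (d * negArg g) := by rw [← mul_assoc, h.inv_mul, one_mul]
    _ = g := by rw [h1, mul_one]

theorem CentralRoot.g_zero (h : CentralRoot ζ d g) : constantCoeff g = 1 := by
  have h1 := congrArg constantCoeff h.mul_inv
  rwa [map_mul, h.d_zero, one_mul, map_one] at h1

theorem CentralRoot.zeta_eq (h : CentralRoot ζ d g) :
    ζ = shiftArg (halfShift M N) d * shiftArg (-halfShift M N) g := by
  rw [h.shift, mul_assoc, ← shiftHom_apply, ← shiftHom_apply, ← map_mul, h.mul_inv, map_one, mul_one]

theorem commute_of_central {f : PowerSeries R} (h : ∀ n y, Commute (coeff n f) y)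
    (x : PowerSeries R) : Commute f x := commute_of_coeff fun m _ => h m _

/-- By `IsZeta.scale` and uniqueness, ψ(ζ) is χ(ζ) f(u + h)/f(u - h), where h is `halfShift M N`.
Then ψ(d) and f χ(d) solve the same difference equation with the same constant term. -/
theorem CentralRoot.map_d (h : CentralRoot ζ d g) (hne : M ≠ N) (i : Idx M N)
    {χ ψ : YTw G →ₐ[ℂ] R} {f k : PowerSeries R} (hfk : f * k = 1) (hkf : k * f = 1)
    (hk : negArg k = k) (f0 : constantCoeff f = 1)
    (hf : ∀ n y, Commute (coeff n f) y) (hkc : ∀ n y, Commute (coeff n k) y)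
    (hψ : (sStd G).map (PowerSeries.map (ψ : YTw G →+* R)) =
        ((sStd G).map (PowerSeries.map (χ : YTw G →+* R))).map (f * ·)) :
    PowerSeries.map (ψ : YTw G →+* R) d = f * PowerSeries.map (χ : YTw G →+* R) d := by
  have cf : ∀ c x, Commute (shiftArg c f) x := fun c =>
    commute_of_central (commute_coeff_substInv hf)
  have kf : ∀ c, shiftArg c k * shiftArg c f = 1 := fun c => by
    rw [← shiftHom_apply, ← shiftHom_apply, ← map_mul, hkf, map_one]
  have fk : ∀ c, shiftArg c f * shiftArg c k = 1 := fun c => by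
    rw [← shiftHom_apply, ← shiftHom_apply, ← map_mul, hfk, map_one]
  have h1 : IsZeta (((sStd G).map (PowerSeries.map (χ : YTw G →+* R))).map (f * ·))
      (shiftArg (-halfShift M N) k * PowerSeries.map (χ : YTw G →+* R) ζ *
        shiftArg (halfShift M N) f) :=
    (h.zeta.map χ).scale hfk hkf hk hkc (by rw [mul_assoc, fk, mul_one])
  have h2 := h.zeta.map ψ
  rw [hψ] at h2
  have h3 := h2.unique h1 i
  have hs : ∀ φ : YTw G →ₐ[ℂ] R, shiftArg (halfShift M N) (PowerSeries.map (φ : YTw G →+* R) d) =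
      PowerSeries.map (φ : YTw G →+* R) ζ * shiftArg (-halfShift M N)
        (PowerSeries.map (φ : YTw G →+* R) d) := fun φ => by
    rw [← map_shiftArg, ← map_shiftArg, h.shift, map_mul]
  have e0 : ∀ (φ : YTw G →ₐ[ℂ] R) n, coeff n (PowerSeries.map (φ : YTw G →+* R) ζ) =
      φ (coeff n ζ) := fun φ n => coeff_map _ _ _
  have c0 : ∀ φ : YTw G →ₐ[ℂ] R, constantCoeff (PowerSeries.map (φ : YTw G →+* R) d) = 1 :=
    fun φ => by
      rw [← coeff_zero_eq_constantCoeff_apply, coeff_map,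
        coeff_zero_eq_constantCoeff_apply, h.d_zero, map_one]
  refine eq_of_half_shift (halfShift_ne_zero hne) (by rw [e0, h.zero, map_one])
    (by rw [e0, h.one, map_zero]) (hs ψ) ?_ (by rw [map_mul, f0, c0, c0, one_mul])
  rw [← shiftHom_apply, ← shiftHom_apply, map_mul, map_mul, shiftHom_apply, shiftHom_apply,
    shiftHom_apply, shiftHom_apply, hs χ, h3]
  generalize PowerSeries.map (χ : YTw G →+* R) ζ = Z
  generalize shiftArg (-halfShift M N) (PowerSeries.map (χ : YTw G →+* R) d) = D
  have e1 := (cf (-halfShift M N) (Z * shiftArg (halfShift M N) f)).eq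
  calc shiftArg (halfShift M N) f * (Z * D)
      = Z * shiftArg (halfShift M N) f * D := by rw [← mul_assoc, (cf _ Z).eq]
    _ = shiftArg (-halfShift M N) k * (shiftArg (-halfShift M N) f *
          (Z * shiftArg (halfShift M N) f)) * D := by rw [← mul_assoc, kf, one_mul]
    _ = _ := by rw [e1]; simp only [mul_assoc]

end Scaling

/-! ### Automorphisms S(u) ↦ f(u) S(u) and the projection π -/

section ScaledHom

variable {M N : ℕ} {G : Matrix (Idx M N) (Idx M N) ℂ} {R R' : Type*} [Ring R] [Algebra ℂ R]
  [Ring R'] [Algebra ℂ R'] {ζ d g : PowerSeries (YTw G)} {χ ψ ω : YTw G →ₐ[ℂ] R} {f f' : PowerSeries R}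

/-- The homomorphism `ψ` sends `S(u)` to `f(u)` times the image of `S(u)` under `χ`. -/
def IsScaledHom (χ ψ : YTw G →ₐ[ℂ] R) (f : PowerSeries R) : Prop :=
  ∀ i j, PowerSeries.map (ψ : YTw G →+* R) (sStd G i j) =
    f * PowerSeries.map (χ : YTw G →+* R) (sStd G i j)

theorem IsScaledHom.comp (h : IsScaledHom χ ψ f) (σ : R →ₐ[ℂ] R') :
    IsScaledHom (σ.comp χ) (σ.comp ψ) (PowerSeries.map (σ : R →+* R') f) := fun i j => by
  rw [series_map_comp, series_map_comp, h, map_mul]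

theorem IsScaledHom.trans (h : IsScaledHom χ ψ f) (h' : IsScaledHom ψ ω f') :
    IsScaledHom χ ω (f' * f) := fun i j => by rw [h', h, mul_assoc]

theorem IsScaledHom.ext (h : IsScaledHom χ ψ f) (h' : IsScaledHom χ ω f) : ψ = ω :=
  ytw_hom_ext fun i j => by rw [h, h']

theorem IsScaledHom.eq (h : IsScaledHom χ ψ 1) : ψ = χ :=
  h.ext fun _ _ => (one_mul _).symm

theorem exists_scaled (hG : IsSupersymmetric G) (χ : YTw G →ₐ[ℂ] R) (hf : negArg f = f)
    (f0 : constantCoeff f = 1) (hc : ∀ n y, Commute (coeff n f) y) :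
    ∃ ψ, IsScaledHom χ ψ f := by
  obtain ⟨ψ, h⟩ := exists_scaled_hom hG χ hf f0 hc
  exact ⟨ψ, fun i j => congrFun (congrFun h i) j⟩

theorem coeff_map_algebraMap_commute (f : PowerSeries ℂ) (n : ℕ) (y : R) :
    Commute (coeff n (PowerSeries.map (algebraMap ℂ R) f)) y := by
  rw [coeff_map]
  exact Algebra.commutes _ _

theorem negArg_map_algebraMap (f : PowerSeries ℂ) : negArg (PowerSeries.map (algebraMap ℂ R) f) =
    PowerSeries.map (algebraMap ℂ R) (negArg f) := (map_negArg (Algebra.ofId ℂ R) f).symm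

theorem map_map_algebraMap (σ : R →ₐ[ℂ] R') (f : PowerSeries ℂ) :
    PowerSeries.map (σ : R →+* R') (PowerSeries.map (algebraMap ℂ R) f) =
      PowerSeries.map (algebraMap ℂ R') f := by
  ext n
  rw [coeff_map, coeff_map, coeff_map]
  exact σ.commutes _

theorem isScaling_iff {f : PowerSeries ℂ} {φ : YTw G ≃ₐ[ℂ] YTw G} : IsScaling G f φ ↔
    IsScaledHom (AlgHom.id ℂ _) (φ : YTw G →ₐ[ℂ] YTw G) (PowerSeries.map (algebraMap ℂ (YTw G)) f) := by
  refine forall_congr' fun i => forall_congr' fun j => ?_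
  rw [series_map_id, sStd, std, Matrix.of_apply, map_mul, map_pow, map_neg, map_one, sign_comm]
  refine ⟨fun h => congrArg _ h, fun h => ?_⟩
  have := congrArg ((-1) ^ (par i * par j + par j) * ·) h
  beta_reduce at this
  rwa [neg_one_pow_mul_self, neg_one_pow_mul_self] at this

theorem negArg_inv {f : PowerSeries ℂ} (hf : negArg f = f) (hff : f * f⁻¹ = 1) :
    negArg f⁻¹ = f⁻¹ := by
  have h := congrArg negHom hff
  rw [map_mul, map_one, negHom_apply, negHom_apply, hf] at h
  exact left_inv_eq_right_inv (by rwa [mul_comm]) hff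

theorem exists_isScaling (hG : IsSupersymmetric G) {f : PowerSeries ℂ}
    (f0 : constantCoeff f = 1) (hf : negArg f = f) : ∃ φ, IsScaling G f φ := by
  have c0 : ∀ {k : PowerSeries ℂ}, constantCoeff k = 1 →
      constantCoeff (PowerSeries.map (algebraMap ℂ (YTw G)) k) = 1 := fun {k} h => by
    rw [← coeff_zero_eq_constantCoeff_apply, coeff_map,
      coeff_zero_eq_constantCoeff_apply, h, map_one]
  have hff : f * f⁻¹ = 1 := PowerSeries.mul_inv_cancel f (by rw [f0]; exact one_ne_zero)
  have hk := negArg_inv hf hff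
  obtain ⟨φ, hφ⟩ := exists_scaled hG (AlgHom.id ℂ _) (by rw [negArg_map_algebraMap, hf]) (c0 f0)
    (coeff_map_algebraMap_commute f)
  obtain ⟨φ', hφ'⟩ := exists_scaled hG (AlgHom.id ℂ _) (by rw [negArg_map_algebraMap, hk])
    (c0 (by rw [PowerSeries.constantCoeff_inv, f0, inv_one])) (coeff_map_algebraMap_commute f⁻¹)
  have h1 := hφ.trans (hφ'.comp φ)
  have h2 := hφ'.trans (hφ.comp φ')
  rw [map_map_algebraMap, ← map_mul, mul_comm, hff, map_one] at h1
  rw [map_map_algebraMap, ← map_mul, hff, map_one] at h2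
  exact ⟨AlgEquiv.ofAlgHom φ φ' h1.eq h2.eq, isScaling_iff.2 hφ⟩

/-- The symmetry relation expresses S(u) linearly through S(-u). Applied to both S and f S, it gives
f(u) S(u) = f(-u) S(u), and S is invertible. -/
theorem negArg_of_isScaling (hG : IsSupersymmetric G) (i : Idx M N) {f : PowerSeries ℂ}
    {φ : YTw G ≃ₐ[ℂ] YTw G} (h : IsScaling G f φ)
    (inj : Function.Injective (algebraMap ℂ (YTw G))) : negArg f = f := by
  have hS := isScaling_iff.1 h
  have h1 := isSymm_iff_smul.1 (isTwSeries_sStd (G := G)).symm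
  have h2 := isSymm_iff_smul.1 ((isTwSeries_sStd (G := G)).map (φ : YTw G →ₐ[ℂ] YTw G)).symm
  obtain ⟨R, r1, -⟩ := exists_inverse hG.nondegenerate (sStd_map_constantCoeff hG)
  have e := eq_of_map_mul_eq r1 (x := PowerSeries.map (algebraMap ℂ (YTw G)) f)
    (y := negArg (PowerSeries.map (algebraMap ℂ (YTw G)) f)) (Matrix.ext fun i j => ?_) i
  · rw [negArg_map_algebraMap] at e
    exact (PowerSeries.map_injective _ inj e).symm
  · refine isUnit_smul_cancel isUnit_two_add_X ?_
    have h3 := h2 i j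
    have hn : ∀ i j, negArg (PowerSeries.map ((φ : YTw G →ₐ[ℂ] YTw G) : YTw G →+* YTw G) (sStd G i j)) =
        negArg (PowerSeries.map (algebraMap ℂ (YTw G)) f) * negArg (sStd G i j) := fun i j => by
      rw [hS, series_map_id, ← negHom_apply, map_mul, negHom_apply, negHom_apply]
    simp only [Matrix.map_apply, hn] at h3
    rw [hS, series_map_id] at h3
    rw [Matrix.map_apply, Matrix.map_apply, h3, ← mul_smul_comm _ (negArg _) (sStd G i j), h1,
      mul_add, mul_smul_comm, mul_smul_comm, sign_comm, Matrix.map_apply, Matrix.map_apply]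

theorem CentralRoot.map_scaled (h : CentralRoot ζ d g) (hne : M ≠ N) (i : Idx M N)
    {k : PowerSeries R} (hfk : f * k = 1) (hkf : k * f = 1) (hk : negArg k = k)
    (f0 : constantCoeff f = 1) (hf : ∀ n y, Commute (coeff n f) y)
    (hkc : ∀ n y, Commute (coeff n k) y) (hψ : IsScaledHom χ ψ f) :
    PowerSeries.map (ψ : YTw G →+* R) d = f * PowerSeries.map (χ : YTw G →+* R) d :=
  h.map_d hne i hfk hkf hk f0 hf hkc (Matrix.ext hψ)

theorem CentralRoot.map_proj (h : CentralRoot ζ d g) (hne : M ≠ N) (i : Idx M N)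
    {π : YTw G →ₐ[ℂ] YTw G} (hπ : IsScaledHom (AlgHom.id ℂ _) π g) :
    PowerSeries.map (π : YTw G →+* YTw G) d = 1 := by
  rw [h.map_scaled hne i h.inv_mul h.mul_inv h.neg_d h.g_zero h.comm_g h.comm_d hπ, series_map_id,
    h.inv_mul]

theorem map_g_of_map_d (h : CentralRoot ζ d g) (hd : PowerSeries.map (χ : YTw G →+* R) d = 1) :
    PowerSeries.map (χ : YTw G →+* R) g = 1 := by
  have e := congrArg (PowerSeries.map (χ : YTw G →+* R)) h.mul_inv
  rwa [map_mul, hd, one_mul, map_one] at e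

/-- A scaling by f multiplies d by f and therefore g by f⁻¹, so g S is unchanged. -/
theorem CentralRoot.scaling_comp (h : CentralRoot ζ d g) (hne : M ≠ N) (i : Idx M N)
    {π : YTw G →ₐ[ℂ] YTw G} (hπ : IsScaledHom (AlgHom.id ℂ _) π g) {f : PowerSeries ℂ}
    (f0 : constantCoeff f = 1) (hf : negArg f = f) {φ : YTw G ≃ₐ[ℂ] YTw G}
    (hφ : IsScaling G f φ) (y : YTw G) : φ (π y) = π y := by
  have hφ' := isScaling_iff.1 hφ
  have hff : f * f⁻¹ = 1 := PowerSeries.mul_inv_cancel f (by rw [f0]; exact one_ne_zero)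
  have hk := negArg_inv hf hff
  have hd := h.map_scaled hne i (by rw [← map_mul, hff, map_one])
    (k := PowerSeries.map (algebraMap ℂ (YTw G)) f⁻¹) (by rw [← map_mul, mul_comm, hff, map_one])
    (by rw [negArg_map_algebraMap, hk]) (by
      rw [← coeff_zero_eq_constantCoeff_apply, coeff_map,
        coeff_zero_eq_constantCoeff_apply, f0, map_one])
    (coeff_map_algebraMap_commute f) (coeff_map_algebraMap_commute f⁻¹) hφ'
  rw [series_map_id] at hd
  have h1 := hφ'.trans (hπ.comp (φ : YTw G →ₐ[ℂ] YTw G))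
  have e : PowerSeries.map ((φ : YTw G →ₐ[ℂ] YTw G) : YTw G →+* YTw G) g *
      PowerSeries.map (algebraMap ℂ (YTw G)) f = g := by
    rw [← mul_one (_ * _), ← h.mul_inv, mul_assoc, ← mul_assoc (PowerSeries.map _ f), ← hd,
      ← mul_assoc, ← map_mul, h.inv_mul, map_one, one_mul]
  rw [e] at h1
  exact DFunLike.congr_fun (h1.ext hπ) y

/-! ### The universal scaling -/

/-- Evaluation of the polynomial variables at central elements. -/
def evalPoly {A : Type*} [Ring A] [Algebra ℂ A] (e : ℕ → Subalgebra.center ℂ A) :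
    A ⊗[ℂ] MvPolynomial ℕ ℂ →ₐ[ℂ] A :=
  Algebra.TensorProduct.lift (AlgHom.id ℂ A) ((Subalgebra.center ℂ A).val.comp (MvPolynomial.aeval e))
    fun x p => Subalgebra.mem_center_iff.1 (MvPolynomial.aeval e p).2 x

theorem evalPoly_tmul {A : Type*} [Ring A] [Algebra ℂ A] (e : ℕ → Subalgebra.center ℂ A) (a : A)
    (p : MvPolynomial ℕ ℂ) : evalPoly e (a ⊗ₜ p) = a * (MvPolynomial.aeval e p : A) :=
  Algebra.TensorProduct.lift_tmul _ _ _ _ _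

/-- In a basis of A the coordinates are polynomials over ℂ vanishing at every point; each involves
finitely many variables, so they are zero. -/
theorem eq_zero_of_evalPoly {A : Type*} [Ring A] [Algebra ℂ A] {w : A ⊗[ℂ] MvPolynomial ℕ ℂ}
    (h : ∀ c : ℕ → ℂ, evalPoly (fun n => algebraMap ℂ _ (c n)) w = 0) : w = 0 := by
  classical
  let b := Module.Basis.ofVectorSpace ℂ A
  have key : ∀ (c : ℕ → ℂ) i w, MvPolynomial.eval c (TensorProduct.equivFinsuppOfBasisLeft b w i) =
      b.repr (evalPoly (fun n => algebraMap ℂ _ (c n)) w) i := by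
    intro c i w
    induction w with
    | zero => simp
    | add x y hx hy => simp only [map_add, Finsupp.add_apply, hx, hy]
    | tmul a p =>
      have e : (MvPolynomial.aeval (fun n => algebraMap ℂ (Subalgebra.center ℂ A) (c n)) p) =
          algebraMap ℂ _ (MvPolynomial.eval c p) := MvPolynomial.aeval_algebraMap_apply _ _ _
      rw [TensorProduct.equivFinsuppOfBasisLeft_apply_tmul_apply, evalPoly_tmul, e,
        MvPolynomial.smul_eval]
      change _ = b.repr (a * algebraMap ℂ A _) i
      rw [← Algebra.commutes, ← Algebra.smul_def, map_smul, Finsupp.smul_apply, smul_eq_mul, mul_comm]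
  refine (TensorProduct.equivFinsuppOfBasisLeft b).injective (Finsupp.ext fun i => ?_)
  rw [map_zero, Finsupp.zero_apply]
  exact MvPolynomial.funext fun c => by rw [key, h, map_zero, map_zero, Finsupp.zero_apply]

/-- The even series with indeterminate coefficients. -/
def evenSeries : PowerSeries (MvPolynomial ℕ ℂ) :=
  PowerSeries.mk fun n => if n = 0 then 1 else if Even n then MvPolynomial.X n else 0

/-- Invariance under scalings with numerical coefficients has to be transferred to the scaling by g,
whose coefficients are central elements. The generic even scaling, with indeterminate coefficients,
specialises to both. -/
theorem CentralRoot.proj_eq_of_mem (h : CentralRoot ζ d g) (hG : IsSupersymmetric G)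
    {π : YTw G →ₐ[ℂ] YTw G} (hπ : IsScaledHom (AlgHom.id ℂ _) π g) {y : YTw G}
    (hy : y ∈ special G) : π y = y := by
  have hneg : ∀ {A : Type} [Ring A] [Algebra ℂ A] {k : PowerSeries A}, negArg k = k → ∀ n, ¬Even n →
      coeff n k = 0 := fun {A} _ _ {k} hk n hn => by
    have h1 := congrArg (coeff n) hk
    rw [coeff_negArg, (Nat.not_even_iff_odd.1 hn).neg_one_pow, neg_one_mul] at h1
    have h2 := congrArg ((1 / 2 : ℂ) • ·) (neg_eq_iff_add_eq_zero.1 h1)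
    beta_reduce at h2
    rw [smul_zero] at h2
    rw [← h2]; module
  let ι₁ : YTw G →ₐ[ℂ] YTw G ⊗[ℂ] MvPolynomial ℕ ℂ := Algebra.TensorProduct.includeLeft
  let ι₂ : MvPolynomial ℕ ℂ →ₐ[ℂ] YTw G ⊗[ℂ] MvPolynomial ℕ ℂ := Algebra.TensorProduct.includeRight
  obtain ⟨Ψ, hΨ⟩ := exists_scaled hG ι₁
    (f := PowerSeries.map (ι₂ : _ →+* YTw G ⊗[ℂ] MvPolynomial ℕ ℂ) evenSeries)
    (by
      rw [← map_negArg]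
      congr 1
      ext n : 1
      rw [coeff_negArg, evenSeries, coeff_mk]
      split_ifs with h1 h2
      · simp [h1]
      · simp [h2.neg_one_pow]
      · simp)
    (by
      rw [← coeff_zero_eq_constantCoeff_apply, coeff_map, evenSeries,
        coeff_mk, if_pos rfl, map_one])
    (fun n w => by
      rw [coeff_map]
      induction w with
      | zero => exact Commute.zero_right _
      | add x y hx hy => exact hx.add_right hy
      | tmul a p =>
        refine (Algebra.TensorProduct.tmul_mul_tmul _ _ _ _).trans
          (Eq.trans ?_ (Algebra.TensorProduct.tmul_mul_tmul _ _ _ _).symm)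
        rw [one_mul, mul_one, mul_comm])
  have hev : ∀ {k : PowerSeries (YTw G)} (e : ℕ → Subalgebra.center ℂ (YTw G)),
      (∀ n, coeff n k = if n = 0 then 1 else if Even n then (e n : YTw G) else 0) →
      IsScaledHom (AlgHom.id ℂ _) ((evalPoly e).comp Ψ) k := fun {k} e hk => by
    have h1 := hΨ.comp (evalPoly e)
    have e1 : (evalPoly e).comp ι₁ = AlgHom.id ℂ _ := AlgHom.ext fun a => by
      refine (evalPoly_tmul _ _ _).trans ?_
      rw [map_one]; exact mul_one _
    have e2 : PowerSeries.map (evalPoly e : _ →+* YTw G) (PowerSeries.map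
        (ι₂ : _ →+* YTw G ⊗[ℂ] MvPolynomial ℕ ℂ) evenSeries) = k := by
      ext n
      rw [hk, coeff_map, coeff_map]
      refine (evalPoly_tmul _ _ _).trans ?_
      rw [one_mul, evenSeries, coeff_mk]
      split_ifs
      · rw [map_one]; rfl
      · rw [MvPolynomial.aeval_X]
      · rw [map_zero]; rfl
    rwa [e1, e2] at h1
  -- All numerical specialisations of the generic scaling fix y, so the generic scaling does.
  have hΨy : Ψ y = y ⊗ₜ 1 := by
    rw [← sub_eq_zero]
    refine eq_zero_of_evalPoly fun c => ?_
    set f : PowerSeries ℂ := PowerSeries.mk fun n => if n = 0 then 1 else if Even n then c n else 0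
      with hf
    have f0 : constantCoeff f = 1 := by
      rw [← coeff_zero_eq_constantCoeff_apply, hf, coeff_mk, if_pos rfl]
    have hfe : negArg f = f := by
      ext n
      rw [coeff_negArg, hf, coeff_mk]
      split_ifs with h1 h2
      · simp [h1]
      · simp [h2.neg_one_pow]
      · simp
    obtain ⟨φ, hφ⟩ := exists_isScaling hG f0 hfe
    have h1 := hev (k := PowerSeries.map (algebraMap ℂ (YTw G)) f) (fun n => algebraMap ℂ _ (c n))
      fun n => by
        rw [coeff_map, hf, coeff_mk]
        split_ifs
        · exact map_one _
        · rfl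
        · exact map_zero _
    have h2 := DFunLike.congr_fun (h1.ext (isScaling_iff.1 hφ)) y
    rw [map_sub, evalPoly_tmul, map_one]
    change ((evalPoly _).comp Ψ) y - y * 1 = 0
    rw [h2, mul_one, sub_eq_zero]
    exact hy f φ f0 hφ
  -- Specialising the even-indexed variables to the coefficients of g turns the generic scaling into
  -- π; the odd coefficients of g vanish since g is even.
  have h1 := hev (k := g) (fun n => ⟨coeff n g, Subalgebra.mem_center_iff.2 fun x =>
    (h.comm_g n x).eq.symm⟩) fun n => by
      split_ifs with h1 h2
      · rw [h1, coeff_zero_eq_constantCoeff_apply, h.g_zero]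
      · rfl
      · exact hneg h.neg_g n h2
  rw [hπ.ext h1, AlgHom.comp_apply, hΨy, evalPoly_tmul, map_one]
  exact mul_one _

theorem CentralRoot.mem_special_iff (h : CentralRoot ζ d g) (hG : IsSupersymmetric G) (hne : M ≠ N)
    (i : Idx M N) (inj : Function.Injective (algebraMap ℂ (YTw G))) {π : YTw G →ₐ[ℂ] YTw G}
    (hπ : IsScaledHom (AlgHom.id ℂ _) π g) {y : YTw G} : y ∈ special G ↔ π y = y := by
  refine ⟨h.proj_eq_of_mem hG hπ, fun hy f φ f0 hφ => ?_⟩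
  rw [← hy]
  exact h.scaling_comp hne i hπ f0 (negArg_of_isScaling hG i hφ inj) hφ y

end ScaledHom

/-! ### Parity components, and the center as a subalgebra -/

section Parity

variable {M N : ℕ} {G : Matrix (Idx M N) (Idx M N) ℂ} {y : YTw G} {ζ d g : PowerSeries (YTw G)}

theorem letter_sStd (x : Gen M N) :
    letter (sStd G) x = (-1) ^ (par x.1 * par x.2.1 + par x.2.1) * sGen G x := by
  rw [letter, sCoeff, sStd, std, Matrix.of_apply, coeff_neg_one_pow_mul, sSeries,
    coeff_map, freeSeries, coeff_mk]
  rfl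

theorem word_mem_parityPart (l : List (Gen M N)) : word (sStd G) l ∈ parityPart G
    (l.map fun g => ((par g.1 + par g.2.1 : ℕ) : ZMod 2)).sum := by
  induction l with
  | nil => exact one_mem_parityPart G
  | cons x l ih =>
    simp only [word, List.map_cons, List.prod_cons, List.sum_cons]
    refine mul_mem_parityPart G ?_ ih
    rw [letter_sStd, sign_mul_mem]
    exact Submodule.subset_span ⟨[x], by simp, by simp⟩

theorem exists_parity (hG : IsSupersymmetric G) (y : YTw G) :
    ∃ a ∈ parityPart G 0, ∃ b ∈ parityPart G 1, y = a + b := by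
  obtain ⟨d, hd⟩ := exists_mem_filt (isTwGen_sStd hG) y
  suffices h : filt (sStd G) d ≤ parityPart G 0 ⊔ parityPart G 1 by
    obtain ⟨a, ha, b, hb, h⟩ := Submodule.mem_sup.1 (h hd)
    exact ⟨a, ha, b, hb, h.symm⟩
  refine Submodule.span_le.2 ?_
  rintro _ ⟨l, -, rfl⟩
  have hl := word_mem_parityPart (G := G) l
  rcases (by decide : ∀ p : ZMod 2, p = 0 ∨ p = 1) (l.map fun g => ((par g.1 + par g.2.1 : ℕ) : ZMod 2)).sum
    with h | h <;> rw [h] at hl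
  exacts [Submodule.mem_sup_left hl, Submodule.mem_sup_right hl]

theorem par_sGen (hG : IsSupersymmetric G) (x : Gen M N) :
    parTw hG (sGen G x) = (-1) ^ (par x.1 + par x.2.1) * sGen G x := by
  have e : sGen G x = (-1) ^ (par x.1 * par x.2.1 + par x.2.1) * letter (sStd G) x := by
    rw [letter_sStd, neg_one_pow_mul_self]
  rw [e, map_mul, map_pow, map_neg, map_one, par_letter (isTwGen_sStd hG), sign_comm]

theorem parTw_of_mem (hG : IsSupersymmetric G) {q : ZMod 2} (hy : y ∈ parityPart G q) :
    parTw hG y = (-1) ^ q.val * y := by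
  induction hy using Submodule.span_induction with
  | mem x hx =>
    obtain ⟨l, rfl, rfl⟩ := hx
    induction l with
    | nil => simp
    | cons x l ih =>
      simp only [List.map_cons, List.prod_cons, List.sum_cons, map_mul, par_sGen, ih]
      rw [mul_assoc, sign_comm, ← mul_assoc ((-1) ^ _), ← pow_add, neg_one_pow_eq_pow_mod_two,
        ZMod.val_add, ZMod.val_natCast, Nat.mod_add_mod, ← neg_one_pow_eq_pow_mod_two]
  | zero => simp
  | add x y _ _ hx hy => rw [map_add, hx, hy, mul_add]
  | smul c x _ hx => rw [map_smul, hx, mul_smul_comm]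

theorem parTw_of_mem_zero (hG : IsSupersymmetric G) (hy : y ∈ parityPart G 0) : parTw hG y = y := by
  rw [parTw_of_mem hG hy, ZMod.val_zero, pow_zero, one_mul]

theorem parTw_of_mem_one (hG : IsSupersymmetric G) (hy : y ∈ parityPart G 1) : parTw hG y = -y := by
  rw [parTw_of_mem hG hy, show (1 : ZMod 2).val = 1 from rfl, pow_one]; exact neg_one_mul y

theorem mem_parityPart_zero (hG : IsSupersymmetric G) (hy : parTw hG y = y) : y ∈ parityPart G 0 := by
  obtain ⟨a, ha, b, hb, rfl⟩ := exists_parity hG y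
  rw [map_add, parTw_of_mem_zero hG ha, parTw_of_mem_one hG hb, add_right_inj, neg_eq_iff_add_eq_zero]
    at hy
  have : b = (1 / 2 : ℂ) • (b + b) := by module
  rwa [this, hy, smul_zero, add_zero]

theorem mem_parityPart_one (hG : IsSupersymmetric G) (hy : parTw hG y = -y) : y ∈ parityPart G 1 := by
  obtain ⟨a, ha, b, hb, rfl⟩ := exists_parity hG y
  rw [map_add, parTw_of_mem_zero hG ha, parTw_of_mem_one hG hb, neg_add, add_left_inj,
    eq_neg_iff_add_eq_zero] at hy
  have : a = (1 / 2 : ℂ) • (a + a) := by module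
  rwa [this, hy, smul_zero, zero_add]

theorem commute_of_mem_adjoin (hc : ∀ n y, Commute (coeff n ζ) y) {z : YTw G}
    (hz : z ∈ Algebra.adjoin ℂ (Set.range fun n => coeff n ζ)) (y : YTw G) :
    Commute z y := by
  induction hz using Algebra.adjoin_induction with
  | mem x hx => obtain ⟨n, rfl⟩ := hx; exact hc n y
  | algebraMap r => exact Algebra.commutes r y
  | add a b _ _ ha hb => exact ha.add_left hb
  | mul a b _ _ ha hb => exact ha.mul_left hb

theorem parTw_of_mem_adjoin (hG : IsSupersymmetric G) (i : Idx M N) (hζ : IsZeta (sStd G) ζ) {z : YTw G}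
    (hz : z ∈ Algebra.adjoin ℂ (Set.range fun n => coeff n ζ)) : parTw hG z = z := by
  induction hz using Algebra.adjoin_induction with
  | mem x hx =>
    obtain ⟨n, rfl⟩ := hx
    have h := congrArg (coeff n) ((isTwGen_sStd hG).map_zeta hζ i)
    rwa [coeff_map] at h
  | algebraMap r => exact (parTw hG).commutes r
  | add a b _ _ ha hb => rw [map_add, ha, hb]
  | mul a b _ _ ha hb => rw [map_mul, ha, hb]

/-- A homogeneous supercentral element satisfies x y = y γᵖ(x) for all x, which is the form needed
for `mem_of_supercentral`. Conversely the coefficients of ζ are even and central. -/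
theorem center_eq_adjoin (hG : IsSupersymmetric G) (hne : M ≠ N) (i : Idx M N)
    (hζ : IsZeta (sStd G) ζ) (hc : ∀ n y, Commute (coeff n ζ) y)
    (h0 : coeff 0 ζ = 1) (h1 : coeff 1 ζ = 0) :
    center G = Algebra.adjoin ℂ (Set.range fun n => coeff n ζ) := by
  have hS := isTwGen_sStd hG
  have hΔ := isSlotTw_slotTw hG
  have key : ∀ p, ∀ y ∈ centralPart G p,
      y ∈ Algebra.adjoin ℂ (Set.range fun n => coeff n ζ) := fun p y hy => by
    refine mem_of_supercentral hS hΔ i (fun n => Algebra.subset_adjoin ⟨n, rfl⟩)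
      (fun z hz => commute_of_mem_adjoin hc hz) (fun z => parTw_of_mem_adjoin hG i hζ)
      (zeta_sub_trGen_mem hS hΔ (slot_zeta hne hS hΔ hζ hc i) h0 h1) (parTw_of_mem hG hy.1)
      fun x => ?_
    obtain ⟨a, ha, b, hb, rfl⟩ := exists_parity hG x
    have h1 := hy.2 0 a ha
    have h2 := hy.2 1 b hb
    rw [map_add, mul_add, add_mul]
    rcases (by decide : ∀ p : ZMod 2, p = 0 ∨ p = 1) p with rfl | rfl
    · simpa using congrArg₂ (· + ·) h1.symm h2.symm
    · rw [show (1 : ZMod 2).val = 1 from rfl] at h2 ⊢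
      rw [ZMod.val_zero, mul_zero, pow_zero, one_mul] at h1
      rw [mul_one, pow_one] at h2
      rw [pow_one, parTw_of_mem_zero hG ha, parTw_of_mem_one hG hb, h1]
      exact congrArg _ ((mul_neg y b).trans ((congrArg Neg.neg (h2.trans (neg_one_mul (b * y)))).trans
        (neg_neg _))).symm
  refine le_antisymm (fun y hy => ?_) fun y hy => ?_
  · obtain ⟨a, ha, b, hb, rfl⟩ := Submodule.mem_sup.1 hy
    exact Subalgebra.add_mem _ (key 0 a ha) (key 1 b hb)
  · refine Submodule.mem_sup_left ⟨mem_parityPart_zero hG (parTw_of_mem_adjoin hG i hζ hy),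
      fun q x _ => ?_⟩
    rw [ZMod.val_zero, zero_mul, pow_zero, one_mul]
    exact commute_of_mem_adjoin hc hy x

/-- The difference equation is solved over B and then mapped by v. With B the algebra generated by
the coefficients of ζ, this places the coefficients of d and of its inverse in that algebra. -/
theorem exists_centralRoot_map (hne : M ≠ N) {B : Type*} [Ring B] [Algebra ℂ B] {v : B →ₐ[ℂ] YTw G}
    (hv : Function.Injective v) (hvc : ∀ b y, Commute (v b) y) {ξ : PowerSeries B}
    (e : PowerSeries.map (v : B →+* YTw G) ξ = ζ) (hζ : IsZeta (sStd G) ζ) (hn : ζ * negArg ζ = 1)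
    (h0 : coeff 0 ζ = 1) (h1 : coeff 1 ζ = 0) : ∃ d g : PowerSeries B,
      CentralRoot ζ (PowerSeries.map (v : B →+* YTw G) d) (PowerSeries.map (v : B →+* YTw G) g) := by
  have k0 := h0
  have k1 := h1
  rw [← e, coeff_map] at h0 h1
  rw [← e, ← map_negArg, ← map_mul] at hn
  obtain ⟨d, g, hd, hdg, hgd, hs, hnd⟩ := exists_root (halfShift_ne_zero hne)
    (hv (h0.trans (map_one v).symm)) (hv (h1.trans (map_zero v).symm))
    (PowerSeries.map_injective (v : B →+* YTw G) hv (hn.trans (map_one _).symm))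
  refine ⟨d, g, hζ, k0, k1, ?_, by rw [← map_mul, hdg, map_one], by rw [← map_mul, hgd, map_one],
    by rw [← map_shiftArg, hs, map_mul, map_shiftArg, e], by rw [← map_negArg, hnd],
    fun n y => ?_, fun n y => ?_⟩
  · rw [← coeff_zero_eq_constantCoeff_apply, coeff_map,
      coeff_zero_eq_constantCoeff_apply, hd, map_one]
  · rw [coeff_map]; exact hvc _ y
  · rw [coeff_map]; exact hvc _ y

theorem exists_centralRoot (hne : M ≠ N) (hζ : IsZeta (sStd G) ζ)
    (hc : ∀ n y, Commute (coeff n ζ) y) (hn : ζ * negArg ζ = 1)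
    (h0 : coeff 0 ζ = 1) (h1 : coeff 1 ζ = 0) :
    ∃ d g, CentralRoot ζ d g ∧ (∀ n, coeff n d ∈
        Algebra.adjoin ℂ (Set.range fun n => coeff n ζ)) ∧ ∀ n, coeff n g ∈
        Algebra.adjoin ℂ (Set.range fun n => coeff n ζ) := by
  obtain ⟨d, g, h⟩ := exists_centralRoot_map hne
    (B := Algebra.adjoin ℂ (Set.range fun n => coeff n ζ)) (v := Subalgebra.val _)
    Subtype.val_injective (fun b => commute_of_mem_adjoin hc b.2)
    (ξ := PowerSeries.mk fun n => ⟨coeff n ζ, Algebra.subset_adjoin ⟨n, rfl⟩⟩)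
    (by ext n; rw [coeff_map, coeff_mk]; rfl) hζ hn h0 h1
  refine ⟨_, _, h, fun n => ?_, fun n => ?_⟩ <;> rw [coeff_map] <;>
    exact Subtype.property _

end Parity

/-! ### The tensor product decomposition and the quotient -/

section Decomposition

variable {M N : ℕ} {G : Matrix (Idx M N) (Idx M N) ℂ} {R : Type*} [Ring R] [Algebra ℂ R]
  {ζ d g : PowerSeries (YTw G)} {π : YTw G →ₐ[ℂ] YTw G}

theorem proj_comp (hπ : IsScaledHom (AlgHom.id ℂ _) π g) {ψ : YTw G →ₐ[ℂ] R}
    (hg : PowerSeries.map (ψ : YTw G →+* R) g = 1) : ψ.comp π = ψ := by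
  have h1 := hπ.comp ψ
  rw [hg] at h1
  exact h1.eq

theorem CentralRoot.proj_proj (h : CentralRoot ζ d g) (hne : M ≠ N) (i : Idx M N)
    (hπ : IsScaledHom (AlgHom.id ℂ _) π g) (y : YTw G) : π (π y) = π y :=
  DFunLike.congr_fun (proj_comp hπ (map_g_of_map_d h (h.map_proj hne i hπ))) y

theorem CentralRoot.map_zeta_of_map_d (h : CentralRoot ζ d g) {χ : YTw G →ₐ[ℂ] R}
    (hd : PowerSeries.map (χ : YTw G →+* R) d = 1) : PowerSeries.map (χ : YTw G →+* R) ζ = 1 := by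
  rw [h.zeta_eq, map_mul, map_shiftArg, map_shiftArg, hd, map_g_of_map_d h hd, ← shiftHom_apply,
    ← shiftHom_apply, map_one, map_one, mul_one]

/-- When ζ becomes 1, the constant series 1 solves the difference equation and is its only solution
with constant term 1. -/
theorem CentralRoot.map_d_of_map_zeta (h : CentralRoot ζ d g) (hne : M ≠ N) {χ : YTw G →ₐ[ℂ] R}
    (hζ : PowerSeries.map (χ : YTw G →+* R) ζ = 1) : PowerSeries.map (χ : YTw G →+* R) d = 1 := by
  refine eq_of_half_shift (ζ := 1) (halfShift_ne_zero hne) (by simp) (by simp [coeff_one])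
    ?_ ?_ ?_
  · rw [← map_shiftArg, h.shift, map_mul, hζ, map_shiftArg]
  · rw [← shiftHom_apply, ← shiftHom_apply, map_one, map_one, mul_one]
  · rw [← coeff_zero_eq_constantCoeff_apply, coeff_map,
      coeff_zero_eq_constantCoeff_apply, h.d_zero, map_one, map_one]

theorem CentralRoot.parTw_proj (h : CentralRoot ζ d g) (hG : IsSupersymmetric G) (i : Idx M N)
    (hπ : IsScaledHom (AlgHom.id ℂ _) π g) (hg : ∀ n, coeff n g ∈
      Algebra.adjoin ℂ (Set.range fun n => coeff n ζ)) (y : YTw G) :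
    parTw hG (π y) = π (parTw hG y) := by
  have e : (parTw hG).comp π = π.comp (parTw hG) := ytw_hom_ext fun k l => by
    have eg : PowerSeries.map (parTw hG : YTw G →+* YTw G) g = g := by
      ext n
      rw [coeff_map]
      exact parTw_of_mem_adjoin hG i h.zeta (hg n)
    rw [series_map_comp, series_map_comp, hπ, series_map_id, map_mul, eg, map_parTw, map_mul, map_pow,
      map_neg, map_one, hπ, series_map_id, sign_comm]
  exact DFunLike.congr_fun e y

theorem coeff_includeLeft_commute {A B : Type*} [Ring A] [Algebra ℂ A] [Ring B] [Algebra ℂ B]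
    {f : PowerSeries A} (h : ∀ n y, Commute (coeff n f) y) (n : ℕ) (w : A ⊗[ℂ] B) :
    Commute (coeff n (PowerSeries.map
      ((Algebra.TensorProduct.includeLeft : A →ₐ[ℂ] A ⊗[ℂ] B) : A →+* A ⊗[ℂ] B) f)) w := by
  rw [coeff_map]
  induction w with
  | zero => exact Commute.zero_right _
  | add x y hx hy => exact hx.add_right hy
  | tmul a p =>
    refine (Algebra.TensorProduct.tmul_mul_tmul _ _ _ _).trans
      (Eq.trans ?_ (Algebra.TensorProduct.tmul_mul_tmul _ _ _ _).symm)
    rw [one_mul, mul_one, (h n a).eq]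

/-- Composing multiplication with θ gives the inclusion of P ⊗ Q into A ⊗ A, injective because
everything is flat over a field. Surjectivity is the generation hypothesis. -/
theorem exists_tensorEquiv {A : Type*} [Ring A] [Algebra ℂ A] {P Q : Subalgebra ℂ A}
    (hc : ∀ z ∈ P, ∀ y, Commute z y) {θ : A →ₐ[ℂ] A ⊗[ℂ] A} (h1 : ∀ z ∈ P, θ z = z ⊗ₜ 1)
    (h2 : ∀ y ∈ Q, θ y = 1 ⊗ₜ y) (hs : ∀ B : Subalgebra ℂ A, P ≤ B → Q ≤ B → B = ⊤) :
    ∃ e : (P ⊗[ℂ] Q) ≃ₐ[ℂ] A, ∀ (z : P) (y : Q), e (z ⊗ₜ[ℂ] y) = (z : A) * (y : A) := by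
  let μ : (P ⊗[ℂ] Q) →ₐ[ℂ] A := Algebra.TensorProduct.lift P.val Q.val fun z y => hc z z.2 y
  have hμ : ∀ (z : P) (y : Q), μ (z ⊗ₜ[ℂ] y) = (z : A) * (y : A) :=
    fun z y => Algebra.TensorProduct.lift_tmul _ _ _ _ _
  refine ⟨AlgEquiv.ofBijective μ ⟨?_, ?_⟩, hμ⟩
  · have e : ∀ w, θ (μ w) = TensorProduct.map P.val.toLinearMap Q.val.toLinearMap w := fun w => by
      induction w with
      | zero => simp only [map_zero]
      | add x y hx hy => simp only [map_add, hx, hy]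
      | tmul z y =>
        rw [hμ, map_mul, h1 z z.2, h2 y y.2, Algebra.TensorProduct.tmul_mul_tmul, mul_one, one_mul]
        rfl
    refine Function.Injective.of_comp (f := θ) ?_
    rw [show θ ∘ μ = _ from funext e]
    exact TensorProduct.map_injective_of_flat_flat _ _ Subtype.val_injective Subtype.val_injective
  · rw [← AlgHom.range_eq_top]
    exact hs _ (fun z hz => ⟨(⟨z, hz⟩ : P) ⊗ₜ 1, (hμ _ _).trans (mul_one z)⟩)
      fun y hy => ⟨1 ⊗ₜ (⟨y, hy⟩ : Q), (hμ _ _).trans (one_mul y)⟩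

/-- θ sends S to ι₁(d) · ι₂(π S). By `map_scaled` and π(d) = 1 it agrees with ι₁ on d, hence on the
coefficients of ζ; on the image of π the factor ι₁(d) is cancelled. -/
theorem CentralRoot.exists_split (h : CentralRoot ζ d g) (hG : IsSupersymmetric G) (hne : M ≠ N)
    (i : Idx M N) (hπ : IsScaledHom (AlgHom.id ℂ _) π g) {ι₁ ι₂ : YTw G →ₐ[ℂ] R}
    (hdc : ∀ n y, Commute (coeff n (PowerSeries.map (ι₁ : YTw G →+* R) d)) y)
    (hgc : ∀ n y, Commute (coeff n (PowerSeries.map (ι₁ : YTw G →+* R) g)) y) :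
    ∃ θ : YTw G →ₐ[ℂ] R,
      (∀ z ∈ Algebra.adjoin ℂ (Set.range fun n => coeff n ζ), θ z = ι₁ z) ∧
      ∀ y, θ (π y) = ι₂ (π y) := by
  have k1 : PowerSeries.map (ι₁ : YTw G →+* R) d * PowerSeries.map (ι₁ : YTw G →+* R) g = 1 := by
    rw [← map_mul, h.mul_inv, map_one]
  have k2 : PowerSeries.map (ι₁ : YTw G →+* R) g * PowerSeries.map (ι₁ : YTw G →+* R) d = 1 := by
    rw [← map_mul, h.inv_mul, map_one]
  have k4 : constantCoeff (PowerSeries.map (ι₁ : YTw G →+* R) d) = 1 := by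
    rw [← coeff_zero_eq_constantCoeff_apply, coeff_map,
      coeff_zero_eq_constantCoeff_apply, h.d_zero, map_one]
  obtain ⟨θ, hθ⟩ := exists_scaled hG (ι₂.comp π) (by rw [← map_negArg, h.neg_d]) k4 hdc
  have hd : PowerSeries.map (θ : YTw G →+* R) d = PowerSeries.map (ι₁ : YTw G →+* R) d := by
    rw [h.map_scaled hne i k1 k2 (by rw [← map_negArg, h.neg_g]) k4 hdc hgc hθ, series_map_comp,
      h.map_proj hne i hπ, map_one, mul_one]
  have hg : PowerSeries.map (θ : YTw G →+* R) g = PowerSeries.map (ι₁ : YTw G →+* R) g :=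
    left_inv_eq_right_inv (by rw [← hd, ← map_mul, h.inv_mul, map_one]) k1
  have hζ : PowerSeries.map (θ : YTw G →+* R) ζ = PowerSeries.map (ι₁ : YTw G →+* R) ζ := by
    rw [h.zeta_eq, map_mul, map_mul, map_shiftArg, map_shiftArg, map_shiftArg, map_shiftArg, hd, hg]
  refine ⟨θ, fun z hz => ?_, fun y => ?_⟩
  · refine (Algebra.adjoin_le (S := AlgHom.equalizer θ ι₁) ?_ hz :)
    rintro _ ⟨n, rfl⟩
    have := congrArg (coeff n) hζ
    rwa [coeff_map, coeff_map] at this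
  · have h1 := hθ.trans (hπ.comp θ)
    rw [hg, k2] at h1
    exact DFunLike.congr_fun h1.eq y

/-- The two inclusions into Y ⊗ Y provide the splitting, and S = d · π(S) shows that the center and
the image of π generate. -/
theorem CentralRoot.exists_centerEquiv (h : CentralRoot ζ d g) (hG : IsSupersymmetric G) (hne : M ≠ N)
    (i : Idx M N) (inj : Function.Injective (algebraMap ℂ (YTw G)))
    (hπ : IsScaledHom (AlgHom.id ℂ _) π g) (hc : ∀ z ∈ center G, ∀ y, Commute z y)
    (hZ : center G = Algebra.adjoin ℂ (Set.range fun n => coeff n ζ))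
    (hd : ∀ n, coeff n d ∈ center G) :
    ∃ e : (center G ⊗[ℂ] special G) ≃ₐ[ℂ] YTw G, ∀ (z : center G) (y : special G),
      e (z ⊗ₜ[ℂ] y) = (z : YTw G) * (y : YTw G) := by
  have hsp : ∀ y, y ∈ special G ↔ π y = y := fun y => h.mem_special_iff hG hne i inj hπ
  obtain ⟨θ, h1, h2⟩ := h.exists_split hG hne i hπ (coeff_includeLeft_commute h.comm_d)
    (coeff_includeLeft_commute h.comm_g) (ι₂ := Algebra.TensorProduct.includeRight)
  refine exists_tensorEquiv hc (θ := θ) (fun z hz => h1 z (hZ ▸ hz))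
    (fun y hy => by rw [← (hsp y).1 hy]; exact h2 y) fun B hP hQ =>
    (isTwGen_sStd hG).gen _ fun k l n => ?_
  have e : sStd G k l = d * PowerSeries.map (π : YTw G →+* YTw G) (sStd G k l) := by
    rw [hπ, series_map_id, ← mul_assoc, h.mul_inv, one_mul]
  rw [e, coeff_mul]
  refine Subalgebra.sum_mem _ fun p _ => ?_
  rw [coeff_map]
  exact B.mul_mem (hP (hd p.1)) (hQ ((hsp _).2 (h.proj_proj hne i hπ _)))

/-- In the quotient ζ, hence d, becomes 1, so y and π(y) have the same class; this gives
surjectivity. Conversely π kills the ideal because π(ζ) = 1, so the classes of elements fixed by π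
are distinct. -/
theorem CentralRoot.exists_quotientEquiv (h : CentralRoot ζ d g) (hG : IsSupersymmetric G) (hne : M ≠ N)
    (i : Idx M N) (inj : Function.Injective (algebraMap ℂ (YTw G)))
    (hπ : IsScaledHom (AlgHom.id ℂ _) π g) (hz2 : coeff 2 ζ = 0) :
    ∃ q : special G ≃ₐ[ℂ] (coeffIdeal (shiftArg (halfShift M N) ζ)).ringCon.Quotient,
      ∀ y : special G, q y = (coeffIdeal (shiftArg (halfShift M N) ζ)).ringCon.mk' (y : YTw G) := by
  have hsp : ∀ y, y ∈ special G ↔ π y = y := fun y => h.mem_special_iff hG hne i inj hπ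
  set I := coeffIdeal (shiftArg (halfShift M N) ζ) with hI
  let mk : YTw G →ₐ[ℂ] I.ringCon.Quotient := RingCon.mkₐ ℂ I.ringCon
  have hmk : ∀ {x y}, mk x = mk y ↔ x - y ∈ I := fun {x y} =>
    (RingCon.eq I.ringCon).trans (TwoSidedIdeal.rel_iff I x y)
  -- The coefficients of index 0, 1, 2 are already 1, 0, 0, which is why generators of index at
  -- least 3 suffice.
  have hm1 : PowerSeries.map (mk : YTw G →+* I.ringCon.Quotient) (shiftArg (halfShift M N) ζ) = 1 := by
    ext n
    rw [coeff_map, coeff_one]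
    change mk _ = _
    match n with
    | 0 =>
      rw [coeff_zero_eq_constantCoeff_apply, shiftArg, constantCoeff_substInv,
        ← coeff_zero_eq_constantCoeff_apply, h.zero, map_one, if_pos rfl]
    | 1 => rw [shiftArg, coeff_one_substInv, h.one, smul_zero, map_zero, if_neg one_ne_zero]
    | 2 =>
      rw [shiftArg, substInv, coeff_mk, Finset.sum_range_succ, Finset.sum_range_succ,
        Finset.sum_range_one, h.one, hz2, smul_zero, smul_zero, pow_zero, coeff_one,
        if_neg two_ne_zero, zero_smul, add_zero, add_zero, map_zero, if_neg two_ne_zero]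
    | n + 3 =>
      rw [if_neg (by omega), ← map_zero mk, hmk, sub_zero]
      exact TwoSidedIdeal.subset_span ⟨n + 3, by omega, rfl⟩
  have hm2 : PowerSeries.map (mk : YTw G →+* I.ringCon.Quotient) ζ = 1 := by
    have := congrArg (shiftHom (-halfShift M N)) hm1
    rwa [map_one, shiftHom_apply, ← map_shiftArg, shiftArg_shiftArg, neg_add_cancel, shiftArg_zero]
      at this
  have hm3 := proj_comp hπ (map_g_of_map_d h (h.map_d_of_map_zeta hne hm2))
  have hI0 : I ≤ TwoSidedIdeal.ker π := by
    refine TwoSidedIdeal.span_le.2 ?_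
    rintro _ ⟨r, hr, rfl⟩
    refine (TwoSidedIdeal.mem_ker π).2 ?_
    have := congrArg (coeff r) (map_shiftArg π (halfShift M N) ζ)
    rw [h.map_zeta_of_map_d (h.map_proj hne i hπ), ← shiftHom_apply _ 1, map_one, coeff_one,
      if_neg (by omega), coeff_map] at this
    exact this
  refine ⟨AlgEquiv.ofBijective (mk.comp (special G).val) ⟨fun x y hxy => Subtype.ext ?_, fun w => ?_⟩,
    fun y => rfl⟩
  · have := (TwoSidedIdeal.mem_ker π).1 (hI0 (hmk.1 hxy))
    rw [map_sub, sub_eq_zero] at this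
    exact ((hsp _).1 x.2).symm.trans (this.trans ((hsp _).1 y.2))
  · obtain ⟨y, rfl⟩ := RingCon.mkₐ_surjective (α := ℂ) I.ringCon w
    exact ⟨⟨π y, (hsp _).2 (h.proj_proj hne i hπ _)⟩, DFunLike.congr_fun hm3 y⟩

end Decomposition

end SuperYangian

/-! ### The main theorem -/

theorem mainTheorem2 (M N : ℕ) (hMN : 2 ≤ M + N) (hne : M ≠ N)
    (G : Matrix (SuperYangian.Idx M N) (SuperYangian.Idx M N) ℂ)
    (hG : SuperYangian.IsSupersymmetric G) :
    -- `S(u) ↦ f(u) S(u)` defines an automorphism exactly for even `f`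
    (∀ f : PowerSeries ℂ, PowerSeries.constantCoeff f = 1 →
      ((∃ φ : SuperYangian.YTw G ≃ₐ[ℂ] SuperYangian.YTw G, SuperYangian.IsScaling G f φ) ↔
        SuperYangian.negArg f = f)) ∧
    -- `𝒵Y^{tw}` is purely even and `SY^{tw}` is a graded subalgebra
    (∀ z ∈ SuperYangian.center G, z ∈ SuperYangian.parityPart G 0) ∧
    (∀ y ∈ SuperYangian.special G,
      ∃ y₀ ∈ SuperYangian.special G, ∃ y₁ ∈ SuperYangian.special G,
        y₀ ∈ SuperYangian.parityPart G 0 ∧ y₁ ∈ SuperYangian.parityPart G 1 ∧ y = y₀ + y₁) ∧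
    -- multiplication is an isomorphism `𝒵Y^{tw} ⊗ SY^{tw} ≃ Y^{tw}`
    (∃ e : (SuperYangian.center G ⊗[ℂ] SuperYangian.special G) ≃ₐ[ℂ] SuperYangian.YTw G,
      ∀ (z : SuperYangian.center G) (y : SuperYangian.special G),
        e (z ⊗ₜ[ℂ] y) = (z : SuperYangian.YTw G) * (y : SuperYangian.YTw G)) ∧
    -- the embedding into `Y(gl_{M|N})`, the series `ζ(u) = z(u) z(-u - M + N)⁻¹`, and the quotient
    (∃ emb : SuperYangian.YTw G →ₐ[ℂ] SuperYangian.YGl M N,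
      SuperYangian.IsTwistedMap G emb ∧ Function.Injective emb ∧
      ∃ z : PowerSeries (SuperYangian.YGl M N), SuperYangian.IsCentralSeries z ∧
      ∃ ζ : PowerSeries (SuperYangian.YTw G),
        PowerSeries.map (emb : SuperYangian.YTw G →+* SuperYangian.YGl M N) ζ *
            SuperYangian.negShiftArg ((M : ℂ) - N) z = z ∧
        (∀ r, PowerSeries.coeff r ζ ∈ SuperYangian.center G) ∧
        ∃ q : SuperYangian.special G ≃ₐ[ℂ] (SuperYangian.coeffIdeal ζ).ringCon.Quotient,
          ∀ y : SuperYangian.special G,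
            q y = (SuperYangian.coeffIdeal ζ).ringCon.mk' (y : SuperYangian.YTw G)) := by
  obtain ⟨i⟩ : Nonempty (SuperYangian.Idx M N) := Fintype.card_pos_iff.1 (by simp; omega)
  obtain ⟨φ, hφ⟩ := SuperYangian.exists_twisted_hom hG
  obtain ⟨z, ζ, hz, hzζ, hζ, hc, hn, h0, h1, h2⟩ := SuperYangian.exists_zeta hG hne i hφ
  have := SuperYangian.nontrivial_ygl (M := M) (N := N)
  have : Nontrivial (SuperYangian.YTw G) := φ.toRingHom.domain_nontrivial
  have inj : Function.Injective (algebraMap ℂ (SuperYangian.YTw G)) := 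
    (algebraMap ℂ (SuperYangian.YTw G)).injective
  obtain ⟨d, g, h, hd, hg⟩ := SuperYangian.exists_centralRoot hne hζ hc hn h0 h1
  -- π is the scaling of S by g = d⁻¹, the projection onto the special subalgebra.
  obtain ⟨π, hπ⟩ := SuperYangian.exists_scaled hG (AlgHom.id ℂ _) h.neg_g h.g_zero h.comm_g
  have hZ := SuperYangian.center_eq_adjoin hG hne i hζ hc h0 h1
  have hsp : ∀ y, y ∈ SuperYangian.special G ↔ π y = y := fun y => h.mem_special_iff hG hne i inj hπ
  refine ⟨fun f f0 => ⟨fun ⟨ψ, hψ⟩ => SuperYangian.negArg_of_isScaling hG i hψ inj,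
    SuperYangian.exists_isScaling hG f0⟩, fun w hw => SuperYangian.mem_parityPart_zero hG
    (SuperYangian.parTw_of_mem_adjoin hG i hζ (hZ ▸ hw)), fun y hy => ?_,
    h.exists_centerEquiv hG hne i inj hπ (fun w hw => SuperYangian.commute_of_mem_adjoin hc (hZ ▸ hw))
      hZ fun n => by rw [hZ]; exact hd n,
    φ, SuperYangian.isTwistedMap_of hG hφ, SuperYangian.injective_twistedMap hG hφ, z, hz, _, hzζ,
    fun r => ?_, h.exists_quotientEquiv hG hne i inj hπ h2⟩
  · obtain ⟨a, ha, b, hb, rfl⟩ := SuperYangian.exists_parity hG y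
    have key := h.parTw_proj hG i hπ hg
    refine ⟨π a, (hsp _).2 (h.proj_proj hne i hπ a), π b, (hsp _).2 (h.proj_proj hne i hπ b),
      SuperYangian.mem_parityPart_zero hG ((key a).trans ?_),
      SuperYangian.mem_parityPart_one hG ((key b).trans ?_), ?_⟩
    · rw [SuperYangian.parTw_of_mem_zero hG ha]
    · rw [SuperYangian.parTw_of_mem_one hG hb, map_neg]
    · rw [← map_add, (hsp _).1 hy]
  -- The series 𝔷 is ζ shifted by (M - N)/2, so its coefficients are linear combinations of those of
  -- ζ.
  · rw [hZ, SuperYangian.shiftArg, SuperYangian.substInv, PowerSeries.coeff_mk]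
    exact Subalgebra.sum_mem _ fun k _ => Subalgebra.smul_mem _ (Algebra.subset_adjoin (Set.mem_range_self k)) _

end
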